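/- **Setting.** Let $\mathcal S\subset\{-1,0,1\}^2\setminus\{(0,0)\}$ be a non-singular step set, i.e. $\mathcal S$ is not contained in any half-plane $\{(i,j): \alpha i+\beta j\ge 0\}$ with $(\alpha,\beta)\ne(0,0)$, and let $z\in\,]0,1/|\mathcal S|[$. Let $q(i,j;n)$ be the number of $n$-step walks in $\mathbf Z_+^2$ with steps in $\mathcal S$ from $(0,0)$ to $(i,j)$, $Q(x,y)=\sum_{i,j,n\ge0}q(i,j;n)x^iy^jz^n$, and $$K(x,y)=xyz\Big[\sum_{(i,j)\in\mathcal S}x^iy^j-\tfrac1z\Big]=a(x)y^2+b(x)y+c(x)=\tilde a(y)x^2+\tilde b(y)x+\tilde c(y).$$ Put $d=b^2-4ac$ and $\tilde d=\tilde b^2-4\tilde a\tilde c$. Let $x_1<x_2$ be the roots of $d$ in $]-1,1[$, $x_3$ its smallest root in $]1,\infty[$, and $x_4$ its remaining root ($x_4=\infty$ if $\deg d=3$); $y_1,\dots,y_4$ are defined likewise from $\tilde d$. With $X(y_1)=-\tilde b(y_1)/(2\tilde a(y_1))$ (and the interval $]-\infty,x_1[$ below if $\tilde a(y_1)=0$),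 put $$\omega_1=i\int_{x_1}^{x_2}\frac{dx}{\sqrt{-d(x)}},\qquad \omega_2=\int_{x_2}^{x_3}\frac{dx}{\sqrt{d(x)}},\qquad \omega_3=\int_{X(y_1)}^{x_1}\frac{dx}{\sqrt{d(x)}} .$$ Let $\wp$ be the Weierstrass function with periods $\omega_1,\omega_2$, let $g_x(t)=d''(x_4)/6+d'(x_4)/(t-x_4)$ if $x_4\neq\infty$ and $g_x(t)=d''(0)/6+d'''(0)t/6$ if $x_4=\infty$, define $g_y$ in the same way from $\tilde d,y_4$, and set $x(\omega)=g_x^{-1}(\wp(\omega))$, $y(\omega)=g_y^{-1}(\wp(\omega-\omega_3/2))$, with values in $\mathbf C\cup\{\infty\}$. Let $\Delta_x=\{\omega: 0<\Re\omega<\omega_2,\ |x(\omega)|<1\}$ and $\Delta_y=\{\omega:\omega_3/2<\Re\omega<\omega_3/2+\omega_2,\ |y(\omega)|<1\}$, and let $r_x$ (resp. $r_y$) be the meromorphic function on $\mathbf C$ that equals $K(x(\omega),0)Q(x(\omega),0)$ on $\Delta_x$ (resp. $K(0,y(\omega))Q(0,y(\omega))$ on $\Delta_y$). For $k,\ell\in\mathbf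 Z$ let $\mathcal M_{k,\ell}=\omega_1[\ell,\ell+1[\,+\,\omega_2[\tfrac k2,\tfrac{k+1}2[$ and $\mathcal N_{k,\ell}=\tfrac{\omega_3}2+\omega_1[\ell,\ell+1[\,+\,\omega_2]\tfrac k2,\tfrac{k+1}2]$. The branches of $x\mapsto Q(x,0)$ are the functions $x\mapsto r_x(\omega)/K(x,0)$ on $\mathbf C\setminus([x_1,x_2]\cup[x_3,x_4])$, where $\omega$ is the unique element of $\mathcal M_{k,\ell}$ with $x(\omega)=x$; the branches of $y\mapsto Q(0,y)$ are the functions $y\mapsto r_y(\omega)/K(0,y)$ on $\mathbf C\setminus([y_1,y_2]\cup[y_3,y_4])$, where $\omega$ is the unique element of $\mathcal N_{k,\ell}$ with $y(\omega)=y$. (Here $[x_3,x_4]$ passes through $\infty$ if $x_4<0$, and similarly for $[y_3,y_4]$.) Let $\Pi_x=\omega_1[0,1[\,+\,\omega_2[0,1[$, $\Pi_y=\tfrac{\omega_3}{2}+\omega_1[0,1[\,+\,\omega_2]0,1]$, $f_y(\omega)=x(\omega)\,[y(-\omega+\omega_1+\omega_2)-y(\omega)]$, and $$\mathcal I_x(\omega_0)=x(\{\omega\in\Pi_x:\Im\omega=\Im\omega_0\}),\quad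 \mathcal I_y(\omega_0)=y(\{\omega\in\Pi_y:\Im\omega=\Im\omega_0\})\subset\mathbf C\cup\{\infty\}.$$ For $\omega,\omega'\in\Pi_y$ and an integer $n\ge0$ write $\omega\ll_n\omega'$ if $\omega+n\omega_3=\omega'+p\omega_2$ for some $p\in\mathbf Z$, and $\omega\ll\omega'$ if $\omega\ll_n\omega'$ for some $n\ge0$. **Lemma 21.** Let $z$ be such that $\omega_2/\omega_3$ is irrational, let $\omega_0\in\Pi_y$ be such that $r_y(\omega_0)\ne\infty$, and let $\mathcal A(\omega_0)=\{\omega\in\Pi_y:\Im\omega=\Im\omega_0,\ f_y(\omega)=\infty\}$. Assume that $\omega_0\in\mathcal A(\omega_0)$ and that for some $k\ge0$ and some $\omega^1,\dots,\omega^k\in\mathcal A(\omega_0)$, distinct from each other and from $\omega_0$: (A) $\omega_0\ll_{n_1}\omega^1\ll_{n_2}\cdots\ll_{n_k}\omega^k$; (B) with $m_j=n_1+\dots+n_j$, $\ \lim_{\omega\to\omega_0}\{f_y(\omega)+f_y(\omega+m_1\omega_3)+\dots+f_y(\omega+m_k\omega_3)\}=\infty$; (C) there is no other $\omega\in\mathcal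 A(\omega_0)$ such that $\omega_0\ll\omega$. Then the set of poles of all branches of $x\mapsto Q(x,0)$ (resp. $y\mapsto Q(0,y)$) is dense on the curve $\mathcal I_x(\omega_0)$ (resp. $\mathcal I_y(\omega_0)$), i.e. the poles lying on the curve form a dense subset of it. -/

import Mathlib

open Filter Topology Polynomial

noncomputable section

namespace QuarterPlane

/-! ### Walks and their generating functions -/

/-- A set of small steps: a set of jumps to the eight nearest neighbours. -/
def IsSmallStepSet (S : Finset (ℤ × ℤ)) : Prop :=
  ∀ s ∈ S, s ≠ 0 ∧ |s.1| ≤ 1 ∧ |s.2| ≤ 1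

/-- The model is non-singular: the steps are not contained in a closed half-plane
`{(i, j) | a i + b j ≥ 0}` with the origin on its boundary. -/
def NonSingular (S : Finset (ℤ × ℤ)) : Prop :=
  ∀ a b : ℤ, (a, b) ≠ (0, 0) → ∃ s ∈ S, a * s.1 + b * s.2 < 0

/-- The step set obtained by exchanging the two coordinates. -/
def transpose (S : Finset (ℤ × ℤ)) : Finset (ℤ × ℤ) := S.image Prod.swap

/-- `q(i, j; n)`: the number of walks with `n` steps in `S` that start at the origin, stay in the
quarter plane and end at `(i, j)`. -/
def walkCount (S : Finset (ℤ × ℤ)) (i j n : ℕ) : ℕ :=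
  ((Fintype.piFinset fun _ : Fin n => S).filter fun w =>
    (∀ m : Fin n, 0 ≤ (∑ l ∈ Finset.Iic m, w l).1 ∧ 0 ≤ (∑ l ∈ Finset.Iic m, w l).2) ∧
      ∑ l, w l = ((i : ℤ), (j : ℤ))).card

/-- The generating function `Q(x, y; z) = ∑ q(i, j; n) x ^ i y ^ j z ^ n`. -/
def Q (S : Finset (ℤ × ℤ)) (z : ℝ) (x y : ℂ) : ℂ :=
  ∑' p : ℕ × ℕ × ℕ, (walkCount S p.1 p.2.1 p.2.2 : ℂ) * x ^ p.1 * y ^ p.2.1 * (z : ℂ) ^ p.2.2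

/-- The kernel `K(x, y; z) = x y z (∑_{(i,j) ∈ S} x ^ i y ^ j - 1 / z)`. -/
def K (S : Finset (ℤ × ℤ)) (z : ℝ) (x y : ℂ) : ℂ :=
  (z : ℂ) * ∑ s ∈ S, x ^ (s.1 + 1).toNat * y ^ (s.2 + 1).toNat - x * y

/-! ### The coefficients of the kernel, the discriminant and the branch points

`K(x, y) = a(x) y ^ 2 + b(x) y + c(x)`. The corresponding objects for the expansion
`ã(y) x ^ 2 + b̃(y) x + c̃(y)` are those of the transposed step set. -/

/-- `z x ∑_{(i, j) ∈ S} x ^ i` for fixed `j`. -/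
def rowPoly (S : Finset (ℤ × ℤ)) (z : ℝ) (j : ℤ) : ℝ[X] :=
  ∑ s ∈ S with s.2 = j, C z * X ^ (s.1 + 1).toNat

def aPoly (S : Finset (ℤ × ℤ)) (z : ℝ) : ℝ[X] := rowPoly S z 1

def bPoly (S : Finset (ℤ × ℤ)) (z : ℝ) : ℝ[X] := rowPoly S z 0 - X

def cPoly (S : Finset (ℤ × ℤ)) (z : ℝ) : ℝ[X] := rowPoly S z (-1)

/-- The discriminant `d(x) = b(x) ^ 2 - 4 a(x) c(x)`. -/
def disc (S : Finset (ℤ × ℤ)) (z : ℝ) : ℝ[X] :=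
  bPoly S z ^ 2 - 4 * aPoly S z * cPoly S z

/-- The branch point `x₁`: the smaller root of `d` in `]-1, 1[`. -/
def x₁ (S : Finset (ℤ × ℤ)) (z : ℝ) : ℝ := sInf {x : ℝ | (disc S z).IsRoot x ∧ |x| < 1}

/-- The branch point `x₂`: the larger root of `d` in `]-1, 1[`. -/
def x₂ (S : Finset (ℤ × ℤ)) (z : ℝ) : ℝ := sSup {x : ℝ | (disc S z).IsRoot x ∧ |x| < 1}

/-- The branch point `x₃`: the smallest root of `d` in `]1, ∞[`. -/
def x₃ (S : Finset (ℤ × ℤ)) (z : ℝ) : ℝ := sInf {x : ℝ | (disc S z).IsRoot x ∧ 1 < x}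

open Classical in
/-- The branch point `x₄`: the remaining root of `d` outside `[-1, 1]`; if there is none (that is,
if `d` has degree three), then `x₄ = ∞`, which is encoded by `none`. -/
def x₄ (S : Finset (ℤ × ℤ)) (z : ℝ) : Option ℝ :=
  if h : ∃ x : ℝ, (disc S z).IsRoot x ∧ 1 < |x| ∧ x ≠ x₃ S z then some h.choose else none

/-- The branch points `y_ℓ` are the roots of the discriminant `d̃(y)`. -/
def y₁ (S : Finset (ℤ × ℤ)) (z : ℝ) : ℝ := x₁ (transpose S) z

/-- The cuts `[x₁, x₂] ∪ [x₃, x₄]`, where `[x₃, x₄]` passes through `∞` if `x₄ < 0`. -/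
def cutX (S : Finset (ℤ × ℤ)) (z : ℝ) : Set ℂ :=
  Complex.ofReal '' (Set.Icc (x₁ S z) (x₂ S z) ∪
    match x₄ S z with
    | some t => if t < 0 then Set.Ici (x₃ S z) ∪ Set.Iic t else Set.Icc (x₃ S z) t
    | none => Set.Ici (x₃ S z))

/-- The cuts `[y₁, y₂] ∪ [y₃, y₄]`. -/
def cutY (S : Finset (ℤ × ℤ)) (z : ℝ) : Set ℂ := cutX (transpose S) z

/-! ### The periods -/

/-- The length `ω₁ / i = ∫_{x₁}^{x₂} dx / √(-d(x))`. -/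
def period₁Im (S : Finset (ℤ × ℤ)) (z : ℝ) : ℝ :=
  ∫ x in Set.Ioo (x₁ S z) (x₂ S z), 1 / √(-(disc S z).eval x)

/-- `ω₁ = i ∫_{x₁}^{x₂} dx / √(-d(x))`. -/
def ω₁ (S : Finset (ℤ × ℤ)) (z : ℝ) : ℂ := Complex.I * (period₁Im S z : ℂ)

/-- `ω₂ = ∫_{x₂}^{x₃} dx / √(d(x))`. -/
def ω₂ (S : Finset (ℤ × ℤ)) (z : ℝ) : ℝ :=
  ∫ x in Set.Ioo (x₂ S z) (x₃ S z), 1 / √((disc S z).eval x)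

open Classical in
/-- The real interval `]X(y₁), x₁[`, where `X(y₁) = -b̃(y₁) / (2 ã(y₁))` is the double root of
`x ↦ K(x, y₁)`; if `ã(y₁) = 0`, then `X(y₁) = ∞` and the interval is `]-∞, x₁[`. -/
def period₃Interval (S : Finset (ℤ × ℤ)) (z : ℝ) : Set ℝ :=
  if (aPoly (transpose S) z).eval (y₁ S z) = 0 then Set.Iio (x₁ S z)
  else Set.Ioo
    (-(bPoly (transpose S) z).eval (y₁ S z) / (2 * (aPoly (transpose S) z).eval (y₁ S z)))
    (x₁ S z)

/-- `ω₃ = ∫_{X(y₁)}^{x₁} dx / √(d(x))`. -/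
def ω₃ (S : Finset (ℤ × ℤ)) (z : ℝ) : ℝ :=
  ∫ x in period₃Interval S z, 1 / √((disc S z).eval x)

/-! ### The uniformization -/

open Classical in
/-- The Weierstrass function `℘(ω; ω₁, ω₂)` with values in the Riemann sphere. -/
def wp (S : Finset (ℤ × ℤ)) (z : ℝ) (ω : ℂ) : OnePoint ℂ :=
  if h : LinearIndependent ℝ ![ω₁ S z, (ω₂ S z : ℂ)] then
    if ω ∈ (PeriodPair.mk _ _ h).lattice then OnePoint.infty
    else ((PeriodPair.mk _ _ h).weierstrassP ω : ℂ)
  else OnePoint.infty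

open Classical in
/-- The inverse, on the Riemann sphere, of the homography
`g(t) = d''(x₄) / 6 + d'(x₄) / (t - x₄)` if `x₄ ≠ ∞`, `g(t) = d''(0) / 6 + d'''(0) t / 6` if
`x₄ = ∞`. -/
def gInv (d : ℝ[X]) : Option ℝ → OnePoint ℂ → OnePoint ℂ
  | some t₄, none => ((t₄ : ℂ) : OnePoint ℂ)
  | some t₄, some u =>
      if u = (((derivative^[2] d).eval t₄ / 6 : ℝ) : ℂ) then OnePoint.infty
      else (((t₄ : ℂ) + (((derivative d).eval t₄ : ℝ) : ℂ) /
        (u - (((derivative^[2] d).eval t₄ / 6 : ℝ) : ℂ)) : ℂ) : OnePoint ℂ)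
  | none, none => OnePoint.infty
  | none, some u =>
      ((6 * (u - (((derivative^[2] d).eval 0 / 6 : ℝ) : ℂ)) /
        (((derivative^[3] d).eval 0 : ℝ) : ℂ) : ℂ) : OnePoint ℂ)

/-- The coordinate `x(ω) = g_x⁻¹(℘(ω))` on the universal covering. -/
def xCov (S : Finset (ℤ × ℤ)) (z : ℝ) (ω : ℂ) : OnePoint ℂ :=
  gInv (disc S z) (x₄ S z) (wp S z ω)

/-- The coordinate `y(ω) = g_y⁻¹(℘(ω - ω₃ / 2))` on the universal covering. -/
def yCov (S : Finset (ℤ × ℤ)) (z : ℝ) (ω : ℂ) : OnePoint ℂ :=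
  gInv (disc (transpose S) z) (x₄ (transpose S) z) (wp S z (ω - (ω₃ S z : ℂ) / 2))

/-- The finite value of a point of the Riemann sphere (and `0` for the point `∞`). -/
def finVal : OnePoint ℂ → ℂ
  | none => 0
  | some u => u

/-- The function `x(ω)` as a meromorphic function with values in `ℂ`. -/
def xVal (S : Finset (ℤ × ℤ)) (z : ℝ) (ω : ℂ) : ℂ := finVal (xCov S z ω)

/-- The function `y(ω)` as a meromorphic function with values in `ℂ`. -/
def yVal (S : Finset (ℤ × ℤ)) (z : ℝ) (ω : ℂ) : ℂ := finVal (yCov S z ω)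

/-- The function `f` takes the value `∞` at `ω` (for meromorphic `f`: it has a pole there). -/
def IsPole (f : ℂ → ℂ) (ω : ℂ) : Prop := Tendsto f (𝓝[≠] ω) (Bornology.cobounded ℂ)

/-! ### The lifted functions and their continuation -/

/-- The lifting of `ξ`: the symmetry `ω ↦ -ω + 2 ω_{x₂} = -ω + ω₁ + ω₂`. -/
def xiHat (S : Finset (ℤ × ℤ)) (z : ℝ) (ω : ℂ) : ℂ := -ω + (ω₁ S z + (ω₂ S z : ℂ))

/-- `f_y(ω) = x(ω) (y(ξ̂ ω) - y(ω))`. -/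
def fy (S : Finset (ℤ × ℤ)) (z : ℝ) (ω : ℂ) : ℂ :=
  xVal S z ω * (yVal S z (xiHat S z ω) - yVal S z ω)

/-- The domain `Δ_x`: the part of `{|x(ω)| < 1}` lying in the strip `0 < Re ω < ω₂`. -/
def DeltaX (S : Finset (ℤ × ℤ)) (z : ℝ) : Set ℂ :=
  {ω | 0 < ω.re ∧ ω.re < ω₂ S z ∧ ∃ x : ℂ, ‖x‖ < 1 ∧ xCov S z ω = (x : OnePoint ℂ)}

/-- The domain `Δ_y`: the part of `{|y(ω)| < 1}` lying in the strip
`ω₃ / 2 < Re ω < ω₃ / 2 + ω₂`. -/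
def DeltaY (S : Finset (ℤ × ℤ)) (z : ℝ) : Set ℂ :=
  {ω | ω₃ S z / 2 < ω.re ∧ ω.re < ω₃ S z / 2 + ω₂ S z ∧
    ∃ y : ℂ, ‖y‖ < 1 ∧ yCov S z ω = (y : OnePoint ℂ)}

/-- `r` is a meromorphic continuation to `ℂ` of the lifting of `x ↦ K(x, 0) Q(x, 0)` to `Δ_x`. -/
def IsContinuationX (S : Finset (ℤ × ℤ)) (z : ℝ) (r : ℂ → ℂ) : Prop :=
  Meromorphic r ∧ ∀ ω ∈ DeltaX S z, r ω = K S z (xVal S z ω) 0 * Q S z (xVal S z ω) 0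

/-- `r` is a meromorphic continuation to `ℂ` of the lifting of `y ↦ K(0, y) Q(0, y)` to `Δ_y`. -/
def IsContinuationY (S : Finset (ℤ × ℤ)) (z : ℝ) (r : ℂ → ℂ) : Prop :=
  Meromorphic r ∧ ∀ ω ∈ DeltaY S z, r ω = K S z 0 (yVal S z ω) * Q S z 0 (yVal S z ω)

/-- The meromorphic function `r_x` on `ℂ`; by the identity theorem the continuation is unique
(up to the values at the points of a discrete set, which play no role for poles). -/
def rx (S : Finset (ℤ × ℤ)) (z : ℝ) : ℂ → ℂ := Classical.epsilon (IsContinuationX S z)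

/-- The meromorphic function `r_y` on `ℂ`. -/
def ry (S : Finset (ℤ × ℤ)) (z : ℝ) : ℂ → ℂ := Classical.epsilon (IsContinuationY S z)

/-! ### The branches and their poles -/

/-- `M_{k,ℓ} = ω₁ [ℓ, ℓ + 1[ + ω₂ [k / 2, (k + 1) / 2[`. -/
def cellM (S : Finset (ℤ × ℤ)) (z : ℝ) (k l : ℤ) : Set ℂ :=
  {ω | ∃ s ∈ Set.Ico (l : ℝ) (l + 1), ∃ t ∈ Set.Ico ((k : ℝ) / 2) (((k : ℝ) + 1) / 2),
    ω = (s : ℂ) * ω₁ S z + (t : ℂ) * (ω₂ S z : ℂ)}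

/-- `N_{k,ℓ} = ω₃ / 2 + ω₁ [ℓ, ℓ + 1[ + ω₂ ]k / 2, (k + 1) / 2]`. -/
def cellN (S : Finset (ℤ × ℤ)) (z : ℝ) (k l : ℤ) : Set ℂ :=
  {ω | ∃ s ∈ Set.Ico (l : ℝ) (l + 1), ∃ t ∈ Set.Ioc ((k : ℝ) / 2) (((k : ℝ) + 1) / 2),
    ω = (ω₃ S z : ℂ) / 2 + (s : ℂ) * ω₁ S z + (t : ℂ) * (ω₂ S z : ℂ)}

/-- The parallelogram `Π_x = ω₁ [0, 1[ + ω₂ [0, 1[`. -/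
def PiX (S : Finset (ℤ × ℤ)) (z : ℝ) : Set ℂ := cellM S z 0 0 ∪ cellM S z 1 0

/-- The parallelogram `Π_y = ω₃ / 2 + ω₁ [0, 1[ + ω₂ ]0, 1]`. -/
def PiY (S : Finset (ℤ × ℤ)) (z : ℝ) : Set ℂ := cellN S z 0 0 ∪ cellN S z 1 0

/-- The branch of `x ↦ Q(x, 0)` on `ℂ` minus the cuts given by `M_{k,ℓ}`: its value at `x` is
`r_x(ω) / K(x, 0)`, where `ω` is the unique element of `M_{k,ℓ}` with `x(ω) = x`. -/
def branchX (S : Finset (ℤ × ℤ)) (z : ℝ) (k l : ℤ) (x : ℂ) : ℂ :=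
  rx S z (Function.invFunOn (xCov S z) (cellM S z k l) (x : OnePoint ℂ)) / K S z x 0

/-- The branch of `y ↦ Q(0, y)` on `ℂ` minus the cuts given by `N_{k,ℓ}`. -/
def branchY (S : Finset (ℤ × ℤ)) (z : ℝ) (k l : ℤ) (y : ℂ) : ℂ :=
  ry S z (Function.invFunOn (yCov S z) (cellN S z k l) (y : OnePoint ℂ)) / K S z 0 y

/-- The set of the poles of all branches of `x ↦ Q(x, 0)`. -/
def polesX (S : Finset (ℤ × ℤ)) (z : ℝ) : Set ℂ :=
  {x | x ∉ cutX S z ∧ ∃ k l : ℤ, IsPole (branchX S z k l) x}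

/-- The set of the poles of all branches of `y ↦ Q(0, y)`. -/
def polesY (S : Finset (ℤ × ℤ)) (z : ℝ) : Set ℂ :=
  {y | y ∉ cutY S z ∧ ∃ k l : ℤ, IsPole (branchY S z k l) y}

/-- The curve `I_x(ω₀) = x({ω ∈ Π_x | Im ω = Im ω₀})` on the Riemann sphere. -/
def curveX (S : Finset (ℤ × ℤ)) (z : ℝ) (ω₀ : ℂ) : Set (OnePoint ℂ) :=
  xCov S z '' {ω | ω ∈ PiX S z ∧ ω.im = ω₀.im}

/-- The curve `I_y(ω₀) = y({ω ∈ Π_y | Im ω = Im ω₀})` on the Riemann sphere. -/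
def curveY (S : Finset (ℤ × ℤ)) (z : ℝ) (ω₀ : ℂ) : Set (OnePoint ℂ) :=
  yCov S z '' {ω | ω ∈ PiY S z ∧ ω.im = ω₀.im}

/-- The subset `P` of `ℂ` is dense on the curve `I` of the Riemann sphere: the points of `P` on
`I` form a dense subset of `I`. -/
def DenseOnCurve (P : Set ℂ) (I : Set (OnePoint ℂ)) : Prop :=
  I ⊆ closure (((↑) : ℂ → OnePoint ℂ) '' P ∩ I)

/-! ### The order and the poles of `f_y` -/

/-- `ω ≪_n ω'`: there is `p ∈ ℤ` with `ω + n ω₃ = ω' + p ω₂`. -/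
def PrecBy (S : Finset (ℤ × ℤ)) (z : ℝ) (n : ℕ) (ω ω' : ℂ) : Prop :=
  ∃ p : ℤ, ω + (n : ℂ) * (ω₃ S z : ℂ) = ω' + (p : ℂ) * (ω₂ S z : ℂ)

/-- `ω ≪ ω'`: `ω ≪_n ω'` for some non-negative integer `n`. -/
def Prec (S : Finset (ℤ × ℤ)) (z : ℝ) (ω ω' : ℂ) : Prop := ∃ n : ℕ, PrecBy S z n ω ω'

/-- `A(ω₀) = {ω ∈ Π_y | Im ω = Im ω₀, f_y(ω) = ∞}`. -/
def polesFy (S : Finset (ℤ × ℤ)) (z : ℝ) (ω₀ : ℂ) : Set ℂ :=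
  {ω | ω ∈ PiY S z ∧ ω.im = ω₀.im ∧ IsPole (fy S z) ω}

end QuarterPlane

end

open QuarterPlane

/-!
The function `℘` with periods `ω₁, ω₂` uniformizes the curve `K(x, y) = 0`. The quartics `d` and `d̃`
have the same invariants, so the homographies `g_x` and `g_y` bring both to the same cubic, and the
cubic of the lattice `ω₁ ℤ + ω₂ ℤ` agrees with it because its two period integrals determine a cubic
with real roots of sum zero (`roots_eq_of_integrals`, by monotonicity of the complete elliptic
integral; the result is `exists_unif`). Along `x = x(ω)`, a root `y` of the kernel satisfies
`y' ^ 2 = 4 d̃(y)`, hence a second-order equation with polynomial right-hand side, and so it is a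
translate of the coordinate of the transposed model. The translation is `ω₃ / 2`, because `X(y₁)` is
the double root of `x ↦ K(x, y₁)` (`Unif.exists_curve`).

In the strip `ω₂ / 2 ≤ Re ω ≤ (ω₂ + ω₃) / 2` one of `|x(ω)|`, `|y(ω)|` is smaller than one
(`Curve.mem_or_mem`): it suffices to exclude `|x| = 1 ≤ |y|`, and `K` has no zero with
`|x| = |y| = 1`, so a connectedness argument on the unit circle reduces this to the real point with
`x = 1`. The functional equation of `Q` therefore lifts `K(x, 0) Q(x, 0)` to the strip. The lift is
extended by the reflection `ω ↦ ω₂ - ω` and then by translation to a meromorphic function `R` with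
`R(ω + ω₃) = R(ω) + y(ω + ω₃) (x(ω + ω₃) - x(ω))`. A connectedness argument in the unit disc shows
that `R` agrees with the given lifts on the whole of `Δ_x` and `Δ_y`, so that `r_x = R` and
`r_y = K(0, 0) Q(0, 0) + x y - R` off a discrete set (`Curve.exists_continuation`).

It follows that `r_y(ω + ω₃) = r_y(ω) + f_y(ω)`, and
`r_y(ω + N ω₃) = r_y(ω) + ∑_{j < N} f_y(ω + j ω₃)`. Modulo `ω₂`, the only poles of `f_y` among the
points `ω₀ + j ω₃` with `j ≥ 0` are `ω₀, ω¹, …, ω^k`, at the indices `0, m₁, …, m_k`; the sum of these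
terms is infinite at `ω₀` by assumption, and `r_y(ω₀)` is finite. Hence `r_y` has a pole at
`ω₀ + N ω₃` for all large `N` (`Curve.eventually_isPole`), and so has `r_x`, since `x y` is finite
there for large `N`. As `ω₂ / ω₃` is irrational, these points are dense modulo `ω₂` on the line through
`ω₀`, and all but finitely many of them avoid the boundaries of the cells, where the branches are cut.
Inside a cell a pole of `r_x` or `r_y` is a pole of a branch (`Unif.isPole_branch`); the factor
`1 / K(x, 0)` cannot cancel it, because `K(x, 0)` is a polynomial in `x`.
-/

namespace QuarterPlane

/-! ### Meromorphic functions on the plane -/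

/-- Identity theorem: meromorphic functions that agree near one point agree, up to a discrete set. -/
theorem eventuallyEq_of_meromorphic {f g : ℂ → ℂ} (hf : Meromorphic f) (hg : Meromorphic g)
    {a : ℂ} (h : f =ᶠ[𝓝[≠] a] g) (b : ℂ) : f =ᶠ[𝓝[≠] b] g := by
  by_contra hb
  have hm : Meromorphic (f - g) := hf.sub hg
  have h1 : meromorphicOrderAt (f - g) b ≠ ⊤ := by
    rw [Ne, meromorphicOrderAt_eq_top_iff]
    intro h'
    exact hb (h'.mono fun z hz => sub_eq_zero.mp hz)
  have h2 := hm.exists_meromorphicOrderAt_ne_top_iff_forall.mp ⟨b, h1⟩ a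
  rw [Ne, meromorphicOrderAt_eq_top_iff] at h2
  exact h2 (h.mono fun z hz => sub_eq_zero.mpr hz)

/-- Two meromorphic functions that agree at points accumulating at `a` agree everywhere, up to
a discrete set. -/
theorem eventuallyEq_of_frequently {f g : ℂ → ℂ} (hf : Meromorphic f) (hg : Meromorphic g)
    {a : ℂ} (h : ∃ᶠ z in 𝓝[≠] a, f z = g z) (b : ℂ) : f =ᶠ[𝓝[≠] b] g :=
  eventuallyEq_of_meromorphic hf hg (((hf a).frequently_eq_iff_eventuallyEq (hg a)).mp h) b

theorem isPole_iff {f : ℂ → ℂ} {a : ℂ} (hf : MeromorphicAt f a) :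
    IsPole f a ↔ meromorphicOrderAt f a < 0 := tendsto_cobounded_iff_meromorphicOrderAt_neg hf

theorem exists_tendsto_of_not_isPole {f : ℂ → ℂ} {a : ℂ} (hf : MeromorphicAt f a)
    (h : ¬ IsPole f a) : ∃ c, Tendsto f (𝓝[≠] a) (𝓝 c) := by
  rw [isPole_iff hf, not_lt] at h
  exact tendsto_nhds_of_meromorphicOrderAt_nonneg hf h

theorem isPole_congr {f g : ℂ → ℂ} {a : ℂ} (h : f =ᶠ[𝓝[≠] a] g) : IsPole f a ↔ IsPole g a :=
  tendsto_congr' h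

theorem tendsto_punctured_add (a c : ℂ) : Tendsto (fun w => w + c) (𝓝[≠] a) (𝓝[≠] (a + c)) := by
  refine tendsto_nhdsWithin_of_tendsto_nhds_of_eventually_within _ ?_ ?_
  · exact ((continuous_id.add continuous_const).tendsto a).mono_left nhdsWithin_le_nhds
  · filter_upwards [self_mem_nhdsWithin] with w hw
    simpa using hw

theorem meromorphic_comp_add {f : ℂ → ℂ} (hf : Meromorphic f) (c : ℂ) :
    Meromorphic fun w => f (w + c) := fun w =>
  (hf (w + c)).comp_analyticAt (g := fun w => w + c) (by fun_prop)

theorem isPole_comp_add {f : ℂ → ℂ} {a c : ℂ} :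
    IsPole (fun w => f (w + c)) a ↔ IsPole f (a + c) := by
  constructor
  · intro h
    have := h.comp (by simpa using tendsto_punctured_add (a + c) (-c) :
      Tendsto (fun w => w + -c) (𝓝[≠] (a + c)) (𝓝[≠] a))
    simpa [IsPole, Function.comp_def] using this
  · intro h
    exact h.comp (tendsto_punctured_add a c)

/-- Uniqueness for differential equations `u'' = F(u)`: the difference `w` of two solutions
satisfies an equation `w'' = φ w`, which is impossible for a function with a zero of finite order
at least two. -/
theorem eventuallyEq_of_second_order {f g φ : ℂ → ℂ} {a : ℂ} (hf : AnalyticAt ℂ f a)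
    (hg : AnalyticAt ℂ g a) (hφ : AnalyticAt ℂ φ a) (h0 : f a = g a) (h1 : deriv f a = deriv g a)
    (h2 : ∀ᶠ z in 𝓝 a, deriv (deriv f) z - deriv (deriv g) z = φ z * (f z - g z)) :
    f =ᶠ[𝓝 a] g := by
  have hu : AnalyticAt ℂ (f - g) a := hf.sub hg
  have e1 : deriv (f - g) =ᶠ[𝓝 a] deriv f - deriv g := by
    filter_upwards [hf.eventually_analyticAt, hg.eventually_analyticAt] with z hz1 hz2
    rw [deriv_sub hz1.differentiableAt hz2.differentiableAt, Pi.sub_apply]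
  have e2 : deriv (deriv (f - g)) =ᶠ[𝓝 a] φ * (f - g) := by
    filter_upwards [e1.deriv, hf.deriv.eventually_analyticAt, hg.deriv.eventually_analyticAt,
      h2] with z hz hz1 hz2 h3
    rw [hz, deriv_sub hz1.differentiableAt hz2.differentiableAt, h3]
    rfl
  have z0 : (f - g) a = 0 := by simp [h0]
  have z1 : deriv (f - g) a = 0 := by rw [e1.eq_of_nhds]; simp [h1]
  have o1 := hu.analyticOrderAt_deriv_add_one
  have o2 := hu.deriv.analyticOrderAt_deriv_add_one
  have o3 : analyticOrderAt (deriv (deriv (f - g))) a =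
      analyticOrderAt φ a + analyticOrderAt (f - g) a := by
    rw [analyticOrderAt_congr e2, analyticOrderAt_mul hφ hu]
  have s1 : (fun z => (f - g) z - (f - g) a) = f - g := by ext z; simp [h0]
  have s2 : (fun z => deriv (f - g) z - deriv (f - g) a) = deriv (f - g) := by ext z; simp [z1]
  rw [s1] at o1
  rw [s2] at o2
  rw [o3] at o2
  have htop : analyticOrderAt (f - g) a = ⊤ := by
    by_contra hne
    obtain ⟨n, hn⟩ := ENat.ne_top_iff_exists.mp hne
    rw [← hn] at o1 o2
    rw [← o2] at o1
    generalize analyticOrderAt φ a = m at o1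
    cases m with
    | top => simp at o1
    | coe m => norm_cast at o1; omega
  rw [analyticOrderAt_eq_top] at htop
  filter_upwards [htop] with z hz
  exact sub_eq_zero.mp hz

/-! ### The Weierstrass function -/

section Weierstrass

variable (L : PeriodPair)

theorem wP_deriv (w : ℂ) : deriv L.weierstrassP w = L.derivWeierstrassP w := by
  rw [PeriodPair.deriv_weierstrassP]

theorem wP_analyticAt {w : ℂ} (hw : w ∉ L.lattice) : AnalyticAt ℂ L.weierstrassP w :=
  L.analyticOnNhd_weierstrassP w hw

theorem eventually_notMem_lattice {w : ℂ} (hw : w ∉ L.lattice) : ∀ᶠ u in 𝓝 w, u ∉ L.lattice :=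
  L.isClosed_lattice.isOpen_compl.mem_nhds hw

theorem eventually_punctured_notMem_lattice (w : ℂ) : ∀ᶠ u in 𝓝[≠] w, u ∉ L.lattice := by
  filter_upwards [nhdsWithin_le_nhds (L.compl_lattice_sdiff_singleton_mem_nhds w),
    self_mem_nhdsWithin] with u hu hu' h
  exact hu ⟨h, hu'⟩

theorem wP_isPole_iff (w : ℂ) : IsPole L.weierstrassP w ↔ w ∈ L.lattice := by
  rw [isPole_iff (L.meromorphic_weierstrassP w)]
  constructor
  · intro h
    by_contra hw
    exact absurd (wP_analyticAt L hw).meromorphicOrderAt_nonneg (not_le.mpr h)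
  · intro h
    rw [L.order_weierstrassP w h]
    decide

theorem wP_deriv_ne_zero_eventually (w : ℂ) : ∀ᶠ u in 𝓝[≠] w, L.derivWeierstrassP u ≠ 0 := by
  rcases (L.meromorphic_derivWeierstrassP w).eventually_eq_zero_or_eventually_ne_zero with h | h
  · exfalso
    -- otherwise `℘` would be constant near a point off the lattice, hence bounded at the origin
    have h0 := eventuallyEq_of_meromorphic L.meromorphic_derivWeierstrassP
      (g := fun _ => 0) (fun _ => MeromorphicAt.const 0 _) h (L.ω₁ / 2)
    have hnl := L.ω₁_div_two_notMem_lattice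
    have hc : ∀ᶠ u in 𝓝 (L.ω₁ / 2), L.derivWeierstrassP u = 0 :=
      ((L.analyticOnNhd_derivWeierstrassP _ hnl).frequently_zero_iff_eventually_zero).mp
        h0.frequently
    obtain ⟨r, hr, hball⟩ := Metric.eventually_nhds_iff_ball.mp
      (hc.and (eventually_notMem_lattice L hnl))
    have hconst : ∀ᶠ u in 𝓝[≠] (L.ω₁ / 2), L.weierstrassP u = L.weierstrassP (L.ω₁ / 2) := by
      filter_upwards [nhdsWithin_le_nhds (Metric.ball_mem_nhds _ hr)] with u hu
      refine Metric.isOpen_ball.is_const_of_deriv_eq_zero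
        (convex_ball (L.ω₁ / 2) r).isPreconnected ?_ ?_ hu (Metric.mem_ball_self hr)
      · exact fun v hv => (wP_analyticAt L (hball v hv).2).differentiableAt.differentiableWithinAt
      · intro v hv
        simpa [wP_deriv] using (hball v hv).1
    have h2 := eventuallyEq_of_meromorphic L.meromorphic_weierstrassP
      (g := fun _ => L.weierstrassP (L.ω₁ / 2)) (fun _ => MeromorphicAt.const _ _) hconst 0
    have h3 := (wP_isPole_iff L 0).mpr (zero_mem _)
    rw [isPole_congr h2, isPole_iff (MeromorphicAt.const _ _)] at h3
    exact absurd (analyticAt_const (𝕜 := ℂ)).meromorphicOrderAt_nonneg (not_le.mpr h3)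
  · exact h

theorem wP_deriv_deriv {w : ℂ} (hw : w ∉ L.lattice) :
    deriv L.derivWeierstrassP w = 6 * L.weierstrassP w ^ 2 - L.g₂ / 2 := by
  have hP := wP_analyticAt L hw
  have hP' := L.analyticOnNhd_derivWeierstrassP w hw
  have hlim : ∀ᶠ u in 𝓝[≠] w, deriv L.derivWeierstrassP u = 6 * L.weierstrassP u ^ 2 - L.g₂ / 2 := by
    filter_upwards [wP_deriv_ne_zero_eventually L w, eventually_punctured_notMem_lattice L w]
      with u hu hul
    have e : (fun v => L.derivWeierstrassP v ^ 2) =ᶠ[𝓝 u]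
        fun v => 4 * L.weierstrassP v ^ 3 - L.g₂ * L.weierstrassP v - L.g₃ := by
      filter_upwards [eventually_notMem_lattice L hul] with v hv
      exact L.derivWeierstrassP_sq v hv
    have d1 : HasDerivAt L.weierstrassP (L.derivWeierstrassP u) u := by
      rw [← wP_deriv]; exact (wP_analyticAt L hul).differentiableAt.hasDerivAt
    have d2 := (L.analyticOnNhd_derivWeierstrassP u hul).differentiableAt.hasDerivAt
    have e1 := (d2.pow 2).unique ((((((d1.pow 3).const_mul 4).sub
      (d1.const_mul L.g₂)).sub_const L.g₃)).congr_of_eventuallyEq e)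
    apply mul_left_cancel₀ (mul_ne_zero two_ne_zero hu)
    simp only [Nat.cast_ofNat] at e1
    linear_combination e1
  exact tendsto_nhds_unique_of_eventuallyEq
    ((hP'.deriv.continuousAt.tendsto).mono_left nhdsWithin_le_nhds)
    (((by fun_prop : ContinuousAt (fun u => 6 * L.weierstrassP u ^ 2 - L.g₂ / 2) w).tendsto).mono_left
      nhdsWithin_le_nhds) hlim

theorem wP_second_order (c w : ℂ) (hw : w + c ∉ L.lattice) :
    ∀ᶠ z in 𝓝 w, deriv (deriv fun v => L.weierstrassP (v + c)) z =
      6 * L.weierstrassP (z + c) ^ 2 - L.g₂ / 2 := by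
  have h1 : deriv (fun v => L.weierstrassP (v + c)) = fun v => L.derivWeierstrassP (v + c) := by
    ext v
    rw [deriv_comp_add_const, wP_deriv]
  have : Tendsto (fun z => z + c) (𝓝 w) (𝓝 (w + c)) :=
    (continuous_id.add continuous_const).tendsto w
  filter_upwards [this.eventually (eventually_notMem_lattice L hw)] with z hz
  rw [h1, deriv_comp_add_const, wP_deriv_deriv L hz]

/-- If a translate of `℘` agrees with `℘` to first order at a point, then the translation is by
an element of the lattice. -/
theorem sub_mem_lattice_of_wP_eq {u v : ℂ} (hu : u ∉ L.lattice) (hv : v ∉ L.lattice)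
    (h0 : L.weierstrassP u = L.weierstrassP v)
    (h1 : L.derivWeierstrassP u = L.derivWeierstrassP v) : u - v ∈ L.lattice := by
  have hf : AnalyticAt ℂ (fun w => L.weierstrassP (w + u)) 0 :=
    AnalyticAt.comp (g := L.weierstrassP) (f := fun w : ℂ => w + u)
      (by simpa using wP_analyticAt L hu) (by fun_prop)
  have hg : AnalyticAt ℂ (fun w => L.weierstrassP (w + v)) 0 :=
    AnalyticAt.comp (g := L.weierstrassP) (f := fun w : ℂ => w + v)
      (by simpa using wP_analyticAt L hv) (by fun_prop)
  have := eventuallyEq_of_second_order hf hg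
    (show AnalyticAt ℂ (fun z => 6 * (L.weierstrassP (z + u) + L.weierstrassP (z + v))) 0 from
      analyticAt_const.mul (hf.add hg)) (by simpa using h0)
    (by simpa [deriv_comp_add_const, wP_deriv] using h1) (by
      filter_upwards [wP_second_order L u 0 (by simpa using hu),
        wP_second_order L v 0 (by simpa using hv)] with z h2 h3
      rw [h2, h3]
      ring)
  have h2 := eventuallyEq_of_meromorphic (meromorphic_comp_add L.meromorphic_weierstrassP u)
    (meromorphic_comp_add L.meromorphic_weierstrassP v)
    (this.filter_mono nhdsWithin_le_nhds) (-v)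
  have h3 := isPole_congr h2
  rw [isPole_comp_add, isPole_comp_add, wP_isPole_iff, wP_isPole_iff] at h3
  have := h3.mpr (by simp)
  rwa [neg_add_eq_sub] at this

theorem wP_eq_iff {u v : ℂ} (hu : u ∉ L.lattice) (hv : v ∉ L.lattice) :
    L.weierstrassP u = L.weierstrassP v ↔ u - v ∈ L.lattice ∨ u + v ∈ L.lattice := by
  constructor
  · intro h
    have h2 : L.derivWeierstrassP u ^ 2 = L.derivWeierstrassP v ^ 2 := by
      rw [L.derivWeierstrassP_sq u hu, L.derivWeierstrassP_sq v hv, h]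
    rcases sq_eq_sq_iff_eq_or_eq_neg.mp h2 with h3 | h3
    · exact Or.inl (sub_mem_lattice_of_wP_eq L hu hv h h3)
    · right
      have hv' : -v ∉ L.lattice := by simpa using hv
      have := sub_mem_lattice_of_wP_eq L hu hv' (by rw [L.weierstrassP_neg, h])
        (by rw [L.derivWeierstrassP_neg, h3])
      simpa using this
  · rintro (h | h)
    · have := L.weierstrassP_add_coe v ⟨_, h⟩
      simpa using this
    · have := L.weierstrassP_add_coe (-v) ⟨_, h⟩
      simpa using this

/-- A value omitted by `℘` would make `1 / (℘ - c)` a bounded entire function. -/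
theorem wP_surjective (c : ℂ) : ∃ u, u ∉ L.lattice ∧ L.weierstrassP u = c := by
  classical
  by_contra! hc
  let f : ℂ → ℂ := fun w => if w ∈ L.lattice then 0 else (L.weierstrassP w - c)⁻¹
  have hfan : ∀ w, AnalyticAt ℂ f w := by
    intro w
    have hmer : MeromorphicAt (fun w => L.weierstrassP w - c) w :=
      (L.meromorphic_weierstrassP w).sub (MeromorphicAt.const c w)
    have hev : f =ᶠ[𝓝[≠] w] (fun w => L.weierstrassP w - c)⁻¹ := by
      filter_upwards [eventually_punctured_notMem_lattice L w] with u hu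
      simp [f, hu]
    by_cases hw : w ∈ L.lattice
    · refine AnalyticAt.of_meromorphicOrderAt_pos ?_ (by simp [f, hw])
      rw [meromorphicOrderAt_congr hev, meromorphicOrderAt_inv]
      have hneg : meromorphicOrderAt (fun w => L.weierstrassP w - c) w = -2 := by
        have : (fun w => L.weierstrassP w - c) = L.weierstrassP + fun _ => -c := by
          ext; simp [sub_eq_add_neg]
        rw [this, meromorphicOrderAt_add_eq_left_of_lt (MeromorphicAt.const _ _),
          L.order_weierstrassP w hw]
        rw [L.order_weierstrassP w hw]
        exact lt_of_lt_of_le (by decide) (analyticAt_const (𝕜 := ℂ)).meromorphicOrderAt_nonneg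
      rw [hneg]
      decide
    · have h1 : AnalyticAt ℂ (fun w => (L.weierstrassP w - c)⁻¹) w :=
        ((wP_analyticAt L hw).sub analyticAt_const).inv (sub_ne_zero.mpr (hc w hw))
      refine h1.congr ?_
      filter_upwards [eventually_notMem_lattice L hw] with u hu
      simp [f, hu]
  have hd : Differentiable ℂ f := fun w => (hfan w).differentiableAt
  have hper : ∀ z, ∀ w ∈ L.lattice, f (z + w) = f z := by
    intro z w hw
    have := L.weierstrassP_add_coe z ⟨w, hw⟩
    simp only at this
    simp only [f, this, L.lattice.add_mem_iff_left hw]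
  have hb := (IsZLattice.isCompact_range_of_periodic L.lattice f hd.continuous
    fun z w hw => hper z w hw).isBounded
  have h0 := hd.apply_eq_apply_of_bounded hb (L.ω₁ / 2) 0
  have hn := L.ω₁_div_two_notMem_lattice
  simp only [f, hn, if_false, zero_mem, if_true, inv_eq_zero] at h0
  exact hc _ hn (sub_eq_zero.mp h0)

end Weierstrass

/-! ### Rectangular lattices -/

/-- The period pair `(i A, B)` with `A, B > 0`, which spans a rectangular lattice. -/
structure IsRect (L : PeriodPair) (A B : ℝ) : Prop where
  posA : 0 < A
  posB : 0 < B
  per₁ : L.ω₁ = Complex.I * (A : ℂ)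
  per₂ : L.ω₂ = (B : ℂ)

/-- The value of `℘` at the half-period `ω₂ / 2`. -/
noncomputable def e₁ (L : PeriodPair) : ℝ := (L.weierstrassP (L.ω₂ / 2)).re

/-- The value of `℘` at the half-period `(ω₁ + ω₂) / 2`. -/
noncomputable def e₂ (L : PeriodPair) : ℝ := (L.weierstrassP ((L.ω₁ + L.ω₂) / 2)).re

/-- The value of `℘` at the half-period `ω₁ / 2`. -/
noncomputable def e₃ (L : PeriodPair) : ℝ := (L.weierstrassP (L.ω₁ / 2)).re

/-- Substituting a solution `f` of `f' ^ 2 = 4 φ(f)` in `∫ dv / √φ(v)`. -/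
theorem integral_image_of_sq_deriv {f ρ φ : ℝ → ℝ} {a b : ℝ} (hab : a ≤ b)
    (hf : ∀ t ∈ Set.Ioo a b, HasDerivAt f (ρ t) t) (hinj : Set.InjOn f (Set.Ioo a b))
    (hρ : ∀ t ∈ Set.Ioo a b, ρ t ^ 2 = 4 * φ (f t)) (hφ : ∀ t ∈ Set.Ioo a b, 0 < φ (f t)) :
    ∫ v in f '' Set.Ioo a b, 1 / √(φ v) = 2 * (b - a) := by
  rw [MeasureTheory.integral_image_eq_integral_abs_deriv_smul measurableSet_Ioo
    (fun t ht => (hf t ht).hasDerivWithinAt) hinj]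
  have : Set.EqOn (fun t => |ρ t| • (1 / √(φ (f t)))) (fun _ => (2 : ℝ)) (Set.Ioo a b) := by
    intro t ht
    have h1 : |ρ t| = 2 * √(φ (f t)) := by
      rw [← Real.sqrt_sq_eq_abs, hρ t ht, Real.sqrt_mul (by norm_num)]
      congr 1
      rw [show (4 : ℝ) = 2 ^ 2 by norm_num, Real.sqrt_sq (by norm_num)]
    have h2 : √(φ (f t)) ≠ 0 := (Real.sqrt_pos.mpr (hφ t ht)).ne'
    simp only [h1, smul_eq_mul]
    field_simp
  rw [MeasureTheory.setIntegral_congr_fun measurableSet_Ioo this]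
  simp [hab, mul_comm]

namespace IsRect

variable {L : PeriodPair} {A B : ℝ}

theorem mem_iff (h : IsRect L A B) (w : ℂ) : w ∈ L.lattice ↔ (∃ n : ℤ, w.re = n * B) ∧ ∃ m : ℤ, w.im = m * A := by
  rw [PeriodPair.mem_lattice]
  constructor
  · rintro ⟨m, n, rfl⟩
    exact ⟨⟨n, by simp [h.per₁, h.per₂]⟩, ⟨m, by simp [h.per₁, h.per₂]⟩⟩
  · rintro ⟨⟨n, hn⟩, ⟨m, hm⟩⟩
    refine ⟨m, n, ?_⟩
    apply Complex.ext <;> simp [h.per₁, h.per₂, hn, hm]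

theorem int_mul_ne_half {C : ℝ} (hC : 0 < C) (n : ℤ) : C / 2 ≠ n * C := by
  intro h1
  have h2 : (1 : ℝ) = ((2 * n : ℤ) : ℝ) := by
    push_cast
    field_simp at h1
    linarith
  have h3 : (1 : ℤ) = 2 * n := by exact_mod_cast h2
  omega

theorem notMem_of_re_between (h : IsRect L A B) {w : ℂ} (h0 : 0 < w.re) (h1 : w.re < B) : w ∉ L.lattice := by
  rw [h.mem_iff]
  rintro ⟨⟨n, hn⟩, -⟩
  rw [hn] at h0 h1
  have hB := h.posB
  have h2 : (0 : ℝ) < n := by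
    by_contra hc
    push Not at hc
    nlinarith
  have h3 : (n : ℝ) < 1 := by
    by_contra hc
    push Not at hc
    nlinarith
  have : (0 : ℤ) < n := by exact_mod_cast h2
  have : n < (1 : ℤ) := by exact_mod_cast h3
  omega

theorem notMem_of_im_between (h : IsRect L A B) {w : ℂ} (h0 : 0 < w.im) (h1 : w.im < A) : w ∉ L.lattice := by
  rw [h.mem_iff]
  rintro ⟨-, ⟨n, hn⟩⟩
  rw [hn] at h0 h1
  have hA := h.posA
  have h2 : (0 : ℝ) < n := by
    by_contra hc
    push Not at hc
    nlinarith
  have h3 : (n : ℝ) < 1 := by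
    by_contra hc
    push Not at hc
    nlinarith
  have : (0 : ℤ) < n := by exact_mod_cast h2
  have : n < (1 : ℤ) := by exact_mod_cast h3
  omega

theorem conj_mem (h : IsRect L A B) {w : ℂ} (hw : w ∈ L.lattice) : (starRingEnd ℂ) w ∈ L.lattice := by
  rw [h.mem_iff] at hw ⊢
  obtain ⟨⟨n, hn⟩, ⟨m, hm⟩⟩ := hw
  exact ⟨⟨n, by simpa using hn⟩, ⟨-m, by simp [hm]⟩⟩

theorem wP_conj (h : IsRect L A B) (w : ℂ) :
    L.weierstrassP ((starRingEnd ℂ) w) = (starRingEnd ℂ) (L.weierstrassP w) := by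
  let E : L.lattice ≃ L.lattice :=
    { toFun := fun l => ⟨(starRingEnd ℂ) l, h.conj_mem l.2⟩
      invFun := fun l => ⟨(starRingEnd ℂ) l, h.conj_mem l.2⟩
      left_inv := fun l => by simp
      right_inv := fun l => by simp }
  have h1 := L.hasSum_weierstrassP ((starRingEnd ℂ) w)
  have h2 := (L.hasSum_weierstrassP w).map (starRingEnd ℂ) Complex.continuous_conj
  rw [← E.hasSum_iff] at h1
  refine h1.unique ?_
  convert h2 using 1
  ext l
  simp [E]

theorem wP_add_mem {w : ℂ} {l : ℂ} (hl : l ∈ L.lattice) :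
    L.weierstrassP (w + l) = L.weierstrassP w := L.weierstrassP_add_coe w ⟨l, hl⟩

/-- `℘` is real on the vertical lines through the half-lattice. -/
theorem im_eq_zero_of_re (h : IsRect L A B) {w : ℂ} (n : ℤ) (hw : w.re = n * (B / 2)) :
    (L.weierstrassP w).im = 0 := by
  have h1 : (starRingEnd ℂ) w = -w + ((n : ℂ) * B) := by
    apply Complex.ext
    · simp [hw]; ring
    · simp
  have h2 : ((n : ℂ) * B) ∈ L.lattice := by
    rw [h.mem_iff]
    exact ⟨⟨n, by simp⟩, ⟨0, by simp⟩⟩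
  have h3 := h.wP_conj w
  rw [h1, wP_add_mem h2, L.weierstrassP_neg] at h3
  exact Complex.conj_eq_iff_im.mp h3.symm

/-- `℘` is real on the horizontal lines through the half-lattice. -/
theorem im_eq_zero_of_im (h : IsRect L A B) {w : ℂ} (n : ℤ) (hw : w.im = n * (A / 2)) :
    (L.weierstrassP w).im = 0 := by
  have h1 : (starRingEnd ℂ) w = w + (-(n : ℂ) * (Complex.I * A)) := by
    apply Complex.ext
    · simp
    · simp [hw]; ring
  have h2 : (-(n : ℂ) * (Complex.I * A)) ∈ L.lattice := by
    rw [h.mem_iff]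
    exact ⟨⟨0, by simp⟩, ⟨-n, by simp⟩⟩
  have h3 := h.wP_conj w
  rw [h1, wP_add_mem h2] at h3
  exact Complex.conj_eq_iff_im.mp h3.symm

theorem half₁ (h : IsRect L A B) : L.ω₁ / 2 = Complex.I * (A / 2 : ℝ) := by rw [h.per₁]; push_cast; ring

theorem half₂ (h : IsRect L A B) : L.ω₂ / 2 = ((B / 2 : ℝ) : ℂ) := by rw [h.per₂]; push_cast; ring

theorem half₁₂ (h : IsRect L A B) : (L.ω₁ + L.ω₂) / 2 = Complex.I * (A / 2 : ℝ) + ((B / 2 : ℝ) : ℂ) := by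
  rw [h.per₁, h.per₂]; push_cast; ring

theorem half₁₂_notMem (h : IsRect L A B) : (L.ω₁ + L.ω₂) / 2 ∉ L.lattice := by
  rw [h.half₁₂]
  have := h.posB
  exact h.notMem_of_re_between (by simp; linarith) (by simp; linarith)

theorem wP_half₁ (h : IsRect L A B) : L.weierstrassP (L.ω₁ / 2) = (e₃ L : ℂ) := by
  apply Complex.ext
  · simp [e₃]
  · rw [h.im_eq_zero_of_im 1 (by rw [h.half₁]; simp)]; simp

theorem wP_half₂ (h : IsRect L A B) : L.weierstrassP (L.ω₂ / 2) = (e₁ L : ℂ) := by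
  apply Complex.ext
  · simp [e₁]
  · rw [h.im_eq_zero_of_im 0 (by rw [h.half₂]; simp)]; simp

theorem wP_half₁₂ (h : IsRect L A B) : L.weierstrassP ((L.ω₁ + L.ω₂) / 2) = (e₂ L : ℂ) := by
  apply Complex.ext
  · simp [e₂]
  · rw [h.im_eq_zero_of_im 1 (by rw [h.half₁₂]; simp)]; simp

theorem deriv_half {u : ℂ} (hu : 2 * u ∈ L.lattice) : L.derivWeierstrassP u = 0 := by
  have h1 := L.derivWeierstrassP_add_coe (-u) ⟨_, hu⟩
  rw [L.derivWeierstrassP_neg] at h1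
  simp only at h1
  rw [show -u + 2 * u = u by ring] at h1
  have : 2 * L.derivWeierstrassP u = 0 := by linear_combination h1
  simpa using this

/-- The differential equation `℘' ^ 2 = 4 (℘ - e₁) (℘ - e₂) (℘ - e₃)` with distinct `e₁, e₂, e₃` of sum
zero: `℘'` vanishes at the half-periods, so that `e₁, e₂, e₃` are the roots of `4 v ^ 3 - g₂ v - g₃`. -/
theorem sq_deriv (h : IsRect L A B) {w : ℂ} (hw : w ∉ L.lattice) : L.derivWeierstrassP w ^ 2 =
    4 * ((L.weierstrassP w - e₁ L) * (L.weierstrassP w - e₂ L) * (L.weierstrassP w - e₃ L)) ∧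
    e₁ L + e₂ L + e₃ L = 0 ∧ e₁ L ≠ e₂ L ∧ e₁ L ≠ e₃ L ∧ e₂ L ≠ e₃ L := by
  have hA := h.posA
  have hB := h.posB
  have root : ∀ u : ℂ, u ∉ L.lattice → 2 * u ∈ L.lattice →
      4 * L.weierstrassP u ^ 3 - L.g₂ * L.weierstrassP u - L.g₃ = 0 := by
    intro u hu hu2
    rw [← L.derivWeierstrassP_sq u hu, deriv_half hu2]
    ring
  have m1 : 2 * (L.ω₁ / 2) ∈ L.lattice := by
    rw [mul_div_cancel₀ _ (two_ne_zero)]; exact L.ω₁_mem_lattice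
  have m2 : 2 * (L.ω₂ / 2) ∈ L.lattice := by
    rw [mul_div_cancel₀ _ (two_ne_zero)]; exact L.ω₂_mem_lattice
  have m3 : 2 * ((L.ω₁ + L.ω₂) / 2) ∈ L.lattice := by
    rw [mul_div_cancel₀ _ (two_ne_zero)]; exact add_mem L.ω₁_mem_lattice L.ω₂_mem_lattice
  have r1 := root _ L.ω₂_div_two_notMem_lattice m2
  have r2 := root _ h.half₁₂_notMem m3
  have r3 := root _ L.ω₁_div_two_notMem_lattice m1
  rw [h.wP_half₂] at r1
  rw [h.wP_half₁₂] at r2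
  rw [h.wP_half₁] at r3
  -- `℘` takes the same value at two points only if they agree up to sign and periods
  have n12 : (e₁ L : ℂ) ≠ e₂ L := by
    rw [← h.wP_half₂, ← h.wP_half₁₂]
    intro hc
    rcases (wP_eq_iff L L.ω₂_div_two_notMem_lattice h.half₁₂_notMem).mp hc with h1 | h1 <;>
    · rw [h.half₂, h.half₁₂, h.mem_iff] at h1
      obtain ⟨-, n, hn⟩ := h1
      simp at hn
      first
      | exact int_mul_ne_half hA n hn
      | exact int_mul_ne_half hA (-n) (by push_cast; linarith)
  have n13 : (e₁ L : ℂ) ≠ e₃ L := by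
    rw [← h.wP_half₂, ← h.wP_half₁]
    intro hc
    rcases (wP_eq_iff L L.ω₂_div_two_notMem_lattice L.ω₁_div_two_notMem_lattice).mp hc with h1 | h1 <;>
    · rw [h.half₂, h.half₁, h.mem_iff] at h1
      obtain ⟨-, n, hn⟩ := h1
      simp at hn
      first
      | exact int_mul_ne_half hA n hn
      | exact int_mul_ne_half hA (-n) (by push_cast; linarith)
  have n23 : (e₂ L : ℂ) ≠ e₃ L := by
    rw [← h.wP_half₁₂, ← h.wP_half₁]
    intro hc
    rcases (wP_eq_iff L h.half₁₂_notMem L.ω₁_div_two_notMem_lattice).mp hc with h1 | h1 <;>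
    · rw [h.half₁₂, h.half₁, h.mem_iff] at h1
      obtain ⟨⟨n, hn⟩, -⟩ := h1
      simp at hn
      exact int_mul_ne_half hB n hn
  have s12 : 4 * ((e₁ L : ℂ) ^ 2 + e₁ L * e₂ L + e₂ L ^ 2) - L.g₂ = 0 :=
    mul_left_cancel₀ (sub_ne_zero.mpr n12) (by linear_combination r1 - r2)
  have s13 : 4 * ((e₁ L : ℂ) ^ 2 + e₁ L * e₃ L + e₃ L ^ 2) - L.g₂ = 0 :=
    mul_left_cancel₀ (sub_ne_zero.mpr n13) (by linear_combination r1 - r3)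
  have s : (e₁ L : ℂ) + e₂ L + e₃ L = 0 :=
    mul_left_cancel₀ (mul_ne_zero (by norm_num : (4 : ℂ) ≠ 0) (sub_ne_zero.mpr n23))
      (by linear_combination s12 - s13)
  refine ⟨?_, by exact_mod_cast s, by exact_mod_cast n12, by exact_mod_cast n13,
    by exact_mod_cast n23⟩
  rw [L.derivWeierstrassP_sq w hw]
  linear_combination (L.weierstrassP w - e₁ L) * (4 * L.weierstrassP w - 4 * e₂ L) * s +
    (L.weierstrassP w - e₁ L) * s12 + r1

theorem sum_eq_zero (h : IsRect L A B) : e₁ L + e₂ L + e₃ L = 0 := (h.sq_deriv L.ω₁_div_two_notMem_lattice).2.1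

/-- Along a line on which `℘` is real it is a real solution of the Weierstrass equation, with a
sign that depends on the direction `δ ∈ {1, i}`. -/
theorem line_hasDerivAt (h : IsRect L A B) {p δ : ℂ} {ε : ℝ} (hδ : δ ^ 2 = (ε : ℂ)) {t : ℝ}
    (hL : p + t * δ ∉ L.lattice) (hreal : ∀ᶠ s : ℝ in 𝓝 t, (L.weierstrassP (p + s * δ)).im = 0) :
    ∃ ρ : ℝ, HasDerivAt (fun s : ℝ => (L.weierstrassP (p + s * δ)).re) ρ t ∧
      L.derivWeierstrassP (p + t * δ) * δ = ρ ∧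
      ρ ^ 2 = 4 * (ε * (((L.weierstrassP (p + t * δ)).re - e₁ L) *
        ((L.weierstrassP (p + t * δ)).re - e₂ L) * ((L.weierstrassP (p + t * δ)).re - e₃ L))) := by
  have d0 : HasDerivAt (fun s : ℂ => p + s * δ) δ (t : ℂ) := by
    simpa using ((hasDerivAt_id (t : ℂ)).mul_const δ).const_add p
  have d1 : HasDerivAt (fun s : ℂ => L.weierstrassP (p + s * δ))
      (L.derivWeierstrassP (p + t * δ) * δ) (t : ℂ) := by
    refine HasDerivAt.comp (h₂ := L.weierstrassP) (t : ℂ) ?_ d0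
    rw [← wP_deriv]
    exact (wP_analyticAt L hL).differentiableAt.hasDerivAt
  have d2 : HasDerivAt (fun s : ℝ => L.weierstrassP (p + s * δ))
      (L.derivWeierstrassP (p + t * δ) * δ) t := d1.comp_ofReal
  have d3 : HasDerivAt (fun s : ℝ => (L.weierstrassP (p + s * δ)).re)
      (L.derivWeierstrassP (p + t * δ) * δ).re t :=
    (Complex.reCLM.hasFDerivAt.comp_hasDerivAt t d2)
  have d4 : HasDerivAt (fun s : ℝ => (L.weierstrassP (p + s * δ)).im)
      (L.derivWeierstrassP (p + t * δ) * δ).im t :=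
    (Complex.imCLM.hasFDerivAt.comp_hasDerivAt t d2)
  have him : (L.derivWeierstrassP (p + t * δ) * δ).im = 0 :=
    d4.unique ((hasDerivAt_const t (0 : ℝ)).congr_of_eventuallyEq hreal)
  have hρ : L.derivWeierstrassP (p + t * δ) * δ =
      ((L.derivWeierstrassP (p + t * δ) * δ).re : ℂ) := by
    apply Complex.ext <;> simp [him]
  refine ⟨_, d3, hρ, ?_⟩
  have hv : L.weierstrassP (p + t * δ) = ((L.weierstrassP (p + t * δ)).re : ℂ) := by
    apply Complex.ext <;> simp [hreal.self_of_nhds]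
  have hsq := (h.sq_deriv hL).1
  have : (((L.derivWeierstrassP (p + t * δ) * δ).re : ℂ)) ^ 2 =
      4 * (ε * (((L.weierstrassP (p + t * δ)).re - e₁ L) *
        ((L.weierstrassP (p + t * δ)).re - e₂ L) *
        ((L.weierstrassP (p + t * δ)).re - e₃ L))) := by
    rw [← hρ, ← hv, mul_pow, hsq, hδ]
    ring
  exact_mod_cast this

theorem line_continuousOn {p δ : ℂ} {s : Set ℝ} (hL : ∀ t ∈ s, p + (t : ℂ) * δ ∉ L.lattice) :
    ContinuousOn (fun t : ℝ => (L.weierstrassP (p + t * δ)).re) s := by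
  intro t ht
  have h1 : ContinuousAt (fun t : ℝ => L.weierstrassP (p + t * δ)) t :=
    ContinuousAt.comp (g := L.weierstrassP) (f := fun t : ℝ => p + t * δ)
      (wP_analyticAt L (hL t ht)).continuousAt (by fun_prop)
  exact (Complex.continuous_re.continuousAt.comp h1).continuousWithinAt

end IsRect

/-! ### The values of `℘` on the symmetry lines -/

/-- The real part of `℘` along the line `t ↦ p + t δ`. -/
noncomputable def lineVal (L : PeriodPair) (p δ : ℂ) (t : ℝ) : ℝ := (L.weierstrassP (p + t * δ)).re

/-- The cubic `(v - e₁) (v - e₂) (v - e₃)`, a quarter of the right-hand side of the differential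
equation of `℘`. -/
noncomputable def cubic (L : PeriodPair) (v : ℝ) : ℝ := (v - e₁ L) * (v - e₂ L) * (v - e₃ L)

namespace IsRect

variable {L : PeriodPair} {A B : ℝ}

/-- On a line on which `℘` is real, with direction `δ ∈ {1, i}`, the sign of the cubic is that of
`δ ^ 2`, because `℘' ^ 2 δ ^ 2` is the square of a real derivative. -/
theorem sign_cubic (h : IsRect L A B) {p δ : ℂ} {ε : ℝ} (hδ : δ ^ 2 = (ε : ℂ)) {t : ℝ}
    (hL : p + t * δ ∉ L.lattice) (hreal : ∀ s : ℝ, (L.weierstrassP (p + s * δ)).im = 0) :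
    0 ≤ ε * cubic L (lineVal L p δ t) := by
  obtain ⟨ρ, -, -, hρ⟩ := h.line_hasDerivAt hδ hL (.of_forall hreal)
  have := sq_nonneg ρ
  rw [hρ] at this
  unfold cubic lineVal
  linarith

/-- Near the double pole at the origin `℘` tends to `+∞` along the real axis and to `-∞` along the
imaginary axis. -/
theorem tendsto_lineVal_zero (L : PeriodPair) {δ : ℂ} {ε : ℝ} (hδ : δ ^ 2 = (ε : ℂ))
    (hε : ε * ε = 1) : Tendsto (fun t => ε * lineVal L 0 δ t) (𝓝[>] 0) atTop := by
  have hε0 : ε ≠ 0 := left_ne_zero_of_mul_eq_one hε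
  have e1 : ∀ t : ℝ, t ≠ 0 → ε * lineVal L 0 δ t =
      (t⁻¹) ^ 2 + ε * (L.weierstrassPExcept 0 (t * δ)).re := by
    intro t ht
    have h1 := L.weierstrassPExcept_def ⟨0, zero_mem _⟩ (t * δ)
    simp only [sub_zero, ne_eq, OfNat.ofNat_ne_zero, not_false_eq_true, zero_pow, div_zero,
      zero_sub] at h1
    have h2 : 1 / ((t : ℂ) * δ) ^ 2 = ((ε * (t⁻¹) ^ 2 : ℝ) : ℂ) := by
      rw [mul_pow, hδ]
      have : (ε : ℂ) * ε = 1 := by exact_mod_cast hε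
      have h3 : (ε : ℂ) ≠ 0 := by exact_mod_cast hε0
      have h4 : (t : ℂ) ≠ 0 := by exact_mod_cast ht
      push_cast
      field_simp
      linear_combination -this
    rw [h2] at h1
    have h3 : L.weierstrassP (t * δ) = L.weierstrassPExcept 0 (t * δ) + ((ε * (t⁻¹) ^ 2 : ℝ) : ℂ) := by
      rw [h1]; ring
    simp only [lineVal, zero_add]
    rw [h3, Complex.add_re, Complex.ofReal_re, mul_add, ← mul_assoc, hε]
    ring
  have h1 : Tendsto (fun t : ℝ => (t⁻¹) ^ 2) (𝓝[>] 0) atTop :=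
    (tendsto_pow_atTop two_ne_zero).comp tendsto_inv_nhdsGT_zero
  have h2 : Tendsto (fun t : ℝ => ε * (L.weierstrassPExcept 0 (t * δ)).re) (𝓝[>] 0)
      (𝓝 (ε * (L.weierstrassPExcept 0 (((0 : ℝ) : ℂ) * δ)).re)) := by
    have h3 : ContinuousAt (fun t : ℝ => L.weierstrassPExcept 0 (t * δ)) 0 := by
      refine ContinuousAt.comp (g := L.weierstrassPExcept 0) (f := fun t : ℝ => (t : ℂ) * δ)
        ?_ (by fun_prop)
      simpa using (L.analyticAt_weierstrassPExcept 0).continuousAt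
    exact ((continuousAt_const.mul (Complex.continuous_re.continuousAt.comp h3)).tendsto).mono_left
      nhdsWithin_le_nhds
  refine (h1.atTop_add h2).congr' ?_
  filter_upwards [self_mem_nhdsWithin] with t ht
  exact (e1 t (ne_of_gt ht)).symm

theorem real_hor_zero (h : IsRect L A B) (s : ℝ) : (L.weierstrassP (0 + s * 1)).im = 0 :=
  h.im_eq_zero_of_im 0 (by simp)

theorem real_hor_half (h : IsRect L A B) (s : ℝ) : (L.weierstrassP (L.ω₁ / 2 + s * 1)).im = 0 :=
  h.im_eq_zero_of_im 1 (by simp [h.half₁])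

theorem real_ver_zero (h : IsRect L A B) (s : ℝ) :
    (L.weierstrassP (0 + s * Complex.I)).im = 0 :=
  h.im_eq_zero_of_re 0 (by simp)

theorem real_ver_half (h : IsRect L A B) (s : ℝ) :
    (L.weierstrassP (L.ω₂ / 2 + s * Complex.I)).im = 0 :=
  h.im_eq_zero_of_re 1 (by simp [h.half₂])

theorem notMem_hor_zero (h : IsRect L A B) {t : ℝ} (ht : t ∈ Set.Ioo 0 B) :
    (0 : ℂ) + t * 1 ∉ L.lattice :=
  h.notMem_of_re_between (by simpa using ht.1) (by simpa using ht.2)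

theorem notMem_hor_half (h : IsRect L A B) (t : ℝ) : L.ω₁ / 2 + t * 1 ∉ L.lattice := by
  have := h.posA
  exact h.notMem_of_im_between (by rw [h.half₁]; simp; linarith) (by rw [h.half₁]; simp; linarith)

theorem notMem_ver_zero (h : IsRect L A B) {t : ℝ} (ht : t ∈ Set.Ioo 0 A) :
    (0 : ℂ) + t * Complex.I ∉ L.lattice :=
  h.notMem_of_im_between (by simpa using ht.1) (by simpa using ht.2)

theorem notMem_ver_half (h : IsRect L A B) (t : ℝ) : L.ω₂ / 2 + t * Complex.I ∉ L.lattice := by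
  have := h.posB
  exact h.notMem_of_re_between (by rw [h.half₂]; simp; linarith) (by rw [h.half₂]; simp; linarith)

theorem I_sq_cast : Complex.I ^ 2 = ((-1 : ℝ) : ℂ) := by simp

theorem one_sq_cast : (1 : ℂ) ^ 2 = ((1 : ℝ) : ℂ) := by simp

theorem lineVal_hor_zero_half (h : IsRect L A B) : lineVal L 0 1 (B / 2) = e₁ L := by
  unfold lineVal e₁
  rw [h.half₂]; simp

theorem lineVal_ver_zero_half (h : IsRect L A B) : lineVal L 0 Complex.I (A / 2) = e₃ L := by
  unfold lineVal e₃
  rw [h.half₁]; simp [mul_comm]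

theorem lineVal_hor_half_half (h : IsRect L A B) : lineVal L (L.ω₁ / 2) 1 (B / 2) = e₂ L := by
  unfold lineVal e₂
  rw [h.half₁₂, h.half₁]; simp

theorem lineVal_hor_half_zero (L : PeriodPair) : lineVal L (L.ω₁ / 2) 1 0 = e₃ L := by
  unfold lineVal e₃
  simp

theorem lineVal_ver_half_half (h : IsRect L A B) :
    lineVal L (L.ω₂ / 2) Complex.I (A / 2) = e₂ L := by
  unfold lineVal e₂
  rw [h.half₁₂, h.half₂]
  congr 2
  push_cast
  ring

theorem lineVal_ver_half_zero (L : PeriodPair) : lineVal L (L.ω₂ / 2) Complex.I 0 = e₁ L := by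
  unfold lineVal e₁
  simp

theorem exists_hor_zero (h : IsRect L A B) {v : ℝ} (hv : e₁ L ≤ v) :
    ∃ t ∈ Set.Ioc 0 (B / 2), lineVal L 0 1 t = v := by
  have hB := h.posB
  have h1 := (tendsto_lineVal_zero L one_sq_cast (by norm_num)).eventually_ge_atTop v
  obtain ⟨t, ht1, ht2⟩ := (h1.and (Ioo_mem_nhdsGT (half_pos hB))).exists
  rw [one_mul] at ht1
  have hc : ContinuousOn (lineVal L 0 1) (Set.Icc t (B / 2)) :=
    line_continuousOn fun s hs => h.notMem_hor_zero
      ⟨lt_of_lt_of_le ht2.1 hs.1, by linarith [hs.2]⟩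
  obtain ⟨s, hs, hsv⟩ := intermediate_value_Icc' ht2.2.le hc
    (show v ∈ Set.Icc _ _ from ⟨by rw [h.lineVal_hor_zero_half]; exact hv, ht1⟩)
  exact ⟨s, ⟨lt_of_lt_of_le ht2.1 hs.1, hs.2⟩, hsv⟩

theorem exists_ver_zero (h : IsRect L A B) {v : ℝ} (hv : v ≤ e₃ L) :
    ∃ t ∈ Set.Ioc 0 (A / 2), lineVal L 0 Complex.I t = v := by
  have hA := h.posA
  have h1 := (tendsto_lineVal_zero L I_sq_cast (by norm_num)).eventually_ge_atTop (-v)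
  obtain ⟨t, ht1, ht2⟩ := (h1.and (Ioo_mem_nhdsGT (half_pos hA))).exists
  have hc : ContinuousOn (lineVal L 0 Complex.I) (Set.Icc t (A / 2)) :=
    line_continuousOn fun s hs => h.notMem_ver_zero
      ⟨lt_of_lt_of_le ht2.1 hs.1, by linarith [hs.2]⟩
  obtain ⟨s, hs, hsv⟩ := intermediate_value_Icc ht2.2.le hc
    (show v ∈ Set.Icc _ _ from ⟨by linarith, by rw [h.lineVal_ver_zero_half]; exact hv⟩)
  exact ⟨s, ⟨lt_of_lt_of_le ht2.1 hs.1, hs.2⟩, hsv⟩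

theorem cubic_nonneg_of_ge (h : IsRect L A B) {v : ℝ} (hv : e₁ L ≤ v) : 0 ≤ cubic L v := by
  have hB := h.posB
  obtain ⟨t, ht, rfl⟩ := h.exists_hor_zero hv
  have := h.sign_cubic one_sq_cast (h.notMem_hor_zero ⟨ht.1, by linarith [ht.2]⟩) h.real_hor_zero
  linarith

theorem cubic_nonpos_of_le (h : IsRect L A B) {v : ℝ} (hv : v ≤ e₃ L) : cubic L v ≤ 0 := by
  have hA := h.posA
  obtain ⟨t, ht, rfl⟩ := h.exists_ver_zero hv
  have := h.sign_cubic I_sq_cast (h.notMem_ver_zero ⟨ht.1, by linarith [ht.2]⟩) h.real_ver_zero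
  linarith

/-- The sign of the cubic on `[e₁, ∞[` and on `]-∞, e₃]` forces the order of its roots. -/
theorem e_order (h : IsRect L A B) : e₃ L < e₂ L ∧ e₂ L < e₁ L := by
  obtain ⟨-, -, h12, h13, h23⟩ := h.sq_deriv L.ω₁_div_two_notMem_lattice
  have up : ∀ v, e₁ L ≤ v → 0 ≤ (v - e₁ L) * (v - e₂ L) * (v - e₃ L) := fun v =>
    h.cubic_nonneg_of_ge
  have dn : ∀ v, v ≤ e₃ L → (v - e₁ L) * (v - e₂ L) * (v - e₃ L) ≤ 0 := fun v =>
    h.cubic_nonpos_of_le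
  generalize e₁ L = a at *
  generalize e₂ L = b at *
  generalize e₃ L = c at *
  have neg : ∀ x y z : ℝ, 0 < x → y < 0 → 0 < z → x * y * z < 0 := fun x y z hx hy hz =>
    mul_neg_of_neg_of_pos (mul_neg_of_pos_of_neg hx hy) hz
  -- no root lies above `a`
  have hba : b < a := by
    rcases lt_or_gt_of_ne h12 with h1 | h1
    · exfalso
      rcases lt_or_gt_of_ne h23 with h2 | h2
      · -- `a < b < c`
        have := up ((b + c) / 2) (by linarith)
        nlinarith [mul_pos (mul_pos (show 0 < (b + c) / 2 - a by linarith)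
          (show 0 < (b + c) / 2 - b by linarith)) (show 0 < c - (b + c) / 2 by linarith)]
      · have h3 : max a c < b := max_lt h1 h2
        have h4 : a ≤ max a c := le_max_left _ _
        have h5 : c ≤ max a c := le_max_right _ _
        have := up ((max a c + b) / 2) (by linarith)
        nlinarith [mul_pos (mul_pos (show 0 < (max a c + b) / 2 - a by linarith)
          (show 0 < b - (max a c + b) / 2 by linarith))
          (show 0 < (max a c + b) / 2 - c by linarith)]
    · exact h1
  have hca : c < a := by
    rcases lt_or_gt_of_ne h13 with h1 | h1
    · exfalso
      have := up ((a + c) / 2) (by linarith)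
      nlinarith [mul_pos (mul_pos (show 0 < (a + c) / 2 - a by linarith)
        (show 0 < (a + c) / 2 - b by linarith)) (show 0 < c - (a + c) / 2 by linarith)]
    · exact h1
  refine ⟨?_, hba⟩
  rcases lt_or_gt_of_ne h23 with h1 | h1
  · exfalso
    have := dn ((b + c) / 2) (by linarith)
    nlinarith [mul_pos (mul_pos (show 0 < a - (b + c) / 2 by linarith)
      (show 0 < (b + c) / 2 - b by linarith)) (show 0 < c - (b + c) / 2 by linarith)]
  · exact h1

theorem cubic_neg_mid (h : IsRect L A B) {v : ℝ} (h2 : e₂ L < v) (h1 : v < e₁ L) :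
    cubic L v < 0 := by
  have := h.e_order
  unfold cubic
  nlinarith [mul_pos (mul_pos (show 0 < e₁ L - v by linarith) (show 0 < v - e₂ L by linarith))
    (show 0 < v - e₃ L by linarith)]

theorem cubic_pos_mid (h : IsRect L A B) {v : ℝ} (h3 : e₃ L < v) (h2 : v < e₂ L) :
    0 < cubic L v := by
  have := h.e_order
  unfold cubic
  nlinarith [mul_pos (mul_pos (show 0 < e₁ L - v by linarith) (show 0 < e₂ L - v by linarith))
    (show 0 < v - e₃ L by linarith)]

theorem cubic_pos_of_gt (h : IsRect L A B) {v : ℝ} (h1 : e₁ L < v) : 0 < cubic L v := by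
  have := h.e_order
  unfold cubic
  exact mul_pos (mul_pos (by linarith) (by linarith)) (by linarith)

theorem cubic_neg_of_lt (h : IsRect L A B) {v : ℝ} (h3 : v < e₃ L) : cubic L v < 0 := by
  have := h.e_order
  unfold cubic
  nlinarith [mul_pos (mul_pos (show 0 < e₁ L - v by linarith) (show 0 < e₂ L - v by linarith))
    (show 0 < e₃ L - v by linarith)]

/-- A continuous function which never takes a value in a gap `]a, b[` stays on its side. -/
theorem ge_of_avoids {f : ℝ → ℝ} {s : Set ℝ} (hs : IsPreconnected s) (hf : ContinuousOn f s)
    {t₀ : ℝ} (ht₀ : t₀ ∈ s) {a b : ℝ} (hab : a < b) (h0 : b ≤ f t₀)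
    (hgap : ∀ t ∈ s, f t ∉ Set.Ioo a b) {t : ℝ} (ht : t ∈ s) : b ≤ f t := by
  by_contra hc
  push Not at hc
  have hI := (hs.image f hf).ordConnected.out (Set.mem_image_of_mem f ht)
    (Set.mem_image_of_mem f ht₀)
  have hle : max (f t) a < b := max_lt hc hab
  obtain ⟨u, hu, huv⟩ := hI (show (max (f t) a + b) / 2 ∈ Set.Icc _ _ from
    ⟨by linarith [le_max_left (f t) a], by linarith⟩)
  exact hgap u hu ⟨by rw [huv]; linarith [le_max_right (f t) a], by rw [huv]; linarith⟩

theorem le_of_avoids {f : ℝ → ℝ} {s : Set ℝ} (hs : IsPreconnected s) (hf : ContinuousOn f s)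
    {t₀ : ℝ} (ht₀ : t₀ ∈ s) {a b : ℝ} (hab : a < b) (h0 : f t₀ ≤ a)
    (hgap : ∀ t ∈ s, f t ∉ Set.Ioo a b) {t : ℝ} (ht : t ∈ s) : f t ≤ a := by
  have := ge_of_avoids (f := fun t => - f t) hs hf.neg ht₀ (neg_lt_neg hab) (by linarith)
    (fun t ht h => hgap t ht ⟨by linarith [h.2], by linarith [h.1]⟩) ht
  linarith

theorem hor_zero_ge (h : IsRect L A B) {t : ℝ} (ht : t ∈ Set.Ioo 0 B) :
    e₁ L ≤ lineVal L 0 1 t := by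
  have hB := h.posB
  refine ge_of_avoids isPreconnected_Ioo (line_continuousOn fun s hs => h.notMem_hor_zero hs)
    (t₀ := B / 2) ⟨by linarith, by linarith⟩ h.e_order.2 h.lineVal_hor_zero_half.ge ?_ ht
  intro s hs hv
  have h1 := h.sign_cubic one_sq_cast (h.notMem_hor_zero hs) h.real_hor_zero
  rw [one_mul] at h1
  exact absurd (h.cubic_neg_mid hv.1 hv.2) (not_lt.mpr h1)

theorem ver_zero_le (h : IsRect L A B) {t : ℝ} (ht : t ∈ Set.Ioo 0 A) :
    lineVal L 0 Complex.I t ≤ e₃ L := by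
  have hA := h.posA
  refine le_of_avoids isPreconnected_Ioo (line_continuousOn fun s hs => h.notMem_ver_zero hs)
    (t₀ := A / 2) ⟨by linarith, by linarith⟩ h.e_order.1 h.lineVal_ver_zero_half.le ?_ ht
  intro s hs hv
  have h1 := h.sign_cubic I_sq_cast (h.notMem_ver_zero hs) h.real_ver_zero
  have := h.cubic_pos_mid hv.1 hv.2
  unfold lineVal at *
  linarith

theorem ver_half_mem (h : IsRect L A B) (t : ℝ) :
    lineVal L (L.ω₂ / 2) Complex.I t ∈ Set.Icc (e₂ L) (e₁ L) := by
  have hc : ContinuousOn (lineVal L (L.ω₂ / 2) Complex.I) Set.univ :=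
    line_continuousOn fun s _ => h.notMem_ver_half s
  have hs : ∀ s, cubic L (lineVal L (L.ω₂ / 2) Complex.I s) ≤ 0 := fun s => by
    have h1 := h.sign_cubic I_sq_cast (h.notMem_ver_half s) h.real_ver_half
    linarith
  constructor
  · refine ge_of_avoids isPreconnected_univ hc (Set.mem_univ 0) h.e_order.1
      (by rw [lineVal_ver_half_zero]; exact h.e_order.2.le) ?_ (Set.mem_univ t)
    intro s _ hv
    exact absurd (h.cubic_pos_mid hv.1 hv.2) (not_lt.mpr (hs s))
  · by_contra hlt
    exact absurd (h.cubic_pos_of_gt (not_le.mp hlt)) (not_lt.mpr (hs t))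

theorem hor_half_mem (h : IsRect L A B) (t : ℝ) :
    lineVal L (L.ω₁ / 2) 1 t ∈ Set.Icc (e₃ L) (e₂ L) := by
  have hc : ContinuousOn (lineVal L (L.ω₁ / 2) 1) Set.univ :=
    line_continuousOn fun s _ => h.notMem_hor_half s
  have hs : ∀ s, 0 ≤ cubic L (lineVal L (L.ω₁ / 2) 1 s) := fun s => by
    have h1 := h.sign_cubic one_sq_cast (h.notMem_hor_half s) h.real_hor_half
    linarith
  constructor
  · by_contra hlt
    exact absurd (h.cubic_neg_of_lt (not_le.mp hlt)) (not_lt.mpr (hs t))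
  · refine le_of_avoids isPreconnected_univ hc (Set.mem_univ 0) h.e_order.2
      (by rw [lineVal_hor_half_zero]; exact h.e_order.1.le) ?_ (Set.mem_univ t)
    intro s _ hv
    exact absurd (h.cubic_neg_mid hv.1 hv.2) (not_lt.mpr (hs s))

end IsRect

/-! ### The periods as elliptic integrals -/

namespace IsRect

variable {L : PeriodPair} {A B : ℝ}

/-- Points of `[0, C / 2]` that agree up to sign modulo `C` are equal. -/
theorem eq_of_int_mul {C t s : ℝ} (hC : 0 < C) (ht : t ∈ Set.Icc 0 (C / 2))
    (hs : s ∈ Set.Icc 0 (C / 2)) (h : (∃ n : ℤ, t - s = n * C) ∨ ∃ n : ℤ, t + s = n * C) :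
    t = s := by
  obtain ⟨ht0, ht1⟩ := ht
  obtain ⟨hs0, hs1⟩ := hs
  rcases h with ⟨n, hn⟩ | ⟨n, hn⟩
  · have h1 : n < 1 := by
      by_contra hc
      have : (1 : ℝ) ≤ n := by exact_mod_cast not_lt.mp hc
      nlinarith
    have h2 : -1 < n := by
      by_contra hc
      have : (n : ℝ) ≤ -1 := by exact_mod_cast not_lt.mp hc
      nlinarith
    obtain rfl : n = 0 := by omega
    simp at hn
    linarith
  · have h1 : n < 2 := by
      by_contra hc
      have : (2 : ℝ) ≤ n := by exact_mod_cast not_lt.mp hc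
      nlinarith
    have h2 : -1 < n := by
      by_contra hc
      have : (n : ℝ) ≤ -1 := by exact_mod_cast not_lt.mp hc
      nlinarith
    obtain rfl | rfl : n = 0 ∨ n = 1 := by omega
    · simp at hn
      linarith
    · simp at hn
      linarith

theorem wP_eq_lineVal {p δ : ℂ} {t : ℝ} (h : (L.weierstrassP (p + t * δ)).im = 0) :
    L.weierstrassP (p + t * δ) = (lineVal L p δ t : ℂ) := by
  apply Complex.ext <;> simp [lineVal, h]

theorem injOn_hor_zero (h : IsRect L A B) : Set.InjOn (lineVal L 0 1) (Set.Ioc 0 (B / 2)) := by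
  intro t ht s hs hts
  have hB := h.posB
  have h1 : L.weierstrassP (0 + t * 1) = L.weierstrassP (0 + s * 1) := by
    rw [wP_eq_lineVal (h.real_hor_zero t), wP_eq_lineVal (h.real_hor_zero s), hts]
  have := (wP_eq_iff L (h.notMem_hor_zero ⟨ht.1, by linarith [ht.2]⟩)
    (h.notMem_hor_zero ⟨hs.1, by linarith [hs.2]⟩)).mp h1
  refine eq_of_int_mul hB ⟨ht.1.le, ht.2⟩ ⟨hs.1.le, hs.2⟩ ?_
  refine this.imp (fun hm => ?_) fun hm => ?_ <;>
  · obtain ⟨⟨n, hn⟩, -⟩ := (h.mem_iff _).mp hm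
    exact ⟨n, by simpa using hn⟩

theorem injOn_hor_half (h : IsRect L A B) :
    Set.InjOn (lineVal L (L.ω₁ / 2) 1) (Set.Icc 0 (B / 2)) := by
  intro t ht s hs hts
  have h1 : L.weierstrassP (L.ω₁ / 2 + t * 1) = L.weierstrassP (L.ω₁ / 2 + s * 1) := by
    rw [wP_eq_lineVal (h.real_hor_half t), wP_eq_lineVal (h.real_hor_half s), hts]
  have := (wP_eq_iff L (h.notMem_hor_half t) (h.notMem_hor_half s)).mp h1
  refine eq_of_int_mul h.posB ht hs ?_
  refine this.imp (fun hm => ?_) fun hm => ?_ <;>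
  · rw [h.half₁, h.mem_iff] at hm
    obtain ⟨⟨n, hn⟩, -⟩ := hm
    exact ⟨n, by simpa using hn⟩

theorem injOn_ver_half (h : IsRect L A B) :
    Set.InjOn (lineVal L (L.ω₂ / 2) Complex.I) (Set.Icc 0 (A / 2)) := by
  intro t ht s hs hts
  have h1 : L.weierstrassP (L.ω₂ / 2 + t * Complex.I) =
      L.weierstrassP (L.ω₂ / 2 + s * Complex.I) := by
    rw [wP_eq_lineVal (h.real_ver_half t), wP_eq_lineVal (h.real_ver_half s), hts]
  have := (wP_eq_iff L (h.notMem_ver_half t) (h.notMem_ver_half s)).mp h1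
  refine eq_of_int_mul h.posA ht hs ?_
  refine this.imp (fun hm => ?_) fun hm => ?_ <;>
  · rw [h.half₂, h.mem_iff] at hm
    obtain ⟨-, ⟨n, hn⟩⟩ := hm
    exact ⟨n, by simpa using hn⟩

theorem image_hor_half (h : IsRect L A B) :
    lineVal L (L.ω₁ / 2) 1 '' Set.Ioo 0 (B / 2) = Set.Ioo (e₃ L) (e₂ L) := by
  have hB := h.posB
  apply Set.Subset.antisymm
  · rintro _ ⟨t, ht, rfl⟩
    have hm := h.hor_half_mem t
    refine ⟨lt_of_le_of_ne hm.1 fun hc => ?_, lt_of_le_of_ne hm.2 fun hc => ?_⟩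
    · rw [← lineVal_hor_half_zero] at hc
      have := h.injOn_hor_half ⟨le_rfl, by linarith⟩ ⟨ht.1.le, ht.2.le⟩ hc
      linarith [ht.1]
    · rw [← h.lineVal_hor_half_half] at hc
      have := h.injOn_hor_half ⟨ht.1.le, ht.2.le⟩ ⟨by linarith, le_rfl⟩ hc
      linarith [ht.2]
  · have := intermediate_value_Ioo (show (0 : ℝ) ≤ B / 2 by linarith)
      (line_continuousOn (L := L) (p := L.ω₁ / 2) (δ := 1) fun s _ => h.notMem_hor_half s)
    intro v hv
    exact this ⟨by have := lineVal_hor_half_zero L; unfold lineVal at this; rw [this]; exact hv.1,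
      by have := h.lineVal_hor_half_half; unfold lineVal at this; rw [this]; exact hv.2⟩

theorem image_ver_half (h : IsRect L A B) :
    lineVal L (L.ω₂ / 2) Complex.I '' Set.Ioo 0 (A / 2) = Set.Ioo (e₂ L) (e₁ L) := by
  have hA := h.posA
  apply Set.Subset.antisymm
  · rintro _ ⟨t, ht, rfl⟩
    have hm := h.ver_half_mem t
    refine ⟨lt_of_le_of_ne hm.1 fun hc => ?_, lt_of_le_of_ne hm.2 fun hc => ?_⟩
    · rw [← h.lineVal_ver_half_half] at hc
      have := h.injOn_ver_half ⟨by linarith, le_rfl⟩ ⟨ht.1.le, ht.2.le⟩ hc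
      linarith [ht.2]
    · rw [← lineVal_ver_half_zero] at hc
      have := h.injOn_ver_half ⟨ht.1.le, ht.2.le⟩ ⟨le_rfl, by linarith⟩ hc
      linarith [ht.1]
  · have := intermediate_value_Ioo' (show (0 : ℝ) ≤ A / 2 by linarith)
      (line_continuousOn (L := L) (p := L.ω₂ / 2) (δ := Complex.I) fun s _ => h.notMem_ver_half s)
    intro v hv
    exact this ⟨by have := h.lineVal_ver_half_half; unfold lineVal at this; rw [this]; exact hv.1,
      by have := lineVal_ver_half_zero L; unfold lineVal at this; rw [this]; exact hv.2⟩

theorem gt_hor_zero (h : IsRect L A B) {t : ℝ} (ht : t ∈ Set.Ioo 0 (B / 2)) :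
    e₁ L < lineVal L 0 1 t := by
  have hB := h.posB
  refine lt_of_le_of_ne (h.hor_zero_ge ⟨ht.1, by linarith [ht.2]⟩) fun hc => ?_
  rw [← h.lineVal_hor_zero_half] at hc
  have := h.injOn_hor_zero ⟨by linarith, le_rfl⟩ ⟨ht.1, ht.2.le⟩ hc
  linarith [ht.2]

theorem image_hor_zero_Ioi (h : IsRect L A B) :
    lineVal L 0 1 '' Set.Ioo 0 (B / 2) = Set.Ioi (e₁ L) := by
  apply Set.Subset.antisymm
  · rintro _ ⟨t, ht, rfl⟩
    exact h.gt_hor_zero ht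
  · intro v hv
    obtain ⟨t, ht, rfl⟩ := h.exists_hor_zero (le_of_lt hv)
    refine ⟨t, ⟨ht.1, lt_of_le_of_ne ht.2 ?_⟩, rfl⟩
    rintro rfl
    rw [h.lineVal_hor_zero_half] at hv
    exact lt_irrefl (e₁ L) hv

theorem image_hor_zero (h : IsRect L A B) {t₀ : ℝ} (ht₀ : t₀ ∈ Set.Ioo 0 (B / 2)) :
    lineVal L 0 1 '' Set.Ioo t₀ (B / 2) = Set.Ioo (e₁ L) (lineVal L 0 1 t₀) := by
  have hB := h.posB
  have hc : ∀ t ∈ Set.Ioo 0 (B / 2), ContinuousOn (lineVal L 0 1) (Set.Icc t (B / 2)) :=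
    fun t ht => line_continuousOn fun s hs => h.notMem_hor_zero
      ⟨lt_of_lt_of_le ht.1 hs.1, by linarith [hs.2]⟩
  apply Set.Subset.antisymm
  · rintro _ ⟨t, ht, rfl⟩
    have ht' : t ∈ Set.Ioo 0 (B / 2) := ⟨ht₀.1.trans ht.1, ht.2⟩
    refine ⟨h.gt_hor_zero ht', ?_⟩
    by_contra hlt
    obtain ⟨s, hs, hsv⟩ := intermediate_value_Icc' ht.2.le (hc t ht')
      (show lineVal L 0 1 t₀ ∈ Set.Icc _ _ from
        ⟨by rw [h.lineVal_hor_zero_half]; exact (h.gt_hor_zero ht₀).le, not_lt.mp hlt⟩)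
    have := h.injOn_hor_zero ⟨lt_of_lt_of_le ht'.1 hs.1, hs.2⟩ ⟨ht₀.1, ht₀.2.le⟩ hsv
    linarith [ht.1, hs.1]
  · intro v hv
    exact intermediate_value_Ioo' ht₀.2.le (hc t₀ ht₀)
      ⟨by rw [h.lineVal_hor_zero_half]; exact hv.1, hv.2⟩

/-- A period as a complete elliptic integral: substitute `v = ℘` along a line. -/
theorem integral_line (h : IsRect L A B) {p δ : ℂ} {ε : ℝ} (hδ : δ ^ 2 = (ε : ℂ)) {a b : ℝ}
    (hab : a ≤ b) (hL : ∀ t ∈ Set.Ioo a b, p + (t : ℂ) * δ ∉ L.lattice)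
    (hreal : ∀ s : ℝ, (L.weierstrassP (p + s * δ)).im = 0)
    (hinj : Set.InjOn (lineVal L p δ) (Set.Ioo a b))
    (hpos : ∀ t ∈ Set.Ioo a b, 0 < ε * cubic L (lineVal L p δ t)) :
    ∫ v in lineVal L p δ '' Set.Ioo a b, 1 / √(ε * cubic L v) = 2 * (b - a) := by
  choose! ρ hρ using fun t ht => h.line_hasDerivAt hδ (hL t ht) (.of_forall hreal)
  exact integral_image_of_sq_deriv (ρ := ρ) (φ := fun v => ε * cubic L v) hab
    (fun t ht => (hρ t ht).1) hinj (fun t ht => (hρ t ht).2.2) hpos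

theorem integral_B (h : IsRect L A B) :
    ∫ v in Set.Ioo (e₃ L) (e₂ L), 1 / √(cubic L v) = B := by
  have hB := h.posB
  have := h.integral_line (p := L.ω₁ / 2) one_sq_cast (show (0 : ℝ) ≤ B / 2 by linarith)
    (fun t _ => h.notMem_hor_half t) h.real_hor_half
    (h.injOn_hor_half.mono Set.Ioo_subset_Icc_self) (fun t ht => by
      have hm : lineVal L (L.ω₁ / 2) 1 t ∈ Set.Ioo (e₃ L) (e₂ L) :=
        h.image_hor_half ▸ Set.mem_image_of_mem _ ht
      rw [one_mul]
      exact h.cubic_pos_mid hm.1 hm.2)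
  rw [h.image_hor_half] at this
  simp only [one_mul] at this
  rw [this]; ring

theorem integral_A (h : IsRect L A B) :
    ∫ v in Set.Ioo (e₂ L) (e₁ L), 1 / √(-cubic L v) = A := by
  have hA := h.posA
  have := h.integral_line (p := L.ω₂ / 2) I_sq_cast (show (0 : ℝ) ≤ A / 2 by linarith)
    (fun t _ => h.notMem_ver_half t) h.real_ver_half
    (h.injOn_ver_half.mono Set.Ioo_subset_Icc_self) (fun t ht => by
      have hm : lineVal L (L.ω₂ / 2) Complex.I t ∈ Set.Ioo (e₂ L) (e₁ L) :=
        h.image_ver_half ▸ Set.mem_image_of_mem _ ht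
      have := h.cubic_neg_mid hm.1 hm.2
      linarith)
  rw [h.image_ver_half] at this
  simp only [neg_mul, one_mul] at this
  rw [this]; ring

theorem integral_Ioi (h : IsRect L A B) : ∫ v in Set.Ioi (e₁ L), 1 / √(cubic L v) = B := by
  have hB := h.posB
  have := h.integral_line (p := 0) one_sq_cast (show (0 : ℝ) ≤ B / 2 by linarith)
    (fun t ht => h.notMem_hor_zero ⟨ht.1, by linarith [ht.2]⟩) h.real_hor_zero
    (h.injOn_hor_zero.mono Set.Ioo_subset_Ioc_self) (fun t ht => by
      rw [one_mul]
      exact h.cubic_pos_of_gt (h.gt_hor_zero ht))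
  rw [h.image_hor_zero_Ioi] at this
  simp only [one_mul] at this
  rw [this]; ring

/-- An incomplete elliptic integral. -/
theorem integral_Ioo (h : IsRect L A B) {v₀ : ℝ} (hv₀ : e₁ L < v₀) :
    ∃ t₀ ∈ Set.Ioo 0 (B / 2), L.weierstrassP t₀ = (v₀ : ℂ) ∧
      ∫ v in Set.Ioo (e₁ L) v₀, 1 / √(cubic L v) = B - 2 * t₀ := by
  have hB := h.posB
  obtain ⟨t₀, ht₀, hv⟩ : v₀ ∈ lineVal L 0 1 '' Set.Ioo 0 (B / 2) := by
    rw [h.image_hor_zero_Ioi]; exact hv₀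
  refine ⟨t₀, ht₀, ?_, ?_⟩
  · have := wP_eq_lineVal (h.real_hor_zero t₀)
    rw [hv] at this
    simpa using this
  · have := h.integral_line (p := 0) one_sq_cast ht₀.2.le
      (fun t ht => h.notMem_hor_zero ⟨ht₀.1.trans ht.1, by linarith [ht.2]⟩) h.real_hor_zero
      (h.injOn_hor_zero.mono ((Set.Ioo_subset_Ioo_left ht₀.1.le).trans Set.Ioo_subset_Ioc_self))
      (fun t ht => by
        rw [one_mul]
        exact h.cubic_pos_of_gt (h.gt_hor_zero ⟨ht₀.1.trans ht.1, ht.2⟩))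
    rw [h.image_hor_zero ht₀, hv] at this
    simp only [one_mul] at this
    rw [this]; ring

/-- `℘` increases from `e₃` to `e₂` on the segment from `ω₁ / 2` to `(ω₁ + ω₂) / 2`. -/
theorem deriv_hor_half_pos (h : IsRect L A B) {t : ℝ} (ht : t ∈ Set.Ioo 0 (B / 2)) :
    ∃ ρ : ℝ, 0 < ρ ∧ L.derivWeierstrassP (L.ω₁ / 2 + t) = ρ := by
  have hB := h.posB
  obtain ⟨ρ, h1, h2, h3⟩ := h.line_hasDerivAt (p := L.ω₁ / 2) (t := t) one_sq_cast
    (h.notMem_hor_half t) (.of_forall h.real_hor_half)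
  have hm : lineVal L (L.ω₁ / 2) 1 t ∈ Set.Ioo (e₃ L) (e₂ L) :=
    h.image_hor_half ▸ Set.mem_image_of_mem _ ht
  have hmono : StrictMonoOn (lineVal L (L.ω₁ / 2) 1) (Set.Icc 0 (B / 2)) := by
    refine ContinuousOn.strictMonoOn_of_injOn_Icc (by linarith) ?_
      (line_continuousOn fun s _ => h.notMem_hor_half s) h.injOn_hor_half
    rw [lineVal_hor_half_zero, h.lineVal_hor_half_half]
    exact h.e_order.1.le
  have hne : ρ ≠ 0 := by
    rintro rfl
    have := h.cubic_pos_mid hm.1 hm.2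
    unfold cubic lineVal at this
    linarith
  have hge : 0 ≤ ρ := by
    have h4 : HasDerivWithinAt (lineVal L (L.ω₁ / 2) 1) ρ (Set.Icc 0 (B / 2)) t :=
      HasDerivAt.hasDerivWithinAt h1
    have h5 := hmono.monotoneOn.derivWithin_nonneg (x := t)
    rwa [h4.derivWithin (uniqueDiffOn_Icc (show (0 : ℝ) < B / 2 by linarith) t
      (Set.mem_Icc.mpr ⟨ht.1.le, ht.2.le⟩))] at h5
  refine ⟨ρ, lt_of_le_of_ne hge (Ne.symm hne), by simpa using h2⟩

theorem deriv_hor_half_neg (h : IsRect L A B) {t : ℝ} (ht : t ∈ Set.Ioo (B / 2) B) :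
    ∃ ρ : ℝ, ρ < 0 ∧ L.derivWeierstrassP (L.ω₁ / 2 + t) = ρ := by
  obtain ⟨ρ, h1, h2⟩ := h.deriv_hor_half_pos (t := B - t) ⟨by linarith [ht.2], by linarith [ht.1]⟩
  refine ⟨-ρ, by linarith, ?_⟩
  have h3 := L.derivWeierstrassP_add_coe (-(L.ω₁ / 2 + (B - t : ℝ)))
    ⟨_, add_mem L.ω₁_mem_lattice L.ω₂_mem_lattice⟩
  simp only at h3
  rw [L.derivWeierstrassP_neg, h2] at h3
  rw [show L.ω₁ / 2 + (t : ℂ) = -(L.ω₁ / 2 + ((B - t : ℝ) : ℂ)) + (L.ω₁ + L.ω₂) by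
    rw [h.per₂]; push_cast; ring, h3]
  push_cast; rfl

end IsRect

/-! ### Complete elliptic integrals determine the roots of the cubic -/

/-- The complete elliptic integral of the first kind with parameter `m`. -/
noncomputable def ellK (m : ℝ) : ℝ := ∫ θ in (0 : ℝ)..(Real.pi / 2), 1 / √(1 - m * Real.sin θ ^ 2)

theorem one_sub_mul_sin_sq_pos {m : ℝ} (hm : m < 1) (θ : ℝ) : 0 < 1 - m * Real.sin θ ^ 2 := by
  have h1 := Real.sin_sq_le_one θ
  have h2 := sq_nonneg (Real.sin θ)
  rcases le_or_gt m 0 with h | h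
  · nlinarith
  · nlinarith

theorem continuous_ellK_integrand {m : ℝ} (hm : m < 1) :
    Continuous fun θ => 1 / √(1 - m * Real.sin θ ^ 2) :=
  continuous_const.div (by fun_prop) fun θ =>
    (Real.sqrt_pos.mpr (one_sub_mul_sin_sq_pos hm θ)).ne'

theorem ellK_pos {m : ℝ} (hm : m < 1) : 0 < ellK m :=
  intervalIntegral.intervalIntegral_pos_of_pos ((continuous_ellK_integrand hm).intervalIntegrable _ _)
    (fun θ => one_div_pos.mpr (Real.sqrt_pos.mpr (one_sub_mul_sin_sq_pos hm θ)))
    (by linarith [Real.pi_pos])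

theorem ellK_lt {m m' : ℝ} (h : m < m') (hm' : m' < 1) : ellK m < ellK m' := by
  have hpi := Real.pi_pos
  have key : ∀ θ, 1 / √(1 - m * Real.sin θ ^ 2) ≤ 1 / √(1 - m' * Real.sin θ ^ 2) := fun θ =>
    one_div_le_one_div_of_le (Real.sqrt_pos.mpr (one_sub_mul_sin_sq_pos hm' θ))
      (Real.sqrt_le_sqrt (by nlinarith [sq_nonneg (Real.sin θ)]))
  refine intervalIntegral.integral_lt_integral_of_continuousOn_of_le_of_exists_lt (by linarith)
    (continuous_ellK_integrand (h.trans hm')).continuousOn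
    (continuous_ellK_integrand hm').continuousOn (fun θ _ => key θ)
    ⟨Real.pi / 2, ⟨by linarith, le_rfl⟩, ?_⟩
  have h1 := one_sub_mul_sin_sq_pos hm' (Real.pi / 2)
  refine one_div_lt_one_div_of_lt (Real.sqrt_pos.mpr h1) (Real.sqrt_lt_sqrt h1.le ?_)
  simp
  exact h

/-- The substitution `v = c + (b - c) sin² θ`. -/
theorem integral_eq_ellK {a b c : ℝ} (hcb : c < b) (hba : b < a) :
    ∫ v in Set.Ioo c b, 1 / √((v - a) * (v - b) * (v - c)) =
      2 / √(a - c) * ellK ((b - c) / (a - c)) := by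
  have hpi := Real.pi_pos
  have hγ : 0 < a - c := by linarith
  have hm : (b - c) / (a - c) < 1 := by rw [div_lt_one hγ]; linarith
  set f : ℝ → ℝ := fun θ => c + (b - c) * Real.sin θ ^ 2 with hf
  have hd : ∀ θ, HasDerivAt f ((b - c) * (2 * Real.sin θ * Real.cos θ)) θ := by
    intro θ
    have := (((Real.hasDerivAt_sin θ).pow 2).const_mul (b - c)).const_add c
    exact this.congr_deriv (by simp)
  have hmono : StrictMonoOn f (Set.Icc 0 (Real.pi / 2)) := by
    intro x hx y hy hxy
    have h1 := Real.sin_lt_sin_of_lt_of_le_pi_div_two (by linarith [hx.1]) hy.2 hxy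
    have h2 := Real.sin_nonneg_of_nonneg_of_le_pi hx.1 (by linarith [hx.2])
    have : Real.sin x ^ 2 < Real.sin y ^ 2 := by nlinarith
    simp only [hf]
    nlinarith
  have himg : f '' Set.Ioo 0 (Real.pi / 2) = Set.Ioo c b := by
    have e0 : f 0 = c := by simp [hf]
    have e1 : f (Real.pi / 2) = b := by simp [hf]
    apply Set.Subset.antisymm
    · rintro _ ⟨t, ht, rfl⟩
      have h1 := hmono ⟨le_rfl, by linarith⟩ ⟨ht.1.le, ht.2.le⟩ ht.1
      have h2 := hmono ⟨ht.1.le, ht.2.le⟩ ⟨by linarith, le_rfl⟩ ht.2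
      rw [e0] at h1
      rw [e1] at h2
      exact ⟨h1, h2⟩
    · have := intermediate_value_Ioo (show (0 : ℝ) ≤ Real.pi / 2 by linarith)
        (f := f) (by fun_prop)
      rwa [e0, e1] at this
  rw [← himg, MeasureTheory.integral_image_eq_integral_abs_deriv_smul measurableSet_Ioo
    (fun t _ => (hd t).hasDerivWithinAt) (hmono.injOn.mono Set.Ioo_subset_Icc_self)]
  have hE : Set.EqOn (fun θ => |(b - c) * (2 * Real.sin θ * Real.cos θ)| •
      (1 / √((f θ - a) * (f θ - b) * (f θ - c))))
      (fun θ => 2 / √(a - c) * (1 / √(1 - (b - c) / (a - c) * Real.sin θ ^ 2)))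
      (Set.Ioo 0 (Real.pi / 2)) := by
    intro θ hθ
    have hs : 0 < Real.sin θ := Real.sin_pos_of_pos_of_lt_pi hθ.1 (by linarith [hθ.2])
    have hc : 0 < Real.cos θ := Real.cos_pos_of_mem_Ioo ⟨by linarith [hθ.1], hθ.2⟩
    have hcs : Real.cos θ ^ 2 = 1 - Real.sin θ ^ 2 := Real.cos_sq' θ
    have h1 : (f θ - a) * (f θ - b) * (f θ - c) = ((b - c) * (Real.sin θ * Real.cos θ)) ^ 2 *
        ((a - c) * (1 - (b - c) / (a - c) * Real.sin θ ^ 2)) := by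
      have : (a - c) * (1 - (b - c) / (a - c) * Real.sin θ ^ 2) =
          (a - c) - (b - c) * Real.sin θ ^ 2 := by field_simp
      rw [this, mul_pow, mul_pow, hcs]
      simp only [hf]
      ring
    have hbc : 0 < (b - c) * (Real.sin θ * Real.cos θ) := mul_pos (by linarith) (mul_pos hs hc)
    have h3 := Real.sqrt_pos.mpr hγ
    have h4 := Real.sqrt_pos.mpr (one_sub_mul_sin_sq_pos hm θ)
    simp only [smul_eq_mul]
    rw [h1, Real.sqrt_mul (sq_nonneg _), Real.sqrt_sq hbc.le, Real.sqrt_mul hγ.le, abs_of_pos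
      (by rw [mul_assoc 2]; nlinarith)]
    have hb0 : b - c ≠ 0 := sub_ne_zero.mpr hcb.ne'
    generalize √(1 - (b - c) / (a - c) * Real.sin θ ^ 2) = r at *
    field_simp
  rw [MeasureTheory.setIntegral_congr_fun measurableSet_Ioo hE,
    ← MeasureTheory.integral_Ioc_eq_integral_Ioo, ← intervalIntegral.integral_of_le (by linarith),
    intervalIntegral.integral_const_mul, ellK]

theorem integral_neg_eq_ellK {a b c : ℝ} (hcb : c < b) (hba : b < a) :
    ∫ v in Set.Ioo b a, 1 / √(-((v - a) * (v - b) * (v - c))) =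
      2 / √(a - c) * ellK ((a - b) / (a - c)) := by
  have h1 := integral_eq_ellK (a := -c) (b := -b) (c := -a) (by linarith) (by linarith)
  rw [show -c - -a = a - c by ring, show -b - -a = a - b by ring] at h1
  rw [← h1]
  have h2 := MeasureTheory.integral_image_eq_integral_abs_deriv_smul (s := Set.Ioo b a)
    measurableSet_Ioo (f := fun v => -v) (f' := fun _ => -1)
    (fun t _ => (hasDerivAt_neg t).hasDerivWithinAt) neg_injective.injOn
    (fun v => 1 / √((v - -c) * (v - -b) * (v - -a)))
  rw [show (fun v : ℝ => -v) '' Set.Ioo b a = Set.Ioo (-a) (-b) by simp] at h2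
  rw [h2]
  refine MeasureTheory.setIntegral_congr_fun measurableSet_Ioo fun v _ => ?_
  simp only [abs_neg, abs_one, one_smul]
  congr 2
  ring

theorem integral_cubic_pos {a b c : ℝ} (hcb : c < b) (hba : b < a) :
    0 < ∫ v in Set.Ioo c b, 1 / √((v - a) * (v - b) * (v - c)) := by
  have hγ : 0 < a - c := by linarith
  rw [integral_eq_ellK hcb hba]
  exact mul_pos (div_pos two_pos (Real.sqrt_pos.mpr hγ))
    (ellK_pos (by rw [div_lt_one hγ]; linarith))

theorem integral_neg_cubic_pos {a b c : ℝ} (hcb : c < b) (hba : b < a) :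
    0 < ∫ v in Set.Ioo b a, 1 / √(-((v - a) * (v - b) * (v - c))) := by
  have hγ : 0 < a - c := by linarith
  rw [integral_neg_eq_ellK hcb hba]
  exact mul_pos (div_pos two_pos (Real.sqrt_pos.mpr hγ))
    (ellK_pos (by rw [div_lt_one hγ]; linarith))

/-- The two period integrals of a cubic with real roots are `2 K(m) / √γ` and `2 K(1 - m) / √γ`;
as `K` is increasing they determine `m` and `γ`. -/
theorem roots_le_of_integrals {a b c a' b' c' : ℝ} (hcb : c < b) (hba : b < a) (hcb' : c' < b')
    (hba' : b' < a') (hm : (b - c) / (a - c) ≤ (b' - c') / (a' - c'))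
    (h1 : ∫ v in Set.Ioo c b, 1 / √((v - a) * (v - b) * (v - c)) =
      ∫ v in Set.Ioo c' b', 1 / √((v - a') * (v - b') * (v - c')))
    (h2 : ∫ v in Set.Ioo b a, 1 / √(-((v - a) * (v - b) * (v - c))) =
      ∫ v in Set.Ioo b' a', 1 / √(-((v - a') * (v - b') * (v - c')))) :
    (b - c) / (a - c) = (b' - c') / (a' - c') ∧ a - c = a' - c' := by
  have hγ : 0 < a - c := by linarith
  have hγ' : 0 < a' - c' := by linarith
  have s := Real.sqrt_pos.mpr hγ
  have s' := Real.sqrt_pos.mpr hγ'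
  have m1 : (b - c) / (a - c) < 1 := by rw [div_lt_one hγ]; linarith
  have m1' : (b' - c') / (a' - c') < 1 := by rw [div_lt_one hγ']; linarith
  have n1 : (a - b) / (a - c) < 1 := by rw [div_lt_one hγ]; linarith
  have n1' : (a' - b') / (a' - c') < 1 := by rw [div_lt_one hγ']; linarith
  have nm : (a - b) / (a - c) = 1 - (b - c) / (a - c) := by field_simp; ring
  have nm' : (a' - b') / (a' - c') = 1 - (b' - c') / (a' - c') := by field_simp; ring
  rw [integral_eq_ellK hcb hba, integral_eq_ellK hcb' hba', div_mul_eq_mul_div, div_mul_eq_mul_div,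
    div_eq_div_iff s.ne' s'.ne'] at h1
  rw [integral_neg_eq_ellK hcb hba, integral_neg_eq_ellK hcb' hba', div_mul_eq_mul_div,
    div_mul_eq_mul_div, div_eq_div_iff s.ne' s'.ne'] at h2
  -- if the parameters differ, then `K(m) < K(m')` and `K(1 - m) > K(1 - m')`, so that the two
  -- equations compare `√γ` and `√γ'` in opposite directions
  have k1 := ellK_pos m1
  have k2 := ellK_pos n1'
  rcases hm.eq_or_lt with hm | hm
  · refine ⟨hm, ?_⟩
    rw [hm] at h1
    have k3 := ellK_pos m1'
    have : √(a - c) = √(a' - c') := by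
      apply mul_left_cancel₀ (mul_pos two_pos k3).ne'
      linarith
    rwa [Real.sqrt_inj hγ.le hγ'.le] at this
  · exfalso
    have l1 := ellK_lt hm m1'
    have l2 : ellK ((a' - b') / (a' - c')) < ellK ((a - b) / (a - c)) :=
      ellK_lt (by rw [nm, nm']; linarith) n1
    have c1 : √(a - c) < √(a' - c') := by
      by_contra hc
      nlinarith [not_lt.mp hc]
    have c2 : √(a' - c') < √(a - c) := by
      by_contra hc
      nlinarith [not_lt.mp hc]
    linarith

theorem roots_eq_of_integrals {a b c a' b' c' : ℝ} (hcb : c < b) (hba : b < a) (hcb' : c' < b')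
    (hba' : b' < a') (hs : a + b + c = 0) (hs' : a' + b' + c' = 0)
    (h1 : ∫ v in Set.Ioo c b, 1 / √((v - a) * (v - b) * (v - c)) =
      ∫ v in Set.Ioo c' b', 1 / √((v - a') * (v - b') * (v - c')))
    (h2 : ∫ v in Set.Ioo b a, 1 / √(-((v - a) * (v - b) * (v - c))) =
      ∫ v in Set.Ioo b' a', 1 / √(-((v - a') * (v - b') * (v - c')))) :
    a = a' ∧ b = b' ∧ c = c' := by
  have hγ : 0 < a - c := by linarith
  have key : (b - c) / (a - c) = (b' - c') / (a' - c') ∧ a - c = a' - c' := by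
    rcases le_total ((b - c) / (a - c)) ((b' - c') / (a' - c')) with hm | hm
    · exact roots_le_of_integrals hcb hba hcb' hba' hm h1 h2
    · have := roots_le_of_integrals hcb' hba' hcb hba hm h1.symm h2.symm
      exact ⟨this.1.symm, this.2.symm⟩
  obtain ⟨k1, k2⟩ := key
  rw [← k2, div_left_inj' hγ.ne'] at k1
  refine ⟨?_, ?_, ?_⟩ <;> linarith

/-! ### The coefficients of the kernel -/

/-- The weight `z` of the step `(i, j)`, or `0` if `(i, j)` is not a step. -/
noncomputable def wt (S : Finset (ℤ × ℤ)) (z : ℝ) (i j : ℤ) : ℝ := if (i, j) ∈ S then z else 0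

theorem wt_transpose (S : Finset (ℤ × ℤ)) (z : ℝ) (i j : ℤ) :
    wt (transpose S) z i j = wt S z j i := by
  simp [wt, transpose]

theorem transpose_transpose (S : Finset (ℤ × ℤ)) : transpose (transpose S) = S := by
  simp [transpose, Finset.image_image]

theorem card_transpose (S : Finset (ℤ × ℤ)) : (transpose S).card = S.card :=
  Finset.card_image_of_injective _ Prod.swap_injective

theorem IsSmallStepSet.transpose {S : Finset (ℤ × ℤ)} (hS : IsSmallStepSet S) :
    IsSmallStepSet (transpose S) := by
  intro s hs
  obtain ⟨t, ht, rfl⟩ := Finset.mem_image.mp hs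
  obtain ⟨h0, h1, h2⟩ := hS t ht
  exact ⟨fun h => h0 (by simpa using congrArg Prod.swap h), h2, h1⟩

theorem NonSingular.transpose {S : Finset (ℤ × ℤ)} (hS : NonSingular S) :
    NonSingular (transpose S) := by
  intro a b hab
  obtain ⟨s, hs, h⟩ := hS b a (by simpa [and_comm] using hab)
  exact ⟨s.swap, Finset.mem_image_of_mem _ hs, by simpa [add_comm] using h⟩

/-- A sum over the steps as a sum over the nine nearest positions. -/
theorem sum_steps {M : Type*} [AddCommMonoid M] {S : Finset (ℤ × ℤ)} (hS : IsSmallStepSet S)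
    (f : ℤ × ℤ → M) : ∑ s ∈ S, f s =
      ∑ i ∈ Finset.Icc (-1 : ℤ) 1, ∑ j ∈ Finset.Icc (-1 : ℤ) 1, if (i, j) ∈ S then f (i, j) else 0 := by
  rw [← Finset.sum_product', Finset.sum_ite_mem]
  refine Finset.sum_congr ?_ fun _ _ => rfl
  symm
  rw [Finset.inter_eq_right]
  intro s hs
  obtain ⟨-, h1, h2⟩ := hS s hs
  rw [abs_le] at h1 h2
  simp [h1, h2]

theorem Icc_neg_one_one : Finset.Icc (-1 : ℤ) 1 = {-1, 0, 1} := by decide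

theorem rowPoly_eq {S : Finset (ℤ × ℤ)} (hS : IsSmallStepSet S) (z : ℝ) {j : ℤ}
    (hj : j = -1 ∨ j = 0 ∨ j = 1) :
    rowPoly S z j = C (wt S z (-1) j) + C (wt S z 0 j) * X + C (wt S z 1 j) * X ^ 2 := by
  unfold rowPoly
  rw [Finset.sum_filter, sum_steps hS, Icc_neg_one_one]
  rcases hj with rfl | rfl | rfl <;>
  · simp [wt, apply_ite (C : ℝ → ℝ[X]), ite_mul, add_assoc]

theorem wt_zero {S : Finset (ℤ × ℤ)} (hS : IsSmallStepSet S) (z : ℝ) : wt S z 0 0 = 0 := by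
  unfold wt
  rw [if_neg]
  intro h
  exact (hS _ h).1 rfl

section

variable {S : Finset (ℤ × ℤ)} (z : ℝ)

theorem aPoly_eval (hS : IsSmallStepSet S) (x : ℝ) :
    (aPoly S z).eval x = wt S z (-1) 1 + wt S z 0 1 * x + wt S z 1 1 * x ^ 2 := by
  simp [aPoly, rowPoly_eq hS]

theorem bPoly_eval (hS : IsSmallStepSet S) (x : ℝ) :
    (bPoly S z).eval x = wt S z (-1) 0 - x + wt S z 1 0 * x ^ 2 := by
  simp [bPoly, rowPoly_eq hS, wt_zero hS]
  ring

theorem cPoly_eval (hS : IsSmallStepSet S) (x : ℝ) :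
    (cPoly S z).eval x = wt S z (-1) (-1) + wt S z 0 (-1) * x + wt S z 1 (-1) * x ^ 2 := by
  simp [cPoly, rowPoly_eq hS]

/-- The complex polynomial function `a(x)`. -/
noncomputable def aF (S : Finset (ℤ × ℤ)) (z : ℝ) (x : ℂ) : ℂ :=
  wt S z (-1) 1 + wt S z 0 1 * x + wt S z 1 1 * x ^ 2

/-- The complex polynomial function `b(x)`. -/
noncomputable def bF (S : Finset (ℤ × ℤ)) (z : ℝ) (x : ℂ) : ℂ :=
  wt S z (-1) 0 - x + wt S z 1 0 * x ^ 2

/-- The complex polynomial function `c(x)`. -/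
noncomputable def cF (S : Finset (ℤ × ℤ)) (z : ℝ) (x : ℂ) : ℂ :=
  wt S z (-1) (-1) + wt S z 0 (-1) * x + wt S z 1 (-1) * x ^ 2

theorem aF_ofReal (hS : IsSmallStepSet S) (x : ℝ) : aF S z x = ((aPoly S z).eval x : ℝ) := by
  rw [aPoly_eval z hS]; simp [aF]

theorem bF_ofReal (hS : IsSmallStepSet S) (x : ℝ) : bF S z x = ((bPoly S z).eval x : ℝ) := by
  rw [bPoly_eval z hS]; simp [bF]

theorem cF_ofReal (hS : IsSmallStepSet S) (x : ℝ) : cF S z x = ((cPoly S z).eval x : ℝ) := by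
  rw [cPoly_eval z hS]; simp [cF]

theorem K_eq (hS : IsSmallStepSet S) (x y : ℂ) :
    K S z x y = aF S z x * y ^ 2 + bF S z x * y + cF S z x := by
  have h0 := wt_zero hS z
  unfold K aF bF cF
  rw [Finset.mul_sum, sum_steps hS, Icc_neg_one_one]
  unfold wt at *
  simp [apply_ite (fun r : ℝ => (r : ℂ)), ite_mul, add_assoc] at h0 ⊢
  have h1 : (if ((0 : ℤ), (0 : ℤ)) ∈ S then (z : ℂ) * (x * y) else 0) = 0 := by
    split_ifs with h
    · simp [h0 h]
    · rfl
  rw [h1]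
  split_ifs <;> ring

theorem K_transpose (hS : IsSmallStepSet S) (x y : ℂ) : K (transpose S) z y x = K S z x y := by
  rw [K_eq z hS, K_eq z hS.transpose]
  simp only [aF, bF, cF, wt_transpose]
  ring

end

/-! ### The discriminant -/

/-- The coefficient of `x ^ m` in the discriminant. -/
noncomputable def dC (S : Finset (ℤ × ℤ)) (z : ℝ) : ℕ → ℝ
  | 0 => wt S z (-1) 0 ^ 2 - 4 * wt S z (-1) 1 * wt S z (-1) (-1)
  | 1 => -2 * wt S z (-1) 0 - 4 * (wt S z (-1) 1 * wt S z 0 (-1) + wt S z 0 1 * wt S z (-1) (-1))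
  | 2 => 1 + 2 * wt S z (-1) 0 * wt S z 1 0 - 4 * (wt S z (-1) 1 * wt S z 1 (-1) +
      wt S z 0 1 * wt S z 0 (-1) + wt S z 1 1 * wt S z (-1) (-1))
  | 3 => -2 * wt S z 1 0 - 4 * (wt S z 0 1 * wt S z 1 (-1) + wt S z 1 1 * wt S z 0 (-1))
  | 4 => wt S z 1 0 ^ 2 - 4 * wt S z 1 1 * wt S z 1 (-1)
  | _ => 0

/-- The value of the discriminant at a complex point. -/
noncomputable def dF (S : Finset (ℤ × ℤ)) (z : ℝ) (x : ℂ) : ℂ :=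
  dC S z 0 + dC S z 1 * x + dC S z 2 * x ^ 2 + dC S z 3 * x ^ 3 + dC S z 4 * x ^ 4

theorem disc_eq {S : Finset (ℤ × ℤ)} (hS : IsSmallStepSet S) (z : ℝ) :
    disc S z = C (dC S z 0) + C (dC S z 1) * X + C (dC S z 2) * X ^ 2 + C (dC S z 3) * X ^ 3 +
      C (dC S z 4) * X ^ 4 := by
  unfold disc aPoly bPoly cPoly
  rw [rowPoly_eq hS z (by simp), rowPoly_eq hS z (by simp), rowPoly_eq hS z (by simp), wt_zero hS]
  simp only [dC, map_add, map_sub, map_mul, map_pow, map_neg, map_one, map_zero,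
    show (C (2 : ℝ) : ℝ[X]) = 2 from rfl, show (C (4 : ℝ) : ℝ[X]) = 4 from rfl]
  ring

theorem disc_eval {S : Finset (ℤ × ℤ)} (hS : IsSmallStepSet S) (z x : ℝ) :
    (disc S z).eval x = dC S z 0 + dC S z 1 * x + dC S z 2 * x ^ 2 + dC S z 3 * x ^ 3 +
      dC S z 4 * x ^ 4 := by
  rw [disc_eq hS]; simp

theorem disc_eval' (S : Finset (ℤ × ℤ)) (z x : ℝ) : (disc S z).eval x =
    (bPoly S z).eval x ^ 2 - 4 * (aPoly S z).eval x * (cPoly S z).eval x := by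
  simp [disc]

theorem dF_ofReal {S : Finset (ℤ × ℤ)} (hS : IsSmallStepSet S) (z x : ℝ) :
    dF S z x = ((disc S z).eval x : ℝ) := by
  rw [disc_eval hS]; simp [dF]

theorem dF_eq (S : Finset (ℤ × ℤ)) (z : ℝ) (x : ℂ) :
    dF S z x = bF S z x ^ 2 - 4 * aF S z x * cF S z x := by
  simp only [dF, aF, bF, cF, dC]
  push_cast
  ring

theorem disc_derivs {S : Finset (ℤ × ℤ)} (hS : IsSmallStepSet S) (z x : ℝ) :
    (derivative (disc S z)).eval x =
      dC S z 1 + 2 * dC S z 2 * x + 3 * dC S z 3 * x ^ 2 + 4 * dC S z 4 * x ^ 3 ∧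
    (derivative^[2] (disc S z)).eval x =
      2 * dC S z 2 + 6 * dC S z 3 * x + 12 * dC S z 4 * x ^ 2 ∧
    (derivative^[3] (disc S z)).eval x = 6 * dC S z 3 + 24 * dC S z 4 * x := by
  rw [disc_eq hS]
  refine ⟨?_, ?_, ?_⟩
  · simp; ring
  · simp [Function.iterate_succ, derivative_pow]; ring
  · simp [Function.iterate_succ, derivative_pow]; ring

/-- `d(x) = ν (x - t₁) (x - t₂) (t₃ - x) (1 - s x)` with `-1 < t₁ < t₂ < 1 < t₃` and `|s| < 1`: the
fourth branch point is `1 / s`, which is the point at infinity for `s = 0`. -/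
structure Branch (d : ℝ[X]) (t₁ t₂ t₃ ν s : ℝ) : Prop where
  lt₁ : -1 < t₁
  lt₁₂ : t₁ < t₂
  lt₂ : t₂ < 1
  lt₃ : 1 < t₃
  pos : 0 < ν
  s_lt : s < 1
  lt_s : -1 < s
  st₃ : s * t₃ < 1
  eval_eq : ∀ x, d.eval x = ν * ((x - t₁) * (x - t₂) * (t₃ - x) * (1 - s * x))

/-- A real polynomial of degree at most four with the sign pattern `+ - + -` at the points
`-1 < p < 1 < q`. -/
theorem exists_branch {d : ℝ[X]} {d₀ d₁ d₂ d₃ d₄ p q : ℝ}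
    (hd : ∀ x, d.eval x = d₀ + d₁ * x + d₂ * x ^ 2 + d₃ * x ^ 3 + d₄ * x ^ 4)
    (hp : p ∈ Set.Ioo (-1) 1) (hq : 1 < q) (h₁ : 0 < d.eval (-1)) (h₂ : d.eval p < 0)
    (h₃ : 0 < d.eval 1) (h₄ : d.eval q < 0) :
    ∃ t₁ t₂ t₃ ν s, Branch d t₁ t₂ t₃ ν s ∧ p < t₂ := by
  have hc : ∀ s : Set ℝ, ContinuousOn (fun x => d.eval x) s := fun s => d.continuous.continuousOn
  obtain ⟨t₁, ht₁, r₁⟩ := intermediate_value_Ioo' hp.1.le (hc _) (show (0 : ℝ) ∈ Set.Ioo _ _ from ⟨h₂, h₁⟩)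
  obtain ⟨t₂, ht₂, r₂⟩ := intermediate_value_Ioo hp.2.le (hc _) (show (0 : ℝ) ∈ Set.Ioo _ _ from ⟨h₂, h₃⟩)
  obtain ⟨t₃, ht₃, r₃⟩ := intermediate_value_Ioo' hq.le (hc _) (show (0 : ℝ) ∈ Set.Ioo _ _ from ⟨h₄, h₃⟩)
  simp only at r₁ r₂ r₃
  have l12 : t₁ < t₂ := ht₁.2.trans ht₂.1
  have l23 : t₂ < t₃ := ht₂.2.trans ht₃.1
  set r := d₃ + d₄ * (t₁ + t₂ + t₃) with hr
  -- the remainder of the division by `(x - t₁) (x - t₂) (x - t₃)` vanishes at three points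
  have fac : ∀ x, d.eval x = (x - t₁) * (x - t₂) * (x - t₃) * (d₄ * x + r) := by
    rw [hd] at r₁ r₂ r₃
    have w12 : d₁ + d₂ * (t₁ + t₂) + d₃ * (t₁ ^ 2 + t₁ * t₂ + t₂ ^ 2) +
        d₄ * (t₁ ^ 3 + t₁ ^ 2 * t₂ + t₁ * t₂ ^ 2 + t₂ ^ 3) = 0 :=
      mul_left_cancel₀ (sub_ne_zero.mpr l12.ne') (by linear_combination r₂ - r₁)
    have w23 : d₁ + d₂ * (t₂ + t₃) + d₃ * (t₂ ^ 2 + t₂ * t₃ + t₃ ^ 2) +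
        d₄ * (t₂ ^ 3 + t₂ ^ 2 * t₃ + t₂ * t₃ ^ 2 + t₃ ^ 3) = 0 :=
      mul_left_cancel₀ (sub_ne_zero.mpr l23.ne') (by linear_combination r₃ - r₂)
    have w : d₂ + d₃ * (t₁ + t₂ + t₃) + d₄ * (t₁ ^ 2 + t₂ ^ 2 + t₃ ^ 2 + t₁ * t₂ + t₁ * t₃ +
        t₂ * t₃) = 0 :=
      mul_left_cancel₀ (sub_ne_zero.mpr (l12.trans l23).ne') (by linear_combination w23 - w12)
    intro x
    rw [hd, hr]
    linear_combination r₁ + (x - t₁) * w12 + (x - t₁) * (x - t₂) * w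
  -- the signs of `d` at `-1`, `1`, `q` show that the fourth factor `d₄ x + r` is negative there, hence
  -- on `[-1, q]`, which contains `t₃`
  have f1 : d₄ + r < 0 := by
    rw [fac] at h₃
    have := mul_pos (mul_pos (show 0 < 1 - t₁ by linarith [ht₁.2, hp.2]) (show 0 < 1 - t₂ by linarith [ht₂.2]))
      (show 0 < t₃ - 1 by linarith [ht₃.1])
    nlinarith
  have f2 : -d₄ + r < 0 := by
    rw [fac] at h₁
    have := mul_pos (mul_pos (show 0 < 1 + t₁ by linarith [ht₁.1]) (show 0 < 1 + t₂ by linarith [ht₂.1, hp.1]))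
      (show 0 < t₃ + 1 by linarith [ht₃.1])
    nlinarith
  have f3 : d₄ * q + r < 0 := by
    rw [fac] at h₄
    have := mul_pos (mul_pos (show 0 < q - t₁ by linarith [ht₁.2, hp.2]) (show 0 < q - t₂ by linarith [ht₂.2]))
      (show 0 < q - t₃ by linarith [ht₃.2])
    nlinarith
  have hν : 0 < -r := by linarith
  refine ⟨t₁, t₂, t₃, -r, d₄ / (-r), ⟨ht₁.1, l12, ht₂.2, ht₃.1, hν, ?_, ?_, ?_, ?_⟩, ht₂.1⟩
  · rw [div_lt_one hν]; linarith
  · rw [lt_div_iff₀ hν]; linarith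
  · rw [div_mul_eq_mul_div, div_lt_one hν]
    have h5 : d₄ * (q - 1) ≤ 0 ∨ 0 ≤ d₄ := by
      rcases le_total d₄ 0 with h | h
      · left; nlinarith
      · right; exact h
    rcases le_total d₄ 0 with h | h
    · nlinarith [ht₃.1]
    · nlinarith [ht₃.2]
  · intro x
    rw [fac]
    have : r ≠ 0 := by linarith
    field_simp
    ring

/-- A point of `]0, 1[` with a negative discriminant: either `b` vanishes somewhere in `]0, 1[`, or
`b(0) = 0` and `4 a c` dominates `b ^ 2` near the origin. -/
theorem exists_disc_neg {a₀ a₁ a₂ b₀ b₂ c₀ c₁ c₂ z : ℝ} (hz : 0 < z) (hz1 : z < 1)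
    (ha₀ : 0 ≤ a₀) (ha₁ : 0 ≤ a₁) (ha₂ : 0 ≤ a₂) (hb₀ : 0 ≤ b₀) (hb₂ : 0 ≤ b₂) (hc₀ : 0 ≤ c₀)
    (hc₁ : 0 ≤ c₁) (hc₂ : 0 ≤ c₂) (hb : b₀ + b₂ < 1) (ha : 0 < a₀ + a₁ + a₂)
    (hc : 0 < c₀ + c₁ + c₂)
    (h : 0 < b₀ ∨ z ≤ a₀ ∧ z ≤ c₀ ∨ z ≤ a₀ ∧ z ≤ c₁ ∨ z ≤ a₁ ∧ z ≤ c₀) :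
    ∃ p ∈ Set.Ioo (0 : ℝ) 1, (b₀ - p + b₂ * p ^ 2) ^ 2 -
      4 * (a₀ + a₁ * p + a₂ * p ^ 2) * (c₀ + c₁ * p + c₂ * p ^ 2) < 0 := by
  have quad_pos : ∀ u v w p : ℝ, 0 ≤ u → 0 ≤ v → 0 ≤ w → 0 < u + v + w → 0 < p → p < 1 →
      0 < u + v * p + w * p ^ 2 := by
    intro u v w p hu hv hw huvw hp hp1
    have : (u + v + w) * p ^ 2 ≤ u + v * p + w * p ^ 2 := by
      nlinarith [mul_nonneg hu (show 0 ≤ 1 - p ^ 2 by nlinarith), mul_nonneg hv (show 0 ≤ p - p ^ 2 by nlinarith)]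
    exact lt_of_lt_of_le (mul_pos huvw (pow_pos hp 2)) this
  rcases hb₀.eq_or_lt with hb0 | hb0
    -- `p = z ^ 2` works: `4 a(p) c(p) ≥ 4 z ^ 4`, whereas `b(p) ^ 2 ≤ z ^ 4`
  · refine ⟨z ^ 2, ⟨by positivity, by nlinarith⟩, ?_⟩
    have hzz : z ^ 2 ≤ 1 := by nlinarith
    have hz2 : 0 < z ^ 2 := by positivity
    have key : z ^ 4 ≤ (a₀ + a₁ * z ^ 2 + a₂ * (z ^ 2) ^ 2) * (c₀ + c₁ * z ^ 2 + c₂ * (z ^ 2) ^ 2) := by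
      have hA1 : a₀ ≤ a₀ + a₁ * z ^ 2 + a₂ * (z ^ 2) ^ 2 := by
        nlinarith [mul_nonneg ha₁ hz2.le, mul_nonneg ha₂ (sq_nonneg (z ^ 2))]
      have hA2 : a₁ * z ^ 2 ≤ a₀ + a₁ * z ^ 2 + a₂ * (z ^ 2) ^ 2 := by
        nlinarith [mul_nonneg ha₂ (sq_nonneg (z ^ 2))]
      have hC1 : c₀ ≤ c₀ + c₁ * z ^ 2 + c₂ * (z ^ 2) ^ 2 := by
        nlinarith [mul_nonneg hc₁ hz2.le, mul_nonneg hc₂ (sq_nonneg (z ^ 2))]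
      have hC2 : c₁ * z ^ 2 ≤ c₀ + c₁ * z ^ 2 + c₂ * (z ^ 2) ^ 2 := by
        nlinarith [mul_nonneg hc₂ (sq_nonneg (z ^ 2))]
      have hz3 : z * z ^ 2 ≤ z := by nlinarith
      rcases h with h | ⟨h1, h2⟩ | ⟨h1, h2⟩ | ⟨h1, h2⟩
      · linarith
      · calc z ^ 4 ≤ z * z := by nlinarith
          _ ≤ _ := mul_le_mul (h1.trans hA1) (h2.trans hC1) hz.le (by linarith)
      · calc z ^ 4 = z * (z * z ^ 2) := by ring
          _ ≤ _ := mul_le_mul (h1.trans hA1)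
            ((mul_le_mul_of_nonneg_right h2 hz2.le).trans hC2) (by positivity) (by linarith)
      · calc z ^ 4 = z * z ^ 2 * z := by ring
          _ ≤ _ := mul_le_mul ((mul_le_mul_of_nonneg_right h1 hz2.le).trans hA2) (h2.trans hC1)
            hz.le (by nlinarith)
    have hb' : (b₀ - z ^ 2 + b₂ * (z ^ 2) ^ 2) ^ 2 ≤ z ^ 4 := by
      rw [← hb0, show (0 - z ^ 2 + b₂ * (z ^ 2) ^ 2) ^ 2 = z ^ 4 * (1 - b₂ * z ^ 2) ^ 2 by ring]
      have h1 : 0 ≤ b₂ * z ^ 2 := by positivity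
      have h2 : b₂ * z ^ 2 ≤ 1 := by nlinarith
      have h3 : (1 - b₂ * z ^ 2) ^ 2 ≤ 1 := by nlinarith
      have h4 : 0 < z ^ 4 := by positivity
      nlinarith
    have h4 : 0 < z ^ 4 := by positivity
    nlinarith
    -- at a zero of `b` the discriminant is `-4 a c < 0`
  · obtain ⟨p, hp, hpv⟩ := intermediate_value_Ioo' (zero_le_one (α := ℝ))
      (f := fun p => b₀ - p + b₂ * p ^ 2) (by fun_prop) (show (0 : ℝ) ∈ Set.Ioo _ _ from
        ⟨by norm_num; linarith, by simpa using hb0⟩)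
    refine ⟨p, hp, ?_⟩
    simp only at hpv
    rw [hpv]
    have h1 := quad_pos a₀ a₁ a₂ p ha₀ ha₁ ha₂ ha hp.1 hp.2
    have h2 := quad_pos c₀ c₁ c₂ p hc₀ hc₁ hc₂ hc hp.1 hp.2
    nlinarith [mul_pos h1 h2]

/-- The standing assumptions on the step set and the parameter. -/
structure Model (S : Finset (ℤ × ℤ)) (z : ℝ) : Prop where
  small : IsSmallStepSet S
  nonsing : NonSingular S
  z_pos : 0 < z
  z_lt : z < 1 / (S.card : ℝ)

namespace Model

variable {S : Finset (ℤ × ℤ)} {z : ℝ}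

theorem transpose (h : Model S z) : Model (transpose S) z :=
  ⟨h.small.transpose, h.nonsing.transpose, h.z_pos, by rw [card_transpose]; exact h.z_lt⟩

theorem card_pos (h : Model S z) : (0 : ℝ) < S.card := by
  by_contra hc
  have h0 : (S.card : ℝ) = 0 := le_antisymm (not_lt.mp hc) (Nat.cast_nonneg _)
  have := h.z_lt
  rw [h0, div_zero] at this
  linarith [h.z_pos]

theorem z_mul_card (h : Model S z) : z * S.card < 1 := (lt_div_iff₀ h.card_pos).mp h.z_lt

theorem wt_nonneg (h : Model S z) (i j : ℤ) : 0 ≤ wt S z i j := by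
  unfold wt
  split_ifs
  exacts [h.z_pos.le, le_rfl]

theorem sum_wt (h : Model S z) : wt S z (-1) (-1) + wt S z (-1) 0 + wt S z (-1) 1 + wt S z 0 (-1) +
    wt S z 0 1 + wt S z 1 (-1) + wt S z 1 0 + wt S z 1 1 < 1 := by
  have h1 := sum_steps h.small (fun _ => z)
  have h0 := wt_zero h.small z
  rw [Finset.sum_const, nsmul_eq_mul, Icc_neg_one_one] at h1
  have h2 := h.z_mul_card
  unfold wt at *
  simp at h1
  rw [mul_comm] at h2
  rw [h1] at h2
  have h3 : (if ((0 : ℤ), (0 : ℤ)) ∈ S then z else 0) = 0 := h0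
  rw [h3] at h2
  linarith

theorem wt_eq (h : (i, j) ∈ S) : wt S z i j = z := by simp [wt, h]

/-- Non-singularity in terms of the eight possible steps. -/
theorem exists_step (h : Model S z) {a b : ℤ} (hab : (a, b) ≠ (0, 0)) :
    ∃ i j : ℤ, (i, j) ∈ S ∧ a * i + b * j < 0 ∧ (i = -1 ∨ i = 0 ∨ i = 1) ∧
      (j = -1 ∨ j = 0 ∨ j = 1) := by
  obtain ⟨⟨i, j⟩, hs, hlt⟩ := h.nonsing a b hab
  obtain ⟨-, h1, h2⟩ := h.small _ hs
  rw [abs_le] at h1 h2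
  simp only at h1 h2 hlt
  exact ⟨i, j, hs, hlt, by omega, by omega⟩

theorem sum_up_pos (h : Model S z) : 0 < wt S z (-1) 1 + wt S z 0 1 + wt S z 1 1 := by
  obtain ⟨i, j, hs, hlt, hi, hj⟩ := h.exists_step (a := 0) (b := -1) (by simp)
  obtain rfl : j = 1 := by omega
  have h1 := h.wt_nonneg (-1) 1
  have h2 := h.wt_nonneg 0 1
  have h3 := h.wt_nonneg 1 1
  have hz := h.z_pos
  rcases hi with rfl | rfl | rfl <;> have := wt_eq (z := z) hs <;> linarith

theorem sum_down_pos (h : Model S z) : 0 < wt S z (-1) (-1) + wt S z 0 (-1) + wt S z 1 (-1) := by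
  obtain ⟨i, j, hs, hlt, hi, hj⟩ := h.exists_step (a := 0) (b := 1) (by simp)
  obtain rfl : j = -1 := by omega
  have h1 := h.wt_nonneg (-1) (-1)
  have h2 := h.wt_nonneg 0 (-1)
  have h3 := h.wt_nonneg 1 (-1)
  have hz := h.z_pos
  rcases hi with rfl | rfl | rfl <;> have := wt_eq (z := z) hs <;> linarith

/-- The alternative needed for `exists_disc_neg`, on the side `i = ε` of the step set. -/
theorem side_alternative (h : Model S z) {ε : ℤ} (hε : ε = -1 ∨ ε = 1) :
    0 < wt S z ε 0 ∨ z ≤ wt S z ε 1 ∧ z ≤ wt S z ε (-1) ∨ z ≤ wt S z ε 1 ∧ z ≤ wt S z 0 (-1) ∨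
      z ≤ wt S z 0 1 ∧ z ≤ wt S z ε (-1) := by
  have hz := h.z_pos
  have w1 : ∀ i j : ℤ, (i, j) ∈ S → z ≤ wt S z i j := fun i j hs => (wt_eq hs).ge
  have m1 : (ε, 0) ∈ S ∨ (ε, 1) ∈ S ∨ (ε, -1) ∈ S := by
    obtain ⟨i, j, hs, hlt, hi, hj⟩ := h.exists_step (a := -ε) (b := 0) (by rcases hε with rfl | rfl <;> simp)
    have : i = ε := by rcases hε with rfl | rfl <;> omega
    subst this
    rcases hj with rfl | rfl | rfl <;> simp [hs]
  have m2 : (ε, 0) ∈ S ∨ (ε, -1) ∈ S ∨ (0, -1) ∈ S := by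
    obtain ⟨i, j, hs, hlt, hi, hj⟩ := h.exists_step (a := -ε) (b := 1) (by simp)
    rcases hε with rfl | rfl <;> rcases hi with rfl | rfl | rfl <;>
      rcases hj with rfl | rfl | rfl <;> first | omega | simp [hs]
  have m3 : (ε, 0) ∈ S ∨ (ε, 1) ∈ S ∨ (0, 1) ∈ S := by
    obtain ⟨i, j, hs, hlt, hi, hj⟩ := h.exists_step (a := -ε) (b := -1) (by simp)
    rcases hε with rfl | rfl <;> rcases hi with rfl | rfl | rfl <;>
      rcases hj with rfl | rfl | rfl <;> first | omega | simp [hs]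
  rcases m1 with m | m | m
  · exact Or.inl (lt_of_lt_of_le hz (w1 _ _ m))
  · rcases m2 with k | k | k
    · exact Or.inl (lt_of_lt_of_le hz (w1 _ _ k))
    · exact Or.inr (Or.inl ⟨w1 _ _ m, w1 _ _ k⟩)
    · exact Or.inr (Or.inr (Or.inl ⟨w1 _ _ m, w1 _ _ k⟩))
  · rcases m3 with k | k | k
    · exact Or.inl (lt_of_lt_of_le hz (w1 _ _ k))
    · exact Or.inr (Or.inl ⟨w1 _ _ k, w1 _ _ m⟩)
    · exact Or.inr (Or.inr (Or.inr ⟨w1 _ _ k, w1 _ _ m⟩))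

theorem z_lt_one (h : Model S z) : z < 1 := by
  have h1 : (1 : ℝ) ≤ S.card := by
    have := h.card_pos
    have : 0 < S.card := by exact_mod_cast this
    exact_mod_cast this
  have := h.z_mul_card
  nlinarith [h.z_pos]

theorem disc_one_pos (h : Model S z) : 0 < (disc S z).eval 1 := by
  rw [disc_eval', aPoly_eval z h.small, bPoly_eval z h.small, cPoly_eval z h.small]
  have h0 := h.sum_wt
  have h1 := h.sum_up_pos
  have h2 := h.sum_down_pos
  generalize ha : wt S z (-1) 1 + wt S z 0 1 * 1 + wt S z 1 1 * 1 ^ 2 = a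
  generalize hc : wt S z (-1) (-1) + wt S z 0 (-1) * 1 + wt S z 1 (-1) * 1 ^ 2 = c
  generalize hb : wt S z (-1) 0 - 1 + wt S z 1 0 * 1 ^ 2 = b
  have : a + c < -b := by linarith
  nlinarith [sq_nonneg (a - c)]

theorem disc_neg_one_pos (h : Model S z) : 0 < (disc S z).eval (-1) := by
  rw [disc_eval', aPoly_eval z h.small, bPoly_eval z h.small, cPoly_eval z h.small]
  have h0 := h.sum_wt
  have n := h.wt_nonneg
  have n1 := n (-1) 1
  have n2 := n 0 1
  have n3 := n 1 1
  have n4 := n (-1) (-1)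
  have n5 := n 0 (-1)
  have n6 := n 1 (-1)
  have n7 := n (-1) 0
  have n8 := n 1 0
  generalize ha : wt S z (-1) 1 + wt S z 0 1 * (-1) + wt S z 1 1 * (-1) ^ 2 = a
  generalize hc : wt S z (-1) (-1) + wt S z 0 (-1) * (-1) + wt S z 1 (-1) * (-1) ^ 2 = c
  generalize hb : wt S z (-1) 0 - (-1) + wt S z 1 0 * (-1) ^ 2 = b
  have hb1 : 1 ≤ b := by linarith
  have hac : |a + c| < 1 := by
    rw [abs_lt]
    constructor <;> linarith
  have : (a + c) ^ 2 < 1 := by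
    rw [abs_lt] at hac
    nlinarith
  nlinarith [sq_nonneg (a - c)]

theorem exists_disc_neg_inside (h : Model S z) : ∃ p ∈ Set.Ioo (0 : ℝ) 1, (disc S z).eval p < 0 := by
  have n := h.wt_nonneg
  obtain ⟨p, hp, hpv⟩ := exists_disc_neg h.z_pos h.z_lt_one (n (-1) 1) (n 0 1) (n 1 1) (n (-1) 0) (n 1 0)
    (n (-1) (-1)) (n 0 (-1)) (n 1 (-1))
    (by linarith [h.sum_wt, n (-1) 1, n 0 1, n 1 1, n (-1) (-1), n 0 (-1), n 1 (-1)])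
    h.sum_up_pos h.sum_down_pos (h.side_alternative (Or.inl rfl))
  refine ⟨p, hp, ?_⟩
  rwa [disc_eval', aPoly_eval z h.small, bPoly_eval z h.small, cPoly_eval z h.small]

theorem exists_disc_neg_outside (h : Model S z) : ∃ q : ℝ, 1 < q ∧ (disc S z).eval q < 0 := by
  have n := h.wt_nonneg
  have hu := h.sum_up_pos
  have hd := h.sum_down_pos
  obtain ⟨p, hp, hpv⟩ := exists_disc_neg h.z_pos h.z_lt_one (n 1 1) (n 0 1) (n (-1) 1) (n 1 0) (n (-1) 0)
    (n 1 (-1)) (n 0 (-1)) (n (-1) (-1))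
    (by linarith [h.sum_wt, n (-1) 1, n 0 1, n 1 1, n (-1) (-1), n 0 (-1), n 1 (-1)])
    (by linarith) (by linarith) (h.side_alternative (Or.inr rfl))
  refine ⟨p⁻¹, (one_lt_inv₀ hp.1).mpr hp.2, ?_⟩
  rw [disc_eval', aPoly_eval z h.small, bPoly_eval z h.small, cPoly_eval z h.small]
  have hp0 := hp.1.ne'
  have hp4 : 0 < p ^ 4 := pow_pos hp.1 4
  refine (mul_lt_mul_iff_right₀ hp4).mp ?_
  rw [mul_zero]
  refine lt_of_eq_of_lt ?_ hpv
  field_simp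
  ring

theorem exists_branch (h : Model S z) : ∃ t₁ t₂ t₃ ν s, Branch (disc S z) t₁ t₂ t₃ ν s ∧ 0 < t₂ := by
  obtain ⟨p, hp, hpv⟩ := h.exists_disc_neg_inside
  obtain ⟨q, hq, hqv⟩ := h.exists_disc_neg_outside
  obtain ⟨t₁, t₂, t₃, ν, s, hb, hlt⟩ := QuarterPlane.exists_branch (disc_eval h.small z)
    ⟨by linarith [hp.1], hp.2⟩ hq h.disc_neg_one_pos hpv h.disc_one_pos hqv
  exact ⟨t₁, t₂, t₃, ν, s, hb, hp.1.trans hlt⟩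

end Model

/-! ### The homography that brings the discriminant to Weierstrass form -/

namespace Branch

/-- The factor `h` in `g(x) = g₀ - h x / (1 - s x)`. -/
noncomputable def slope (t₁ t₂ t₃ ν s : ℝ) : ℝ := ν * ((1 - s * t₁) * (1 - s * t₂) * (1 - s * t₃))

/-- The value `g₀ = g(0)`; with this choice the images of `t₁, t₂, t₃` have sum zero. -/
noncomputable def base (t₁ t₂ t₃ ν s : ℝ) : ℝ :=
  ν / 3 * (t₁ * (1 - s * t₂) * (1 - s * t₃) + t₂ * (1 - s * t₁) * (1 - s * t₃) +
    t₃ * (1 - s * t₁) * (1 - s * t₂))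

/-- The homography `g(x) = g₀ - h x / (1 - s x)`. -/
noncomputable def homog (g h s x : ℝ) : ℝ := g - h * x / (1 - s * x)

variable {d : ℝ[X]} {t₁ t₂ t₃ ν s : ℝ}

theorem one_sub_pos_of_mem {x : ℝ} (hs1 : s < 1) (hs2 : -1 < s) (h1 : -1 ≤ x) (h2 : x ≤ 1) :
    0 < 1 - s * x := by
  rcases le_total 0 x with h | h <;> nlinarith

theorem pos₁ (b : Branch d t₁ t₂ t₃ ν s) : 0 < 1 - s * t₁ :=
  one_sub_pos_of_mem b.s_lt b.lt_s b.lt₁.le (b.lt₁₂.trans b.lt₂).le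

theorem pos₂ (b : Branch d t₁ t₂ t₃ ν s) : 0 < 1 - s * t₂ :=
  one_sub_pos_of_mem b.s_lt b.lt_s (b.lt₁.trans b.lt₁₂).le b.lt₂.le

theorem pos₃ (b : Branch d t₁ t₂ t₃ ν s) : 0 < 1 - s * t₃ := by linarith [b.st₃]

theorem slope_pos (b : Branch d t₁ t₂ t₃ ν s) : 0 < slope t₁ t₂ t₃ ν s :=
  mul_pos b.pos (mul_pos (mul_pos b.pos₁ b.pos₂) b.pos₃)

theorem homog_sub {g h x y : ℝ} (hx : 1 - s * x ≠ 0) (hy : 1 - s * y ≠ 0) :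
    homog g h s x - homog g h s y = h * (y - x) / ((1 - s * x) * (1 - s * y)) := by
  unfold homog
  rw [sub_sub_sub_cancel_left, div_sub_div _ _ hy hx, mul_comm (1 - s * x)]
  congr 1
  ring

theorem homog_strictAntiOn {g h : ℝ} (hh : 0 < h) :
    StrictAntiOn (homog g h s) {x | 0 < 1 - s * x} := by
  intro x hx y hy hxy
  have hx' : 0 < 1 - s * x := hx
  have hy' : 0 < 1 - s * y := hy
  have := homog_sub (g := g) (h := h) hx'.ne' hy'.ne'
  have h2 : 0 < h * (y - x) / ((1 - s * x) * (1 - s * y)) :=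
    div_pos (mul_pos hh (by linarith)) (mul_pos hx' hy')
  linarith

theorem homog_t₁ (b : Branch d t₁ t₂ t₃ ν s) (g : ℝ) : homog g (slope t₁ t₂ t₃ ν s) s t₁ =
    g - ν * (t₁ * (1 - s * t₂) * (1 - s * t₃)) := by
  have := b.pos₁.ne'
  unfold homog slope
  rw [sub_right_inj, div_eq_iff this]
  ring

theorem homog_t₂ (b : Branch d t₁ t₂ t₃ ν s) (g : ℝ) : homog g (slope t₁ t₂ t₃ ν s) s t₂ =
    g - ν * (t₂ * (1 - s * t₁) * (1 - s * t₃)) := by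
  have := b.pos₂.ne'
  unfold homog slope
  rw [sub_right_inj, div_eq_iff this]
  ring

theorem homog_t₃ (b : Branch d t₁ t₂ t₃ ν s) (g : ℝ) : homog g (slope t₁ t₂ t₃ ν s) s t₃ =
    g - ν * (t₃ * (1 - s * t₁) * (1 - s * t₂)) := by
  have := b.pos₃.ne'
  unfold homog slope
  rw [sub_right_inj, div_eq_iff this]
  ring

theorem sum_homog (b : Branch d t₁ t₂ t₃ ν s) :
    homog (base t₁ t₂ t₃ ν s) (slope t₁ t₂ t₃ ν s) s t₁ +
      homog (base t₁ t₂ t₃ ν s) (slope t₁ t₂ t₃ ν s) s t₂ +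
      homog (base t₁ t₂ t₃ ν s) (slope t₁ t₂ t₃ ν s) s t₃ = 0 := by
  rw [b.homog_t₁, b.homog_t₂, b.homog_t₃]
  unfold base
  ring

theorem cubic_homog (b : Branch d t₁ t₂ t₃ ν s) (g : ℝ) {x : ℝ} (hx : 1 - s * x ≠ 0) :
    (homog g (slope t₁ t₂ t₃ ν s) s x - homog g (slope t₁ t₂ t₃ ν s) s t₁) *
      (homog g (slope t₁ t₂ t₃ ν s) s x - homog g (slope t₁ t₂ t₃ ν s) s t₂) *
      (homog g (slope t₁ t₂ t₃ ν s) s x - homog g (slope t₁ t₂ t₃ ν s) s t₃) =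
    (slope t₁ t₂ t₃ ν s / (1 - s * x) ^ 2) ^ 2 * d.eval x := by
  have h1 := b.pos₁.ne'
  have h2 := b.pos₂.ne'
  have h3 := b.pos₃.ne'
  rw [homog_sub hx h1, homog_sub hx h2, homog_sub hx h3, b.eval_eq]
  unfold slope
  field_simp
  ring

theorem hasDerivAt_homog {g h x : ℝ} (hx : 1 - s * x ≠ 0) :
    HasDerivAt (homog g h s) (-(h / (1 - s * x) ^ 2)) x := by
  have h1 : HasDerivAt (fun x => h * x) h x := by simpa using (hasDerivAt_id x).const_mul h
  have h2 : HasDerivAt (fun x => 1 - s * x) (-s) x := by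
    simpa using ((hasDerivAt_id x).const_mul s).const_sub 1
  refine ((h1.div h2 hx).const_sub g).congr_deriv ?_
  field_simp
  ring

/-- The substitution `v = g(x)` in an elliptic integral. -/
theorem integral_homog (b : Branch d t₁ t₂ t₃ ν s) (g ε : ℝ) {U : Set ℝ} (hU : MeasurableSet U)
    (hpos : ∀ x ∈ U, 0 < 1 - s * x) :
    ∫ v in homog g (slope t₁ t₂ t₃ ν s) s '' U,
      1 / √(ε * ((v - homog g (slope t₁ t₂ t₃ ν s) s t₁) *
        (v - homog g (slope t₁ t₂ t₃ ν s) s t₂) * (v - homog g (slope t₁ t₂ t₃ ν s) s t₃))) =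
    ∫ x in U, 1 / √(ε * d.eval x) := by
  rw [MeasureTheory.integral_image_eq_integral_abs_deriv_smul hU
    (fun x hx => (hasDerivAt_homog (hpos x hx).ne').hasDerivWithinAt)
    ((homog_strictAntiOn b.slope_pos).injOn.mono hpos)]
  refine MeasureTheory.setIntegral_congr_fun hU fun x hx => ?_
  have h1 : 0 < slope t₁ t₂ t₃ ν s / (1 - s * x) ^ 2 :=
    div_pos b.slope_pos (pow_pos (hpos x hx) 2)
  simp only [smul_eq_mul, abs_neg]
  rw [abs_of_pos h1, b.cubic_homog g (hpos x hx).ne', mul_left_comm, Real.sqrt_mul (sq_nonneg _),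
    Real.sqrt_sq h1.le, one_div, mul_inv, ← mul_assoc,
    mul_inv_cancel₀ h1.ne', one_mul, one_div]

/-- The image under `g` of a set of the form `{x < b | a < x}`, described by the inverse map. -/
theorem image_homog {g h : ℝ} (hh : 0 < h) {U V : Set ℝ} (hU : ∀ x ∈ U, 0 < 1 - s * x)
    (hV : ∀ v ∈ V, 0 < h + s * (g - v)) (hUV : ∀ x, 0 < 1 - s * x → (x ∈ U ↔ homog g h s x ∈ V)) :
    homog g h s '' U = V := by
  apply Set.Subset.antisymm
  · rintro _ ⟨x, hx, rfl⟩
    exact (hUV x (hU x hx)).mp hx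
  · intro v hv
    have hD := hV v hv
    have h1 : 1 - s * ((g - v) / (h + s * (g - v))) = h / (h + s * (g - v)) := by
      field_simp; ring
    have h2 : 0 < 1 - s * ((g - v) / (h + s * (g - v))) := by rw [h1]; exact div_pos hh hD
    have h3 : homog g h s ((g - v) / (h + s * (g - v))) = v := by
      unfold homog
      rw [h1, mul_div_assoc', div_div_div_cancel_right₀ hD.ne', mul_div_cancel_left₀ _ hh.ne']
      ring
    exact ⟨_, (hUV _ h2).mpr (by rw [h3]; exact hv), h3⟩

theorem homog_den {g h x : ℝ} (hx : 1 - s * x ≠ 0) :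
    h + s * (g - homog g h s x) = h / (1 - s * x) := by
  unfold homog
  field_simp
  ring

theorem image_homog_Ioo {g h a c : ℝ} (hh : 0 < h) (ha : 0 < 1 - s * a) (hc : 0 < 1 - s * c) :
    homog g h s '' Set.Ioo a c = Set.Ioo (homog g h s c) (homog g h s a) := by
  have hanti := homog_strictAntiOn (s := s) (g := g) hh
  refine image_homog hh ?_ ?_ ?_
  · intro x hx
    rcases le_total 0 s with h | h <;> nlinarith [hx.1, hx.2]
  · intro v hv
    have h1 : 0 < h + s * (g - homog g h s a) := by rw [homog_den ha.ne']; exact div_pos hh ha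
    have h2 : 0 < h + s * (g - homog g h s c) := by rw [homog_den hc.ne']; exact div_pos hh hc
    rcases le_total 0 s with h | h <;> nlinarith [hv.1, hv.2]
  · intro x hx
    rw [Set.mem_Ioo, Set.mem_Ioo, hanti.lt_iff_gt hc hx, hanti.lt_iff_gt hx ha, and_comm]

/-- The coefficients of a quartic in terms of its factorization. -/
theorem coeff_eq {d₀ d₁ d₂ d₃ d₄ : ℝ} (b : Branch d t₁ t₂ t₃ ν s)
    (hd : ∀ x, d.eval x = d₀ + d₁ * x + d₂ * x ^ 2 + d₃ * x ^ 3 + d₄ * x ^ 4) :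
    d₀ = ν * (t₁ * t₂ * t₃) ∧ d₁ = -ν * ((t₁ + t₂) * t₃ + t₁ * t₂ * (1 + s * t₃)) ∧
      d₂ = ν * (t₃ + (t₁ + t₂) * (1 + s * t₃) + t₁ * t₂ * s) ∧
      d₃ = -ν * (1 + s * t₃ + (t₁ + t₂) * s) ∧ d₄ = ν * s := by
  have f : ∀ x, d₀ + d₁ * x + d₂ * x ^ 2 + d₃ * x ^ 3 + d₄ * x ^ 4 =
      ν * ((x - t₁) * (x - t₂) * (t₃ - x) * (1 - s * x)) := fun x => by rw [← hd, b.eval_eq]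
  have f0 := f 0
  have f1 := f 1
  have f2 := f (-1)
  have f3 := f 2
  have f4 := f (-2)
  refine ⟨?_, ?_, ?_, ?_, ?_⟩
  · linear_combination f0
  · linear_combination (2 / 3) * (f1 - f2) - (f3 - f4) / 12
  · linear_combination (2 / 3) * (f1 + f2) - (f3 + f4) / 24 - (5 / 4) * f0
  · linear_combination (f3 - f4) / 12 - (f1 - f2) / 6
  · linear_combination (f3 + f4) / 24 - (f1 + f2) / 6 + f0 / 4

/-- The elementary symmetric functions of the images of `t₁, t₂, t₃` are, up to sign, the
invariants of the quartic. -/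
theorem invariants {d₀ d₁ d₂ d₃ d₄ : ℝ} (b : Branch d t₁ t₂ t₃ ν s)
    (hd : ∀ x, d.eval x = d₀ + d₁ * x + d₂ * x ^ 2 + d₃ * x ^ 3 + d₄ * x ^ 4) (v : ℝ) :
    (v - homog (base t₁ t₂ t₃ ν s) (slope t₁ t₂ t₃ ν s) s t₁) *
      (v - homog (base t₁ t₂ t₃ ν s) (slope t₁ t₂ t₃ ν s) s t₂) *
      (v - homog (base t₁ t₂ t₃ ν s) (slope t₁ t₂ t₃ ν s) s t₃) =
    v ^ 3 - (4 * d₀ * d₄ - d₁ * d₃ + d₂ ^ 2 / 3) * v -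
      (8 / 3 * d₀ * d₂ * d₄ + d₁ * d₂ * d₃ / 3 - 2 / 27 * d₂ ^ 3 - d₁ ^ 2 * d₄ - d₀ * d₃ ^ 2) := by
  obtain ⟨rfl, rfl, rfl, rfl, rfl⟩ := b.coeff_eq hd
  rw [b.homog_t₁, b.homog_t₂, b.homog_t₃]
  unfold base
  ring

theorem root_iff (b : Branch d t₁ t₂ t₃ ν s) (x : ℝ) :
    d.IsRoot x ↔ x = t₁ ∨ x = t₂ ∨ x = t₃ ∨ s * x = 1 := by
  rw [IsRoot.def, b.eval_eq]
  have := b.pos.ne'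
  simp only [mul_eq_zero, this, false_or, sub_eq_zero, or_assoc]
  constructor
  · rintro (h | h | h | h)
    exacts [Or.inl h, Or.inr (Or.inl h), Or.inr (Or.inr (Or.inl h.symm)), Or.inr (Or.inr (Or.inr h.symm))]
  · rintro (h | h | h | h)
    exacts [Or.inl h, Or.inr (Or.inl h), Or.inr (Or.inr (Or.inl h.symm)), Or.inr (Or.inr (Or.inr h.symm))]

theorem one_lt_abs_of_mul_eq_one (b : Branch d t₁ t₂ t₃ ν s) {x : ℝ} (hx : s * x = 1) : 1 < |x| := by
  by_contra hc
  obtain ⟨h1, h2⟩ := abs_le.mp (not_lt.mp hc)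
  have := one_sub_pos_of_mem b.s_lt b.lt_s h1 h2
  linarith

theorem ne_t₃_of_mul_eq_one (b : Branch d t₁ t₂ t₃ ν s) {x : ℝ} (hx : s * x = 1) : x ≠ t₃ := by
  rintro rfl
  linarith [b.st₃]

theorem roots_inside (b : Branch d t₁ t₂ t₃ ν s) : {x : ℝ | d.IsRoot x ∧ |x| < 1} = {t₁, t₂} := by
  have h1 := b.lt₁
  have h2 := b.lt₁₂
  have h3 := b.lt₂
  have h4 := b.lt₃
  ext x
  simp only [Set.mem_ofPred_eq, b.root_iff, Set.mem_insert_iff, Set.mem_singleton_iff]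
  constructor
  · rintro ⟨h | h | h | h, hx⟩
    · exact Or.inl h
    · exact Or.inr h
    · rw [abs_lt] at hx; linarith
    · linarith [b.one_lt_abs_of_mul_eq_one h]
  · rintro (rfl | rfl)
    · exact ⟨Or.inl rfl, abs_lt.mpr ⟨by linarith, by linarith⟩⟩
    · exact ⟨Or.inr (Or.inl rfl), abs_lt.mpr ⟨by linarith, by linarith⟩⟩

theorem isLeast_outside (b : Branch d t₁ t₂ t₃ ν s) : IsLeast {x : ℝ | d.IsRoot x ∧ 1 < x} t₃ := by
  have h1 := b.lt₁
  have h2 := b.lt₁₂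
  have h3 := b.lt₂
  have h4 := b.lt₃
  refine ⟨⟨(b.root_iff _).mpr (by simp), h4⟩, ?_⟩
  rintro x ⟨hx, hx1⟩
  rcases (b.root_iff x).mp hx with h | h | h | h
  · linarith
  · linarith
  · exact h.ge
  · by_contra hc
    have := b.st₃
    have hs : 0 < s := by
      by_contra hs
      nlinarith
    nlinarith

end Branch

theorem x₁_eq {S : Finset (ℤ × ℤ)} {z t₁ t₂ t₃ ν s : ℝ} (b : Branch (disc S z) t₁ t₂ t₃ ν s) :
    x₁ S z = t₁ := by
  rw [x₁, b.roots_inside, csInf_pair, min_eq_left b.lt₁₂.le]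

theorem x₂_eq {S : Finset (ℤ × ℤ)} {z t₁ t₂ t₃ ν s : ℝ} (b : Branch (disc S z) t₁ t₂ t₃ ν s) :
    x₂ S z = t₂ := by
  rw [x₂, b.roots_inside, csSup_pair, max_eq_right b.lt₁₂.le]

theorem x₃_eq {S : Finset (ℤ × ℤ)} {z t₁ t₂ t₃ ν s : ℝ} (b : Branch (disc S z) t₁ t₂ t₃ ν s) :
    x₃ S z = t₃ := b.isLeast_outside.csInf_eq

theorem x₄_of_ne_zero {S : Finset (ℤ × ℤ)} {z t₁ t₂ t₃ ν s : ℝ}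
    (b : Branch (disc S z) t₁ t₂ t₃ ν s) (hs : s ≠ 0) : x₄ S z = some s⁻¹ := by
  have h : ∃ x : ℝ, (disc S z).IsRoot x ∧ 1 < |x| ∧ x ≠ x₃ S z := by
    have hs1 : s * s⁻¹ = 1 := mul_inv_cancel₀ hs
    refine ⟨s⁻¹, (b.root_iff _).mpr (by simp [hs1]), b.one_lt_abs_of_mul_eq_one hs1, ?_⟩
    rw [x₃_eq b]
    exact b.ne_t₃_of_mul_eq_one hs1
  rw [x₄, dif_pos h]
  obtain ⟨h1, h2, h3'⟩ := h.choose_spec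
  have h3 : h.choose ≠ t₃ := fun e => h3' (e.trans (x₃_eq b).symm)
  generalize h.choose = x at h1 h2 h3
  have l1 := b.lt₁
  have l2 := b.lt₁₂
  have l3 := b.lt₂
  congr 1
  rcases (b.root_iff _).mp h1 with h | h | h | h
  · rw [h] at h2
    exact absurd h2 (not_lt.mpr (abs_le.mpr ⟨by linarith, by linarith⟩))
  · rw [h] at h2
    exact absurd h2 (not_lt.mpr (abs_le.mpr ⟨by linarith, by linarith⟩))
  · exact absurd h h3
  · exact eq_inv_of_mul_eq_one_right h

theorem x₄_of_eq_zero {S : Finset (ℤ × ℤ)} {z t₁ t₂ t₃ ν s : ℝ}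
    (b : Branch (disc S z) t₁ t₂ t₃ ν s) (hs : s = 0) : x₄ S z = none := by
  rw [x₄, dif_neg]
  rintro ⟨x, h1, h2, h3⟩
  rw [x₃_eq b] at h3
  have l1 := b.lt₁
  have l2 := b.lt₁₂
  have l3 := b.lt₂
  rcases (b.root_iff _).mp h1 with h | h | h | h
  · rw [h] at h2
    exact absurd h2 (not_lt.mpr (abs_le.mpr ⟨by linarith, by linarith⟩))
  · rw [h] at h2
    exact absurd h2 (not_lt.mpr (abs_le.mpr ⟨by linarith, by linarith⟩))
  · exact h3 h
  · rw [hs, zero_mul] at h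
    exact zero_ne_one h

open Classical in
/-- The inverse homography `v ↦ (g₀ - v) / (h + s (g₀ - v))` on the Riemann sphere. -/
noncomputable def mobInv (g h s : ℝ) : OnePoint ℂ → OnePoint ℂ
  | none => if s = 0 then OnePoint.infty else (((s : ℂ)⁻¹ : ℂ) : OnePoint ℂ)
  | some v => if (h : ℂ) + s * (g - v) = 0 then OnePoint.infty
      else (((g - v) / (h + s * (g - v)) : ℂ) : OnePoint ℂ)

theorem gInv_eq {S : Finset (ℤ × ℤ)} {z t₁ t₂ t₃ ν s : ℝ} (hS : IsSmallStepSet S)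
    (b : Branch (disc S z) t₁ t₂ t₃ ν s) (u : OnePoint ℂ) :
    gInv (disc S z) (x₄ S z) u =
      mobInv (Branch.base t₁ t₂ t₃ ν s) (Branch.slope t₁ t₂ t₃ ν s) s u := by
  classical
  obtain ⟨-, c1, c2, c3, c4⟩ := b.coeff_eq (disc_eval hS z)
  by_cases hs : s = 0
  · rw [x₄_of_eq_zero b hs]
    subst hs
    have hν := b.pos.ne'
    have hνc : (ν : ℂ) ≠ 0 := by exact_mod_cast hν
    obtain ⟨-, d2, d3⟩ := disc_derivs hS z 0
    match u with
    | none => simp [gInv, mobInv]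
    | some v =>
      simp only [gInv, mobInv, d2, d3, c2, c3, Branch.base, Branch.slope]
      simp only [Complex.ofReal_zero, zero_mul, add_zero, sub_zero, mul_one, hνc, if_false]
      congr 1
      push_cast
      field_simp
      ring
  · rw [x₄_of_ne_zero b hs]
    have hsc : (s : ℂ) ≠ 0 := by exact_mod_cast hs
    obtain ⟨d1, d2, -⟩ := disc_derivs hS z s⁻¹
    have k1 : (derivative (disc S z)).eval s⁻¹ = Branch.slope t₁ t₂ t₃ ν s / s ^ 2 := by
      rw [d1, c1, c2, c3, c4]
      unfold Branch.slope
      field_simp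
      ring
    have k2 : (derivative^[2] (disc S z)).eval s⁻¹ / 6 =
        Branch.base t₁ t₂ t₃ ν s + Branch.slope t₁ t₂ t₃ ν s / s := by
      rw [d2, c2, c3, c4]
      unfold Branch.slope Branch.base
      field_simp
      ring
    match u with
    | none => simp [gInv, mobInv, hs]
    | some v =>
      simp only [gInv, mobInv, k1, k2]
      have e : (Branch.slope t₁ t₂ t₃ ν s : ℂ) + s * (Branch.base t₁ t₂ t₃ ν s - v) =
          -s * (v - ((Branch.base t₁ t₂ t₃ ν s + Branch.slope t₁ t₂ t₃ ν s / s : ℝ) : ℂ)) := by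
        push_cast
        field_simp
        ring
      have hiff : v = ((Branch.base t₁ t₂ t₃ ν s + Branch.slope t₁ t₂ t₃ ν s / s : ℝ) : ℂ) ↔
          (Branch.slope t₁ t₂ t₃ ν s : ℂ) + s * (Branch.base t₁ t₂ t₃ ν s - v) = 0 := by
        rw [e, mul_eq_zero, neg_eq_zero, or_iff_right hsc, sub_eq_zero]
      by_cases hv : v = ((Branch.base t₁ t₂ t₃ ν s + Branch.slope t₁ t₂ t₃ ν s / s : ℝ) : ℂ)
      · rw [if_pos hv, if_pos (hiff.mp hv)]
      · rw [if_neg hv, if_neg fun h => hv (hiff.mpr h)]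
        congr 1
        have hv' := sub_ne_zero.mpr hv
        rw [e]
        have e2 : (Branch.base t₁ t₂ t₃ ν s : ℂ) =
            ((Branch.base t₁ t₂ t₃ ν s + Branch.slope t₁ t₂ t₃ ν s / s : ℝ) : ℂ) -
              (Branch.slope t₁ t₂ t₃ ν s : ℂ) / s := by push_cast; ring
        rw [e2]
        generalize ((Branch.base t₁ t₂ t₃ ν s + Branch.slope t₁ t₂ t₃ ν s / s : ℝ) : ℂ) = κ at hv' ⊢
        push_cast
        field_simp
        ring

/-! ### The uniformization by the Weierstrass function -/

/-- The uniformization of a model: the period lattice `L` is rectangular with sides `A` and `B`, the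
discriminant factors as in `Branch`, and the homography `g - h x / (1 - s x)` maps the branch points
`x₁, x₂, x₃` to the values of `℘` at the half-periods. -/
structure Unif (S : Finset (ℤ × ℤ)) (z : ℝ) (L : PeriodPair) (A B g h ν s : ℝ) : Prop where
  model : Model S z
  rect : IsRect L A B
  per₁ : ω₁ S z = L.ω₁
  per₂ : ω₂ S z = B
  wp_of_mem : ∀ ω ∈ L.lattice, wp S z ω = OnePoint.infty
  wp_of_notMem : ∀ ω ∉ L.lattice, wp S z ω = (L.weierstrassP ω : ℂ)
  branch : Branch (disc S z) (x₁ S z) (x₂ S z) (x₃ S z) ν s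
  x₂_pos : 0 < x₂ S z
  base_eq : g = Branch.base (x₁ S z) (x₂ S z) (x₃ S z) ν s
  slope_eq : h = Branch.slope (x₁ S z) (x₂ S z) (x₃ S z) ν s
  e₁_eq : e₁ L = Branch.homog g h s (x₁ S z)
  e₂_eq : e₂ L = Branch.homog g h s (x₂ S z)
  e₃_eq : e₃ L = Branch.homog g h s (x₃ S z)

theorem wp_eq {S : Finset (ℤ × ℤ)} {z : ℝ} {L : PeriodPair} (h1 : ω₁ S z = L.ω₁)
    (h2 : (ω₂ S z : ℂ) = L.ω₂) :
    (∀ ω ∈ L.lattice, wp S z ω = OnePoint.infty) ∧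
      ∀ ω ∉ L.lattice, wp S z ω = (L.weierstrassP ω : ℂ) := by
  have hli : LinearIndependent ℝ ![ω₁ S z, (ω₂ S z : ℂ)] := by
    rw [h1, h2]; exact L.indep
  have hL : PeriodPair.mk _ _ hli = L := by
    cases L
    simp only at h1 h2
    simp only [PeriodPair.mk.injEq]
    exact ⟨h1, h2⟩
  constructor
  · intro ω hω
    rw [wp, dif_pos hli, hL, if_pos hω]
  · intro ω hω
    rw [wp, dif_pos hli, hL, if_neg hω]

theorem linearIndependent_rect {A B : ℝ} (hA : 0 < A) (hB : 0 < B) :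
    LinearIndependent ℝ ![Complex.I * (A : ℂ), (B : ℂ)] := by
  rw [LinearIndependent.pair_iff]
  intro a b hab
  have h1 := congrArg Complex.re hab
  have h2 := congrArg Complex.im hab
  simp at h1 h2
  exact ⟨h2.resolve_right hA.ne', h1.resolve_right hB.ne'⟩

/-- The roots of a cubic, in decreasing order, are determined by its values. -/
theorem roots_eq_of_cubic {a b c a' b' c' : ℝ} (hcb : c < b) (hba : b < a) (hcb' : c' < b')
    (hba' : b' < a') (h : ∀ v, (v - a) * (v - b) * (v - c) = (v - a') * (v - b') * (v - c')) :
    a = a' ∧ b = b' ∧ c = c' := by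
  have r : ∀ v, (v = a ∨ v = b ∨ v = c) ↔ (v = a' ∨ v = b' ∨ v = c') := by
    intro v
    have := h v
    have e : ∀ p q r : ℝ, (v = p ∨ v = q ∨ v = r) ↔ (v - p) * (v - q) * (v - r) = 0 := by
      intro p q r
      simp only [mul_eq_zero, sub_eq_zero, or_assoc]
    rw [e, e, this]
  have ha := (r a).mp (Or.inl rfl)
  have ha' := (r a').mpr (Or.inl rfl)
  have hc := (r c).mp (Or.inr (Or.inr rfl))
  have hc' := (r c').mpr (Or.inr (Or.inr rfl))
  have h1 : a = a' := by
    apply le_antisymm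
    · rcases ha with h | h | h <;> linarith
    · rcases ha' with h | h | h <;> linarith
  have h2 : c = c' := by
    apply le_antisymm
    · rcases hc' with h | h | h <;> linarith
    · rcases hc with h | h | h <;> linarith
  refine ⟨h1, ?_, h2⟩
  rcases (r b).mp (Or.inr (Or.inl rfl)) with h | h | h
  · linarith
  · exact h
  · linarith

section

variable {S : Finset (ℤ × ℤ)} {z t₁ t₂ t₃ ν s : ℝ}

theorem period₁Im_eq (b : Branch (disc S z) t₁ t₂ t₃ ν s) (g : ℝ) :
    period₁Im S z = ∫ v in Set.Ioo (Branch.homog g (Branch.slope t₁ t₂ t₃ ν s) s t₂)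
      (Branch.homog g (Branch.slope t₁ t₂ t₃ ν s) s t₁),
      1 / √(-((v - Branch.homog g (Branch.slope t₁ t₂ t₃ ν s) s t₁) *
        (v - Branch.homog g (Branch.slope t₁ t₂ t₃ ν s) s t₂) *
        (v - Branch.homog g (Branch.slope t₁ t₂ t₃ ν s) s t₃))) := by
  rw [period₁Im, x₁_eq b, x₂_eq b, ← Branch.image_homog_Ioo b.slope_pos b.pos₁ b.pos₂]
  have := b.integral_homog g (-1) (U := Set.Ioo t₁ t₂) measurableSet_Ioo (fun x hx =>
    Branch.one_sub_pos_of_mem b.s_lt b.lt_s (b.lt₁.trans hx.1).le (hx.2.trans b.lt₂).le)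
  simp only [neg_one_mul] at this
  exact this.symm

theorem ω₂_eq (b : Branch (disc S z) t₁ t₂ t₃ ν s) (g : ℝ) :
    ω₂ S z = ∫ v in Set.Ioo (Branch.homog g (Branch.slope t₁ t₂ t₃ ν s) s t₃)
      (Branch.homog g (Branch.slope t₁ t₂ t₃ ν s) s t₂),
      1 / √((v - Branch.homog g (Branch.slope t₁ t₂ t₃ ν s) s t₁) *
        (v - Branch.homog g (Branch.slope t₁ t₂ t₃ ν s) s t₂) *
        (v - Branch.homog g (Branch.slope t₁ t₂ t₃ ν s) s t₃)) := by
  rw [ω₂, x₂_eq b, x₃_eq b, ← Branch.image_homog_Ioo b.slope_pos b.pos₂ b.pos₃]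
  have := b.integral_homog g 1 (U := Set.Ioo t₂ t₃) measurableSet_Ioo (fun x hx => by
    have h2 := b.pos₂
    have h3 := b.pos₃
    rcases le_total 0 s with h | h <;> nlinarith [hx.1, hx.2])
  simp only [one_mul] at this
  exact this.symm

theorem Branch.homog_order {d : ℝ[X]} (b : Branch d t₁ t₂ t₃ ν s) (g : ℝ) :
    Branch.homog g (Branch.slope t₁ t₂ t₃ ν s) s t₃ < Branch.homog g (Branch.slope t₁ t₂ t₃ ν s) s t₂ ∧
    Branch.homog g (Branch.slope t₁ t₂ t₃ ν s) s t₂ < Branch.homog g (Branch.slope t₁ t₂ t₃ ν s) s t₁ :=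
  ⟨Branch.homog_strictAntiOn b.slope_pos b.pos₂ b.pos₃ (b.lt₂.trans b.lt₃),
    Branch.homog_strictAntiOn b.slope_pos b.pos₁ b.pos₂ b.lt₁₂⟩

end

/-- The invariants of the quartics `d` and `d̃` agree, so both curves have the same lattice of
periods. -/
theorem exists_unif {S : Finset (ℤ × ℤ)} {z : ℝ} (hm : Model S z) :
    ∃ L A B g h ν s g' h' ν' s', Unif S z L A B g h ν s ∧ Unif (transpose S) z L A B g' h' ν' s' := by
  obtain ⟨t₁, t₂, t₃, ν, s, b, hp⟩ := hm.exists_branch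
  obtain ⟨t₁', t₂', t₃', ν', s', b', hp'⟩ := hm.transpose.exists_branch
  obtain ⟨o1, o2⟩ := b.homog_order (Branch.base t₁ t₂ t₃ ν s)
  obtain ⟨o1', o2'⟩ := b'.homog_order (Branch.base t₁' t₂' t₃' ν' s')
  obtain ⟨r1, r2, r3⟩ := roots_eq_of_cubic o1 o2 o1' o2' fun v => by
    rw [b.invariants (disc_eval hm.small z), b'.invariants (disc_eval hm.small.transpose z)]
    simp only [dC, wt_transpose]
    ring
  have hs := b.sum_homog
  have hA := period₁Im_eq b (Branch.base t₁ t₂ t₃ ν s)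
  have hB := ω₂_eq b (Branch.base t₁ t₂ t₃ ν s)
  have hA' := period₁Im_eq b' (Branch.base t₁' t₂' t₃' ν' s')
  have hB' := ω₂_eq b' (Branch.base t₁' t₂' t₃' ν' s')
  rw [← r1, ← r2, ← r3, ← hA] at hA'
  rw [← r1, ← r2, ← r3, ← hB] at hB'
  have pA : 0 < period₁Im S z := by rw [hA]; exact integral_neg_cubic_pos o1 o2
  have pB : 0 < ω₂ S z := by rw [hB]; exact integral_cubic_pos o1 o2
  let L : PeriodPair := ⟨_, _, linearIndependent_rect pA pB⟩
  have hr : IsRect L (period₁Im S z) (ω₂ S z) := ⟨pA, pB, rfl, rfl⟩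
  obtain ⟨oe1, oe2⟩ := hr.e_order
  -- the cubic of the lattice and the transformed discriminant have the same two period integrals
  obtain ⟨q1, q2, q3⟩ := roots_eq_of_integrals oe1 oe2 o1 o2 hr.sum_eq_zero hs
    (hr.integral_B.trans hB) (hr.integral_A.trans hA)
  obtain ⟨w1, w2⟩ := wp_eq (S := S) (z := z) (L := L) rfl rfl
  have k1 : ω₁ (transpose S) z = L.ω₁ := by rw [ω₁, hA']
  have k2 : (ω₂ (transpose S) z : ℂ) = L.ω₂ := by rw [hB']
  obtain ⟨w1', w2'⟩ := wp_eq k1 k2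
  have x1 := x₁_eq b
  have x2 := x₂_eq b
  have x3 := x₃_eq b
  have x1' := x₁_eq b'
  have x2' := x₂_eq b'
  have x3' := x₃_eq b'
  refine ⟨L, period₁Im S z, ω₂ S z, _, _, ν, s, _, _, ν', s',
    ⟨hm, hr, rfl, rfl, w1, w2, by rwa [x1, x2, x3], by rwa [x2], rfl, rfl, ?_, ?_, ?_⟩,
    ⟨hm.transpose, hr, k1, hB', w1', w2', by rwa [x1', x2', x3'], by rwa [x2'], rfl, rfl,
      ?_, ?_, ?_⟩⟩
  · rw [x1, x2, x3, q1]
  · rw [x1, x2, x3, q2]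
  · rw [x1, x2, x3, q3]
  · rw [x1', x2', x3', q1, r1]
  · rw [x1', x2', x3', q2, r2]
  · rw [x1', x2', x3', q3, r3]

/-! ### The coordinate `x(ω)` -/

theorem finVal_coe (c : ℂ) : finVal (c : OnePoint ℂ) = c := rfl

theorem coe_finVal {p : OnePoint ℂ} (hp : p ≠ OnePoint.infty) : (finVal p : OnePoint ℂ) = p := by
  match p with
  | none => exact absurd rfl hp
  | some v => rfl

theorem mobInv_injective {g h s : ℝ} (hh : h ≠ 0) : Function.Injective (mobInv g h s) := by
  have hc : (h : ℂ) ≠ 0 := by exact_mod_cast hh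
  have key : ∀ v : ℂ, mobInv g h s none = mobInv g h s (some v) → False := by
    intro v hv
    by_cases hs : s = 0
    · subst hs
      simp [mobInv, hc] at hv
    · have hsc : (s : ℂ) ≠ 0 := by exact_mod_cast hs
      simp only [mobInv, if_neg hs] at hv
      split_ifs at hv with h0
      · exact OnePoint.coe_ne_infty _ hv
      · have hv' := OnePoint.coe_injective hv
        rw [inv_eq_one_div, div_eq_div_iff hsc h0] at hv'
        apply hc
        linear_combination hv'
  intro p q hpq
  match p, q with
  | none, none => rfl
  | none, some v => exact (key v hpq).elim
  | some v, none => exact (key v hpq.symm).elim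
  | some v, some w =>
    congr 1
    simp only [mobInv] at hpq
    split_ifs at hpq with h1 h2 h2
    · have hs : (s : ℂ) ≠ 0 := by
        intro hs
        rw [hs, zero_mul, add_zero] at h1
        exact hc h1
      apply mul_left_cancel₀ hs
      linear_combination h2 - h1
    · exact absurd hpq.symm (OnePoint.coe_ne_infty _)
    · exact absurd hpq (OnePoint.coe_ne_infty _)
    · have := OnePoint.coe_injective hpq
      rw [div_eq_div_iff h1 h2] at this
      apply mul_left_cancel₀ hc
      linear_combination -this

namespace Unif

variable {S : Finset (ℤ × ℤ)} {z : ℝ} {L : PeriodPair} {A B g h ν s : ℝ}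

theorem h_pos (u : Unif S z L A B g h ν s) : 0 < h := by
  rw [u.slope_eq]; exact u.branch.slope_pos

theorem h_ne (u : Unif S z L A B g h ν s) : (h : ℂ) ≠ 0 := by exact_mod_cast u.h_pos.ne'

theorem xCov_eq (u : Unif S z L A B g h ν s) (ω : ℂ) :
    xCov S z ω = mobInv g h s (wp S z ω) := by
  rw [xCov, gInv_eq u.model.small u.branch, ← u.base_eq, ← u.slope_eq]

theorem xCov_of_mem (u : Unif S z L A B g h ν s) {ω : ℂ} (hω : ω ∈ L.lattice) :
    xCov S z ω = if s = 0 then OnePoint.infty else (((s : ℂ)⁻¹ : ℂ) : OnePoint ℂ) := by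
  rw [u.xCov_eq, u.wp_of_mem ω hω]
  rfl

theorem xCov_of_notMem (u : Unif S z L A B g h ν s) {ω : ℂ} (hω : ω ∉ L.lattice) :
    xCov S z ω = if (h : ℂ) + s * (g - L.weierstrassP ω) = 0 then OnePoint.infty
      else (((g - L.weierstrassP ω) / (h + s * (g - L.weierstrassP ω)) : ℂ) : OnePoint ℂ) := by
  rw [u.xCov_eq, u.wp_of_notMem ω hω]
  rfl

theorem xVal_of_notMem (u : Unif S z L A B g h ν s) {ω : ℂ} (hω : ω ∉ L.lattice) :
    xVal S z ω = (g - L.weierstrassP ω) / (h + s * (g - L.weierstrassP ω)) := by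
  rw [xVal, u.xCov_of_notMem hω]
  split_ifs with h0
  · rw [h0, div_zero]; rfl
  · rfl

theorem xVal_coe (S : Finset (ℤ × ℤ)) (z : ℝ) {ω : ℂ} (hx : xCov S z ω ≠ OnePoint.infty) :
    (xVal S z ω : OnePoint ℂ) = xCov S z ω := coe_finVal hx

theorem xVal_eq_of_coe {ω x : ℂ} (hx : xCov S z ω = (x : OnePoint ℂ)) : xVal S z ω = x := by
  rw [xVal, hx, finVal_coe]

theorem den_ne_zero (u : Unif S z L A B g h ν s) {ω : ℂ} (hω : ω ∉ L.lattice)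
    (hx : xCov S z ω ≠ OnePoint.infty) : (h : ℂ) + s * (g - L.weierstrassP ω) ≠ 0 := by
  intro h0
  rw [u.xCov_of_notMem hω, if_pos h0] at hx
  exact hx rfl

/-- `x(ω) = x(ω')` only if `ω' = ± ω` modulo the lattice. -/
theorem xCov_eq_iff (u : Unif S z L A B g h ν s) (ω ω' : ℂ) :
    xCov S z ω = xCov S z ω' ↔ ω - ω' ∈ L.lattice ∨ ω + ω' ∈ L.lattice := by
  rw [u.xCov_eq, u.xCov_eq, (mobInv_injective u.h_pos.ne').eq_iff]
  by_cases h1 : ω ∈ L.lattice <;> by_cases h2 : ω' ∈ L.lattice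
  · rw [u.wp_of_mem _ h1, u.wp_of_mem _ h2]
    exact ⟨fun _ => Or.inl (sub_mem h1 h2), fun _ => rfl⟩
  · rw [u.wp_of_mem _ h1, u.wp_of_notMem _ h2]
    constructor
    · intro hc; exact absurd hc.symm (OnePoint.coe_ne_infty _)
    · rintro (h | h)
      · exact absurd (by simpa using sub_mem h1 h) h2
      · exact absurd (by simpa using sub_mem h h1) h2
  · rw [u.wp_of_notMem _ h1, u.wp_of_mem _ h2]
    constructor
    · intro hc; exact absurd hc (OnePoint.coe_ne_infty _)
    · rintro (h | h)
      · exact absurd (by simpa using add_mem h h2) h1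
      · exact absurd (by simpa using sub_mem h h2) h1
  · rw [u.wp_of_notMem _ h1, u.wp_of_notMem _ h2, OnePoint.coe_injective.eq_iff]
    exact wP_eq_iff L h1 h2

theorem xCov_add (u : Unif S z L A B g h ν s) {l : ℂ} (hl : l ∈ L.lattice) (ω : ℂ) :
    xCov S z (ω + l) = xCov S z ω := by
  rw [u.xCov_eq_iff]
  left
  rwa [add_sub_cancel_left]

theorem xCov_neg (u : Unif S z L A B g h ν s) (ω : ℂ) : xCov S z (-ω) = xCov S z ω := by
  rw [u.xCov_eq_iff]
  right
  rw [neg_add_cancel]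
  exact zero_mem _

theorem xVal_add (u : Unif S z L A B g h ν s) {l : ℂ} (hl : l ∈ L.lattice) (ω : ℂ) :
    xVal S z (ω + l) = xVal S z ω := by rw [xVal, u.xCov_add hl, xVal]

theorem xVal_neg (u : Unif S z L A B g h ν s) (ω : ℂ) : xVal S z (-ω) = xVal S z ω := by
  rw [xVal, u.xCov_neg, xVal]

theorem xCov_surjective (u : Unif S z L A B g h ν s) (x : ℂ) : ∃ ω, xCov S z ω = (x : OnePoint ℂ) := by
  by_cases hx : 1 - (s : ℂ) * x = 0
  · refine ⟨0, ?_⟩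
    have hs : (s : ℂ) ≠ 0 := by rintro hs; simp [hs] at hx
    have hs' : s ≠ 0 := by exact_mod_cast hs
    rw [u.xCov_of_mem (zero_mem _), if_neg hs']
    congr 1
    exact inv_eq_of_mul_eq_one_right (sub_eq_zero.mp hx).symm
  · obtain ⟨ω, h1, h2⟩ := wP_surjective L (g - h * x / (1 - s * x))
    refine ⟨ω, ?_⟩
    have hd : (h : ℂ) + s * (g - L.weierstrassP ω) = h / (1 - s * x) := by
      rw [h2, eq_div_iff hx, sub_sub_cancel, add_mul, mul_assoc, div_mul_cancel₀ _ hx]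
      ring
    have hd0 : (h : ℂ) + s * (g - L.weierstrassP ω) ≠ 0 := by
      rw [hd]; exact div_ne_zero u.h_ne hx
    rw [u.xCov_of_notMem h1, if_neg hd0, hd, h2, sub_sub_cancel, div_div_div_cancel_right₀ hx,
      mul_div_cancel_left₀ _ u.h_ne]

/-- The function `v ↦ (g - v) / (h + s (g - v))` composed with `℘`. -/
theorem meromorphic_aux (L : PeriodPair) (g h s : ℝ) : Meromorphic fun ω =>
    ((g : ℂ) - L.weierstrassP ω) / (h + s * (g - L.weierstrassP ω)) := by
  have h1 : Meromorphic L.weierstrassP := L.meromorphic_weierstrassP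
  have hc : ∀ c : ℂ, Meromorphic fun _ : ℂ => c := fun c ω => MeromorphicAt.const c ω
  exact ((hc g).sub h1).div ((hc h).add ((hc s).mul ((hc g).sub h1)))

theorem xVal_eventuallyEq (u : Unif S z L A B g h ν s) (ω : ℂ) : xVal S z =ᶠ[𝓝[≠] ω]
    fun ω => ((g : ℂ) - L.weierstrassP ω) / (h + s * (g - L.weierstrassP ω)) :=
  (eventually_punctured_notMem_lattice L ω).mono fun _ hv => u.xVal_of_notMem hv

theorem xVal_meromorphic (u : Unif S z L A B g h ν s) : Meromorphic (xVal S z) := fun ω =>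
  (meromorphic_aux L g h s ω).congr (u.xVal_eventuallyEq ω).symm

theorem eventually_wP_ne (L : PeriodPair) (c ω : ℂ) : ∀ᶠ v in 𝓝[≠] ω, L.weierstrassP v ≠ c := by
  have hm : Meromorphic L.weierstrassP := L.meromorphic_weierstrassP
  by_contra hc
  have h1 : ∃ᶠ v in 𝓝[≠] ω, L.weierstrassP v = (fun _ => c) v := hc
  have h2 := eventuallyEq_of_frequently hm (fun v => MeromorphicAt.const c v) h1 0
  have h3 : IsPole L.weierstrassP 0 := (wP_isPole_iff L 0).mpr (zero_mem _)
  rw [isPole_congr h2] at h3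
  have h4 : Tendsto (fun _ : ℂ => c) (𝓝[≠] (0 : ℂ)) (𝓝 c) := tendsto_const_nhds
  exact h3.not_tendsto (Metric.disjoint_cobounded_nhds c) h4

theorem eventually_ne_infty (u : Unif S z L A B g h ν s) (ω : ℂ) :
    ∀ᶠ v in 𝓝[≠] ω, xCov S z v ≠ OnePoint.infty := by
  by_cases hs : s = 0
  · filter_upwards [eventually_punctured_notMem_lattice L ω] with v hv
    rw [u.xCov_of_notMem hv, if_neg (by simpa [hs] using u.h_ne)]
    exact OnePoint.coe_ne_infty _
  · have hsc : (s : ℂ) ≠ 0 := by exact_mod_cast hs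
    filter_upwards [eventually_punctured_notMem_lattice L ω,
      eventually_wP_ne L (g + h / s) ω] with v hv hv2
    rw [u.xCov_of_notMem hv, if_neg]
    · exact OnePoint.coe_ne_infty _
    · intro h0
      apply hv2
      field_simp
      linear_combination -h0

/-- Also at the lattice points, where `℘` has a pole and `x(ω) = 1 / s`, the function `x(ω)` is
continuous unless it is infinite. -/
theorem tendsto_xVal (u : Unif S z L A B g h ν s) {ω : ℂ} (hx : xCov S z ω ≠ OnePoint.infty) :
    Tendsto (xVal S z) (𝓝[≠] ω) (𝓝 (xVal S z ω)) := by
  by_cases hω : ω ∈ L.lattice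
  · have hs : s ≠ 0 := by
      rintro rfl
      rw [u.xCov_of_mem hω, if_pos rfl] at hx
      exact hx rfl
    have hsc : (s : ℂ) ≠ 0 := by exact_mod_cast hs
    have hval : xVal S z ω = (s : ℂ)⁻¹ := xVal_eq_of_coe (by rw [u.xCov_of_mem hω, if_neg hs])
    have h1 : Tendsto L.weierstrassP (𝓝[≠] ω) (Bornology.cobounded ℂ) :=
      (wP_isPole_iff L ω).mpr hω
    have h2 : Tendsto (fun v => -((s : ℂ) * (L.weierstrassP v)) + (h + s * g)) (𝓝[≠] ω)
        (Bornology.cobounded ℂ) := by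
      have h3 := (tendsto_mul_left_cobounded hsc).comp h1
      have h4 := (tendsto_neg_cobounded (E := ℂ)).comp h3
      exact (tendsto_add_const_cobounded (h + s * g : ℂ)).comp h4
    have h5 := (tendsto_inv₀_cobounded (α := ℂ)).comp h2
    have h6 := (h5.const_mul ((h : ℂ) / s)).const_sub (s : ℂ)⁻¹
    rw [mul_zero, sub_zero] at h6
    rw [hval]
    refine h6.congr' ?_
    filter_upwards [u.eventually_ne_infty ω, eventually_punctured_notMem_lattice L ω] with v h8 h9
    have h10 := u.den_ne_zero h9 h8
    rw [u.xVal_of_notMem h9]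
    simp only [Function.comp_apply]
    have e : -((s : ℂ) * (L.weierstrassP v)) + (h + s * g) = h + s * (g - L.weierstrassP v) := by
      ring
    rw [e, eq_div_iff h10, sub_mul, mul_assoc, inv_mul_cancel₀ h10]
    field_simp
    ring
  · have hd := u.den_ne_zero hω hx
    have hc := (wP_analyticAt L hω).continuousAt
    have h1 : ContinuousAt (fun ω => ((g : ℂ) - L.weierstrassP ω) /
        (h + s * (g - L.weierstrassP ω))) ω :=
      (hc.const_sub _).div ((continuousAt_const).add ((hc.const_sub _).const_mul _)) hd
    rw [u.xVal_of_notMem hω]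
    exact (h1.tendsto.mono_left nhdsWithin_le_nhds).congr' (u.xVal_eventuallyEq ω).symm

theorem xVal_analyticAt (u : Unif S z L A B g h ν s) {ω : ℂ} (hx : xCov S z ω ≠ OnePoint.infty) :
    AnalyticAt ℂ (xVal S z) ω :=
  (u.xVal_meromorphic ω).analyticAt (continuousAt_iff_punctured_nhds.mpr (u.tendsto_xVal hx))

theorem isPole_xVal (u : Unif S z L A B g h ν s) {ω : ℂ} (hx : xCov S z ω = OnePoint.infty) :
    IsPole (xVal S z) ω := by
  rw [isPole_congr (u.xVal_eventuallyEq ω)]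
  by_cases hω : ω ∈ L.lattice
  · have hs : s = 0 := by
      by_contra hs
      rw [u.xCov_of_mem hω, if_neg hs] at hx
      exact OnePoint.coe_ne_infty _ hx
    have h1 : Tendsto L.weierstrassP (𝓝[≠] ω) (Bornology.cobounded ℂ) :=
      (wP_isPole_iff L ω).mpr hω
    have h4 := (tendsto_neg_cobounded (E := ℂ)).comp h1
    have h5 := (tendsto_add_const_cobounded (g : ℂ)).comp h4
    have h6 := (tendsto_mul_left_cobounded (inv_ne_zero u.h_ne)).comp h5
    refine h6.congr fun v => ?_
    simp only [Function.comp_apply, hs, Complex.ofReal_zero, zero_mul, add_zero]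
    ring
  · have h0 : (h : ℂ) + s * (g - L.weierstrassP ω) = 0 := by
      by_contra h0
      rw [u.xCov_of_notMem hω, if_neg h0] at hx
      exact OnePoint.coe_ne_infty _ hx
    have hc := (wP_analyticAt L hω).continuousAt
    have hnum : (g : ℂ) - L.weierstrassP ω ≠ 0 := by
      intro h1
      rw [h1, mul_zero, add_zero] at h0
      exact u.h_ne h0
    have h1 : Tendsto (fun v => (h : ℂ) + s * (g - L.weierstrassP v)) (𝓝[≠] ω) (𝓝[≠] 0) := by
      refine tendsto_nhdsWithin_iff.mpr ⟨?_, ?_⟩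
      · rw [← h0]
        exact ((continuousAt_const).add ((hc.const_sub _).const_mul _)).tendsto.mono_left
          nhdsWithin_le_nhds
      · filter_upwards [u.eventually_ne_infty ω, eventually_punctured_notMem_lattice L ω]
          with v h8 h9
        exact u.den_ne_zero h9 h8
    have h2 := (tendsto_inv₀_nhdsNE_zero (α := ℂ)).comp h1
    have h3 : Tendsto (fun v => (g : ℂ) - L.weierstrassP v) (𝓝[≠] ω) (𝓝 (g - L.weierstrassP ω)) :=
      (Tendsto.const_sub _ hc).mono_left nhdsWithin_le_nhds
    unfold IsPole
    rw [← tendsto_norm_atTop_iff_cobounded] at h2 ⊢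
    refine (h3.norm.pos_mul_atTop (norm_pos_iff.mpr hnum) h2).congr fun v => ?_
    rw [div_eq_mul_inv, norm_mul]
    rfl

theorem eventually_ne_infty_nhds (u : Unif S z L A B g h ν s) {ω : ℂ}
    (hx : xCov S z ω ≠ OnePoint.infty) : ∀ᶠ v in 𝓝 ω, xCov S z v ≠ OnePoint.infty := by
  have := u.eventually_ne_infty ω
  rw [eventually_nhdsWithin_iff] at this
  filter_upwards [this] with v hv
  by_cases h1 : v = ω
  · rwa [h1]
  · exact hv h1

theorem xCov_continuous (u : Unif S z L A B g h ν s) : Continuous (xCov S z) := by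
  rw [continuous_iff_continuousAt]
  intro ω
  by_cases hx : xCov S z ω = OnePoint.infty
  · rw [continuousAt_iff_punctured_nhds, hx]
    have h1 := u.isPole_xVal hx
    unfold IsPole at h1
    have h2 : Tendsto (fun x : ℂ => (x : OnePoint ℂ)) (Bornology.cobounded ℂ)
        (𝓝 OnePoint.infty) := by
      rw [Metric.cobounded_eq_cocompact, ← coclosedCompact_eq_cocompact]
      exact OnePoint.tendsto_coe_infty
    refine (h2.comp h1).congr' ?_
    filter_upwards [u.eventually_ne_infty ω] with v hv
    exact xVal_coe S z hv
  · have h1 := (u.xVal_analyticAt hx).continuousAt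
    have h2 : ContinuousAt (fun v => (xVal S z v : OnePoint ℂ)) ω :=
      OnePoint.continuous_coe.continuousAt.comp h1
    refine h2.congr ?_
    filter_upwards [u.eventually_ne_infty_nhds hx] with v hv
    exact xVal_coe S z hv

end Unif

namespace Unif

variable {S : Finset (ℤ × ℤ)} {z : ℝ} {L : PeriodPair} {A B g h ν s : ℝ}

/-! ### The differential equation of `x(ω)` -/

theorem one_sub_xVal (u : Unif S z L A B g h ν s) {ω : ℂ} (hω : ω ∉ L.lattice)
    (hx : xCov S z ω ≠ OnePoint.infty) :
    1 - s * xVal S z ω = h / (h + s * (g - L.weierstrassP ω)) := by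
  have hd := u.den_ne_zero hω hx
  rw [u.xVal_of_notMem hω, eq_div_iff hd, sub_mul, mul_assoc, div_mul_cancel₀ _ hd]
  ring

theorem one_sub_xVal_ne_zero (u : Unif S z L A B g h ν s) {ω : ℂ} (hω : ω ∉ L.lattice)
    (hx : xCov S z ω ≠ OnePoint.infty) : 1 - s * xVal S z ω ≠ 0 := by
  rw [u.one_sub_xVal hω hx]
  exact div_ne_zero u.h_ne (u.den_ne_zero hω hx)

theorem hasDerivAt_xVal (u : Unif S z L A B g h ν s) {ω : ℂ} (hω : ω ∉ L.lattice)
    (hx : xCov S z ω ≠ OnePoint.infty) :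
    HasDerivAt (xVal S z) (-((1 - s * xVal S z ω) ^ 2 / h) * L.derivWeierstrassP ω) ω := by
  have hd := u.den_ne_zero hω hx
  have hh := u.h_ne
  have h1 : HasDerivAt L.weierstrassP (L.derivWeierstrassP ω) ω := by
    rw [← wP_deriv]
    exact (wP_analyticAt L hω).differentiableAt.hasDerivAt
  have h2 := (h1.const_sub (g : ℂ)).div (((h1.const_sub (g : ℂ)).const_mul (s : ℂ)).const_add
    (h : ℂ)) hd
  have h3 : xVal S z =ᶠ[𝓝 ω]
      fun ω => ((g : ℂ) - L.weierstrassP ω) / (h + s * (g - L.weierstrassP ω)) :=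
    (eventually_notMem_lattice L hω).mono fun _ hv => u.xVal_of_notMem hv
  refine (h2.congr_of_eventuallyEq h3).congr_deriv ?_
  rw [u.one_sub_xVal hω hx, div_pow]
  field_simp
  ring

theorem dF_eq_prod (u : Unif S z L A B g h ν s) (x : ℂ) :
    dF S z x = ν * ((x - x₁ S z) * (x - x₂ S z) * (x₃ S z - x) * (1 - s * x)) := by
  obtain ⟨c0, c1, c2, c3, c4⟩ := u.branch.coeff_eq (disc_eval u.model.small z)
  unfold dF
  rw [c0, c1, c2, c3, c4]
  push_cast
  ring

theorem sq_deriv_of_notMem (u : Unif S z L A B g h ν s) {ω : ℂ} (hω : ω ∉ L.lattice)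
    (hx : xCov S z ω ≠ OnePoint.infty) :
    deriv (xVal S z) ω ^ 2 = 4 * dF S z (xVal S z ω) := by
  have h1 := u.one_sub_xVal_ne_zero hω hx
  have hh := u.h_ne
  have hv : L.weierstrassP ω = g - h * xVal S z ω / (1 - s * xVal S z ω) := by
    have hd := u.den_ne_zero hω hx
    rw [u.one_sub_xVal hω hx, u.xVal_of_notMem hω, mul_div_assoc', div_div_div_cancel_right₀ hd,
      mul_div_cancel_left₀ _ hh]
    ring
  rw [(u.hasDerivAt_xVal hω hx).deriv, mul_pow, (u.rect.sq_deriv hω).1, u.dF_eq_prod, u.e₁_eq,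
    u.e₂_eq, u.e₃_eq, hv]
  have b1 := u.branch.pos₁.ne'
  have b2 := u.branch.pos₂.ne'
  have b3 := u.branch.pos₃.ne'
  have b1' : 1 - (s : ℂ) * x₁ S z ≠ 0 := by exact_mod_cast b1
  have b2' : 1 - (s : ℂ) * x₂ S z ≠ 0 := by exact_mod_cast b2
  have b3' : 1 - (s : ℂ) * x₃ S z ≠ 0 := by exact_mod_cast b3
  have e : ∀ t : ℝ, 1 - (s : ℂ) * t ≠ 0 → (g : ℂ) - h * xVal S z ω / (1 - s * xVal S z ω) -
      (Branch.homog g h s t : ℝ) =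
      h * (t - xVal S z ω) / ((1 - s * xVal S z ω) * (1 - s * t)) := by
    intro t ht
    unfold Branch.homog
    push_cast
    rw [sub_sub_sub_cancel_left, div_sub_div _ _ ht h1, mul_comm (1 - (s : ℂ) * t) (1 - _)]
    congr 1
    ring
  rw [e _ b1', e _ b2', e _ b3']
  have hs : (h : ℂ) = ν * ((1 - s * x₁ S z) * (1 - s * x₂ S z) * (1 - s * x₃ S z)) := by
    have := u.slope_eq
    unfold Branch.slope at this
    exact_mod_cast this
  generalize xVal S z ω = x at h1 ⊢
  set p := 1 - (s : ℂ) * x with hp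
  set p1 := 1 - (s : ℂ) * x₁ S z
  set p2 := 1 - (s : ℂ) * x₂ S z
  set p3 := 1 - (s : ℂ) * x₃ S z
  have e2 : (-(p ^ 2 / (h : ℂ))) ^ 2 * (4 * (h * (x₁ S z - x) / (p * p1) *
      (h * (x₂ S z - x) / (p * p2)) * (h * (x₃ S z - x) / (p * p3)))) =
      4 * (h / (p1 * p2 * p3) * ((x - x₁ S z) * (x - x₂ S z) * (x₃ S z - x) * p)) := by
    field_simp
    ring
  rw [e2, hs, mul_div_assoc, div_self (mul_ne_zero (mul_ne_zero b1' b2') b3'), mul_one]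

/-- `x' ^ 2 = 4 d(x)`. -/
theorem sq_deriv (u : Unif S z L A B g h ν s) {ω : ℂ} (hx : xCov S z ω ≠ OnePoint.infty) :
    deriv (xVal S z) ω ^ 2 = 4 * dF S z (xVal S z ω) := by
  have ha := u.xVal_analyticAt hx
  have h1 : Tendsto (fun v => deriv (xVal S z) v ^ 2) (𝓝[≠] ω) (𝓝 (deriv (xVal S z) ω ^ 2)) :=
    ((ha.deriv.continuousAt).pow 2).tendsto.mono_left nhdsWithin_le_nhds
  have h2 : Tendsto (fun v => 4 * dF S z (xVal S z v)) (𝓝[≠] ω) (𝓝 (4 * dF S z (xVal S z ω))) := by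
    have hc : Continuous fun x => 4 * dF S z x := by unfold dF; fun_prop
    exact (hc.continuousAt.comp ha.continuousAt).tendsto.mono_left nhdsWithin_le_nhds
  refine tendsto_nhds_unique (h1.congr' ?_) h2
  filter_upwards [u.eventually_ne_infty ω, eventually_punctured_notMem_lattice L ω] with v h8 h9
  exact u.sq_deriv_of_notMem h9 h8

/-- A nonzero polynomial in `x(ω)` has isolated zeros. -/
theorem eventually_eval_ne_zero (u : Unif S z L A B g h ν s) {p : ℂ[X]} (hp : p ≠ 0) (ω : ℂ) :
    ∀ᶠ v in 𝓝[≠] ω, p.eval (xVal S z v) ≠ 0 := by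
  have h1 : ∀ c : ℂ, ∀ᶠ v in 𝓝[≠] ω, xVal S z v ≠ c := by
    intro c
    obtain ⟨ω', hω'⟩ := u.xCov_surjective c
    have h2 : ∀ᶠ v in 𝓝[≠] ω, v - ω' ∉ L.lattice := by
      have := (tendsto_punctured_add ω (-ω')).eventually
        (eventually_punctured_notMem_lattice L (ω + -ω'))
      simpa [sub_eq_add_neg] using this
    have h3 : ∀ᶠ v in 𝓝[≠] ω, v + ω' ∉ L.lattice :=
      (tendsto_punctured_add ω ω').eventually (eventually_punctured_notMem_lattice L (ω + ω'))
    filter_upwards [h2, h3, u.eventually_ne_infty ω] with v h4 h5 h6 h7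
    have h8 : xCov S z v = xCov S z ω' := by rw [hω', ← xVal_coe S z h6, h7]
    rcases (u.xCov_eq_iff _ _).mp h8 with h | h
    exacts [h4 h, h5 h]
  have h2 : ∀ᶠ v in 𝓝[≠] ω, ∀ c ∈ p.roots.toFinset, xVal S z v ≠ c :=
    (Finset.eventually_all _).mpr fun c _ => h1 c
  filter_upwards [h2] with v hv h0
  exact hv _ (by simpa [hp] using h0) rfl

theorem eventually_xVal_ne (u : Unif S z L A B g h ν s) (c ω : ℂ) :
    ∀ᶠ v in 𝓝[≠] ω, xVal S z v ≠ c := by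
  have := u.eventually_eval_ne_zero (X_sub_C_ne_zero c) ω
  filter_upwards [this] with v hv h0
  apply hv
  simp [h0]

theorem nhds_le_map (u : Unif S z L A B g h ν s) {ω : ℂ} (hx : xCov S z ω ≠ OnePoint.infty) :
    𝓝 (xVal S z ω) ≤ map (xVal S z) (𝓝 ω) := by
  rcases (u.xVal_analyticAt hx).eventually_constant_or_nhds_le_map_nhds with h1 | h1
  · exfalso
    have h2 := u.eventually_xVal_ne (xVal S z ω) ω
    obtain ⟨v, h3, h4⟩ := (h2.and (h1.filter_mono nhdsWithin_le_nhds)).exists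
    exact h3 h4
  · exact h1

/-! ### The values of `x(ω)` on the symmetry lines -/

theorem xCov_of_real (u : Unif S z L A B g h ν s) {ω : ℂ} (hω : ω ∉ L.lattice) {v : ℝ}
    (hv : L.weierstrassP ω = v) (hd : h + s * (g - v) ≠ 0) :
    ∃ x : ℝ, xCov S z ω = ((x : ℂ) : OnePoint ℂ) ∧ 1 - s * x = h / (h + s * (g - v)) ∧
      Branch.homog g h s x = v := by
  have hdc : (h : ℂ) + s * (g - v) ≠ 0 := by exact_mod_cast hd
  have h1 : 1 - s * ((g - v) / (h + s * (g - v))) = h / (h + s * (g - v)) := by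
    rw [eq_div_iff hd, sub_mul, mul_assoc, div_mul_cancel₀ _ hd]
    ring
  refine ⟨(g - v) / (h + s * (g - v)), ?_, h1, ?_⟩
  · rw [u.xCov_of_notMem hω, hv, if_neg hdc]
    push_cast
    rfl
  · unfold Branch.homog
    rw [h1, mul_div_assoc', div_div_div_cancel_right₀ hd, mul_div_cancel_left₀ _ u.h_pos.ne']
    ring

theorem den_e (u : Unif S z L A B g h ν s) : 0 < h + s * (g - e₁ L) ∧ 0 < h + s * (g - e₂ L) ∧
    0 < h + s * (g - e₃ L) := by
  have b := u.branch
  have hh := u.h_pos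
  rw [u.e₁_eq, u.e₂_eq, u.e₃_eq, Branch.homog_den b.pos₁.ne', Branch.homog_den b.pos₂.ne',
    Branch.homog_den b.pos₃.ne']
  exact ⟨div_pos hh b.pos₁, div_pos hh b.pos₂, div_pos hh b.pos₃⟩

theorem den_pos_of_mem {v a c : ℝ} (ha : 0 < h + s * (g - a))
    (hc : 0 < h + s * (g - c)) (hv : v ∈ Set.Icc a c) : 0 < h + s * (g - v) := by
  rcases le_total 0 s with h | h <;> nlinarith [hv.1, hv.2]

theorem mem_Icc_of_homog (u : Unif S z L A B g h ν s) {x a c : ℝ} (hx : 0 < 1 - s * x)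
    (ha : 0 < 1 - s * a) (hc : 0 < 1 - s * c)
    (hv : Branch.homog g h s x ∈ Set.Icc (Branch.homog g h s c) (Branch.homog g h s a)) :
    x ∈ Set.Icc a c := by
  have hanti := Branch.homog_strictAntiOn (s := s) (g := g) u.h_pos
  exact ⟨(hanti.le_iff_ge hx ha).mp hv.2, (hanti.le_iff_ge hc hx).mp hv.1⟩

/-- On the lines `Re ω ∈ ω₂ / 2 + ω₂ ℤ` the values of `x` are on the cut `[x₁, x₂]`. -/
theorem xCov_re_half (u : Unif S z L A B g h ν s) {ω : ℂ} (n : ℤ) (hω : ω.re = B / 2 + n * B) :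
    ∃ x ∈ Set.Icc (x₁ S z) (x₂ S z), xCov S z ω = ((x : ℂ) : OnePoint ℂ) := by
  have hr := u.rect
  have hn : (n : ℂ) * L.ω₂ ∈ L.lattice := by
    have := L.lattice.smul_mem n L.ω₂_mem_lattice
    rwa [zsmul_eq_mul] at this
  have hω' : ω = (L.ω₂ / 2 + (ω.im : ℂ) * Complex.I) + n * L.ω₂ := by
    rw [hr.per₂]
    apply Complex.ext <;> simp [hω]
  rw [hω', u.xCov_add hn]
  have h1 := hr.notMem_ver_half ω.im
  have h2 := IsRect.wP_eq_lineVal (hr.real_ver_half ω.im)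
  have h3 := hr.ver_half_mem ω.im
  obtain ⟨d1, d2, d3⟩ := u.den_e
  have h4 := den_pos_of_mem d2 d1 h3
  obtain ⟨x, hx, hx1, hx2⟩ := u.xCov_of_real h1 h2 h4.ne'
  refine ⟨x, u.mem_Icc_of_homog (by rw [hx1]; exact div_pos u.h_pos h4) u.branch.pos₁ u.branch.pos₂ ?_, hx⟩
  rw [hx2, ← u.e₁_eq, ← u.e₂_eq]
  exact h3

/-- On the lines `Re ω ∈ ω₂ ℤ` the values of `x` are outside of the unit disc. -/
theorem xCov_re_zero (u : Unif S z L A B g h ν s) {ω : ℂ} (n : ℤ) (hω : ω.re = n * B) {x : ℂ}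
    (hx : xCov S z ω = x) : 1 < ‖x‖ := by
  have hr := u.rect
  have b := u.branch
  have habs : ∀ y : ℝ, 1 ≤ s * y → 1 < ‖(y : ℂ)‖ := by
    intro y hy
    rw [Complex.norm_real, Real.norm_eq_abs]
    by_contra hc
    obtain ⟨h1, h2⟩ := abs_le.mp (not_lt.mp hc)
    have := Branch.one_sub_pos_of_mem b.s_lt b.lt_s h1 h2
    linarith
  by_cases hL : ω ∈ L.lattice
  · rw [u.xCov_of_mem hL] at hx
    split_ifs at hx with hs
    · exact absurd hx.symm (OnePoint.coe_ne_infty _)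
    · rw [← OnePoint.coe_injective hx]
      have := habs s⁻¹ (by rw [mul_inv_cancel₀ hs])
      rwa [Complex.ofReal_inv] at this
  obtain ⟨v, hv, hv3⟩ : ∃ v : ℝ, L.weierstrassP ω = v ∧ v ≤ e₃ L := by
    have hA := hr.posA
    set m := ⌊ω.im / A⌋ with hm
    have hf1 : (m : ℝ) * A ≤ ω.im := (le_div_iff₀ hA).mp (Int.floor_le _)
    have hf2 : ω.im < (m + 1) * A := (div_lt_iff₀ hA).mp (Int.lt_floor_add_one _)
    have hnm : (n : ℂ) * L.ω₂ + m * L.ω₁ ∈ L.lattice := by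
      have h1 := L.lattice.smul_mem n L.ω₂_mem_lattice
      have h2 := L.lattice.smul_mem m L.ω₁_mem_lattice
      rw [zsmul_eq_mul] at h1 h2
      exact add_mem h1 h2
    have hω' : ω = (0 + ((ω.im - m * A : ℝ) : ℂ) * Complex.I) + (n * L.ω₂ + m * L.ω₁) := by
      rw [hr.per₂, hr.per₁]
      apply Complex.ext <;> simp [hω]
    have hm0 : 0 < ω.im - m * A := by
      rcases hf1.lt_or_eq with h | h
      · linarith
      · exfalso
        apply hL
        rw [hω', ← h]
        simpa using hnm
    exact ⟨lineVal L 0 Complex.I (ω.im - m * A), (congrArg L.weierstrassP hω').trans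
      ((IsRect.wP_add_mem hnm).trans (IsRect.wP_eq_lineVal (hr.real_ver_zero _))),
      hr.ver_zero_le ⟨hm0, by linarith⟩⟩
  obtain ⟨d1, d2, d3⟩ := u.den_e
  rcases lt_trichotomy (h + s * (g - v)) 0 with hd | hd | hd
  · obtain ⟨y, hy, hy1, hy2⟩ := u.xCov_of_real hL hv hd.ne
    rw [hx] at hy
    rw [OnePoint.coe_injective hy]
    have := div_neg_of_pos_of_neg u.h_pos hd
    exact habs y (by linarith)
  · have hdc : (h : ℂ) + s * (g - v) = 0 := by exact_mod_cast hd
    rw [u.xCov_of_notMem hL, hv, if_pos hdc] at hx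
    exact absurd hx.symm (OnePoint.coe_ne_infty _)
  · obtain ⟨y, hy, hy1, hy2⟩ := u.xCov_of_real hL hv hd.ne'
    rw [hx] at hy
    rw [OnePoint.coe_injective hy, Complex.norm_real, Real.norm_eq_abs]
    have h1 : 0 < 1 - s * y := by rw [hy1]; exact div_pos u.h_pos hd
    have hanti := Branch.homog_strictAntiOn (s := s) (g := g) u.h_pos
    have h2 : x₃ S z ≤ y := (hanti.le_iff_ge h1 b.pos₃).mp (by rw [hy2, ← u.e₃_eq]; exact hv3)
    exact (b.lt₃.trans_le h2).trans_le (le_abs_self y)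

/-- On the line `Im ω = |ω₁| / 2` the values of `x` are in `[x₂, x₃]`. -/
theorem xCov_im_half (u : Unif S z L A B g h ν s) (t : ℝ) :
    ∃ x ∈ Set.Icc (x₂ S z) (x₃ S z), xCov S z (L.ω₁ / 2 + t) = ((x : ℂ) : OnePoint ℂ) ∧
      0 < 1 - s * x := by
  have hr := u.rect
  have h1 := hr.notMem_hor_half t
  have h2 := IsRect.wP_eq_lineVal (hr.real_hor_half t)
  have h3 := hr.hor_half_mem t
  obtain ⟨d1, d2, d3⟩ := u.den_e
  have h4 := den_pos_of_mem d3 d2 h3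
  obtain ⟨x, hx, hx1, hx2⟩ := u.xCov_of_real h1 h2 h4.ne'
  have h5 : 0 < 1 - s * x := by rw [hx1]; exact div_pos u.h_pos h4
  rw [mul_one] at hx
  refine ⟨x, u.mem_Icc_of_homog h5 u.branch.pos₂ u.branch.pos₃ ?_, hx, h5⟩
  rw [hx2, ← u.e₂_eq, ← u.e₃_eq]
  exact h3

theorem notMem_im_half (u : Unif S z L A B g h ν s) (t : ℝ) : L.ω₁ / 2 + t ∉ L.lattice := by
  have := u.rect.notMem_hor_half t
  rwa [mul_one] at this

theorem deriv_im_half_aux (u : Unif S z L A B g h ν s) {t : ℝ} {ρ : ℝ}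
    (hρ : L.derivWeierstrassP (L.ω₁ / 2 + t) = ρ) :
    ∃ κ : ℝ, 0 < κ ∧ deriv (xVal S z) (L.ω₁ / 2 + t) = (-(κ * ρ) : ℝ) := by
  obtain ⟨x, -, hx, h5⟩ := u.xCov_im_half t
  have hne : xCov S z (L.ω₁ / 2 + t) ≠ OnePoint.infty := by rw [hx]; exact OnePoint.coe_ne_infty _
  refine ⟨(1 - s * x) ^ 2 / h, div_pos (pow_pos h5 2) u.h_pos, ?_⟩
  rw [(u.hasDerivAt_xVal (u.notMem_im_half t) hne).deriv, xVal_eq_of_coe hx, hρ]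
  push_cast
  ring

theorem deriv_im_half_neg (u : Unif S z L A B g h ν s) {t : ℝ} (ht : t ∈ Set.Ioo 0 (B / 2)) :
    ∃ ρ : ℝ, ρ < 0 ∧ deriv (xVal S z) (L.ω₁ / 2 + t) = ρ := by
  obtain ⟨ρ, h1, h2⟩ := u.rect.deriv_hor_half_pos ht
  obtain ⟨κ, h3, h4⟩ := u.deriv_im_half_aux h2
  exact ⟨_, neg_neg_of_pos (mul_pos h3 h1), h4⟩

theorem deriv_im_half_pos (u : Unif S z L A B g h ν s) {t : ℝ} (ht : t ∈ Set.Ioo (B / 2) B) :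
    ∃ ρ : ℝ, 0 < ρ ∧ deriv (xVal S z) (L.ω₁ / 2 + t) = ρ := by
  obtain ⟨ρ, h1, h2⟩ := u.rect.deriv_hor_half_neg ht
  obtain ⟨κ, h3, h4⟩ := u.deriv_im_half_aux h2
  exact ⟨_, by nlinarith, h4⟩

theorem xCov_half (u : Unif S z L A B g h ν s) {ω : ℂ} (hω : ω ∉ L.lattice) {t : ℝ}
    (ht : 0 < 1 - s * t) (hv : L.weierstrassP ω = (Branch.homog g h s t : ℝ)) :
    xCov S z ω = ((t : ℂ) : OnePoint ℂ) := by
  have hd : 0 < h + s * (g - Branch.homog g h s t) := by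
    rw [Branch.homog_den ht.ne']; exact div_pos u.h_pos ht
  obtain ⟨x, hx, hx1, hx2⟩ := u.xCov_of_real hω hv hd.ne'
  have h1 : 0 < 1 - s * x := by rw [hx1]; exact div_pos u.h_pos hd
  have hanti := Branch.homog_strictAntiOn (s := s) (g := g) u.h_pos
  rw [hx, hanti.injOn h1 ht hx2]

theorem xCov_half₂ (u : Unif S z L A B g h ν s) :
    xCov S z (L.ω₂ / 2) = ((x₁ S z : ℂ) : OnePoint ℂ) :=
  u.xCov_half L.ω₂_div_two_notMem_lattice u.branch.pos₁ (by rw [u.rect.wP_half₂, u.e₁_eq])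

theorem xCov_half₁₂ (u : Unif S z L A B g h ν s) :
    xCov S z ((L.ω₁ + L.ω₂) / 2) = ((x₂ S z : ℂ) : OnePoint ℂ) :=
  u.xCov_half u.rect.half₁₂_notMem u.branch.pos₂ (by rw [u.rect.wP_half₁₂, u.e₂_eq])

/-- The points with `x(ω)` on the cuts lie on the lines `Re ω ∈ (ω₂ / 2) ℤ`. -/
theorem re_of_mem_cutX (u : Unif S z L A B g h ν s) {ω x : ℂ} (hx : xCov S z ω = (x : OnePoint ℂ))
    (hc : x ∈ cutX S z) : ∃ n : ℤ, ω.re = n * (B / 2) := by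
  have hr := u.rect
  have b := u.branch
  have hB := hr.posB
  -- two points with the same value of `x` have real parts that agree up to sign and periods
  have key : ∀ ω' : ℂ, xCov S z ω' = x → (∃ n : ℤ, ω'.re = n * (B / 2)) →
      ∃ n : ℤ, ω.re = n * (B / 2) := by
    rintro ω' h1 ⟨n, hn⟩
    rcases (u.xCov_eq_iff ω ω').mp (by rw [hx, h1]) with h | h
    · obtain ⟨⟨m, hm⟩, -⟩ := (hr.mem_iff _).mp h
      refine ⟨2 * m + n, ?_⟩
      rw [Complex.sub_re] at hm
      push_cast
      linarith
    · obtain ⟨⟨m, hm⟩, -⟩ := (hr.mem_iff _).mp h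
      refine ⟨2 * m - n, ?_⟩
      rw [Complex.add_re] at hm
      push_cast
      linarith
  have hanti := Branch.homog_strictAntiOn (s := s) (g := g) u.h_pos
  obtain ⟨t, ht, rfl⟩ := hc
  -- outside of `[x₁, x₂]` the cut is the image of the line `Re ω = 0`, where `℘ ≤ e₃`: the point
  -- `t = 1 / s` corresponds to the pole of `℘`, and beyond it the homography has a negative denominator
  have outer : (x₃ S z ≤ t ∧ 0 < 1 - s * t) ∨ 1 - s * t = 0 ∨ (t < x₃ S z ∧ 1 - s * t < 0) →
      ∃ n : ℤ, ω.re = n * (B / 2) := by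
    rintro (⟨h1, h2⟩ | h1 | ⟨h1, h2⟩)
    · obtain ⟨y, hy, hv⟩ := hr.exists_ver_zero (v := Branch.homog g h s t)
        (by rw [u.e₃_eq]; exact (hanti.le_iff_ge h2 b.pos₃).mpr h1)
      refine key (0 + y * Complex.I) (u.xCov_half (hr.notMem_ver_zero ⟨hy.1, by
        linarith [hy.2, hr.posA]⟩) h2 ?_) ⟨0, by simp⟩
      rw [IsRect.wP_eq_lineVal (hr.real_ver_zero y), hv]
    · have hs : s ≠ 0 := by rintro rfl; simp at h1
      refine key 0 ?_ ⟨0, by simp⟩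
      rw [u.xCov_of_mem (zero_mem _), if_neg hs, ← Complex.ofReal_inv,
        inv_eq_of_mul_eq_one_right (show s * t = 1 by linarith)]
    · have hv : Branch.homog g h s t ≤ e₃ L := by
        have := Branch.homog_sub (g := g) (h := h) (s := s) (x := t) (y := x₃ S z) h2.ne b.pos₃.ne'
        have h3 : h * (x₃ S z - t) / ((1 - s * t) * (1 - s * x₃ S z)) ≤ 0 :=
          div_nonpos_of_nonneg_of_nonpos (mul_nonneg u.h_pos.le (by linarith))
            (mul_nonpos_of_nonpos_of_nonneg h2.le b.pos₃.le)
        rw [u.e₃_eq]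
        linarith
      obtain ⟨y, hy, hv⟩ := hr.exists_ver_zero hv
      refine key (0 + y * Complex.I) ?_ ⟨0, by simp⟩
      have hyL : (0 : ℂ) + y * Complex.I ∉ L.lattice :=
        hr.notMem_ver_zero ⟨hy.1, by linarith [hy.2, hr.posA]⟩
      have hd := Branch.homog_den (g := g) (h := h) (s := s) h2.ne
      have hd0 : h + s * (g - Branch.homog g h s t) ≠ 0 := by
        rw [hd]; exact div_ne_zero u.h_pos.ne' h2.ne
      obtain ⟨x, k1, k2, -⟩ := u.xCov_of_real hyL (v := Branch.homog g h s t)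
        (by rw [IsRect.wP_eq_lineVal (hr.real_ver_zero y), hv]) hd0
      rw [k1]
      rw [hd, div_div_cancel₀ u.h_pos.ne'] at k2
      have hs : s ≠ 0 := by rintro rfl; norm_num at h2
      have k3 : s * x = s * t := by linarith
      rw [mul_left_cancel₀ hs k3]
  rcases ht with ht | ht
  · have p : 0 < 1 - s * t := Branch.one_sub_pos_of_mem b.s_lt b.lt_s (b.lt₁.trans_le ht.1).le
      (ht.2.trans_lt b.lt₂).le
    have hv : Branch.homog g h s t ∈ Set.Icc (e₂ L) (e₁ L) := by
      rw [u.e₁_eq, u.e₂_eq]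
      exact ⟨(hanti.le_iff_ge b.pos₂ p).mpr ht.2, (hanti.le_iff_ge p b.pos₁).mpr ht.1⟩
    -- on the line `Re ω = ω₂ / 2` the function `℘` takes all values in `[e₂, e₁]`
    have hcont : ContinuousOn (lineVal L (L.ω₂ / 2) Complex.I) (Set.Icc 0 (A / 2)) :=
      IsRect.line_continuousOn fun y _ => hr.notMem_ver_half y
    have himg := intermediate_value_Icc' (by linarith [hr.posA]) hcont
    rw [hr.lineVal_ver_half_half, IsRect.lineVal_ver_half_zero] at himg
    obtain ⟨y, -, hy⟩ := himg hv
    refine key (L.ω₂ / 2 + y * Complex.I) (u.xCov_half (hr.notMem_ver_half y) p ?_)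
      ⟨1, by simp [hr.per₂]⟩
    rw [IsRect.wP_eq_lineVal (hr.real_ver_half y), hy]
  · apply outer
    by_cases hs : s = 0
    · rw [x₄_of_eq_zero b hs] at ht
      exact Or.inl ⟨ht, by simp [hs]⟩
    · rw [x₄_of_ne_zero b hs] at ht
      simp only at ht
      have h3 := b.lt₃
      rcases lt_or_gt_of_ne hs with hs' | hs'
      · rw [if_pos (inv_lt_zero.mpr hs')] at ht
        rcases ht with ht | ht
        · have ht' : x₃ S z ≤ t := ht
          exact Or.inl ⟨ht', by nlinarith⟩
        · have ht' : t ≤ s⁻¹ := ht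
          have h4 : t * s ≥ 1 := by
            have := mul_le_mul_of_nonpos_right ht' hs'.le
            rwa [inv_mul_cancel₀ hs] at this
          rcases h4.lt_or_eq with h5 | h5
          · exact Or.inr (Or.inr ⟨by linarith [inv_lt_zero.mpr hs'], by linarith⟩)
          · exact Or.inr (Or.inl (by linarith))
      · rw [if_neg (not_lt.mpr (inv_pos.mpr hs').le)] at ht
        have h4 : t * s ≤ 1 := by
          have := mul_le_mul_of_nonneg_right ht.2 hs'.le
          rwa [inv_mul_cancel₀ hs] at this
        rcases h4.lt_or_eq with h5 | h5
        · exact Or.inl ⟨ht.1, by linarith⟩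
        · exact Or.inr (Or.inl (by linarith))

end Unif

/-! ### The shift `ω₃` -/

theorem eval_swap {S : Finset (ℤ × ℤ)} (hS : IsSmallStepSet S) (z x y : ℝ) :
    (aPoly S z).eval x * y ^ 2 + (bPoly S z).eval x * y + (cPoly S z).eval x =
      (aPoly (transpose S) z).eval y * x ^ 2 + (bPoly (transpose S) z).eval y * x +
        (cPoly (transpose S) z).eval y := by
  rw [aPoly_eval z hS, bPoly_eval z hS, cPoly_eval z hS, aPoly_eval z hS.transpose,
    bPoly_eval z hS.transpose, cPoly_eval z hS.transpose]
  simp only [wt_transpose]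
  ring

namespace Unif

variable {S : Finset (ℤ × ℤ)} {z : ℝ} {L : PeriodPair} {A B g h ν s g' h' ν' s' : ℝ}

theorem integral_of_image (u : Unif S z L A B g h ν s) {U V : Set ℝ} (hU : MeasurableSet U)
    (hpos : ∀ x ∈ U, 0 < 1 - s * x) (hV : Branch.homog g h s '' U = V) :
    ∫ x in U, 1 / √((disc S z).eval x) = ∫ v in V, 1 / √(cubic L v) := by
  have := u.branch.integral_homog g 1 hU hpos
  rw [← u.slope_eq, hV] at this
  simp only [one_mul] at this
  rw [← this]
  simp only [cubic, u.e₁_eq, u.e₂_eq, u.e₃_eq]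

/-- The integral of `1 / √d` up to the point with `1 - s x = 0`, which corresponds to the pole of `℘`,
is the full period `ω₂`. -/
theorem integral_to_pole (u : Unif S z L A B g h ν s) {U : Set ℝ} (hU : MeasurableSet U)
    (hs : s ≤ 0) (hmem : ∀ x, x ∈ U ↔ x < x₁ S z ∧ 0 < 1 - s * x) :
    ∫ x in U, 1 / √((disc S z).eval x) = B := by
  have hanti := Branch.homog_strictAntiOn (s := s) (g := g) u.h_pos
  have b := u.branch
  rw [u.integral_of_image hU (fun x hx => ((hmem x).mp hx).2) (V := Set.Ioi (e₁ L)),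
    u.rect.integral_Ioi]
  refine Branch.image_homog u.h_pos (fun x hx => ((hmem x).mp hx).2) ?_ ?_
  · intro v hv
    have h1 := u.den_e.1
    have h2 : e₁ L < v := hv
    nlinarith
  · intro x hx
    rw [hmem, Set.mem_Ioi, u.e₁_eq, hanti.lt_iff_gt b.pos₁ hx]
    exact and_iff_left hx

/-- `ω₃ = ω₂ - 2 t₀`, where `t₀ ∈ ]0, ω₂ / 2[` is the point with `x(t₀) = X(y₁)`. -/
theorem exists_ω₃ (u : Unif S z L A B g h ν s) (u' : Unif (transpose S) z L A B g' h' ν' s')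
    (hirr : Irrational (ω₂ S z / ω₃ S z)) :
    ∃ t₀ ∈ Set.Ioo 0 (B / 2), ω₃ S z = B - 2 * t₀ ∧
      xCov S z (t₀ : ℂ) = if (aPoly (transpose S) z).eval (y₁ S z) = 0 then OnePoint.infty else
        (((-(bPoly (transpose S) z).eval (y₁ S z) /
          (2 * (aPoly (transpose S) z).eval (y₁ S z)) : ℝ) : ℂ) : OnePoint ℂ) := by
  have hr := u.rect
  have b := u.branch
  have hB := hr.posB
  have hanti := Branch.homog_strictAntiOn (s := s) (g := g) u.h_pos
  -- the irrationality excludes the degenerate values `ω₃ = 0`, which is also the value of the integral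
  -- over an empty interval, and `ω₃ = ω₂`
  have hne0 : ω₃ S z ≠ 0 := by
    intro h0
    rw [h0, div_zero] at hirr
    exact not_irrational_zero hirr
  have hneB : ω₃ S z ≠ B := by
    intro h0
    rw [h0, u.per₂, div_self hB.ne'] at hirr
    exact not_irrational_one hirr
  have hd0 : (disc (transpose S) z).eval (y₁ S z) = 0 := by
    rw [u'.branch.eval_eq]
    simp [y₁]
  rw [disc_eval'] at hd0
  by_cases ha : (aPoly (transpose S) z).eval (y₁ S z) = 0
  · rw [if_pos ha]
    have hω : ω₃ S z = ∫ x in Set.Iio (x₁ S z), 1 / √((disc S z).eval x) := by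
      rw [ω₃, period₃Interval, if_pos ha]
    obtain ⟨-, -, -, -, c4⟩ := b.coeff_eq (disc_eval u.model.small z)
    -- if `ã(y₁) = 0`, then the leading coefficient of `d` is a square
    have hs : 0 ≤ s := by
      have h1 : dC S z 4 = (2 * wt S z 1 1 * y₁ S z + wt S z 1 0) ^ 2 := by
        rw [aPoly_eval z u.model.small.transpose] at ha
        simp only [wt_transpose] at ha
        simp only [dC]
        linear_combination (-4 * wt S z 1 1) * ha
      have h2 : 0 ≤ ν * s := by rw [← c4, h1]; positivity
      exact nonneg_of_mul_nonneg_right h2 b.pos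
    rcases hs.eq_or_lt with hs | hs
    · exfalso
      apply hneB
      rw [hω]
      refine u.integral_to_pole measurableSet_Iio hs.symm.le fun x => ?_
      rw [← hs, zero_mul, sub_zero]
      simp
    · have hpos : ∀ x ∈ Set.Iio (x₁ S z), 0 < 1 - s * x := by
        intro x hx
        have h1 : x < x₁ S z := hx
        nlinarith [b.pos₁]
      have h1 : e₁ L < g + h / s := by
        have h2 := u.den_e.1
        have : 0 < (h + s * (g - e₁ L)) / s := div_pos h2 hs
        rw [add_div, mul_div_cancel_left₀ _ hs.ne'] at this
        linarith
      have himg : Branch.homog g h s '' Set.Iio (x₁ S z) = Set.Ioo (e₁ L) (g + h / s) := by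
        refine Branch.image_homog u.h_pos hpos ?_ ?_
        · intro v hv
          have h3 : s * v < s * (g + h / s) := mul_lt_mul_of_pos_left hv.2 hs
          rw [mul_add, mul_div_cancel₀ _ hs.ne'] at h3
          linarith
        · intro x hx
          rw [Set.mem_Iio, Set.mem_Ioo, u.e₁_eq, hanti.lt_iff_gt b.pos₁ hx]
          refine (and_iff_left ?_).symm
          have h4 := Branch.homog_den (g := g) (h := h) hx.ne'
          have h5 := div_pos u.h_pos hx
          rw [← h4] at h5
          have h6 : 0 < (h + s * (g - Branch.homog g h s x)) / s := div_pos h5 hs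
          rw [add_div, mul_div_cancel_left₀ _ hs.ne'] at h6
          linarith
      obtain ⟨t₀, ht₀, k1, k2⟩ := hr.integral_Ioo h1
      refine ⟨t₀, ht₀, by rw [hω, u.integral_of_image measurableSet_Iio hpos himg, k2], ?_⟩
      have hL : (t₀ : ℂ) ∉ L.lattice := hr.notMem_of_re_between (by simpa using ht₀.1)
        (by rw [Complex.ofReal_re]; linarith [ht₀.2])
      rw [u.xCov_of_notMem hL, k1, if_pos]
      have hsc : (s : ℂ) ≠ 0 := by exact_mod_cast hs.ne'
      push_cast
      field_simp
      ring
  · rw [if_neg ha]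
    set X₀ := -(bPoly (transpose S) z).eval (y₁ S z) /
      (2 * (aPoly (transpose S) z).eval (y₁ S z)) with hX₀
    have hω : ω₃ S z = ∫ x in Set.Ioo X₀ (x₁ S z), 1 / √((disc S z).eval x) := by
      rw [ω₃, period₃Interval, if_neg ha]
    have hlt : X₀ < x₁ S z := by
      by_contra hc
      rw [Set.Ioo_eq_empty hc, MeasureTheory.setIntegral_empty] at hω
      exact hne0 hω
    -- `K(X₀, y₁) = 0` for the real point `(X₀, y₁)`, so that `d(X₀)` is a square
    have hdX : 0 ≤ (disc S z).eval X₀ := by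
      have h1 := eval_swap u.model.small z X₀ (y₁ S z)
      have h2 : (aPoly (transpose S) z).eval (y₁ S z) * X₀ ^ 2 +
          (bPoly (transpose S) z).eval (y₁ S z) * X₀ + (cPoly (transpose S) z).eval (y₁ S z) = 0 := by
        rw [hX₀]
        field_simp
        linear_combination -hd0
      rw [h2] at h1
      have h3 : (disc S z).eval X₀ =
          (2 * (aPoly S z).eval X₀ * y₁ S z + (bPoly S z).eval X₀) ^ 2 := by
        rw [disc_eval']
        linear_combination (-4 * (aPoly S z).eval X₀) * h1
      rw [h3]
      positivity
    have hden : 0 ≤ 1 - s * X₀ := by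
      rw [b.eval_eq] at hdX
      have h12 := b.lt₁₂
      have h23 := b.lt₂.trans b.lt₃
      have h1 : 0 < ν * ((X₀ - x₁ S z) * (X₀ - x₂ S z) * (x₃ S z - X₀)) :=
        mul_pos b.pos (mul_pos (mul_pos_of_neg_of_neg (by linarith) (by linarith)) (by linarith))
      have h2 : ν * ((X₀ - x₁ S z) * (X₀ - x₂ S z) * (x₃ S z - X₀) * (1 - s * X₀)) =
        ν * ((X₀ - x₁ S z) * (X₀ - x₂ S z) * (x₃ S z - X₀)) * (1 - s * X₀) := by ring
      rw [h2] at hdX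
      exact nonneg_of_mul_nonneg_right hdX h1
    rcases hden.eq_or_lt with hden | hden
    · exfalso
      have h1 : s * X₀ = 1 := by linarith
      have hx1 : x₁ S z < 1 := b.lt₁₂.trans b.lt₂
      have hs : s < 0 := by
        by_contra hs
        nlinarith [b.s_lt, b.pos₁]
      apply hneB
      rw [hω]
      refine u.integral_to_pole measurableSet_Ioo hs.le fun x => ?_
      rw [Set.mem_Ioo, and_comm]
      refine and_congr_right fun _ => ⟨fun h => ?_, fun h => ?_⟩
      · nlinarith
      · by_contra hc
        nlinarith
    · have hpos : ∀ x ∈ Set.Ioo X₀ (x₁ S z), 0 < 1 - s * x := by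
        intro x hx
        have := b.pos₁
        rcases le_total 0 s with h | h <;> nlinarith [hx.1, hx.2]
      have h1 : e₁ L < Branch.homog g h s X₀ := by
        rw [u.e₁_eq]
        exact hanti hden b.pos₁ hlt
      have himg := Branch.image_homog_Ioo (g := g) u.h_pos hden b.pos₁
      rw [← u.e₁_eq] at himg
      obtain ⟨t₀, ht₀, k1, k2⟩ := hr.integral_Ioo h1
      refine ⟨t₀, ht₀, by rw [hω, u.integral_of_image measurableSet_Ioo hpos himg, k2], ?_⟩
      have hL : (t₀ : ℂ) ∉ L.lattice := hr.notMem_of_re_between (by simpa using ht₀.1)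
        (by rw [Complex.ofReal_re]; linarith [ht₀.2])
      exact u.xCov_half hL hden k1

end Unif

/-! ### The parametrization of the curve `K(x, y) = 0` -/

theorem aF_eq_eval {S : Finset (ℤ × ℤ)} (hS : IsSmallStepSet S) (z : ℝ) (x : ℂ) :
    aF S z x = ((aPoly S z).map Complex.ofRealHom).eval x := by
  simp [aPoly, rowPoly_eq hS, aF]

theorem dF_eq_eval {S : Finset (ℤ × ℤ)} (hS : IsSmallStepSet S) (z : ℝ) (x : ℂ) :
    dF S z x = ((disc S z).map Complex.ofRealHom).eval x := by
  simp [disc_eq hS, dF]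

theorem im_eq_zero_of_sq {w : ℂ} {r : ℝ} (hr : 0 < r) (h : w ^ 2 = r) : w.im = 0 := by
  have h1 := congrArg Complex.re h
  have h2 := congrArg Complex.im h
  simp [sq] at h1 h2
  by_contra hc
  have h3 : w.re = 0 := by
    have : w.re * w.im = 0 := by linarith
    exact (mul_eq_zero.mp this).resolve_right hc
  rw [h3] at h1
  nlinarith [mul_self_nonneg w.im]

theorem im_ne_zero_of_sq {w : ℂ} {r : ℝ} (hr : r < 0) (h : w ^ 2 = r) : w.im ≠ 0 := by
  have h1 := congrArg Complex.re h
  simp [sq] at h1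
  intro hc
  rw [hc] at h1
  nlinarith [mul_self_nonneg w.re]

/-- The polynomial `a(x) Y ^ 2 + b(x) Y + c(x)` for fixed `x`. -/
noncomputable def fiberPoly (S : Finset (ℤ × ℤ)) (z : ℝ) (x : ℂ) : ℂ[X] :=
  C (aF S z x) * X ^ 2 + C (bF S z x) * X + C (cF S z x)

theorem fiberPoly_eval {S : Finset (ℤ × ℤ)} (hS : IsSmallStepSet S) (z : ℝ) (x y : ℂ) :
    (fiberPoly S z x).eval y = K S z x y := by
  simp [fiberPoly, K_eq z hS]

theorem sq_of_K_eq_zero {S : Finset (ℤ × ℤ)} (hS : IsSmallStepSet S) {z : ℝ} {x y : ℂ}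
    (h : K S z x y = 0) : (2 * aF S z x * y + bF S z x) ^ 2 = dF S z x := by
  rw [K_eq z hS] at h
  rw [dF_eq]
  linear_combination 4 * aF S z x * h

theorem Model.aPoly_pos {S : Finset (ℤ × ℤ)} {z : ℝ} (hm : Model S z) {x : ℝ} (hx : 0 < x) :
    0 < (aPoly S z).eval x := by
  rw [aPoly_eval z hm.small]
  have h1 := hm.sum_up_pos
  have h2 := hm.wt_nonneg (-1) 1
  have h3 := hm.wt_nonneg 0 1
  have h4 := hm.wt_nonneg 1 1
  by_contra hc
  have k3 : 0 ≤ wt S z 0 1 * x := mul_nonneg h3 hx.le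
  have k4 : 0 ≤ wt S z 1 1 * x ^ 2 := mul_nonneg h4 (sq_nonneg x)
  have e2 : wt S z (-1) 1 = 0 := by linarith
  have e3 : wt S z 0 1 * x = 0 := by linarith
  have e4 : wt S z 1 1 * x ^ 2 = 0 := by linarith
  have e3' := (mul_eq_zero.mp e3).resolve_right hx.ne'
  have e4' := (mul_eq_zero.mp e4).resolve_right (pow_ne_zero 2 hx.ne')
  linarith

/-- No horizontal line is contained in the curve: for a real `p` with `d(p) < 0` the equation
`K(p, y) = 0` has no real solutions, and `K(1, y) = 0` has only real solutions. -/
theorem fiberPoly_ne_zero {S : Finset (ℤ × ℤ)} {z : ℝ} (hm : Model S z) (y : ℂ) :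
    fiberPoly (transpose S) z y ≠ 0 := by
  intro h0
  have hK : ∀ x, K S z x y = 0 := by
    intro x
    rw [← K_transpose z hm.small, ← fiberPoly_eval hm.small.transpose, h0, eval_zero]
  obtain ⟨p, -, hp⟩ := hm.exists_disc_neg_inside
  have key : ∀ x : ℝ, (2 * aF S z x * y + bF S z x).im = 2 * (aPoly S z).eval x * y.im := by
    intro x
    rw [aF_ofReal z hm.small, bF_ofReal z hm.small]
    simp
  have h1 := im_eq_zero_of_sq hm.disc_one_pos
    (by rw [← dF_ofReal hm.small]; exact sq_of_K_eq_zero hm.small (hK _))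
  have h2 := im_ne_zero_of_sq hp
    (by rw [← dF_ofReal hm.small]; exact sq_of_K_eq_zero hm.small (hK _))
  rw [key] at h1 h2
  have h3 := hm.aPoly_pos one_pos
  have h4 : y.im = 0 := (mul_eq_zero.mp h1).resolve_left (by positivity)
  rw [h4, mul_zero] at h2
  exact h2 rfl

theorem disc_map_ne_zero {S : Finset (ℤ × ℤ)} {z : ℝ} (hm : Model S z) :
    (disc S z).map Complex.ofRealHom ≠ 0 := by
  intro h0
  have h1 := dF_eq_eval hm.small z ((1 : ℝ) : ℂ)
  rw [h0, eval_zero, dF_ofReal hm.small] at h1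
  exact hm.disc_one_pos.ne' (by exact_mod_cast h1)

theorem aPoly_map_ne_zero {S : Finset (ℤ × ℤ)} {z : ℝ} (hm : Model S z) :
    (aPoly S z).map Complex.ofRealHom ≠ 0 := by
  intro h0
  have h1 := aF_eq_eval hm.small z ((1 : ℝ) : ℂ)
  rw [h0, eval_zero, aF_ofReal z hm.small] at h1
  exact (hm.aPoly_pos one_pos).ne' (by exact_mod_cast h1)

/-- Half the second derivative of a solution of `f' ^ 2 = 4 d(f)` as a function of `f`. -/
theorem deriv_deriv_of_sq {S : Finset (ℤ × ℤ)} {z : ℝ} {f : ℂ → ℂ} {a : ℂ} (hf : AnalyticAt ℂ f a)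
    (h : ∀ᶠ v in 𝓝 a, deriv f v ^ 2 = 4 * dF S z (f v)) (hne : deriv f a ≠ 0) :
    ∀ᶠ v in 𝓝 a, deriv (deriv f) v = 2 * (dC S z 1 + 2 * dC S z 2 * f v + 3 * dC S z 3 * f v ^ 2 +
      4 * dC S z 4 * f v ^ 3) := by
  filter_upwards [h.eventually_nhds, hf.eventually_analyticAt,
    hf.deriv.continuousAt.eventually_ne hne] with v h1 h2 h3
  have d1 := h2.differentiableAt.hasDerivAt
  have d2 := h2.deriv.differentiableAt.hasDerivAt
  have e1 := d2.pow 2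
  have e2 : HasDerivAt (fun v => 4 * dF S z (f v)) (4 * (dC S z 1 + 2 * dC S z 2 * f v +
      3 * dC S z 3 * f v ^ 2 + 4 * dC S z 4 * f v ^ 3) * deriv f v) v := by
    unfold dF
    refine ((((((d1.const_mul (dC S z 1 : ℂ)).const_add (dC S z 0 : ℂ)).add
      ((d1.pow 2).const_mul (dC S z 2 : ℂ))).add ((d1.pow 3).const_mul (dC S z 3 : ℂ))).add
      ((d1.pow 4).const_mul (dC S z 4 : ℂ))).const_mul 4).congr_deriv ?_
    push_cast
    ring
  have e3 := e1.unique (e2.congr_of_eventuallyEq h1)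
  apply mul_right_cancel₀ h3
  push_cast at e3
  linear_combination e3 / 2

theorem hasDerivAt_K {S : Finset (ℤ × ℤ)} (hS : IsSmallStepSet S) {z : ℝ} {f g : ℂ → ℂ}
    {f' g' ω : ℂ} (hf : HasDerivAt f f' ω) (hg : HasDerivAt g g' ω) :
    HasDerivAt (fun v => K S z (f v) (g v))
      ((2 * aF (transpose S) z (g ω) * f ω + bF (transpose S) z (g ω)) * f' +
        (2 * aF S z (f ω) * g ω + bF S z (f ω)) * g') ω := by
  simp only [K_eq z hS, aF, bF, cF, wt_transpose]
  have p2 := hf.pow 2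
  have q2 := hg.pow 2
  have da := ((hf.const_mul (wt S z 0 1 : ℂ)).const_add (wt S z (-1) 1 : ℂ)).add
    (p2.const_mul (wt S z 1 1 : ℂ))
  have db := ((hf.const_sub (wt S z (-1) 0 : ℂ))).add (p2.const_mul (wt S z 1 0 : ℂ))
  have dc := ((hf.const_mul (wt S z 0 (-1) : ℂ)).const_add (wt S z (-1) (-1) : ℂ)).add
    (p2.const_mul (wt S z 1 (-1) : ℂ))
  refine (((da.mul q2).add (db.mul hg)).add dc).congr_deriv ?_
  simp only [Pi.add_apply, Pi.pow_apply]
  push_cast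
  ring

/-- The solution `y` of `K(x, y) = 0` along the curve `x = x(ω)`. -/
noncomputable def yLift (S : Finset (ℤ × ℤ)) (z : ℝ) (ω : ℂ) : ℂ :=
  (-bF S z (xVal S z ω) + deriv (xVal S z) ω / 2) / (2 * aF S z (xVal S z ω))

namespace Unif

variable {S : Finset (ℤ × ℤ)} {z : ℝ} {L : PeriodPair} {A B g h ν s g' h' ν' s' : ℝ}

theorem meromorphic_aF (u : Unif S z L A B g h ν s) : Meromorphic fun ω => aF S z (xVal S z ω) := by
  have hx := u.xVal_meromorphic
  have hc : ∀ c : ℂ, Meromorphic fun _ : ℂ => c := fun c ω => MeromorphicAt.const c ω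
  exact ((hc _).add ((hc _).mul hx)).add ((hc _).mul (hx.pow (n := 2)))

theorem yLift_meromorphic (u : Unif S z L A B g h ν s) : Meromorphic (yLift S z) := by
  have hx := u.xVal_meromorphic
  have hc : ∀ c : ℂ, Meromorphic fun _ : ℂ => c := fun c ω => MeromorphicAt.const c ω
  have hb : Meromorphic fun ω => bF S z (xVal S z ω) :=
    ((hc _).sub hx).add ((hc _).mul (hx.pow (n := 2)))
  have hd : Meromorphic (deriv (xVal S z)) := hx.deriv
  exact (hb.neg.add (hd.div (hc 2))).div ((hc 2).mul u.meromorphic_aF)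

theorem K_yLift (u : Unif S z L A B g h ν s) {ω : ℂ} (hx : xCov S z ω ≠ OnePoint.infty)
    (ha : aF S z (xVal S z ω) ≠ 0) : K S z (xVal S z ω) (yLift S z ω) = 0 := by
  have h1 := u.sq_deriv hx
  rw [dF_eq] at h1
  rw [K_eq z u.model.small, yLift]
  field_simp
  linear_combination h1

theorem two_mul_yLift {S : Finset (ℤ × ℤ)} {z : ℝ} {ω : ℂ} (ha : aF S z (xVal S z ω) ≠ 0) :
    2 * aF S z (xVal S z ω) * yLift S z ω + bF S z (xVal S z ω) = deriv (xVal S z) ω / 2 := by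
  rw [yLift]
  field_simp
  ring

theorem eventually_aF_ne (u : Unif S z L A B g h ν s) (ω : ℂ) :
    ∀ᶠ v in 𝓝[≠] ω, aF S z (xVal S z v) ≠ 0 := by
  filter_upwards [u.eventually_eval_ne_zero (aPoly_map_ne_zero u.model) ω] with v hv
  rwa [aF_eq_eval u.model.small]

theorem eventually_yLift_ne (u : Unif S z L A B g h ν s) (c ω : ℂ) :
    ∀ᶠ v in 𝓝[≠] ω, yLift S z v ≠ c := by
  by_contra hc
  have h1 : ∃ᶠ v in 𝓝[≠] ω, yLift S z v = (fun _ => c) v := hc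
  have h2 := eventuallyEq_of_frequently u.yLift_meromorphic (fun v => MeromorphicAt.const c v) h1 ω
  obtain ⟨v, h3, h4, h5, h6⟩ := (h2.and ((u.eventually_ne_infty ω).and ((u.eventually_aF_ne ω).and
    (u.eventually_eval_ne_zero (fiberPoly_ne_zero u.model c) ω)))).exists
  apply h6
  have := u.K_yLift h4 h5
  rw [h3] at this
  rw [fiberPoly_eval u.model.small.transpose, K_transpose z u.model.small, this]

theorem eventually_dF_yLift_ne (u : Unif S z L A B g h ν s) (ω : ℂ) :
    ∀ᶠ v in 𝓝[≠] ω, dF (transpose S) z (yLift S z v) ≠ 0 := by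
  have hne := disc_map_ne_zero u.model.transpose
  have h2 : ∀ᶠ v in 𝓝[≠] ω, ∀ c ∈ ((disc (transpose S) z).map Complex.ofRealHom).roots.toFinset,
      yLift S z v ≠ c := (Finset.eventually_all _).mpr fun c _ => u.eventually_yLift_ne c ω
  filter_upwards [h2] with v hv h0
  rw [dF_eq_eval u.model.small.transpose] at h0
  exact hv _ (by simpa [hne] using h0) rfl

theorem eventually_dF_ne (u : Unif S z L A B g h ν s) (ω : ℂ) :
    ∀ᶠ v in 𝓝[≠] ω, dF S z (xVal S z v) ≠ 0 := by
  filter_upwards [u.eventually_eval_ne_zero (disc_map_ne_zero u.model) ω] with v hv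
  rwa [dF_eq_eval u.model.small]

/-- Implicit differentiation of `K(x, y) = 0` gives `y' ^ 2 = 4 d̃(y)`. -/
theorem sq_deriv_yLift (u : Unif S z L A B g h ν s) {ω : ℂ} (hx : xCov S z ω ≠ OnePoint.infty)
    (ha : aF S z (xVal S z ω) ≠ 0) (hd : dF S z (xVal S z ω) ≠ 0)
    (hy : DifferentiableAt ℂ (yLift S z) ω) :
    deriv (yLift S z) ω ^ 2 = 4 * dF (transpose S) z (yLift S z ω) := by
  have hxd := (u.xVal_analyticAt hx).differentiableAt.hasDerivAt
  have hyd := hy.hasDerivAt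
  have hac : ContinuousAt (fun v => aF S z (xVal S z v)) ω := by
    have hc : Continuous (aF S z) := by unfold aF; fun_prop
    exact hc.continuousAt.comp (u.xVal_analyticAt hx).continuousAt
  have h0 : (fun v => K S z (xVal S z v) (yLift S z v)) =ᶠ[𝓝 ω] fun _ => 0 := by
    filter_upwards [u.eventually_ne_infty_nhds hx, hac.eventually_ne ha] with v h1 h2
    exact u.K_yLift h1 h2
  have hx' : deriv (xVal S z) ω ≠ 0 := by
    intro hc
    have := u.sq_deriv hx
    rw [hc] at this
    apply hd
    linear_combination -this / 4
  have dK := hasDerivAt_K u.model.small (z := z) hxd hyd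
  have e1 := dK.unique ((hasDerivAt_const ω (0 : ℂ)).congr_of_eventuallyEq h0)
  rw [two_mul_yLift ha] at e1
  have e2 : deriv (yLift S z) ω =
      -2 * (2 * aF (transpose S) z (yLift S z ω) * xVal S z ω + bF (transpose S) z (yLift S z ω)) := by
    apply mul_left_cancel₀ hx'
    linear_combination 2 * e1
  have hK : K (transpose S) z (yLift S z ω) (xVal S z ω) = 0 := by
    rw [K_transpose z u.model.small]; exact u.K_yLift hx ha
  rw [e2, ← sq_of_K_eq_zero u.model.small.transpose hK]
  ring

theorem deriv_neg (u : Unif S z L A B g h ν s) (q : ℂ) :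
    deriv (xVal S z) (-q) = -deriv (xVal S z) q := by
  have h1 : (fun v => xVal S z (-v)) = xVal S z := funext u.xVal_neg
  have h2 := deriv_comp_neg (xVal S z) q
  rw [h1] at h2
  rw [h2, neg_neg]

/-- Up to a translation, `y` along the curve `x = x(ω)` is the coordinate of the transposed
model. -/
theorem exists_shift (u : Unif S z L A B g h ν s) (u' : Unif (transpose S) z L A B g' h' ν' s') :
    ∃ c, ∀ ω, xCov S z ω ≠ OnePoint.infty → xCov (transpose S) z (ω + c) ≠ OnePoint.infty →
      K S z (xVal S z ω) (xVal (transpose S) z (ω + c)) = 0 := by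
  -- a generic point, at which none of the two discriminants vanishes
  obtain ⟨p, hx, ha, hd, hdy⟩ := ((u.eventually_ne_infty 0).and ((u.eventually_aF_ne 0).and
    ((u.eventually_dF_ne 0).and (u.eventually_dF_yLift_ne 0)))).exists
  have hxa := u.xVal_analyticAt hx
  have haa : AnalyticAt ℂ (fun v => aF S z (xVal S z v)) p := by unfold aF; fun_prop
  have hya : AnalyticAt ℂ (yLift S z) p := by
    have hb : AnalyticAt ℂ (fun v => bF S z (xVal S z v)) p := by unfold bF; fun_prop
    exact (hb.neg.add (hxa.deriv.div analyticAt_const two_ne_zero)).div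
      (analyticAt_const.mul haa) (mul_ne_zero two_ne_zero ha)
  have hsq : ∀ᶠ v in 𝓝 p, deriv (yLift S z) v ^ 2 = 4 * dF (transpose S) z (yLift S z v) := by
    have hdc : ContinuousAt (fun v => dF S z (xVal S z v)) p := by
      have hc : Continuous (dF S z) := by unfold dF; fun_prop
      exact hc.continuousAt.comp hxa.continuousAt
    filter_upwards [u.eventually_ne_infty_nhds hx, haa.continuousAt.eventually_ne ha,
      hdc.eventually_ne hd, hya.eventually_analyticAt] with v h1 h2 h3 h4
    exact u.sq_deriv_yLift h1 h2 h3 h4.differentiableAt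
  -- the sign of the derivative can be adjusted, since the coordinate of the transposed model is even
  obtain ⟨q, hq, hqd⟩ : ∃ q, xCov (transpose S) z q = (yLift S z p : OnePoint ℂ) ∧
      deriv (xVal (transpose S) z) q = deriv (yLift S z) p := by
    obtain ⟨q, hq⟩ := u'.xCov_surjective (yLift S z p)
    have h1 := u'.sq_deriv (ω := q) (by rw [hq]; exact OnePoint.coe_ne_infty _)
    rw [xVal_eq_of_coe hq, ← hsq.self_of_nhds] at h1
    rcases sq_eq_sq_iff_eq_or_eq_neg.mp h1 with h2 | h2
    · exact ⟨q, hq, h2⟩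
    · exact ⟨-q, by rw [u'.xCov_neg, hq], by rw [u'.deriv_neg, h2, neg_neg]⟩
  have hqf : xCov (transpose S) z q ≠ OnePoint.infty := by rw [hq]; exact OnePoint.coe_ne_infty _
  have hyd : deriv (yLift S z) p ≠ 0 := by
    intro hc
    have := hsq.self_of_nhds
    rw [hc] at this
    apply hdy
    linear_combination -this / 4
  set f : ℂ → ℂ := fun v => xVal (transpose S) z (v + (q - p)) with hf
  have hpq : p + (q - p) = q := by ring
  have hfa : AnalyticAt ℂ f p := by
    have h1 : AnalyticAt ℂ (xVal (transpose S) z) (p + (q - p)) := by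
      rw [hpq]; exact u'.xVal_analyticAt hqf
    exact h1.comp (f := fun v => v + (q - p)) (by fun_prop)
  have hfd : ∀ v, deriv f v = deriv (xVal (transpose S) z) (v + (q - p)) := fun v =>
    deriv_comp_add_const _ _ _
  have htend : Tendsto (fun v => v + (q - p)) (𝓝 p) (𝓝 q) := by
    have : Continuous fun v : ℂ => v + (q - p) := by fun_prop
    have h2 := this.tendsto p
    rwa [hpq] at h2
  have hfsq : ∀ᶠ v in 𝓝 p, deriv f v ^ 2 = 4 * dF (transpose S) z (f v) := by
    filter_upwards [htend.eventually (u'.eventually_ne_infty_nhds hqf)] with v hv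
    rw [hfd]
    exact u'.sq_deriv hv
  have hfp : f p = yLift S z p := by rw [hf]; simp only [hpq]; exact xVal_eq_of_coe hq
  have hfdp : deriv f p = deriv (yLift S z) p := by rw [hfd, hpq, hqd]
  -- `u' ^ 2 = 4 d̃(u)` gives `u'' = 2 d̃'(u)`, an equation with polynomial right-hand side
  have d1 := deriv_deriv_of_sq hya hsq hyd
  have d2 := deriv_deriv_of_sq hfa hfsq (by rwa [hfdp])
  have heq : yLift S z =ᶠ[𝓝 p] f := by
    refine eventuallyEq_of_second_order (φ := fun v => 2 * (2 * dC (transpose S) z 2 +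
      3 * dC (transpose S) z 3 * (yLift S z v + f v) + 4 * dC (transpose S) z 4 *
      (yLift S z v ^ 2 + yLift S z v * f v + f v ^ 2))) hya hfa (by fun_prop) hfp.symm hfdp.symm ?_
    filter_upwards [d1, d2] with v h1 h2
    rw [h1, h2]
    ring
  have hfm : Meromorphic f := meromorphic_comp_add u'.xVal_meromorphic _
  -- the identity spreads from `p` to the plane by the identity theorem
  refine ⟨q - p, fun ω h1 h2 => ?_⟩
  have heqω := eventuallyEq_of_meromorphic u.yLift_meromorphic hfm
    (heq.filter_mono nhdsWithin_le_nhds) ω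
  have hK0 : ∀ᶠ v in 𝓝[≠] ω, K S z (xVal S z v) (f v) = 0 := by
    filter_upwards [heqω, u.eventually_ne_infty ω, u.eventually_aF_ne ω] with v k1 k2 k3
    rw [← k1]
    exact u.K_yLift k2 k3
  have hc1 : ContinuousAt (xVal S z) ω := (u.xVal_analyticAt h1).continuousAt
  have hc2 : ContinuousAt f ω := by
    have := (u'.xVal_analyticAt h2).continuousAt
    exact ContinuousAt.comp (f := fun v => v + (q - p)) this (by fun_prop)
  have hc3 : ContinuousAt (fun v => K S z (xVal S z v) (f v)) ω := by
    simp only [K_eq z u.model.small, aF, bF, cF]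
    fun_prop
  exact (tendsto_nhds_unique ((hc3.tendsto.mono_left nhdsWithin_le_nhds).congr' hK0)
    tendsto_const_nhds)

end Unif

/-- The curve `K(x, y) = 0` with its parametrization `x = ξ(ω)`, `y = η(ω - W / 2)` by the
coordinates `ξ, η` of the model and of the transposed model. -/
structure Curve (S : Finset (ℤ × ℤ)) (z : ℝ) (L : PeriodPair) (A B W g h ν s g' h' ν' s' : ℝ) :
    Prop where
  u : Unif S z L A B g h ν s
  u' : Unif (transpose S) z L A B g' h' ν' s'
  W_pos : 0 < W
  W_lt : W < B
  K_eq_zero : ∀ ω, xCov S z ω ≠ OnePoint.infty →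
    xCov (transpose S) z (ω - W / 2) ≠ OnePoint.infty →
      K S z (xVal S z ω) (xVal (transpose S) z (ω - W / 2)) = 0

namespace Unif

variable {S : Finset (ℤ × ℤ)} {z : ℝ} {L : PeriodPair} {A B g h ν s g' h' ν' s' : ℝ}

/-- At a pole of `x` the leading coefficient of `x ↦ K(x, y)` vanishes. -/
theorem K_infty (u : Unif S z L A B g h ν s) (u' : Unif (transpose S) z L A B g' h' ν' s') {c q : ℂ}
    (hK : ∀ ω, xCov S z ω ≠ OnePoint.infty → xCov (transpose S) z (ω + c) ≠ OnePoint.infty →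
      K S z (xVal S z ω) (xVal (transpose S) z (ω + c)) = 0)
    (hq : xCov S z q = OnePoint.infty) (hqc : xCov (transpose S) z (q + c) ≠ OnePoint.infty) :
    aF (transpose S) z (xVal (transpose S) z (q + c)) = 0 := by
  have hpole := u.isPole_xVal hq
  have h1 : Tendsto (fun v => (xVal S z v)⁻¹) (𝓝[≠] q) (𝓝 0) := tendsto_inv₀_cobounded.comp hpole
  have h2 : ContinuousAt (fun v => xVal (transpose S) z (v + c)) q :=
    ContinuousAt.comp (f := fun v => v + c) (u'.xVal_analyticAt hqc).continuousAt (by fun_prop)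
  have h3 : Tendsto (fun v => xVal (transpose S) z (v + c)) (𝓝[≠] q)
      (𝓝 (xVal (transpose S) z (q + c))) := h2.tendsto.mono_left nhdsWithin_le_nhds
  have ca : Continuous (aF (transpose S) z) := by unfold aF; fun_prop
  have cb : Continuous (bF (transpose S) z) := by unfold bF; fun_prop
  have cc : Continuous (cF (transpose S) z) := by unfold cF; fun_prop
  have h4 := (((ca.tendsto _).comp h3).add (((cb.tendsto _).comp h3).mul h1)).add
    (((cc.tendsto _).comp h3).mul (h1.pow 2))
  rw [mul_zero, add_zero, zero_pow two_ne_zero, mul_zero, add_zero] at h4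
  refine tendsto_nhds_unique h4 ((tendsto_const_nhds (x := (0 : ℂ))).congr' ?_)
  have h5 : ∀ᶠ v in 𝓝[≠] q, xCov (transpose S) z (v + c) ≠ OnePoint.infty :=
    (tendsto_punctured_add q c).eventually (u'.eventually_ne_infty _)
  filter_upwards [u.eventually_ne_infty q, u.eventually_xVal_ne 0 q, h5] with v k1 k2 k3
  have := hK v k1 k3
  rw [← K_transpose z u.model.small, K_eq z u.model.small.transpose] at this
  simp only [Function.comp_apply]
  field_simp
  linear_combination -this

/-- The parametrization of the curve `K(x, y) = 0`: at the point with `y = y₁` the two values of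
`x` coincide, which determines the translation between the coordinates. -/
theorem exists_curve (u : Unif S z L A B g h ν s) (u' : Unif (transpose S) z L A B g' h' ν' s')
    (hirr : Irrational (ω₂ S z / ω₃ S z)) : Curve S z L A B (ω₃ S z) g h ν s g' h' ν' s' := by
  obtain ⟨t₀, ht₀, hW, hx₀⟩ := u.exists_ω₃ u' hirr
  obtain ⟨c, hc⟩ := u.exists_shift u'
  have hS := u.model.small
  have hB := u.rect.posB
  -- `ω₂ / 2 - c` is a point with `y = y₁`, at which `x` takes the value of the double root of
  -- `x ↦ K(x, y₁)`; this is also its value at `t₀ = (ω₂ - ω₃) / 2`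
  have hq' : xCov (transpose S) z ((B / 2 - c : ℂ) + c) = ((y₁ S z : ℂ) : OnePoint ℂ) := by
    have := u'.xCov_half₂
    rw [u.rect.per₂] at this
    rwa [sub_add_cancel]
  have hqf : xCov (transpose S) z ((B / 2 - c : ℂ) + c) ≠ OnePoint.infty := by
    rw [hq']; exact OnePoint.coe_ne_infty _
  have hd0 : dF (transpose S) z (y₁ S z) = 0 := by
    rw [u'.dF_eq_prod]
    simp [y₁]
  rw [dF_eq] at hd0
  have hxq : xCov S z (B / 2 - c : ℂ) = xCov S z t₀ := by
    rw [hx₀]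
    by_cases ha : (aPoly (transpose S) z).eval (y₁ S z) = 0
    · rw [if_pos ha]
      have ha' : aF (transpose S) z (y₁ S z) = 0 := by rw [aF_ofReal z hS.transpose, ha]; simp
      by_contra hne
      have hK := hc _ hne hqf
      rw [xVal_eq_of_coe hq', ← K_transpose z hS, K_eq z hS.transpose, ha'] at hK
      rw [ha'] at hd0
      have hb' : bF (transpose S) z (y₁ S z) = 0 := by
        have : bF (transpose S) z (y₁ S z) ^ 2 = 0 := by linear_combination hd0
        exact pow_eq_zero_iff two_ne_zero |>.mp this
      rw [hb'] at hK
      apply fiberPoly_ne_zero u.model (y₁ S z)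
      have hc' : cF (transpose S) z (y₁ S z) = 0 := by linear_combination hK
      simp [fiberPoly, ha', hb', hc']
    · rw [if_neg ha]
      have ha' : aF (transpose S) z (y₁ S z) ≠ 0 := by
        rw [aF_ofReal z hS.transpose]; exact_mod_cast ha
      have hne : xCov S z (B / 2 - c : ℂ) ≠ OnePoint.infty := by
        intro hinf
        have := u.K_infty u' hc hinf hqf
        rw [xVal_eq_of_coe hq'] at this
        exact ha' this
      have hK := hc _ hne hqf
      rw [xVal_eq_of_coe hq', ← K_transpose z hS, K_eq z hS.transpose] at hK
      rw [← xVal_coe S z hne]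
      congr 1
      push_cast
      rw [← aF_ofReal z hS.transpose, ← bF_ofReal z hS.transpose, eq_div_iff (by simpa using ha')]
      have h2 : (xVal S z (B / 2 - c) * (2 * aF (transpose S) z (y₁ S z)) +
          bF (transpose S) z (y₁ S z)) ^ 2 = 0 := by
        linear_combination 4 * aF (transpose S) z (y₁ S z) * hK + hd0
      have h3 := pow_eq_zero_iff two_ne_zero |>.mp h2
      linear_combination h3
  refine ⟨u, u', by rw [hW]; linarith [ht₀.2], by rw [hW]; linarith [ht₀.1], ?_⟩
  have ht : (t₀ : ℂ) = B / 2 - (ω₃ S z : ℂ) / 2 := by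
    rw [hW]; push_cast; ring
  -- hence `c` is `ω₃ / 2` up to sign and periods; the sign is absorbed by `ω ↦ -ω`
  rcases (u.xCov_eq_iff _ _).mp hxq with hl | hl
  · rw [ht] at hl
    have key : ∀ ω : ℂ, xCov (transpose S) z (ω - (ω₃ S z : ℂ) / 2) = xCov (transpose S) z (-ω + c) := by
      intro ω
      rw [← u'.xCov_neg, u'.xCov_eq_iff]
      left
      convert hl using 1
      ring
    intro ω h1 h2
    have := hc (-ω) (by rwa [u.xCov_neg]) (by rwa [← key])
    rwa [xVal, u.xCov_neg, xVal, ← key] at this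
  · rw [ht] at hl
    have hBL : (B : ℂ) ∈ L.lattice := by rw [← u.rect.per₂]; exact L.ω₂_mem_lattice
    have key : ∀ ω : ℂ, xCov (transpose S) z (ω - (ω₃ S z : ℂ) / 2) = xCov (transpose S) z (ω + c) := by
      intro ω
      rw [u'.xCov_eq_iff]
      left
      convert sub_mem hl hBL using 1
      ring
    intro ω h1 h2
    have := hc ω h1 (by rwa [← key])
    rwa [xVal, xVal, ← key] at this

end Unif

namespace Curve

variable {S : Finset (ℤ × ℤ)} {z : ℝ} {L : PeriodPair} {A B W g h ν s g' h' ν' s' : ℝ}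

/-- Exchanging the coordinates. -/
theorem symm (k : Curve S z L A B W g h ν s g' h' ν' s') :
    Curve (transpose S) z L A B W g' h' ν' s' g h ν s := by
  refine ⟨k.u', by rw [transpose_transpose]; exact k.u, k.W_pos, k.W_lt, ?_⟩
  rw [transpose_transpose]
  intro ω h1 h2
  have e : (W : ℂ) / 2 - ω - W / 2 = -ω := by ring
  have e' : (W : ℂ) / 2 - ω = -(ω - W / 2) := by ring
  have := k.K_eq_zero (W / 2 - ω) (by rwa [e', k.u.xCov_neg]) (by rwa [e, k.u'.xCov_neg])
  rw [e, k.u'.xVal_neg, e', k.u.xVal_neg] at this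
  rwa [K_transpose z k.u.model.small]

end Curve

/-! ### The strip between the lines `x ∈ [x₁, x₂]` and `y ∈ [y₁, y₂]` -/

/-- A nonempty relatively clopen subset of a preconnected set is everything. -/
theorem subset_of_relClopen {X : Type*} [TopologicalSpace X] {C V : Set X} (hC : IsPreconnected C)
    (hcl : ∀ v ∈ C, v ∈ closure V → v ∈ V) (hop : ∀ v ∈ C, v ∈ V → ∀ᶠ w in 𝓝[C] v, w ∈ V)
    (hne : (C ∩ V).Nonempty) : C ⊆ V := by
  have : PreconnectedSpace C := isPreconnected_iff_preconnectedSpace.mp hC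
  have h1 : IsClopen ((↑) ⁻¹' V : Set C) := by
    constructor
    · refine isClosed_of_closure_subset fun v hv => hcl v v.2 ?_
      exact closure_mono (Set.image_preimage_subset _ _) (mem_closure_image continuousAt_subtype_val hv)
    · refine isOpen_iff_mem_nhds.mpr ?_
      rintro ⟨v, hv⟩ hvV
      exact preimage_coe_mem_nhds_subtype.mpr (hop v hv hvV)
  obtain ⟨w, hwC, hwV⟩ := hne
  have h2 := h1.eq_univ ⟨⟨w, hwC⟩, hwV⟩
  intro v hv
  have : (⟨v, hv⟩ : C) ∈ ((↑) ⁻¹' V : Set C) := by rw [h2]; trivial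
  exact this

/-- The open unit disc in the Riemann sphere. -/
def unitDisc : Set (OnePoint ℂ) := (↑) '' Metric.ball (0 : ℂ) 1

theorem isOpen_unitDisc : IsOpen unitDisc :=
  OnePoint.isOpenEmbedding_coe.isOpenMap _ Metric.isOpen_ball

theorem coe_mem_unitDisc {x : ℂ} : (x : OnePoint ℂ) ∈ unitDisc ↔ ‖x‖ < 1 := by
  rw [unitDisc, OnePoint.coe_injective.mem_set_image, mem_ball_zero_iff]

theorem infty_notMem_unitDisc : OnePoint.infty ∉ unitDisc := by
  rintro ⟨x, -, hx⟩
  exact OnePoint.coe_ne_infty _ hx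

theorem ne_infty_of_mem_unitDisc {p : OnePoint ℂ} (hp : p ∈ unitDisc) : p ≠ OnePoint.infty := by
  rintro rfl
  exact infty_notMem_unitDisc hp

/-- The closed unit disc in the Riemann sphere. -/
def closedUnitDisc : Set (OnePoint ℂ) := (↑) '' Metric.closedBall (0 : ℂ) 1

theorem isClosed_closedUnitDisc : IsClosed closedUnitDisc :=
  ((isCompact_closedBall (0 : ℂ) 1).image OnePoint.continuous_coe).isClosed

theorem unitDisc_subset : unitDisc ⊆ closedUnitDisc := Set.image_mono Metric.ball_subset_closedBall

theorem Model.K_ne_zero {S : Finset (ℤ × ℤ)} {z : ℝ} (hm : Model S z) {x y : ℂ} (hx : ‖x‖ = 1)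
    (hy : ‖y‖ = 1) : K S z x y ≠ 0 := by
  intro h0
  have h1 : x * y = z * ∑ s ∈ S, x ^ (s.1 + 1).toNat * y ^ (s.2 + 1).toNat := by
    rw [K] at h0
    linear_combination -h0
  have h2 := congrArg norm h1
  rw [norm_mul, norm_mul, hx, hy, Complex.norm_real, Real.norm_eq_abs, abs_of_pos hm.z_pos] at h2
  have h3 : ‖∑ s ∈ S, x ^ (s.1 + 1).toNat * y ^ (s.2 + 1).toNat‖ ≤ S.card := by
    refine (norm_sum_le_of_le S (f := fun s => x ^ (s.1 + 1).toNat * y ^ (s.2 + 1).toNat)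
      (n := fun _ => (1 : ℝ)) fun s _ => ?_).trans (by simp)
    simp [norm_pow, hx, hy]
  have h4 := mul_le_mul_of_nonneg_left h3 hm.z_pos.le
  linarith [hm.z_mul_card]

theorem Model.K_one_one {S : Finset (ℤ × ℤ)} {z : ℝ} (hm : Model S z) :
    (aPoly S z).eval 1 + (bPoly S z).eval 1 + (cPoly S z).eval 1 < 0 := by
  rw [aPoly_eval z hm.small, bPoly_eval z hm.small, cPoly_eval z hm.small]
  linarith [hm.sum_wt]

namespace Unif

variable {S : Finset (ℤ × ℤ)} {z : ℝ} {L : PeriodPair} {A B g h ν s : ℝ}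

theorem mem_unitDisc_of_re_half (u : Unif S z L A B g h ν s) {ω : ℂ} (n : ℤ)
    (hω : ω.re = B / 2 + n * B) : xCov S z ω ∈ unitDisc := by
  obtain ⟨x, hx, hxe⟩ := u.xCov_re_half n hω
  have b := u.branch
  rw [hxe, coe_mem_unitDisc, Complex.norm_real, Real.norm_eq_abs, abs_lt]
  exact ⟨b.lt₁.trans_le hx.1, hx.2.trans_lt b.lt₂⟩

theorem notMem_unitDisc_of_re_zero (u : Unif S z L A B g h ν s) {ω : ℂ} (n : ℤ)
    (hω : ω.re = n * B) : xCov S z ω ∉ closedUnitDisc := by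
  intro hm
  obtain ⟨x, hx, hxe⟩ := hm
  have := u.xCov_re_zero n hω hxe.symm
  rw [mem_closedBall_zero_iff] at hx
  linarith

theorem deriv_disc_pos (u : Unif S z L A B g h ν s) :
    0 < (derivative (disc S z)).eval (x₂ S z) := by
  have b := u.branch
  obtain ⟨c0, c1, c2, c3, c4⟩ := b.coeff_eq (disc_eval u.model.small z)
  have e : (derivative (disc S z)).eval (x₂ S z) =
      ν * ((x₂ S z - x₁ S z) * (x₃ S z - x₂ S z) * (1 - s * x₂ S z)) := by
    rw [(disc_derivs u.model.small z _).1, c1, c2, c3, c4]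
    ring
  rw [e]
  exact mul_pos b.pos (mul_pos (mul_pos (by linarith [b.lt₁₂]) (by linarith [b.lt₂, b.lt₃])) b.pos₂)

/-- The real coordinate on the line `Im ω = |ω₁| / 2`. -/
theorem exists_real_im_half (u : Unif S z L A B g h ν s) : ∃ X : ℝ → ℝ, Continuous X ∧
    (∀ t : ℝ, xCov S z (L.ω₁ / 2 + t) = ((X t : ℂ) : OnePoint ℂ)) ∧
    (∀ t, X t ∈ Set.Icc (x₂ S z) (x₃ S z)) ∧ X (B / 2) = x₂ S z ∧ X B = x₃ S z := by
  choose X hX1 hX2 hX3 using u.xCov_im_half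
  have hval : ∀ t : ℝ, (X t : ℂ) = xVal S z (L.ω₁ / 2 + t) := fun t => (xVal_eq_of_coe (hX2 t)).symm
  refine ⟨X, ?_, hX2, hX1, ?_, ?_⟩
  · rw [continuous_iff_continuousAt]
    intro t
    have hne : xCov S z (L.ω₁ / 2 + t) ≠ OnePoint.infty := by
      rw [hX2]; exact OnePoint.coe_ne_infty _
    have h1 : ContinuousAt (fun t : ℝ => xVal S z (L.ω₁ / 2 + t)) t :=
      ContinuousAt.comp (f := fun t : ℝ => L.ω₁ / 2 + (t : ℂ)) (u.xVal_analyticAt hne).continuousAt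
        (by fun_prop)
    have h2 : X = fun t : ℝ => (xVal S z (L.ω₁ / 2 + t)).re := by
      ext t; rw [← hval, Complex.ofReal_re]
    rw [h2]
    exact Complex.continuous_re.continuousAt.comp h1
  · have h1 := u.xCov_half₁₂
    have h2 : (L.ω₁ + L.ω₂) / 2 = L.ω₁ / 2 + ((B / 2 : ℝ) : ℂ) := by
      rw [u.rect.per₂]; push_cast; ring
    rw [h2, hX2] at h1
    exact_mod_cast OnePoint.coe_injective h1
  · have h1 : xCov S z (L.ω₁ / 2) = ((x₃ S z : ℂ) : OnePoint ℂ) :=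
      u.xCov_half L.ω₁_div_two_notMem_lattice u.branch.pos₃ (by rw [u.rect.wP_half₁, u.e₃_eq])
    have h2 := u.xCov_add L.ω₂_mem_lattice (L.ω₁ / 2)
    rw [h1, u.rect.per₂, hX2] at h2
    exact_mod_cast OnePoint.coe_injective h2

end Unif

namespace Curve

variable {S : Finset (ℤ × ℤ)} {z : ℝ} {L : PeriodPair} {A B W g h ν s g' h' ν' s' : ℝ}

theorem not_both (k : Curve S z L A B W g h ν s g' h' ν' s') {ω x y : ℂ} (hx : xCov S z ω = x)
    (hy : xCov (transpose S) z (ω - W / 2) = y) (h1 : ‖x‖ = 1) (h2 : ‖y‖ = 1) : False := by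
  have := k.K_eq_zero ω (by rw [hx]; exact OnePoint.coe_ne_infty _)
    (by rw [hy]; exact OnePoint.coe_ne_infty _)
  rw [Unif.xVal_eq_of_coe hx, Unif.xVal_eq_of_coe hy] at this
  exact k.u.model.K_ne_zero h1 h2 this

/-- Along the line `Im ω = |ω₁| / 2` the point `(x, y)` runs through the part of the real oval where
both partial derivatives of `K` are negative; at `x = 1` this gives `y < 1`. -/
theorem lt_one_of_eq_one (k : Curve S z L A B W g h ν s g' h' ν' s') {X Y : ℝ → ℝ}
    (hX : Continuous X) (hXe : ∀ t : ℝ, xCov S z (L.ω₁ / 2 + t) = ((X t : ℂ) : OnePoint ℂ))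
    (hXB : X (B / 2) = x₂ S z) (hY : Continuous Y)
    (hYe : ∀ t : ℝ, xCov (transpose S) z (L.ω₁ / 2 + t) = ((Y t : ℂ) : OnePoint ℂ))
    (hYB : Y (B / 2) = x₂ (transpose S) z) {t : ℝ} (ht : t ∈ Set.Icc (B / 2) ((B + W) / 2))
    (h1 : X t = 1) : Y (t - W / 2) < 1 := by
  have hS := k.u.model.small
  have hW := k.W_pos
  have hWB := k.W_lt
  have hB := k.u.rect.posB
  rcases ht.2.eq_or_lt with hte | hte
  · have : t - W / 2 = B / 2 := by rw [hte]; ring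
    rw [this, hYB]
    exact k.u'.branch.lt₂
  have ht0 : B / 2 < t := by
    rcases ht.1.lt_or_eq with h | h
    · exact h
    · rw [← h, hXB] at h1
      linarith [k.u.branch.lt₂]
  have hsh : ∀ t : ℝ, L.ω₁ / 2 + (t : ℂ) - W / 2 = L.ω₁ / 2 + ((t - W / 2 : ℝ) : ℂ) := by
    intro t; push_cast; ring
  have hKc : ∀ t : ℝ, K S z (X t) (Y (t - W / 2)) = 0 := by
    intro t
    have := k.K_eq_zero (L.ω₁ / 2 + t) (by rw [hXe]; exact OnePoint.coe_ne_infty _)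
      (by rw [hsh, hYe]; exact OnePoint.coe_ne_infty _)
    rwa [hsh, Unif.xVal_eq_of_coe (hXe t), Unif.xVal_eq_of_coe (hYe _)] at this
  have hK : ∀ t : ℝ, (aPoly S z).eval (X t) * Y (t - W / 2) ^ 2 +
      (bPoly S z).eval (X t) * Y (t - W / 2) + (cPoly S z).eval (X t) = 0 := by
    intro t
    have := hKc t
    rw [K_eq z hS, aF_ofReal z hS, bF_ofReal z hS, cF_ofReal z hS] at this
    exact_mod_cast this
  -- the partial derivatives of the kernel along the line
  set F : ℝ → ℝ := fun t => 2 * (aPoly (transpose S) z).eval (Y (t - W / 2)) * X t +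
    (bPoly (transpose S) z).eval (Y (t - W / 2)) with hF
  have hFc : Continuous F := by
    have h1 : Continuous fun t => (aPoly (transpose S) z).eval (Y (t - W / 2)) :=
      (aPoly (transpose S) z).continuous.comp (hY.comp (by fun_prop))
    have h2 : Continuous fun t => (bPoly (transpose S) z).eval (Y (t - W / 2)) :=
      (bPoly (transpose S) z).continuous.comp (hY.comp (by fun_prop))
    exact ((continuous_const.mul h1).mul hX).add h2
  -- `F ^ 2 = d̃(y)` has no zero before the end of the segment, since `y' ^ 2 = 4 d̃(y)` and `y' < 0`
  have hF0 : ∀ v ∈ Set.Ico (B / 2) ((B + W) / 2), F v ≠ 0 := by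
    intro v hv hc
    have hKT : K (transpose S) z (Y (v - W / 2)) (X v) = 0 := by rw [K_transpose z hS]; exact hKc v
    have h2 := sq_of_K_eq_zero hS.transpose hKT
    rw [aF_ofReal z hS.transpose, bF_ofReal z hS.transpose] at h2
    have h3 : ((F v : ℝ) : ℂ) ^ 2 = dF (transpose S) z (Y (v - W / 2)) := by
      rw [← h2, hF]; push_cast; ring
    obtain ⟨ρ, h4, h5⟩ := k.u'.deriv_im_half_neg (t := v - W / 2)
      ⟨by linarith [hv.1], by linarith [hv.2]⟩
    have h6 := k.u'.sq_deriv (ω := L.ω₁ / 2 + ((v - W / 2 : ℝ) : ℂ))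
      (by rw [hYe]; exact OnePoint.coe_ne_infty _)
    rw [h5, Unif.xVal_eq_of_coe (hYe _), ← h3, hc] at h6
    have h7 : ρ ^ 2 = 0 := by
      have : (ρ : ℂ) ^ 2 = 0 := by rw [h6]; simp
      exact_mod_cast this
    have h8 := pow_eq_zero_iff two_ne_zero |>.mp h7
    linarith
  -- at the starting point `x = x₂` and `2 a(x₂) y + b(x₂) = 0`, so that `4 a(x₂) K_x = -d'(x₂) < 0`
  have hFB : F (B / 2) < 0 := by
    have hx2 := k.u.x₂_pos
    have ha := k.u.model.aPoly_pos hx2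
    have hd := k.u.deriv_disc_pos
    have hKB := hK (B / 2)
    have hd0 : (disc S z).eval (x₂ S z) = 0 := by rw [k.u.branch.eval_eq]; simp
    rw [disc_eval'] at hd0
    rw [hXB] at hKB
    have hlin : 2 * (aPoly S z).eval (x₂ S z) * Y (B / 2 - W / 2) + (bPoly S z).eval (x₂ S z) = 0 := by
      have : (2 * (aPoly S z).eval (x₂ S z) * Y (B / 2 - W / 2) +
          (bPoly S z).eval (x₂ S z)) ^ 2 = 0 := by
        linear_combination 4 * (aPoly S z).eval (x₂ S z) * hKB + hd0
      exact pow_eq_zero_iff two_ne_zero |>.mp this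
    have e : 4 * (aPoly S z).eval (x₂ S z) * F (B / 2) =
        -(derivative (disc S z)).eval (x₂ S z) := by
      rw [hF]
      simp only [hXB]
      rw [(disc_derivs hS z _).1]
      rw [aPoly_eval z hS] at hKB hlin ⊢
      rw [bPoly_eval z hS] at hKB hlin
      rw [cPoly_eval z hS] at hKB
      rw [aPoly_eval z hS.transpose, bPoly_eval z hS.transpose]
      simp only [wt_transpose, dC]
      generalize Y (B / 2 - W / 2) = y at *
      linear_combination (2 * (-1 + 2 * wt S z 1 0 * x₂ S z) +
        4 * (wt S z 0 1 + 2 * wt S z 1 1 * x₂ S z) * y) * hlin -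
        4 * (wt S z 0 1 + 2 * wt S z 1 1 * x₂ S z) * hKB
    by_contra hc
    have := mul_nonneg (mul_nonneg (by norm_num : (0 : ℝ) ≤ 4) ha.le) (not_lt.mp hc)
    linarith
  have hFt : F t < 0 := by
    by_contra hc
    have h2 := intermediate_value_Icc ht0.le hFc.continuousOn (show (0 : ℝ) ∈ Set.Icc (F (B / 2)) (F t)
      from ⟨hFB.le, not_lt.mp hc⟩)
    obtain ⟨v, hv, hv0⟩ := h2
    exact hF0 v ⟨hv.1, hv.2.trans_lt hte⟩ hv0
  obtain ⟨ρ, hρ, hρe⟩ := k.u.deriv_im_half_pos (t := t) ⟨ht0, by linarith⟩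
  obtain ⟨σ, hσ, hσe⟩ := k.u'.deriv_im_half_neg (t := t - W / 2) ⟨by linarith, by linarith⟩
  -- differentiating `K(x(ω), y(ω)) = 0`, with `x' > 0` and `y' < 0`
  have hG : F t * ρ + (2 * (aPoly S z).eval 1 * Y (t - W / 2) + (bPoly S z).eval 1) * σ = 0 := by
    have hxf : xCov S z (L.ω₁ / 2 + t) ≠ OnePoint.infty := by
      rw [hXe]; exact OnePoint.coe_ne_infty _
    have hyf : xCov (transpose S) z (L.ω₁ / 2 + t - W / 2) ≠ OnePoint.infty := by
      rw [hsh, hYe]; exact OnePoint.coe_ne_infty _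
    have d1 := (k.u.xVal_analyticAt hxf).differentiableAt.hasDerivAt
    have d2 := (k.u'.xVal_analyticAt hyf).differentiableAt.hasDerivAt
    have d2' : HasDerivAt (fun v => xVal (transpose S) z (v - W / 2))
        (deriv (xVal (transpose S) z) (L.ω₁ / 2 + t - W / 2)) (L.ω₁ / 2 + t) := by
      simpa using d2.comp_sub_const (L.ω₁ / 2 + (t : ℂ)) ((W : ℂ) / 2)
    have d3 := hasDerivAt_K hS (z := z) d1 d2'
    have h0 : (fun v => K S z (xVal S z v) (xVal (transpose S) z (v - W / 2)))
        =ᶠ[𝓝 (L.ω₁ / 2 + (t : ℂ))] fun _ => 0 := by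
      have hc : Tendsto (fun v : ℂ => v - W / 2) (𝓝 (L.ω₁ / 2 + (t : ℂ)))
          (𝓝 (L.ω₁ / 2 + (t : ℂ) - W / 2)) := (continuous_id.sub continuous_const).tendsto _
      filter_upwards [k.u.eventually_ne_infty_nhds hxf,
        hc.eventually (k.u'.eventually_ne_infty_nhds hyf)] with v k1 k2
      exact k.K_eq_zero v k1 k2
    have e1 := d3.unique ((hasDerivAt_const _ (0 : ℂ)).congr_of_eventuallyEq h0)
    rw [hsh, hρe, hσe, Unif.xVal_eq_of_coe (hXe t), Unif.xVal_eq_of_coe (hYe _), aF_ofReal z hS.transpose,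
      bF_ofReal z hS.transpose, aF_ofReal z hS, bF_ofReal z hS] at e1
    rw [← h1]
    simp only [hF]
    exact_mod_cast e1
  have hneg : 2 * (aPoly S z).eval 1 * Y (t - W / 2) + (bPoly S z).eval 1 < 0 := by
    by_contra hc
    have h2 := mul_neg_of_neg_of_pos hFt hρ
    have h3 := mul_nonpos_of_nonneg_of_nonpos (not_lt.mp hc) hσ.le
    linarith
  have hKt := hK t
  rw [h1] at hKt
  have ha := k.u.model.aPoly_pos one_pos
  have h11 := k.u.model.K_one_one
  -- `y ↦ K(1, y)` is convex and negative at `1`, so its slope is positive at a root `y ≥ 1`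
  by_contra hc
  have hY1 : 0 ≤ Y (t - W / 2) - 1 := by linarith
  have hp : (aPoly S z).eval 1 * (1 + Y (t - W / 2)) + (bPoly S z).eval 1 < 0 := by
    linarith [mul_nonneg ha.le hY1]
  have hq := mul_nonneg hY1 (neg_nonneg.mpr hp.le)
  have e : (aPoly S z).eval 1 + (bPoly S z).eval 1 + (cPoly S z).eval 1 =
      (Y (t - W / 2) - 1) * -((aPoly S z).eval 1 * (1 + Y (t - W / 2)) + (bPoly S z).eval 1) := by
    linear_combination hKt
  linarith

/-- The strip `ω₂ / 2 ≤ Re ω ≤ (ω₂ + ω₃) / 2`. -/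
def strip (B W : ℝ) : Set ℂ := {ω | ω.re ∈ Set.Icc (B / 2) ((B + W) / 2)}

theorem mem_strip {ω : ℂ} : ω ∈ strip B W ↔ ω.re ∈ Set.Icc (B / 2) ((B + W) / 2) := Iff.rfl

theorem isClosed_strip (B W : ℝ) : IsClosed (strip B W) :=
  isClosed_Icc.preimage Complex.continuous_re

theorem isPreconnected_strip (B W : ℝ) : IsPreconnected (strip B W) :=
  ((convex_Icc (B / 2) ((B + W) / 2)).is_linear_preimage
    Complex.reLm.isLinear).isPreconnected

theorem y_mem_of_right (k : Curve S z L A B W g h ν s g' h' ν' s') {ω : ℂ}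
    (hω : ω.re = (B + W) / 2) : xCov (transpose S) z (ω - W / 2) ∈ unitDisc := by
  refine k.u'.mem_unitDisc_of_re_half 0 ?_
  have : ((W : ℂ) / 2).re = W / 2 := by
    rw [show (W : ℂ) / 2 = ((W / 2 : ℝ) : ℂ) by push_cast; rfl, Complex.ofReal_re]
  rw [Complex.sub_re, hω, this]
  push_cast
  ring

theorem y_continuous (k : Curve S z L A B W g h ν s g' h' ν' s') :
    Continuous fun ω : ℂ => xCov (transpose S) z (ω - W / 2) :=
  k.u'.xCov_continuous.comp (by fun_prop)

/-- The points of the strip with `x = 1` lie, up to periods, on the line `Im ω = |ω₁| / 2`, on which `x`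
and `y` are real and positive. -/
theorem y_mem_of_x_eq_one (k : Curve S z L A B W g h ν s g' h' ν' s') {ω : ℂ}
    (hω : ω ∈ strip B W) (hx : xCov S z ω = ((1 : ℂ) : OnePoint ℂ)) :
    xCov (transpose S) z (ω - W / 2) ∈ unitDisc := by
  have hr := k.u.rect
  have hB := hr.posB
  have hW := k.W_pos
  have hWB := k.W_lt
  have b := k.u.branch
  obtain ⟨X, hX, hXe, -, hXB, hXB'⟩ := k.u.exists_real_im_half
  obtain ⟨Y, hY, hYe, hYm, hYB, -⟩ := k.u'.exists_real_im_half
  obtain ⟨t, ht, ht1⟩ : (1 : ℝ) ∈ X '' Set.Icc (B / 2) B := by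
    refine intermediate_value_Icc (by linarith) hX.continuousOn ?_
    rw [hXB, hXB']
    exact ⟨b.lt₂.le, b.lt₃.le⟩
  have htB : t < B := by
    rcases ht.2.lt_or_eq with h | h
    · exact h
    · rw [h, hXB'] at ht1
      linarith [b.lt₃]
  have htB' : B / 2 < t := by
    rcases ht.1.lt_or_eq with h | h
    · exact h
    · rw [← h, hXB] at ht1
      linarith [b.lt₂]
  have he : xCov S z ω = xCov S z (L.ω₁ / 2 + t) := by rw [hx, hXe, ht1]; simp
  have h1 : B / 2 ≤ ω.re := hω.1
  have h2 : ω.re ≤ (B + W) / 2 := hω.2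
  have hre : (L.ω₁ / 2 + (t : ℂ)).re = t := by rw [hr.half₁]; simp
  rcases (k.u.xCov_eq_iff _ _).mp he with hl | hl
  · obtain ⟨⟨n, hn⟩, -⟩ := (hr.mem_iff _).mp hl
    rw [Complex.sub_re, hre] at hn
    have hn0 : n = 0 := by
      have k1 : (n : ℝ) < 1 := by by_contra hc; nlinarith
      have k2 : (-1 : ℝ) < n := by by_contra hc; nlinarith
      have k1' : n < 1 := by exact_mod_cast k1
      have k2' : -1 < n := by exact_mod_cast k2
      omega
    rw [hn0, Int.cast_zero, zero_mul] at hn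
    have hlt := k.lt_one_of_eq_one hX hXe hXB hY hYe hYB (t := t) ⟨ht.1, by linarith⟩ ht1
    have he2 : xCov (transpose S) z (ω - W / 2) = ((Y (t - W / 2) : ℂ) : OnePoint ℂ) := by
      rw [← hYe, k.u'.xCov_eq_iff]
      left
      convert hl using 1
      push_cast
      ring
    rw [he2, coe_mem_unitDisc, Complex.norm_real, Real.norm_eq_abs, abs_lt]
    exact ⟨by linarith [(hYm (t - W / 2)).1, k.u'.x₂_pos], hlt⟩
  · exfalso
    obtain ⟨⟨n, hn⟩, -⟩ := (hr.mem_iff _).mp hl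
    rw [Complex.add_re, hre] at hn
    have k1 : (n : ℝ) < 2 := by by_contra hc; nlinarith
    have k2 : (1 : ℝ) < n := by by_contra hc; nlinarith
    have k1' : n < 2 := by exact_mod_cast k1
    have k2' : 1 < n := by exact_mod_cast k2
    omega

/-- In the strip `|x| = 1` implies `|y| < 1`: the values `x` violating this form a clopen subset of
the unit circle, which does not contain `1`. -/
theorem y_mem_of_norm_x_eq_one (k : Curve S z L A B W g h ν s g' h' ν' s') {ω x : ℂ}
    (hω : ω ∈ strip B W) (hx : xCov S z ω = x) (hx1 : ‖x‖ = 1) :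
    xCov (transpose S) z (ω - W / 2) ∈ unitDisc := by
  have hr := k.u.rect
  have hA := hr.posA
  have hyc := k.y_continuous
  by_contra hy
  set P : Set ℂ := {v | v ∈ strip B W ∧ xCov S z v ∈ ((↑) '' Metric.sphere (0 : ℂ) 1 : Set (OnePoint ℂ)) ∧
    xCov (transpose S) z (v - W / 2) ∉ unitDisc} with hP
  have hfin : ∀ v ∈ P, xCov S z v ≠ OnePoint.infty := by
    rintro v ⟨-, ⟨c, -, hc⟩, -⟩
    rw [← hc]
    exact OnePoint.coe_ne_infty _
  have hclosed : IsClosed P := by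
    refine (isClosed_strip B W).inter (IsClosed.inter ?_ ?_)
    · exact (((isCompact_sphere (0 : ℂ) 1).image OnePoint.continuous_coe).isClosed).preimage
        k.u.xCov_continuous
    · exact (isOpen_unitDisc.preimage hyc).isClosed_compl
  have hPy : ∀ v ∈ P, xCov (transpose S) z (v - W / 2) ∉ closedUnitDisc := by
    rintro v ⟨-, ⟨c, hc1, hc⟩, hv⟩ ⟨y, hy1, hye⟩
    rw [← hye, coe_mem_unitDisc, not_lt] at hv
    rw [mem_closedBall_zero_iff] at hy1
    exact k.not_both hc.symm hye.symm (by simpa using hc1) (le_antisymm hy1 hv)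
  have hper : ∀ v ∈ P, ∀ n : ℤ, v + n * L.ω₁ ∈ P ∧ xVal S z (v + n * L.ω₁) = xVal S z v := by
    rintro v ⟨h1, h2, h3⟩ n
    have hl : (n : ℂ) * L.ω₁ ∈ L.lattice := by
      have := L.lattice.smul_mem n L.ω₁_mem_lattice
      rwa [zsmul_eq_mul] at this
    refine ⟨⟨?_, ?_, ?_⟩, k.u.xVal_add hl v⟩
    · rw [mem_strip]
      have : (v + n * L.ω₁).re = v.re := by rw [hr.per₁]; simp
      rw [this]
      exact h1
    · rwa [k.u.xCov_add hl]
    · rw [add_sub_right_comm, k.u'.xCov_add hl]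
      exact h3
  have himg : xVal S z '' P = xVal S z '' (P ∩ {v | v.im ∈ Set.Icc 0 A}) := by
    apply Set.Subset.antisymm
    · rintro _ ⟨v, hv, rfl⟩
      obtain ⟨h1, h2⟩ := hper v hv (-⌊v.im / A⌋)
      refine ⟨_, ⟨h1, ?_⟩, h2⟩
      have hf1 : (⌊v.im / A⌋ : ℝ) * A ≤ v.im := (le_div_iff₀ hA).mp (Int.floor_le _)
      have hf2 : v.im < (⌊v.im / A⌋ + 1) * A := (div_lt_iff₀ hA).mp (Int.lt_floor_add_one _)
      have : (v + ((-⌊v.im / A⌋ : ℤ) : ℂ) * L.ω₁).im = v.im - ⌊v.im / A⌋ * A := by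
        rw [hr.per₁]
        simp
        ring
      rw [Set.mem_ofPred_eq, this]
      exact ⟨by linarith, by linarith⟩
    · exact Set.image_mono Set.inter_subset_left
  -- by periodicity `P` has the same image as a compact part of it
  have hcomp : IsCompact (P ∩ {v | v.im ∈ Set.Icc 0 A}) := by
    have h1 : IsCompact (Set.Icc (B / 2) ((B + W) / 2) ×ℂ Set.Icc 0 A) :=
      isCompact_Icc.reProdIm isCompact_Icc
    refine h1.of_isClosed_subset (hclosed.inter (isClosed_Icc.preimage Complex.continuous_im)) ?_
    rintro v ⟨⟨h1, -⟩, h2⟩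
    exact ⟨h1, h2⟩
  have hVc : IsClosed (xVal S z '' P) := by
    rw [himg]
    refine (hcomp.image_of_continuousOn fun v hv => ?_).isClosed
    exact (k.u.xVal_analyticAt (hfin v hv.1)).continuousAt.continuousWithinAt
  have hsub := subset_of_relClopen (isPreconnected_sphere
    (by rw [Complex.rank_real_complex]; norm_num) (0 : ℂ) 1)
    (fun v _ hv => hVc.closure_subset hv) ?_
    ⟨x, by simpa using hx1, ω, ⟨hω, ⟨x, by simpa using hx1, hx.symm⟩, hy⟩, Unif.xVal_eq_of_coe hx⟩
  · obtain ⟨v, hv, hv1⟩ := hsub (show (1 : ℂ) ∈ Metric.sphere (0 : ℂ) 1 by simp)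
    refine hv.2.2 (k.y_mem_of_x_eq_one hv.1 ?_)
    rw [← hv1, Unif.xVal_coe S z (hfin v hv)]
  -- the image is open by the open mapping theorem: the points of `P` are interior to the strip, as
  -- `|x| < 1` on its left side and `|y| < 1` on its right side
  · rintro _ - ⟨v, hv, rfl⟩
    have h1 : B / 2 < v.re := by
      rcases hv.1.1.lt_or_eq with h | h
      · exact h
      · exfalso
        have h2 := k.u.mem_unitDisc_of_re_half 0 (ω := v) (by rw [← h]; push_cast; ring)
        obtain ⟨c, hc1, hc⟩ := hv.2.1
        rw [← hc, coe_mem_unitDisc] at h2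
        rw [mem_sphere_zero_iff_norm] at hc1
        linarith
    have h2 : v.re < (B + W) / 2 := by
      rcases hv.1.2.lt_or_eq with h | h
      · exact h
      · exact absurd (k.y_mem_of_right h) hv.2.2
    have h3 : ∀ᶠ v' in 𝓝 v, v' ∈ strip B W ∧ xCov (transpose S) z (v' - W / 2) ∉ unitDisc ∧
        xCov S z v' ≠ OnePoint.infty := by
      have e1 : ∀ᶠ v' : ℂ in 𝓝 v, v'.re ∈ Set.Ioo (B / 2) ((B + W) / 2) :=
        Complex.continuous_re.continuousAt.eventually (isOpen_Ioo.mem_nhds ⟨h1, h2⟩)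
      have e2 : ∀ᶠ v' in 𝓝 v, xCov (transpose S) z (v' - W / 2) ∉ closedUnitDisc :=
        hyc.continuousAt.eventually (isClosed_closedUnitDisc.isOpen_compl.mem_nhds (hPy v hv))
      filter_upwards [e1, e2, k.u.eventually_ne_infty_nhds (hfin v hv)] with v' k1 k2 k3
      exact ⟨⟨k1.1.le, k1.2.le⟩, fun hc => k2 (unitDisc_subset hc), k3⟩
    have h4 := k.u.nhds_le_map (hfin v hv) (image_mem_map h3)
    rw [eventually_nhdsWithin_iff]
    filter_upwards [h4] with c hc hc1
    obtain ⟨v', ⟨k1, k2, k3⟩, rfl⟩ := hc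
    exact ⟨v', ⟨k1, ⟨_, hc1, Unif.xVal_coe S z k3⟩, k2⟩, rfl⟩

/-- In the strip one of the two coordinates is in the unit disc. -/
theorem mem_or_mem (k : Curve S z L A B W g h ν s g' h' ν' s') {ω : ℂ} (hω : ω ∈ strip B W) :
    xCov S z ω ∈ unitDisc ∨ xCov (transpose S) z (ω - W / 2) ∈ unitDisc := by
  have hyc := k.y_continuous
  have hxc := k.u.xCov_continuous
  by_contra hc
  rw [not_or] at hc
  set E : Set ℂ := {v | xCov S z v ∉ unitDisc ∧ xCov (transpose S) z (v - W / 2) ∉ unitDisc} with hE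
  have hclosed : IsClosed E :=
    ((isOpen_unitDisc.preimage hxc).isClosed_compl).inter
      ((isOpen_unitDisc.preimage hyc).isClosed_compl)
  have h1 : ∀ v ∈ strip B W, v ∈ E → xCov S z v ∉ closedUnitDisc := by
    rintro v hv ⟨k1, k2⟩ ⟨x, hx1, hx⟩
    rw [← hx, coe_mem_unitDisc, not_lt] at k1
    rw [mem_closedBall_zero_iff] at hx1
    exact k2 (k.y_mem_of_norm_x_eq_one hv hx.symm (le_antisymm hx1 k1))
  have h2 : ∀ v ∈ strip B W, v ∈ E → xCov (transpose S) z (v - W / 2) ∉ closedUnitDisc := by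
    rintro v hv ⟨k1, k2⟩ ⟨y, hy1, hy⟩
    rw [← hy, coe_mem_unitDisc, not_lt] at k2
    rw [mem_closedBall_zero_iff] at hy1
    apply k1
    -- exchange the coordinates by the reflection `v ↦ ω₂ + ω₃ / 2 - v`
    have hBL : (B : ℂ) ∈ L.lattice := by rw [← k.u.rect.per₂]; exact L.ω₂_mem_lattice
    have e1 : (B : ℂ) + W / 2 - v = -(v - W / 2) + B := by ring
    have e2 : (B : ℂ) + W / 2 - v - W / 2 = -v + B := by ring
    have e3 : ((B : ℂ) + W / 2 - v).re = B + W / 2 - v.re := by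
      rw [show (B : ℂ) + W / 2 = ((B + W / 2 : ℝ) : ℂ) by push_cast; rfl, Complex.sub_re,
        Complex.ofReal_re]
    have := k.symm.y_mem_of_norm_x_eq_one (ω := B + W / 2 - v) (x := y) (by
      rw [mem_strip, e3]
      exact ⟨by linarith [hv.2], by linarith [hv.1]⟩)
      (by rw [e1, k.u'.xCov_add hBL, k.u'.xCov_neg, hy]) (le_antisymm hy1 k2)
    rwa [transpose_transpose, e2, k.u.xCov_add hBL, k.u.xCov_neg] at this
  have hsub := subset_of_relClopen (isPreconnected_strip B W)
    (fun v _ hv => hclosed.closure_subset hv) ?_ ⟨ω, hω, hc⟩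
  · have hm : ((B / 2 : ℝ) : ℂ) ∈ strip B W := by
      rw [mem_strip, Complex.ofReal_re]
      exact ⟨le_rfl, by linarith [k.W_pos]⟩
    exact (hsub hm).1 (k.u.mem_unitDisc_of_re_half 0 (by rw [Complex.ofReal_re]; push_cast; ring))
  -- near a point of `E` both moduli stay greater than `1`
  · intro v hv hvE
    have e1 : ∀ᶠ v' in 𝓝 v, xCov S z v' ∉ closedUnitDisc :=
      hxc.continuousAt.eventually (isClosed_closedUnitDisc.isOpen_compl.mem_nhds (h1 v hv hvE))
    have e2 : ∀ᶠ v' in 𝓝 v, xCov (transpose S) z (v' - W / 2) ∉ closedUnitDisc :=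
      hyc.continuousAt.eventually (isClosed_closedUnitDisc.isOpen_compl.mem_nhds (h2 v hv hvE))
    filter_upwards [mem_nhdsWithin_of_mem_nhds e1, mem_nhdsWithin_of_mem_nhds e2] with v' k1 k2
    exact ⟨fun h => k1 (unitDisc_subset h), fun h => k2 (unitDisc_subset h)⟩

end Curve

/-! ### The functional equation of the generating function -/

/-- The partial sums of the walk `w` stay in the quarter plane. -/
def StaysInside {n : ℕ} (w : Fin n → ℤ × ℤ) : Prop :=
  ∀ m : Fin n, 0 ≤ (∑ l ∈ Finset.Iic m, w l).1 ∧ 0 ≤ (∑ l ∈ Finset.Iic m, w l).2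

instance {n : ℕ} (w : Fin n → ℤ × ℤ) : Decidable (StaysInside w) := by
  unfold StaysInside; infer_instance

/-- The walks with `n` steps in the quarter plane. -/
def walks (S : Finset (ℤ × ℤ)) (n : ℕ) : Finset (Fin n → ℤ × ℤ) :=
  (Fintype.piFinset fun _ : Fin n => S).filter StaysInside

theorem sum_Iic_castSucc {n : ℕ} (w : Fin (n + 1) → ℤ × ℤ) (m : Fin n) :
    ∑ l ∈ Finset.Iic m.castSucc, w l = ∑ l ∈ Finset.Iic m, w l.castSucc := by
  rw [← Fin.map_castSuccEmb_Iic, Finset.sum_map]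
  rfl

theorem sum_Iic_last {n : ℕ} (w : Fin (n + 1) → ℤ × ℤ) :
    ∑ l ∈ Finset.Iic (Fin.last n), w l = ∑ l, w l := by
  congr 1
  ext l
  simp [Fin.le_last]

theorem staysInside_succ {n : ℕ} (w : Fin (n + 1) → ℤ × ℤ) :
    StaysInside w ↔ StaysInside (fun l : Fin n => w l.castSucc) ∧
      0 ≤ (∑ l, w l).1 ∧ 0 ≤ (∑ l, w l).2 := by
  constructor
  · intro h
    refine ⟨fun m => ?_, ?_⟩
    · rw [← sum_Iic_castSucc]; exact h m.castSucc
    · rw [← sum_Iic_last]; exact h (Fin.last n)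
  · rintro ⟨h1, h2⟩ m
    refine Fin.lastCases ?_ (fun m => ?_) m
    · rw [sum_Iic_last]; exact h2
    · rw [sum_Iic_castSucc]; exact h1 m

theorem StaysInside.sum_nonneg {n : ℕ} {w : Fin n → ℤ × ℤ} (h : StaysInside w) :
    0 ≤ (∑ l, w l).1 ∧ 0 ≤ (∑ l, w l).2 := by
  cases n with
  | zero => simp
  | succ n => exact ((staysInside_succ w).mp h).2

/-- Removing the last step of a walk. -/
theorem sum_walks_succ (S : Finset (ℤ × ℤ)) (n : ℕ) (f : ℤ × ℤ → ℂ) :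
    ∑ w ∈ walks S (n + 1), f (∑ l, w l) = ∑ w ∈ walks S n, ∑ s ∈ S,
      if 0 ≤ (∑ l, w l + s).1 ∧ 0 ≤ (∑ l, w l + s).2 then f (∑ l, w l + s) else 0 := by
  rw [← Finset.sum_product', ← Finset.sum_filter]
  refine Finset.sum_nbij' (fun w => (fun l : Fin n => w l.castSucc, w (Fin.last n)))
    (fun p => Fin.snoc (α := fun _ => ℤ × ℤ) p.1 p.2) ?_ ?_ ?_ ?_ ?_
  · intro w hw
    rw [walks, Finset.mem_filter, Fintype.mem_piFinset, staysInside_succ, Fin.sum_univ_castSucc] at hw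
    rw [Finset.mem_filter, Finset.mem_product, walks, Finset.mem_filter, Fintype.mem_piFinset]
    exact ⟨⟨⟨fun l => hw.1 _, hw.2.1⟩, hw.1 _⟩, hw.2.2⟩
  · rintro ⟨w, s⟩ hp
    rw [Finset.mem_filter, Finset.mem_product, walks, Finset.mem_filter, Fintype.mem_piFinset] at hp
    rw [walks, Finset.mem_filter, Fintype.mem_piFinset, staysInside_succ, Fin.sum_univ_castSucc]
    refine ⟨fun l => ?_, ?_, ?_⟩
    · refine Fin.lastCases ?_ (fun m => ?_) l
      · simpa using hp.1.2
      · simpa using hp.1.1.1 m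
    · simpa using hp.1.1.2
    · simpa using hp.2
  · intro w _
    ext l : 1
    refine Fin.lastCases ?_ (fun m => ?_) l <;> simp
  · rintro ⟨w, s⟩ _
    simp
  · intro w _
    rw [Fin.sum_univ_castSucc]

/-- The generating polynomial of the endpoints of the walks with `n` steps. -/
noncomputable def endPoly (S : Finset (ℤ × ℤ)) (n : ℕ) (x y : ℂ) : ℂ :=
  ∑ w ∈ walks S n, x ^ (∑ l, w l).1.toNat * y ^ (∑ l, w l).2.toNat

/-- `∑ x ^ (i + 1) y ^ (j + 1)` over the steps. -/
noncomputable def stepPoly (S : Finset (ℤ × ℤ)) (x y : ℂ) : ℂ :=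
  ∑ s ∈ S, x ^ (s.1 + 1).toNat * y ^ (s.2 + 1).toNat

theorem K_eq_stepPoly (S : Finset (ℤ × ℤ)) (z : ℝ) (x y : ℂ) :
    K S z x y = z * stepPoly S x y - x * y := rfl

theorem pow_sub_zero_pow (x : ℂ) (e : ℕ) : x ^ e - 0 ^ e = if e = 0 then 0 else x ^ e := by
  split_ifs with h
  · simp [h]
  · simp [h]

/-- The inclusion-exclusion argument for the last step of a walk. -/
theorem endPoly_succ {S : Finset (ℤ × ℤ)} (hS : IsSmallStepSet S) (n : ℕ) (x y : ℂ) :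
    x * y * endPoly S (n + 1) x y = stepPoly S x y * endPoly S n x y -
      stepPoly S 0 y * endPoly S n 0 y - stepPoly S x 0 * endPoly S n x 0 +
      stepPoly S 0 0 * endPoly S n 0 0 := by
  have h := sum_walks_succ S n (fun p => x ^ p.1.toNat * y ^ p.2.toNat)
  rw [endPoly, h]
  simp only [stepPoly, endPoly]
  simp only [Finset.mul_sum, ← Finset.sum_sub_distrib, ← Finset.sum_add_distrib]
  refine Finset.sum_congr rfl fun w hw => ?_
  simp only [Finset.sum_mul, ← Finset.sum_sub_distrib, ← Finset.sum_add_distrib]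
  refine Finset.sum_congr rfl fun s hs => ?_
  obtain ⟨h1, h2⟩ := (Finset.mem_filter.mp hw).2.sum_nonneg
  obtain ⟨-, s1, s2⟩ := hS s hs
  rw [abs_le] at s1 s2
  generalize (∑ l, w l) = p at h1 h2
  have key : ∀ x y : ℂ, x ^ (s.1 + 1).toNat * y ^ (s.2 + 1).toNat * (x ^ p.1.toNat * y ^ p.2.toNat) =
      x ^ (p.1 + s.1 + 1).toNat * y ^ (p.2 + s.2 + 1).toNat := by
    intro x y
    have e1 : (p.1 + s.1 + 1).toNat = (s.1 + 1).toNat + p.1.toNat := by omega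
    have e2 : (p.2 + s.2 + 1).toNat = (s.2 + 1).toNat + p.2.toNat := by omega
    rw [e1, e2, pow_add, pow_add]
    ring
  rw [key, key, key, key]
  have e : x ^ (p.1 + s.1 + 1).toNat * y ^ (p.2 + s.2 + 1).toNat -
      0 ^ (p.1 + s.1 + 1).toNat * y ^ (p.2 + s.2 + 1).toNat -
      x ^ (p.1 + s.1 + 1).toNat * 0 ^ (p.2 + s.2 + 1).toNat +
      0 ^ (p.1 + s.1 + 1).toNat * 0 ^ (p.2 + s.2 + 1).toNat =
      (x ^ (p.1 + s.1 + 1).toNat - 0 ^ (p.1 + s.1 + 1).toNat) *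
        (y ^ (p.2 + s.2 + 1).toNat - 0 ^ (p.2 + s.2 + 1).toNat) := by ring
  rw [e, pow_sub_zero_pow, pow_sub_zero_pow]
  simp only [Prod.fst_add, Prod.snd_add]
  by_cases c1 : 0 ≤ p.1 + s.1
  · rw [if_neg (show ¬(p.1 + s.1 + 1).toNat = 0 by omega)]
    by_cases c2 : 0 ≤ p.2 + s.2
    · rw [if_neg (show ¬(p.2 + s.2 + 1).toNat = 0 by omega), if_pos ⟨c1, c2⟩]
      have e1 : (p.1 + s.1 + 1).toNat = (p.1 + s.1).toNat + 1 := by omega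
      have e2 : (p.2 + s.2 + 1).toNat = (p.2 + s.2).toNat + 1 := by omega
      rw [e1, e2, pow_succ, pow_succ]
      ring
    · rw [if_pos (show (p.2 + s.2 + 1).toNat = 0 by omega), if_neg (fun h => c2 h.2), mul_zero,
        mul_zero]
  · rw [if_pos (show (p.1 + s.1 + 1).toNat = 0 by omega), if_neg (fun h => c1 h.1), mul_zero,
      zero_mul]

theorem card_walks_le (S : Finset (ℤ × ℤ)) (n : ℕ) : (walks S n).card ≤ S.card ^ n := by
  refine (Finset.card_filter_le _ _).trans ?_
  simp

theorem hasSum_endPoly (S : Finset (ℤ × ℤ)) (n : ℕ) (x y : ℂ) :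
    HasSum (fun p : ℕ × ℕ => (walkCount S p.1 p.2 n : ℂ) * x ^ p.1 * y ^ p.2) (endPoly S n x y) := by
  have h1 := hasSum_fintype (fun w : walks S n =>
    x ^ (∑ l, w.1 l).1.toNat * y ^ (∑ l, w.1 l).2.toNat)
  have h2 := h1.tsum_fiberwise (fun w : walks S n =>
    ((∑ l, w.1 l).1.toNat, (∑ l, w.1 l).2.toNat))
  rw [Finset.sum_coe_sort (walks S n) (fun w => x ^ (∑ l, w l).1.toNat * y ^ (∑ l, w l).2.toNat)] at h2
  refine h2.congr_fun ?_
  rintro ⟨i, j⟩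
  have e1 : ∀ b : ((fun w : walks S n => ((∑ l, w.1 l).1.toNat, (∑ l, w.1 l).2.toNat)) ⁻¹' {(i, j)}),
      x ^ (∑ l, b.1.1 l).1.toNat * y ^ (∑ l, b.1.1 l).2.toNat = x ^ i * y ^ j := by
    rintro ⟨b, hb⟩
    rw [Set.mem_preimage, Set.mem_singleton_iff, Prod.mk.injEq] at hb
    rw [hb.1, hb.2]
  rw [tsum_congr e1, tsum_const, nsmul_eq_mul, mul_assoc]
  congr 2
  rw [walkCount, ← Fintype.card_coe, ← Nat.card_eq_fintype_card]
  refine Nat.card_congr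
    { toFun := fun w => ⟨⟨w.1, ?_⟩, ?_⟩
      invFun := fun b => ⟨b.1.1, ?_⟩
      left_inv := fun w => rfl
      right_inv := fun b => rfl }
  · have := Finset.mem_filter.mp w.2
    exact Finset.mem_filter.mpr ⟨this.1, this.2.1⟩
  · have := (Finset.mem_filter.mp w.2).2.2
    rw [Set.mem_preimage, Set.mem_singleton_iff, this]
    simp
  · have h3 := Finset.mem_filter.mp b.1.2
    obtain ⟨h4, h5⟩ := h3.2.sum_nonneg
    have h6 := b.2
    rw [Set.mem_preimage, Set.mem_singleton_iff, Prod.mk.injEq] at h6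
    refine Finset.mem_filter.mpr ⟨h3.1, h3.2, Prod.ext ?_ ?_⟩
    · simp only [← h6.1]
      omega
    · simp only [← h6.2]
      omega

theorem norm_endPoly_le (S : Finset (ℤ × ℤ)) (n : ℕ) {x y : ℂ} (hx : ‖x‖ ≤ 1) (hy : ‖y‖ ≤ 1) :
    ‖endPoly S n x y‖ ≤ (S.card : ℝ) ^ n := by
  refine (norm_sum_le_of_le _ (n := fun _ => (1 : ℝ)) fun w _ => ?_).trans ?_
  · rw [norm_mul, norm_pow, norm_pow]
    exact mul_le_one₀ (pow_le_one₀ (norm_nonneg _) hx) (pow_nonneg (norm_nonneg _) _)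
      (pow_le_one₀ (norm_nonneg _) hy)
  · rw [Finset.sum_const, nsmul_eq_mul, mul_one]
    exact_mod_cast card_walks_le S n

theorem endPoly_zero (S : Finset (ℤ × ℤ)) (x y : ℂ) : endPoly S 0 x y = 1 := by
  have : walks S 0 = {fun i => i.elim0} := by
    ext w
    rw [Finset.mem_singleton]
    refine ⟨fun _ => funext fun i => i.elim0, ?_⟩
    rintro rfl
    exact Finset.mem_filter.mpr ⟨Fintype.mem_piFinset.mpr fun i => i.elim0, fun i => i.elim0⟩
  rw [endPoly, this]
  simp

section

variable {S : Finset (ℤ × ℤ)} {z : ℝ}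

theorem Model.summable_geometric (hm : Model S z) : Summable fun n : ℕ => (S.card : ℝ) ^ n * z ^ n := by
  have h1 : (fun n : ℕ => (S.card : ℝ) ^ n * z ^ n) = fun n => (z * S.card) ^ n := by
    ext n; rw [mul_pow, mul_comm]
  rw [h1]
  exact summable_geometric_of_lt_one (mul_nonneg hm.z_pos.le hm.card_pos.le) hm.z_mul_card

theorem norm_endPoly_mul_le (hz : 0 ≤ z) (n : ℕ) {x y : ℂ} (hx : ‖x‖ ≤ 1) (hy : ‖y‖ ≤ 1) :
    ‖endPoly S n x y * (z : ℂ) ^ n‖ ≤ (S.card : ℝ) ^ n * z ^ n := by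
  rw [norm_mul, norm_pow, Complex.norm_real, Real.norm_eq_abs, abs_of_nonneg hz]
  exact mul_le_mul_of_nonneg_right (norm_endPoly_le S n hx hy) (pow_nonneg hz n)

/-- The generating function as a power series in `z`. -/
theorem Q_eq_tsum (hm : Model S z) {x y : ℂ} (hx : ‖x‖ ≤ 1) (hy : ‖y‖ ≤ 1) :
    Q S z x y = ∑' n, endPoly S n x y * (z : ℂ) ^ n := by
  obtain ⟨f, hf⟩ : ∃ f : ℕ × (ℕ × ℕ) → ℂ, f = fun q =>
    (walkCount S q.2.1 q.2.2 q.1 : ℂ) * x ^ q.2.1 * y ^ q.2.2 * (z : ℂ) ^ q.1 := ⟨_, rfl⟩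
  have h1 : ∀ n, HasSum (fun p => f (n, p)) (endPoly S n x y * (z : ℂ) ^ n) := fun n => by
    have := (hasSum_endPoly S n x y).mul_right ((z : ℂ) ^ n)
    simp only [hf]
    exact this
  have hsum : Summable f := by
    have hn : 0 ≤ fun q => ‖f q‖ := fun q => norm_nonneg (f q)
    refine Summable.of_norm ?_
    refine (summable_prod_of_nonneg hn).mpr ⟨fun n => (h1 n).summable.norm, ?_⟩
    refine Summable.of_nonneg_of_le (fun n => tsum_nonneg fun p => norm_nonneg _) (fun n => ?_)
      hm.summable_geometric
    have h2 := Complex.hasSum_re (hasSum_endPoly S n ((‖x‖ : ℝ) : ℂ) ((‖y‖ : ℝ) : ℂ))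
    have h3 : HasSum (fun p : ℕ × ℕ => ‖f (n, p)‖)
        ((endPoly S n ((‖x‖ : ℝ) : ℂ) ((‖y‖ : ℝ) : ℂ)).re * z ^ n) := by
      have e : (fun p : ℕ × ℕ => ‖f (n, p)‖) = fun p : ℕ × ℕ =>
          ((walkCount S p.1 p.2 n : ℂ) * ((‖x‖ : ℝ) : ℂ) ^ p.1 * ((‖y‖ : ℝ) : ℂ) ^ p.2).re *
            z ^ n := by
        ext p
        simp only [hf, norm_mul, norm_pow, Complex.norm_natCast, Complex.norm_real,
          Real.norm_eq_abs, abs_of_pos hm.z_pos]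
        congr 1
        rw [← Complex.ofReal_pow, ← Complex.ofReal_pow, ← Complex.ofReal_natCast,
          ← Complex.ofReal_mul, ← Complex.ofReal_mul, Complex.ofReal_re]
      rw [e]
      exact h2.mul_right _
    rw [h3.tsum_eq]
    refine mul_le_mul_of_nonneg_right ?_ (pow_nonneg hm.z_pos.le n)
    exact (Complex.re_le_norm _).trans (norm_endPoly_le S n (by simpa using hx) (by simpa using hy))
  have h4 : Q S z x y = ∑' q, f q := by
    rw [Q, ← ((Equiv.prodComm ℕ (ℕ × ℕ)).trans (Equiv.prodAssoc ℕ ℕ ℕ)).tsum_eq, hf]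
    rfl
  rw [h4, hsum.tsum_prod]
  exact tsum_congr fun n => (h1 n).tsum_eq

theorem summable_endPoly (hm : Model S z) {x y : ℂ} (hx : ‖x‖ ≤ 1) (hy : ‖y‖ ≤ 1) :
    Summable fun n => endPoly S n x y * (z : ℂ) ^ n :=
  Summable.of_norm_bounded hm.summable_geometric
    fun n => norm_endPoly_mul_le hm.z_pos.le n hx hy

theorem hasSum_Q (hm : Model S z) {x y : ℂ} (hx : ‖x‖ ≤ 1) (hy : ‖y‖ ≤ 1) :
    HasSum (fun n => endPoly S n x y * (z : ℂ) ^ n) (Q S z x y) := by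
  rw [Q_eq_tsum hm hx hy]
  exact (summable_endPoly hm hx hy).hasSum

/-- The functional equation of the generating function. -/
theorem functional_equation (hm : Model S z) {x y : ℂ} (hx : ‖x‖ ≤ 1) (hy : ‖y‖ ≤ 1) :
    K S z x y * Q S z x y = K S z x 0 * Q S z x 0 + K S z 0 y * Q S z 0 y - K S z 0 0 * Q S z 0 0 -
      x * y := by
  have h0 : ‖(0 : ℂ)‖ ≤ 1 := by simp
  have h1 := hasSum_Q hm hx hy
  have h2 := (hasSum_nat_add_iff' 1).mpr h1
  simp only [Finset.range_one, Finset.sum_singleton, endPoly_zero, pow_zero, mul_one] at h2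
  have h3 := h2.mul_left (x * y)
  have h4 := ((((h1.mul_left (stepPoly S x y)).sub ((hasSum_Q hm h0 hy).mul_left
    (stepPoly S 0 y))).sub ((hasSum_Q hm hx h0).mul_left (stepPoly S x 0))).add
    ((hasSum_Q hm h0 h0).mul_left (stepPoly S 0 0))).mul_left (z : ℂ)
  have h5 := h3.unique (h4.congr_fun fun n => ?_)
  · simp only [K_eq_stepPoly]
    linear_combination -h5
  · have := endPoly_succ hm.small n x y
    rw [pow_succ]
    linear_combination (z : ℂ) ^ n * z * this

theorem differentiable_endPoly_left (n : ℕ) (y : ℂ) : Differentiable ℂ fun x => endPoly S n x y := by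
  unfold endPoly
  fun_prop

theorem differentiable_endPoly_right (n : ℕ) (x : ℂ) : Differentiable ℂ fun y => endPoly S n x y := by
  unfold endPoly
  fun_prop

/-- The lifted function `K(x, 0) Q(x, 0)` as a function of `x`. -/
noncomputable def Fx (S : Finset (ℤ × ℤ)) (z : ℝ) (x : ℂ) : ℂ := K S z x 0 * Q S z x 0

/-- The lifted function `K(0, y) Q(0, y)` as a function of `y`. -/
noncomputable def Fy (S : Finset (ℤ × ℤ)) (z : ℝ) (y : ℂ) : ℂ := K S z 0 y * Q S z 0 y

theorem Fx_analyticAt (hm : Model S z) {x : ℂ} (hx : ‖x‖ < 1) : AnalyticAt ℂ (Fx S z) x := by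
  have h1 : DifferentiableOn ℂ (fun x => ∑' n, endPoly S n x 0 * (z : ℂ) ^ n) (Metric.ball 0 1) :=
    Complex.differentiableOn_tsum_of_summable_norm hm.summable_geometric
      (fun n => ((differentiable_endPoly_left n 0).mul_const _).differentiableOn) Metric.isOpen_ball
      fun n w hw => norm_endPoly_mul_le hm.z_pos.le n (mem_ball_zero_iff.mp hw).le (by simp)
  have h2 : DifferentiableOn ℂ (fun x => Q S z x 0) (Metric.ball 0 1) :=
    h1.congr fun w hw => Q_eq_tsum hm (mem_ball_zero_iff.mp hw).le (by simp)
  have h3 : Differentiable ℂ fun x => K S z x 0 := by unfold K; fun_prop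
  exact (h3.differentiableOn.mul h2).analyticAt (Metric.isOpen_ball.mem_nhds
    (mem_ball_zero_iff.mpr hx))

theorem Fy_analyticAt (hm : Model S z) {y : ℂ} (hy : ‖y‖ < 1) : AnalyticAt ℂ (Fy S z) y := by
  have h1 : DifferentiableOn ℂ (fun y => ∑' n, endPoly S n 0 y * (z : ℂ) ^ n) (Metric.ball 0 1) :=
    Complex.differentiableOn_tsum_of_summable_norm hm.summable_geometric
      (fun n => ((differentiable_endPoly_right n 0).mul_const _).differentiableOn) Metric.isOpen_ball
      fun n w hw => norm_endPoly_mul_le hm.z_pos.le n (by simp) (mem_ball_zero_iff.mp hw).le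
  have h2 : DifferentiableOn ℂ (fun y => Q S z 0 y) (Metric.ball 0 1) :=
    h1.congr fun w hw => Q_eq_tsum hm (by simp) (mem_ball_zero_iff.mp hw).le
  have h3 : Differentiable ℂ fun y => K S z 0 y := by unfold K; fun_prop
  exact (h3.differentiableOn.mul h2).analyticAt (Metric.isOpen_ball.mem_nhds
    (mem_ball_zero_iff.mpr hy))

end

/-! ### Quasi-periodic extension of a meromorphic function from a strip -/

/-- The sum of `F` along the `n` steps of length `W` from `ω - n W` to `ω`. -/
noncomputable def shiftSum (W : ℝ) (F : ℂ → ℂ) : ℤ → ℂ → ℂ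
  | Int.ofNat n, ω => ∑ j ∈ Finset.range n, F (ω - ((j + 1 : ℕ) : ℂ) * W)
  | Int.negSucc m, ω => -∑ j ∈ Finset.range (m + 1), F (ω + (j : ℂ) * W)

theorem shiftSum_zero (W : ℝ) (F : ℂ → ℂ) (ω : ℂ) : shiftSum W F 0 ω = 0 :=
  Finset.sum_range_zero _

theorem shiftSum_succ (W : ℝ) (F : ℂ → ℂ) (n : ℤ) (ω : ℂ) :
    shiftSum W F (n + 1) (ω + W) = shiftSum W F n ω + F ω := by
  match n with
  | Int.ofNat n =>
    change ∑ j ∈ Finset.range (n + 1), F (ω + W - ((j + 1 : ℕ) : ℂ) * W) = _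
    rw [Finset.sum_range_succ']
    simp only [shiftSum]
    congr 1
    · refine Finset.sum_congr rfl fun j _ => ?_
      congr 1
      push_cast
      ring
    · congr 1
      push_cast
      ring
  | Int.negSucc 0 =>
    change shiftSum W F 0 _ = _
    rw [shiftSum_zero]
    simp [shiftSum]
  | Int.negSucc (m + 1) =>
    change shiftSum W F (Int.negSucc m) _ = _
    simp only [shiftSum]
    rw [Finset.sum_range_succ' _ (m + 1)]
    have : ∀ j : ℕ, ω + (W : ℂ) + j * W = ω + ((j + 1 : ℕ) : ℂ) * W := by
      intro j; push_cast; ring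
    simp only [this, Nat.cast_zero, zero_mul, add_zero]
    ring

theorem shiftSum_add {W : ℝ} {F : ℂ → ℂ} {l : ℂ} (hF : ∀ ω, F (ω + l) = F ω) (n : ℤ) (ω : ℂ) :
    shiftSum W F n (ω + l) = shiftSum W F n ω := by
  match n with
  | Int.ofNat n =>
    simp only [shiftSum, add_sub_right_comm, hF]
  | Int.negSucc m =>
    simp only [shiftSum, add_right_comm _ l, hF]

/-- A function on the strip `α ≤ Re ω < α + W` whose values on the boundary fit together up to `F`
extends to a meromorphic function `R` on the plane with `R(ω + W) = R(ω) + F(ω)`. -/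
theorem exists_quasiperiodic {W α : ℝ} (hW : 0 < W) {F k : ℂ → ℂ} (hF : Meromorphic F)
    (hin : ∀ p : ℂ, α < p.re → p.re < α + W → MeromorphicAt k p)
    (hbd : ∀ p : ℂ, p.re = α → ∃ G : ℂ → ℂ, MeromorphicAt G p ∧
      ∀ᶠ v in 𝓝 p, (α ≤ v.re → k v = G v) ∧ (v.re < α → k (v + W) - F v = G v)) {l : ℂ}
    (hl : l.re = 0) (hk : ∀ ω, k (ω + l) = k ω) (hFl : ∀ ω, F (ω + l) = F ω) :
    ∃ R : ℂ → ℂ, Meromorphic R ∧ (∀ ω, R (ω + W) = R ω + F ω) ∧ (∀ ω, R (ω + l) = R ω) ∧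
      ∀ ω : ℂ, α ≤ ω.re → ω.re < α + W → R ω = k ω := by
  set N : ℂ → ℤ := fun ω => ⌊(ω.re - α) / W⌋ with hN
  set R : ℂ → ℂ := fun ω => k (ω - N ω * W) + shiftSum W F (N ω) ω with hR
  have hN1 : ∀ ω : ℂ, N (ω + W) = N ω + 1 := by
    intro ω
    simp only [hN]
    rw [← Int.floor_add_one, Complex.add_re, Complex.ofReal_re]
    congr 1
    field_simp
    ring
  have hRW : ∀ ω, R (ω + W) = R ω + F ω := by
    intro ω
    simp only [hR, hN1, shiftSum_succ]
    rw [← add_assoc]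
    congr 3
    push_cast
    ring
  have hRl : ∀ ω, R (ω + l) = R ω := by
    intro ω
    have h1 : N (ω + l) = N ω := by simp only [hN, Complex.add_re, hl, add_zero]
    simp only [hR, h1, shiftSum_add hFl, add_sub_right_comm, hk]
  have hR0 : ∀ ω : ℂ, α ≤ ω.re → ω.re < α + W → R ω = k ω := by
    intro ω h1 h2
    have h3 : N ω = 0 := by
      simp only [hN]
      rw [Int.floor_eq_zero_iff]
      exact ⟨div_nonneg (by linarith) hW.le, (div_lt_one hW).mpr (by linarith)⟩
    simp only [hR, h3, shiftSum_zero]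
    simp
  have hbase : ∀ p : ℂ, α ≤ p.re → p.re < α + W → MeromorphicAt R p := by
    intro p h1 h2
    rcases h1.lt_or_eq with h1 | h1
    · refine (hin p h1 h2).congr (Filter.EventuallyEq.filter_mono ?_ nhdsWithin_le_nhds)
      have : ∀ᶠ v : ℂ in 𝓝 p, v.re ∈ Set.Ioo α (α + W) :=
        Complex.continuous_re.continuousAt.eventually (isOpen_Ioo.mem_nhds ⟨h1, h2⟩)
      filter_upwards [this] with v hv
      exact (hR0 v hv.1.le hv.2).symm
    · obtain ⟨G, hG, hGe⟩ := hbd p h1.symm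
      refine hG.congr (Filter.EventuallyEq.filter_mono ?_ nhdsWithin_le_nhds)
      have : ∀ᶠ v : ℂ in 𝓝 p, v.re ∈ Set.Ioo (α - W) (α + W) :=
        Complex.continuous_re.continuousAt.eventually
          (isOpen_Ioo.mem_nhds ⟨by linarith, by linarith⟩)
      filter_upwards [this, hGe] with v hv hvG
      rcases le_or_gt α v.re with h3 | h3
      · rw [hR0 v h3 hv.2, hvG.1 h3]
      · have h4 : (v + W).re = v.re + W := by simp
        have h5 := hRW v
        rw [hR0 (v + W) (by rw [h4]; linarith [hv.1]) (by rw [h4]; linarith)] at h5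
        rw [← hvG.2 h3, h5]
        ring
  -- translating by multiples of `W` reduces to the base strip
  have hup : ∀ p : ℂ, MeromorphicAt R p → MeromorphicAt R (p + W) := by
    intro p hp
    have h1 : ∀ v, R v = (R + F) (v - W) := by
      intro v
      rw [Pi.add_apply, ← hRW, sub_add_cancel]
    have h2 : MeromorphicAt (R + F) (p + W - W) := by
      rw [add_sub_cancel_right]; exact hp.add (hF p)
    have h3 := h2.comp_analyticAt (g := fun v => v - (W : ℂ)) (x := p + W) (by fun_prop)
    exact h3.congr (.of_forall fun v => (h1 v).symm)
  have hdown : ∀ p : ℂ, MeromorphicAt R p → MeromorphicAt R (p - W) := by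
    intro p hp
    have h1 : ∀ v, R v = R (v + W) - F v := fun v => by rw [hRW]; ring
    have h2 : MeromorphicAt R (p - W + W) := by rwa [sub_add_cancel]
    have h3 := h2.comp_analyticAt (g := fun v => v + (W : ℂ)) (x := p - W) (by fun_prop)
    exact (h3.sub (hF (p - W))).congr (.of_forall fun v => (h1 v).symm)
  have hupn : ∀ (n : ℕ) (p : ℂ), MeromorphicAt R p → MeromorphicAt R (p + n * W) := by
    intro n p hp
    induction n with
    | zero => simpa using hp
    | succ n ih =>
      have := hup _ ih
      convert this using 1
      push_cast
      ring
  have hdownn : ∀ (n : ℕ) (p : ℂ), MeromorphicAt R p → MeromorphicAt R (p - n * W) := by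
    intro n p hp
    induction n with
    | zero => simpa using hp
    | succ n ih =>
      have := hdown _ ih
      convert this using 1
      push_cast
      ring
  refine ⟨R, fun p => ?_, hRW, hRl, hR0⟩
  have hf1 : (N p : ℝ) * W ≤ p.re - α := (le_div_iff₀ hW).mp (Int.floor_le _)
  have hf2 : p.re - α < (N p + 1) * W := (div_lt_iff₀ hW).mp (Int.lt_floor_add_one _)
  have hre : (p - N p * W).re = p.re - N p * W := by simp
  have hq := hbase (p - N p * W) (by rw [hre]; linarith) (by rw [hre]; linarith)
  generalize N p = m at hq
  obtain ⟨n, rfl | rfl⟩ := m.eq_nat_or_neg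
  · have := hupn n _ hq
    rwa [Int.cast_natCast, sub_add_cancel] at this
  · have := hdownn n _ hq
    rwa [Int.cast_neg, Int.cast_natCast, neg_mul, sub_neg_eq_add, add_sub_cancel_right] at this

/-! ### The coordinate `y` on the universal covering -/

namespace Curve

variable {S : Finset (ℤ × ℤ)} {z : ℝ} {L : PeriodPair} {A B g h ν s g' h' ν' s' : ℝ}

theorem yCov_eq (k : Curve S z L A B (ω₃ S z) g h ν s g' h' ν' s') (ω : ℂ) :
    yCov S z ω = xCov (transpose S) z (ω - ω₃ S z / 2) := by
  have : wp S z = wp (transpose S) z := by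
    ext1 v
    by_cases hv : v ∈ L.lattice
    · rw [k.u.wp_of_mem _ hv, k.u'.wp_of_mem _ hv]
    · rw [k.u.wp_of_notMem _ hv, k.u'.wp_of_notMem _ hv]
  rw [yCov, xCov, this]

theorem yVal_eq (k : Curve S z L A B (ω₃ S z) g h ν s g' h' ν' s') (ω : ℂ) :
    yVal S z ω = xVal (transpose S) z (ω - ω₃ S z / 2) := by
  rw [yVal, k.yCov_eq, xVal]

theorem yVal_coe {ω : ℂ} (hy : yCov S z ω ≠ OnePoint.infty) :
    (yVal S z ω : OnePoint ℂ) = yCov S z ω := coe_finVal hy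

theorem yCov_add (k : Curve S z L A B (ω₃ S z) g h ν s g' h' ν' s') {l : ℂ} (hl : l ∈ L.lattice)
    (ω : ℂ) : yCov S z (ω + l) = yCov S z ω := by
  rw [k.yCov_eq, k.yCov_eq, add_sub_right_comm, k.u'.xCov_add hl]

theorem yVal_add (k : Curve S z L A B (ω₃ S z) g h ν s g' h' ν' s') {l : ℂ} (hl : l ∈ L.lattice)
    (ω : ℂ) : yVal S z (ω + l) = yVal S z ω := by rw [yVal, k.yCov_add hl, yVal]

theorem period₂_mem (k : Curve S z L A B (ω₃ S z) g h ν s g' h' ν' s') : (B : ℂ) ∈ L.lattice := by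
  rw [← k.u.rect.per₂]; exact L.ω₂_mem_lattice

theorem xCov_reflect (k : Curve S z L A B (ω₃ S z) g h ν s g' h' ν' s') (ω : ℂ) :
    xCov S z (B - ω) = xCov S z ω := by
  rw [← k.u.xCov_neg, neg_sub, ← k.u.xCov_add k.period₂_mem, sub_add_cancel]

theorem xVal_reflect (k : Curve S z L A B (ω₃ S z) g h ν s g' h' ν' s') (ω : ℂ) :
    xVal S z (B - ω) = xVal S z ω := by rw [xVal, k.xCov_reflect, xVal]

theorem yCov_reflect (k : Curve S z L A B (ω₃ S z) g h ν s g' h' ν' s') (ω : ℂ) :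
    yCov S z (B - ω) = yCov S z (ω + ω₃ S z) := by
  rw [k.yCov_eq, k.yCov_eq, ← k.u'.xCov_neg, ← k.u'.xCov_add k.period₂_mem]
  congr 1
  ring

theorem yVal_reflect (k : Curve S z L A B (ω₃ S z) g h ν s g' h' ν' s') (ω : ℂ) :
    yVal S z (B - ω) = yVal S z (ω + ω₃ S z) := by rw [yVal, k.yCov_reflect, yVal]

theorem yVal_xiHat (k : Curve S z L A B (ω₃ S z) g h ν s g' h' ν' s') (ω : ℂ) :
    yVal S z (xiHat S z ω) = yVal S z (ω + ω₃ S z) := by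
  have hl : ω₁ S z ∈ L.lattice := by rw [k.u.per₁]; exact L.ω₁_mem_lattice
  rw [← k.yVal_reflect, ← k.yVal_add hl (B - ω), xiHat, k.u.per₂]
  congr 1
  ring

theorem fy_eq (k : Curve S z L A B (ω₃ S z) g h ν s g' h' ν' s') (ω : ℂ) :
    fy S z ω = xVal S z ω * (yVal S z (ω + ω₃ S z) - yVal S z ω) := by rw [fy, k.yVal_xiHat]

theorem yVal_meromorphic (k : Curve S z L A B (ω₃ S z) g h ν s g' h' ν' s') :
    Meromorphic (yVal S z) := by
  have := meromorphic_comp_add k.u'.xVal_meromorphic (-(ω₃ S z / 2 : ℂ))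
  refine fun v => (this v).congr (.of_forall fun w => ?_)
  rw [k.yVal_eq, sub_eq_add_neg]

theorem yVal_analyticAt (k : Curve S z L A B (ω₃ S z) g h ν s g' h' ν' s') {ω : ℂ}
    (hy : yCov S z ω ≠ OnePoint.infty) : AnalyticAt ℂ (yVal S z) ω := by
  rw [k.yCov_eq] at hy
  have := (k.u'.xVal_analyticAt hy).comp (f := fun v : ℂ => v - ω₃ S z / 2) (by fun_prop)
  exact this.congr (.of_forall fun w => (k.yVal_eq w).symm)

theorem yCov_continuous (k : Curve S z L A B (ω₃ S z) g h ν s g' h' ν' s') :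
    Continuous (yCov S z) := k.y_continuous.congr fun ω => (k.yCov_eq ω).symm

theorem fy_meromorphic (k : Curve S z L A B (ω₃ S z) g h ν s g' h' ν' s') :
    Meromorphic (fy S z) := fun v =>
  ((k.u.xVal_meromorphic v).mul ((meromorphic_comp_add k.yVal_meromorphic _ v).sub
    (k.yVal_meromorphic v))).congr (.of_forall fun w => (k.fy_eq w).symm)

theorem fy_add (k : Curve S z L A B (ω₃ S z) g h ν s g' h' ν' s') {l : ℂ} (hl : l ∈ L.lattice)
    (ω : ℂ) : fy S z (ω + l) = fy S z ω := by
  rw [k.fy_eq, k.fy_eq, k.u.xVal_add hl, k.yVal_add hl, add_right_comm, k.yVal_add hl]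

/-! ### Continuation of the lifted generating functions -/

/-- The lifting of `K(x, 0) Q(x, 0)` to the set where `|x| < 1` or `|y| < 1`; on the part where
`|y| < 1`, it is given by the functional equation. -/
noncomputable def baseLift (S : Finset (ℤ × ℤ)) (z : ℝ) (ω : ℂ) : ℂ :=
  open Classical in
  if xCov S z ω ∈ unitDisc then Fx S z (xVal S z ω)
  else K S z 0 0 * Q S z 0 0 + xVal S z ω * yVal S z ω - Fy S z (yVal S z ω)

theorem baseLift_of_x {ω : ℂ} (hx : xCov S z ω ∈ unitDisc) :
    baseLift S z ω = Fx S z (xVal S z ω) := if_pos hx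

theorem norm_xVal_lt {ω : ℂ} (hx : xCov S z ω ∈ unitDisc) : ‖xVal S z ω‖ < 1 := by
  rwa [← coe_mem_unitDisc, Unif.xVal_coe S z (ne_infty_of_mem_unitDisc hx)]

theorem norm_yVal_lt {ω : ℂ} (hy : yCov S z ω ∈ unitDisc) : ‖yVal S z ω‖ < 1 := by
  rwa [← coe_mem_unitDisc, yVal_coe (ne_infty_of_mem_unitDisc hy)]

theorem baseLift_of_y (k : Curve S z L A B (ω₃ S z) g h ν s g' h' ν' s') {ω : ℂ}
    (hy : yCov S z ω ∈ unitDisc) : baseLift S z ω =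
      K S z 0 0 * Q S z 0 0 + xVal S z ω * yVal S z ω - Fy S z (yVal S z ω) := by
  unfold baseLift
  split_ifs with hx
  · have h1 := functional_equation k.u.model (norm_xVal_lt hx).le (norm_yVal_lt hy).le
    have h2 := k.K_eq_zero ω (ne_infty_of_mem_unitDisc hx)
      (by rw [← k.yCov_eq]; exact ne_infty_of_mem_unitDisc hy)
    rw [← k.yVal_eq] at h2
    rw [h2, zero_mul] at h1
    rw [Fx, Fy]
    linear_combination -h1
  · rfl

theorem Fx_comp_analyticAt (k : Curve S z L A B (ω₃ S z) g h ν s g' h' ν' s') {p : ℂ}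
    (hx : xCov S z p ∈ unitDisc) : AnalyticAt ℂ (fun ω => Fx S z (xVal S z ω)) p :=
  (Fx_analyticAt k.u.model (norm_xVal_lt hx)).comp
    (k.u.xVal_analyticAt (ne_infty_of_mem_unitDisc hx))

theorem Fy_comp_analyticAt (k : Curve S z L A B (ω₃ S z) g h ν s g' h' ν' s') {p : ℂ}
    (hy : yCov S z p ∈ unitDisc) : AnalyticAt ℂ (fun ω => Fy S z (yVal S z ω)) p :=
  (Fy_analyticAt k.u.model (norm_yVal_lt hy)).comp
    (k.yVal_analyticAt (ne_infty_of_mem_unitDisc hy))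

theorem baseLift_meromorphicAt (k : Curve S z L A B (ω₃ S z) g h ν s g' h' ν' s') {p : ℂ}
    (hp : p ∈ strip B (ω₃ S z)) : MeromorphicAt (baseLift S z) p := by
  rcases k.mem_or_mem hp with hx | hy
  · refine (k.Fx_comp_analyticAt hx).meromorphicAt.congr
      (Filter.EventuallyEq.filter_mono ?_ nhdsWithin_le_nhds)
    filter_upwards [k.u.xCov_continuous.continuousAt.eventually (isOpen_unitDisc.mem_nhds hx)]
      with v hv
    exact (baseLift_of_x hv).symm
  · rw [← k.yCov_eq] at hy
    refine (((MeromorphicAt.const (K S z 0 0 * Q S z 0 0) p).add ((k.u.xVal_meromorphic p).mul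
      (k.yVal_meromorphic p))).sub (k.Fy_comp_analyticAt hy).meromorphicAt).congr
      (Filter.EventuallyEq.filter_mono ?_ nhdsWithin_le_nhds)
    filter_upwards [k.yCov_continuous.continuousAt.eventually (isOpen_unitDisc.mem_nhds hy)]
      with v hv
    exact (k.baseLift_of_y hv).symm

theorem y_mem_of_re (k : Curve S z L A B (ω₃ S z) g h ν s g' h' ν' s') {ω : ℂ}
    (hω : ω.re = (B + ω₃ S z) / 2) : yCov S z ω ∈ unitDisc := by
  rw [k.yCov_eq]; exact k.y_mem_of_right hω

/-- The continuation, before it is compared with the lifting on the whole of `Δ_x` and `Δ_y`. -/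
theorem exists_lift (k : Curve S z L A B (ω₃ S z) g h ν s g' h' ν' s') :
    ∃ R : ℂ → ℂ, Meromorphic R ∧
      (∀ ω, R (ω + ω₃ S z) =
        R ω + yVal S z (ω + ω₃ S z) * (xVal S z (ω + ω₃ S z) - xVal S z ω)) ∧
      (∀ ω, R (ω + L.ω₁) = R ω) ∧
      (∀ p : ℂ, p.re = B / 2 → ∀ᶠ v in 𝓝 p, R v = Fx S z (xVal S z v)) ∧
      ∀ p : ℂ, p.re = (B + ω₃ S z) / 2 → ∀ᶠ v in 𝓝 p, R v =
        K S z 0 0 * Q S z 0 0 + xVal S z v * yVal S z v - Fy S z (yVal S z v) := by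
  have hW := k.W_pos
  have hWB := k.W_lt
  set W := ω₃ S z with hWdef
  set c := K S z 0 0 * Q S z 0 0 with hc
  have hB := k.u.rect.posB
  have hl := L.ω₁_mem_lattice
  have hlre : L.ω₁.re = 0 := by rw [k.u.rect.per₁]; simp
  have hre : ∀ p : ℂ, ((B : ℂ) - p).re = B - p.re := fun p => by simp
  have hreW : ∀ p : ℂ, (p + (W : ℂ)).re = p.re + W := fun p => by simp
  -- the lift on the strip `0 ≤ 2 Re ω - ω₂ ≤ ω₃`, extended by the reflection
  -- `ω ↦ ω₂ - ω`, under which `x` is invariant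
  let H : ℂ → ℂ := fun ω => if B / 2 ≤ ω.re then baseLift S z ω else baseLift S z (B - ω)
  have H1 : ∀ ω : ℂ, B / 2 ≤ ω.re → H ω = baseLift S z ω := fun ω h => if_pos h
  have H2 : ∀ ω : ℂ, ω.re < B / 2 → H ω = baseLift S z (B - ω) := fun ω h => if_neg h.not_ge
  have hmem : ∀ {p : ℂ} {a b : ℝ}, a < p.re → p.re < b → ∀ᶠ v in 𝓝 p, v.re ∈ Set.Ioo a b :=
    fun h1 h2 => Complex.continuous_re.continuousAt.eventually (isOpen_Ioo.mem_nhds ⟨h1, h2⟩)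
  have Hx : ∀ v : ℂ, xCov S z v ∈ unitDisc → H v = Fx S z (xVal S z v) := by
    intro v hv
    rcases le_or_gt (B / 2) v.re with h | h
    · rw [H1 v h, baseLift_of_x hv]
    · rw [H2 v h, baseLift_of_x (by rwa [k.xCov_reflect]), k.xVal_reflect]
  have Hy : ∀ v : ℂ, v.re < B / 2 → yCov S z (v + W) ∈ unitDisc →
      H v = c + xVal S z v * yVal S z (v + W) - Fy S z (yVal S z (v + W)) := by
    intro v h1 h2
    rw [H2 v h1, k.baseLift_of_y (by rwa [k.yCov_reflect]), k.xVal_reflect, k.yVal_reflect]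
  have hxhalf : ∀ p : ℂ, p.re = B / 2 → ∀ᶠ v in 𝓝 p, xCov S z v ∈ unitDisc := fun p hp =>
    k.u.xCov_continuous.continuousAt.eventually
      (isOpen_unitDisc.mem_nhds (k.u.mem_unitDisc_of_re_half 0 (by simpa using hp)))
  have hyhalf : ∀ p : ℂ, p.re = (B + W) / 2 → ∀ᶠ v in 𝓝 p, yCov S z v ∈ unitDisc := fun p hp =>
    k.yCov_continuous.continuousAt.eventually (isOpen_unitDisc.mem_nhds (k.y_mem_of_re hp))
  have htr : ∀ (p : ℂ) {P : ℂ → Prop}, (∀ᶠ v in 𝓝 (p + (W : ℂ)), P v) →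
      ∀ᶠ v in 𝓝 p, P (v + W) := fun p P h =>
    ((continuous_id.add continuous_const).tendsto p).eventually h
  -- on the left side `Re ω = (ω₂ - ω₃) / 2` of the double strip the two expressions by `F_y` match
  obtain ⟨R, hR1, hR2, hR3, hR4⟩ := exists_quasiperiodic (W := W) (α := (B - W) / 2) hW
    (F := fun ω => yVal S z (ω + W) * (xVal S z (ω + W) - xVal S z ω)) (k := H)
    (fun v => (meromorphic_comp_add k.yVal_meromorphic _ v).mul
      ((meromorphic_comp_add k.u.xVal_meromorphic _ v).sub (k.u.xVal_meromorphic v))) (by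
      intro p h1 h2
      rcases lt_trichotomy p.re (B / 2) with h3 | h3 | h3
      · have h4 : MeromorphicAt (baseLift S z) (B - p) :=
          k.baseLift_meromorphicAt (mem_strip.mpr (by rw [hre]; constructor <;> linarith))
        refine (h4.comp_analyticAt (g := fun v => (B : ℂ) - v) (x := p) (by fun_prop)).congr
          (Filter.EventuallyEq.filter_mono ?_ nhdsWithin_le_nhds)
        filter_upwards [hmem h1 h3] with v hv
        exact (H2 v hv.2).symm
      · have h4 : xCov S z p ∈ unitDisc := (hxhalf p h3).self_of_nhds
        refine (k.Fx_comp_analyticAt h4).meromorphicAt.congr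
          (Filter.EventuallyEq.filter_mono ?_ nhdsWithin_le_nhds)
        filter_upwards [hxhalf p h3] with v hv
        exact (Hx v hv).symm
      · have h4 : MeromorphicAt (baseLift S z) p :=
          k.baseLift_meromorphicAt (mem_strip.mpr (by constructor <;> linarith))
        refine h4.congr (Filter.EventuallyEq.filter_mono ?_ nhdsWithin_le_nhds)
        filter_upwards [hmem h3 h2] with v hv
        exact (H1 v hv.1.le).symm) (by
      intro p hp
      have hpW : (p + (W : ℂ)).re = (B + W) / 2 := by rw [hreW, hp]; ring
      have hev := htr p (hyhalf _ hpW)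
      refine ⟨fun v => c + xVal S z v * yVal S z (v + W) - Fy S z (yVal S z (v + W)), ?_, ?_⟩
      · refine ((MeromorphicAt.const c p).add ((k.u.xVal_meromorphic p).mul
          (meromorphic_comp_add k.yVal_meromorphic _ p))).sub ?_
        exact ((k.Fy_comp_analyticAt (k.y_mem_of_re hpW)).comp (f := fun v : ℂ => v + W)
          (by fun_prop)).meromorphicAt
      · filter_upwards [hev, hmem (p := p) (a := B / 2 - W) (b := B / 2) (by linarith)
          (by linarith)] with v hv hvre
        refine ⟨fun _ => Hy v hvre.2 hv, fun _ => ?_⟩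
        rw [H1 _ (by rw [hreW]; linarith [hvre.1]), k.baseLift_of_y hv]
        ring) (l := L.ω₁) hlre (by
      intro ω
      have e1 : ∀ v, xCov S z (v + L.ω₁) = xCov S z v := k.u.xCov_add hl
      have e2 : ∀ v, baseLift S z (v + L.ω₁) = baseLift S z v := by
        intro v
        unfold baseLift
        rw [k.u.xVal_add hl, k.yVal_add hl]
        by_cases hv : xCov S z v ∈ unitDisc
        · rw [if_pos hv, if_pos (by rwa [e1])]
        · rw [if_neg hv, if_neg (by rwa [e1])]
      have e3 : baseLift S z (B - (ω + L.ω₁)) = baseLift S z (B - ω) := by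
        rw [← e2]; congr 1; ring
      simp only [H, Complex.add_re, hlre, add_zero, e2, e3]) (by
      intro ω
      simp only [add_right_comm ω L.ω₁, k.u.xVal_add hl, k.yVal_add hl])
  refine ⟨R, hR1, hR2, hR3, ?_, ?_⟩
  · intro p hp
    filter_upwards [hxhalf p hp, hmem (p := p) (a := (B - W) / 2) (b := (B - W) / 2 + W)
      (by linarith) (by linarith)] with v hv hvre
    rw [hR4 v hvre.1.le hvre.2, Hx v hv]
  · intro p hp
    filter_upwards [hyhalf p hp, hmem (p := p) (a := B / 2) (b := B / 2 + W)
      (by linarith) (by linarith)] with v hv hvre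
    have hvre' : (v - (W : ℂ)).re = v.re - W := by simp
    rcases lt_or_ge v.re ((B - W) / 2 + W) with h3 | h3
    · rw [hR4 v (by linarith [hvre.1]) h3, H1 v hvre.1.le, k.baseLift_of_y hv]
    · have h4 := hR2 (v - W)
      rw [sub_add_cancel, hR4 (v - W) (by rw [hvre']; linarith) (by rw [hvre']; linarith [hvre.2]),
        Hy (v - W) (by rw [hvre']; linarith [hvre.2]) (by rwa [sub_add_cancel]), sub_add_cancel] at h4
      rw [h4]
      ring

end Curve

namespace Unif

variable {S : Finset (ℤ × ℤ)} {z : ℝ} {L : PeriodPair} {A B g h ν s : ℝ}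

/-- The part of the strip `0 < Re ω < ω₂` with `|x(ω)| < 1` near whose points `R` is not the lifting
of `Φ`. -/
def badSet (S : Finset (ℤ × ℤ)) (z B : ℝ) (Φ R : ℂ → ℂ) : Set ℂ :=
  {p | 0 < p.re ∧ p.re < B ∧ xCov S z p ∈ unitDisc ∧ ¬ R =ᶠ[𝓝[≠] p] fun ω => Φ (xVal S z ω)}

theorem badSet_add (u : Unif S z L A B g h ν s) {Φ R : ℂ → ℂ} (hper : ∀ ω, R (ω + L.ω₁) = R ω)
    {p : ℂ} (hp : p + L.ω₁ ∈ badSet S z B Φ R) : p ∈ badSet S z B Φ R := by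
  have hlre : L.ω₁.re = 0 := by rw [u.rect.per₁]; simp
  obtain ⟨h1, h2, h3, h4⟩ := hp
  rw [Complex.add_re, hlre, add_zero] at h1 h2
  rw [u.xCov_add L.ω₁_mem_lattice] at h3
  refine ⟨h1, h2, h3, fun h5 => h4 ?_⟩
  have h6 := tendsto_punctured_add (p + L.ω₁) (-L.ω₁)
  rw [add_neg_cancel_right] at h6
  filter_upwards [h6.eventually h5] with v hv
  rw [← hper, ← u.xVal_add L.ω₁_mem_lattice, neg_add_cancel_right] at hv
  exact hv

/-- By periodicity a bad point can be moved to `0 ≤ Im ω ≤ |ω₁|`. -/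
theorem exists_badSet (u : Unif S z L A B g h ν s) {Φ R : ℂ → ℂ} (hper : ∀ ω, R (ω + L.ω₁) = R ω)
    {p : ℂ} (hp : p ∈ badSet S z B Φ R) : ∃ q ∈ badSet S z B Φ R, q.im ∈ Set.Icc 0 A ∧
      xCov S z q = xCov S z p := by
  have hA := u.rect.posA
  have hup : ∀ q ∈ badSet S z B Φ R, q + L.ω₁ ∈ badSet S z B Φ R := by
    intro q hq
    by_contra hc
    have hlre : L.ω₁.re = 0 := by rw [u.rect.per₁]; simp
    obtain ⟨h1, h2, h3, h4⟩ := hq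
    refine h4 ?_
    have h5 : R =ᶠ[𝓝[≠] (q + L.ω₁)] fun ω => Φ (xVal S z ω) := by
      by_contra h5
      exact hc ⟨by simpa [hlre] using h1, by simpa [hlre] using h2,
        by rwa [u.xCov_add L.ω₁_mem_lattice], h5⟩
    filter_upwards [(tendsto_punctured_add q L.ω₁).eventually h5] with v hv
    rwa [hper, u.xVal_add L.ω₁_mem_lattice] at hv
  have hupn : ∀ (n : ℕ) (q : ℂ), q ∈ badSet S z B Φ R → q + n * L.ω₁ ∈ badSet S z B Φ R := by
    intro n q hq
    induction n with
    | zero => simpa using hq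
    | succ n ih =>
      have := hup _ ih
      convert this using 1
      push_cast
      ring
  have hdown : ∀ (n : ℕ) (q : ℂ), q ∈ badSet S z B Φ R → q - n * L.ω₁ ∈ badSet S z B Φ R := by
    intro n q hq
    induction n with
    | zero => simpa using hq
    | succ n ih =>
      refine u.badSet_add hper ?_
      convert ih using 1
      push_cast
      ring
  have hz : ∀ (n : ℤ) (q : ℂ), q ∈ badSet S z B Φ R → q - n * L.ω₁ ∈ badSet S z B Φ R := by
    intro n q hq
    obtain ⟨m, rfl | rfl⟩ := n.eq_nat_or_neg
    · simpa using hdown m q hq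
    · simpa using hupn m q hq
  refine ⟨p - ⌊p.im / A⌋ * L.ω₁, hz _ _ hp, ?_, ?_⟩
  · have him : (p - ⌊p.im / A⌋ * L.ω₁).im = p.im - ⌊p.im / A⌋ * A := by
      rw [u.rect.per₁]; simp
    have hf1 : (⌊p.im / A⌋ : ℝ) * A ≤ p.im := (le_div_iff₀ hA).mp (Int.floor_le _)
    have hf2 : p.im < (⌊p.im / A⌋ + 1) * A := (div_lt_iff₀ hA).mp (Int.lt_floor_add_one _)
    rw [him]
    constructor <;> linarith
  · rw [sub_eq_add_neg]
    refine u.xCov_add (neg_mem ?_) p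
    have := L.lattice.smul_mem ⌊p.im / A⌋ L.ω₁_mem_lattice
    rwa [zsmul_eq_mul] at this

/-- The image of the bad set under `x` is open and closed in the unit disc; as it does not contain
`x₁`, it is empty. -/
theorem eventuallyEq_lift (u : Unif S z L A B g h ν s) {Φ R : ℂ → ℂ}
    (hΦ : ∀ x : ℂ, ‖x‖ < 1 → AnalyticAt ℂ Φ x) (hR : Meromorphic R)
    (hper : ∀ ω, R (ω + L.ω₁) = R ω)
    (hhalf : ∀ p : ℂ, p.re = B / 2 → R =ᶠ[𝓝[≠] p] fun ω => Φ (xVal S z ω)) {p : ℂ}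
    (hp0 : 0 < p.re) (hpB : p.re < B) (hp : xCov S z p ∈ unitDisc) :
    R =ᶠ[𝓝[≠] p] fun ω => Φ (xVal S z ω) := by
  have hB := u.rect.posB
  have hxc := u.xCov_continuous
  by_contra hbad
  have hnorm : ∀ {q : ℂ}, xCov S z q ∈ unitDisc → ‖xVal S z q‖ < 1 := fun {q} hq => by
    rwa [← coe_mem_unitDisc, xVal_coe S z (ne_infty_of_mem_unitDisc hq)]
  have key : Metric.ball (0 : ℂ) 1 ⊆ {v | ∃ q ∈ badSet S z B Φ R, xCov S z q = v} := by
    refine subset_of_relClopen (convex_ball (0 : ℂ) 1).isPreconnected ?_ ?_ ?_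
    · intro v hv hvc
      -- the bad points can be taken in a compact rectangle
      have hsub : {v : ℂ | ∃ q ∈ badSet S z B Φ R, xCov S z q = v} ⊆
          {v : ℂ | (v : OnePoint ℂ) ∈ xCov S z '' closure (badSet S z B Φ R ∩
            (Set.Icc 0 B ×ℂ Set.Icc 0 A))} := by
        rintro v ⟨q, hq, hqv⟩
        obtain ⟨q', hq', him, hqq⟩ := u.exists_badSet hper hq
        exact ⟨q', subset_closure ⟨hq', ⟨hq'.1.le, hq'.2.1.le⟩, him⟩, by rw [hqq, hqv]⟩
      have hcpt : IsCompact (closure (badSet S z B Φ R ∩ (Set.Icc 0 B ×ℂ Set.Icc 0 A))) :=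
        (isCompact_Icc.reProdIm isCompact_Icc).closure_of_subset Set.inter_subset_right
      have hcl : IsClosed {v : ℂ | (v : OnePoint ℂ) ∈ xCov S z '' closure (badSet S z B Φ R ∩
          (Set.Icc 0 B ×ℂ Set.Icc 0 A))} :=
        (hcpt.image hxc).isClosed.preimage OnePoint.continuous_coe
      obtain ⟨q, hq, hqv⟩ := closure_minimal hsub hcl hvc
      have hqd : xCov S z q ∈ unitDisc := by
        rw [hqv, coe_mem_unitDisc]; exact mem_ball_zero_iff.mp hv
      have hqR : q.re ∈ Set.Icc 0 B := by
        have h1 : q ∈ closure (Complex.re ⁻¹' Set.Icc 0 B) :=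
          closure_mono (fun w hw => hw.2.1) hq
        rwa [(isClosed_Icc.preimage Complex.continuous_re).closure_eq] at h1
      have hq0 : q.re ≠ 0 := fun h0 =>
        u.notMem_unitDisc_of_re_zero 0 (by simpa using h0) (unitDisc_subset hqd)
      have hq1 : q.re ≠ B := fun h0 =>
        u.notMem_unitDisc_of_re_zero 1 (by simpa using h0) (unitDisc_subset hqd)
      refine ⟨q, ⟨hqR.1.lt_of_ne hq0.symm, hqR.2.lt_of_ne hq1, hqd, fun hgood => ?_⟩, hqv⟩
      have h2 : ∀ᶠ w in 𝓝 q, R =ᶠ[𝓝[≠] w] fun ω => Φ (xVal S z ω) := by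
        have h3 := eventually_eventually_nhdsWithin.mpr hgood
        rw [eventually_nhdsWithin_iff] at h3
        filter_upwards [h3] with w hw
        by_cases hwq : w = q
        · rw [hwq]; exact hgood
        · have h4 := hw hwq
          rw [nhdsWithin_eq_nhds.mpr (isOpen_compl_singleton.mem_nhds hwq)] at h4
          exact h4.filter_mono nhdsWithin_le_nhds
      obtain ⟨w, hw1, hw2⟩ := (mem_closure_iff_frequently.mp hq).and_eventually h2 |>.exists
      exact hw1.1.2.2.2 hw2
    -- the bad set is open, since meromorphic functions that differ near a point differ at all points
    -- of a punctured neighborhood, and `x` is an open mapping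
    · rintro v hv ⟨q, ⟨h1, h2, h3, h4⟩, hqv⟩
      have hqx : xCov S z q ≠ OnePoint.infty := ne_infty_of_mem_unitDisc h3
      have h5 : MeromorphicAt (fun ω => Φ (xVal S z ω)) q :=
        ((hΦ _ (hnorm h3)).comp (u.xVal_analyticAt hqx)).meromorphicAt
      have h6 : ∀ᶠ w in 𝓝[≠] q, R w ≠ Φ (xVal S z w) := by
        by_contra hc
        exact h4 (((hR q).frequently_eq_iff_eventuallyEq h5).mp hc)
      have h7 : ∀ᶠ w in 𝓝 q, ¬ R =ᶠ[𝓝[≠] w] fun ω => Φ (xVal S z ω) := by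
        have h8 := eventually_eventually_nhdsWithin.mpr h6
        rw [eventually_nhdsWithin_iff] at h8
        filter_upwards [h8] with w hw hcon
        by_cases hwq : w = q
        · rw [hwq] at hcon; exact h4 hcon
        · have h9 := hw hwq
          rw [nhdsWithin_eq_nhds.mpr (isOpen_compl_singleton.mem_nhds hwq)] at h9
          obtain ⟨w', hw'1, hw'2⟩ := (hcon.and (h9.filter_mono nhdsWithin_le_nhds)).exists
          exact hw'2 hw'1
      have h8 : ∀ᶠ w in 𝓝 q, w ∈ badSet S z B Φ R ∧ xCov S z w ≠ OnePoint.infty := by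
        have h9 : ∀ᶠ w : ℂ in 𝓝 q, w.re ∈ Set.Ioo 0 B :=
          Complex.continuous_re.continuousAt.eventually (isOpen_Ioo.mem_nhds ⟨h1, h2⟩)
        filter_upwards [h7, h9, hxc.continuousAt.eventually (isOpen_unitDisc.mem_nhds h3),
          u.eventually_ne_infty_nhds hqx] with w hw1 hw2 hw3 hw4
        exact ⟨⟨hw2.1, hw2.2, hw3, hw1⟩, hw4⟩
      have h9 := u.nhds_le_map hqx
      rw [xVal_eq_of_coe hqv] at h9
      refine nhdsWithin_le_nhds (h9 ?_)
      rw [Filter.mem_map]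
      filter_upwards [h8] with w hw
      exact ⟨w, hw.1, (xVal_coe S z hw.2).symm⟩
    · exact ⟨xVal S z p, mem_ball_zero_iff.mpr (hnorm hp), p, ⟨hp0, hpB, hp, hbad⟩,
        (xVal_coe S z (ne_infty_of_mem_unitDisc hp)).symm⟩
  -- the value `x₁` is only taken on the line `Re ω = ω₂ / 2`, where there are no bad points
  have hx1 : xCov S z (L.ω₂ / 2) ∈ unitDisc :=
    u.mem_unitDisc_of_re_half 0 (by rw [u.rect.half₂]; simp)
  rw [u.xCov_half₂, coe_mem_unitDisc] at hx1
  obtain ⟨q, ⟨h1, h2, -, h4⟩, hq⟩ := key (mem_ball_zero_iff.mpr hx1)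
  rw [← u.xCov_half₂, u.xCov_eq_iff, u.rect.mem_iff, u.rect.mem_iff, u.rect.half₂] at hq
  refine h4 (hhalf q ?_)
  simp only [Complex.sub_re, Complex.add_re, Complex.ofReal_re] at hq
  obtain ⟨⟨n, hn⟩, -⟩ | ⟨⟨n, hn⟩, -⟩ := hq
  · have hn1 : (-1 : ℝ) < n := by nlinarith
    have hn2 : (n : ℝ) < 1 := by nlinarith
    have : n = 0 := by
      have h5 : -1 < n := by exact_mod_cast hn1
      have h6 : n < 1 := by exact_mod_cast hn2
      omega
    rw [this] at hn
    simp only [Int.cast_zero, zero_mul] at hn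
    linarith
  · have hn1 : (0 : ℝ) < n := by nlinarith
    have hn2 : (n : ℝ) < 2 := by nlinarith
    have : n = 1 := by
      have h5 : 0 < n := by exact_mod_cast hn1
      have h6 : n < 2 := by exact_mod_cast hn2
      omega
    rw [this] at hn
    simp only [Int.cast_one, one_mul] at hn
    linarith

end Unif

/-- A meromorphic function can be corrected at exceptional points so that it takes prescribed values
on a set where it agrees with a continuous function up to discrete sets. -/
theorem exists_eq_on_of_eventuallyEq {D : Set ℂ} {Ψ R : ℂ → ℂ} (hR : Meromorphic R)
    (hΨ : ∀ p ∈ D, ContinuousAt Ψ p) (h : ∀ p ∈ D, R =ᶠ[𝓝[≠] p] Ψ) :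
    ∃ r : ℂ → ℂ, (∀ b, r =ᶠ[𝓝[≠] b] R) ∧ ∀ p ∈ D, r p = Ψ p := by
  classical
  refine ⟨D.piecewise Ψ R, fun b => ?_, fun p hp => Set.piecewise_eq_of_mem _ _ _ hp⟩
  filter_upwards [(hR b).eventually_analyticAt] with v hv
  by_cases hvD : v ∈ D
  · rw [Set.piecewise_eq_of_mem _ _ _ hvD]
    exact (tendsto_nhds_unique_of_eventuallyEq
      (hv.continuousAt.tendsto.mono_left nhdsWithin_le_nhds)
      ((hΨ v hvD).tendsto.mono_left nhdsWithin_le_nhds) (h v hvD)).symm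
  · rw [Set.piecewise_eq_of_notMem _ _ _ hvD]

theorem meromorphic_congr {r R : ℂ → ℂ} (hR : Meromorphic R) (h : ∀ b, r =ᶠ[𝓝[≠] b] R) :
    Meromorphic r := fun b => (hR b).congr (h b).symm

/-- The continuation is unique up to a discrete set. -/
theorem eventuallyEq_of_eqOn {r r' : ℂ → ℂ} {D : Set ℂ} (hD : IsOpen D) (hne : D.Nonempty)
    (hr : Meromorphic r) (hr' : Meromorphic r') (h : ∀ p ∈ D, r p = r' p) (b : ℂ) :
    r =ᶠ[𝓝[≠] b] r' := by
  obtain ⟨p, hp⟩ := hne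
  refine eventuallyEq_of_meromorphic hr hr' (a := p) ?_ b
  filter_upwards [nhdsWithin_le_nhds (hD.mem_nhds hp)] with v hv using h v hv

theorem exists_coe_iff_mem_unitDisc {p : OnePoint ℂ} :
    (∃ x : ℂ, ‖x‖ < 1 ∧ p = (x : OnePoint ℂ)) ↔ p ∈ unitDisc := by
  constructor
  · rintro ⟨x, hx, rfl⟩
    exact coe_mem_unitDisc.mpr hx
  · rintro ⟨x, hx, rfl⟩
    exact ⟨x, mem_ball_zero_iff.mp hx, rfl⟩

namespace Curve

variable {S : Finset (ℤ × ℤ)} {z : ℝ} {L : PeriodPair} {A B g h ν s g' h' ν' s' : ℝ}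

theorem mem_DeltaX (k : Curve S z L A B (ω₃ S z) g h ν s g' h' ν' s') {ω : ℂ} :
    ω ∈ DeltaX S z ↔ 0 < ω.re ∧ ω.re < B ∧ xCov S z ω ∈ unitDisc := by
  rw [← exists_coe_iff_mem_unitDisc, ← k.u.per₂, DeltaX, Set.mem_ofPred_eq]

theorem mem_DeltaY (k : Curve S z L A B (ω₃ S z) g h ν s g' h' ν' s') {ω : ℂ} :
    ω ∈ DeltaY S z ↔ 0 < (ω - ω₃ S z / 2).re ∧ (ω - ω₃ S z / 2).re < B ∧
      yCov S z ω ∈ unitDisc := by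
  have : (ω - ω₃ S z / 2).re = ω.re - ω₃ S z / 2 := by simp
  rw [← exists_coe_iff_mem_unitDisc, ← k.u.per₂, DeltaY, Set.mem_ofPred_eq, this, sub_pos,
    sub_lt_iff_lt_add']

theorem isOpen_DeltaX (k : Curve S z L A B (ω₃ S z) g h ν s g' h' ν' s') :
    IsOpen (DeltaX S z) := by
  have : DeltaX S z = Complex.re ⁻¹' Set.Ioo 0 B ∩ xCov S z ⁻¹' unitDisc := by
    ext ω
    rw [k.mem_DeltaX, ← and_assoc]
    rfl
  rw [this]
  exact (isOpen_Ioo.preimage Complex.continuous_re).inter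
    (isOpen_unitDisc.preimage k.u.xCov_continuous)

theorem isOpen_DeltaY (k : Curve S z L A B (ω₃ S z) g h ν s g' h' ν' s') :
    IsOpen (DeltaY S z) := by
  have : DeltaY S z = (fun ω : ℂ => (ω - ω₃ S z / 2).re) ⁻¹' Set.Ioo 0 B ∩
      yCov S z ⁻¹' unitDisc := by
    ext ω
    rw [k.mem_DeltaY, ← and_assoc]
    rfl
  rw [this]
  exact (isOpen_Ioo.preimage (by fun_prop)).inter (isOpen_unitDisc.preimage k.yCov_continuous)

/-- The meromorphic continuation of the lifted generating functions, with its quasi-period `ω₃`. -/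
theorem exists_continuation (k : Curve S z L A B (ω₃ S z) g h ν s g' h' ν' s') :
    ∃ R : ℂ → ℂ, Meromorphic R ∧
      (∀ ω, R (ω + ω₃ S z) =
        R ω + yVal S z (ω + ω₃ S z) * (xVal S z (ω + ω₃ S z) - xVal S z ω)) ∧
      Function.Periodic R L.ω₁ ∧ (∀ b, rx S z =ᶠ[𝓝[≠] b] R) ∧
      ∀ b, ry S z =ᶠ[𝓝[≠] b]
        fun v => K S z 0 0 * Q S z 0 0 + xVal S z v * yVal S z v - R v := by
  obtain ⟨R, hR1, hR2, hR3, hR4, hR5⟩ := k.exists_lift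
  have hB := k.u.rect.posB
  have hl := L.ω₁_mem_lattice
  have hx : ∀ p ∈ DeltaX S z, R =ᶠ[𝓝[≠] p] fun ω => Fx S z (xVal S z ω) := by
    intro p hp
    obtain ⟨h1, h2, h3⟩ := k.mem_DeltaX.mp hp
    exact k.u.eventuallyEq_lift (fun x hx => Fx_analyticAt k.u.model hx) hR1 hR3
      (fun q hq => Filter.EventuallyEq.filter_mono (hR4 q hq) nhdsWithin_le_nhds) h1 h2 h3
  set T : ℂ → ℂ := fun v => K S z 0 0 * Q S z 0 0 + xVal S z v * yVal S z v - R v with hT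
  have hTm : Meromorphic T := fun v => ((MeromorphicAt.const _ v).add
    ((k.u.xVal_meromorphic v).mul (k.yVal_meromorphic v))).sub (hR1 v)
  have hy : ∀ p ∈ DeltaY S z, T =ᶠ[𝓝[≠] p] fun ω => Fy S z (yVal S z ω) := by
    intro p hp
    obtain ⟨h1, h2, h3⟩ := k.mem_DeltaY.mp hp
    -- the same comparison for the transposed model, in the coordinate `ω - ω₃ / 2`
    have hTl : ∀ v, T (v + L.ω₁) = T v := fun v => by
      simp only [hT, k.u.xVal_add hl, k.yVal_add hl, hR3]
    have h4 := k.u'.eventuallyEq_lift (Φ := Fy S z) (R := fun v => T (v + ω₃ S z / 2))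
      (fun x hx => Fy_analyticAt k.u.model hx) (meromorphic_comp_add hTm _)
      (fun v => by rw [add_right_comm, hTl]) (fun q hq => ?_) h1 h2
      (by rwa [← k.yCov_eq])
    · have h5 := tendsto_punctured_add p (-(ω₃ S z / 2 : ℂ))
      rw [← sub_eq_add_neg] at h5
      filter_upwards [h5.eventually h4] with v hv
      rw [neg_add_cancel_right, ← sub_eq_add_neg, ← k.yVal_eq] at hv
      exact hv
    · have h5 := (tendsto_punctured_add q (ω₃ S z / 2 : ℂ)).eventually
        (nhdsWithin_le_nhds (hR5 (q + ω₃ S z / 2) (by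
          rw [Complex.add_re, hq]; simp; ring)))
      filter_upwards [h5] with v hv
      have h6 := k.yVal_eq (v + ω₃ S z / 2)
      rw [add_sub_cancel_right] at h6
      rw [hT]
      simp only [hv, ← h6]
      ring
  have hXne : (DeltaX S z).Nonempty := ⟨((B / 2 : ℝ) : ℂ), k.mem_DeltaX.mpr
    ⟨by rw [Complex.ofReal_re]; linarith, by rw [Complex.ofReal_re]; linarith,
      k.u.mem_unitDisc_of_re_half 0 (by simp)⟩⟩
  have hYne : (DeltaY S z).Nonempty := by
    have h1 : (((((B + ω₃ S z) / 2 : ℝ) : ℂ)) - ω₃ S z / 2).re = B / 2 := by simp; ring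
    exact ⟨_, k.mem_DeltaY.mpr ⟨by rw [h1]; linarith, by rw [h1]; linarith,
      k.y_mem_of_re (Complex.ofReal_re _)⟩⟩
  obtain ⟨r, hr1, hr2⟩ := exists_eq_on_of_eventuallyEq hR1
    (fun p hp => (k.Fx_comp_analyticAt (k.mem_DeltaX.mp hp).2.2).continuousAt) hx
  obtain ⟨t, ht1, ht2⟩ := exists_eq_on_of_eventuallyEq hTm
    (fun p hp => (k.Fy_comp_analyticAt (k.mem_DeltaY.mp hp).2.2).continuousAt) hy
  have hrx : IsContinuationX S z (rx S z) :=
    Classical.epsilon_spec ⟨r, meromorphic_congr hR1 hr1, hr2⟩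
  have hry : IsContinuationY S z (ry S z) :=
    Classical.epsilon_spec ⟨t, meromorphic_congr hTm ht1, ht2⟩
  refine ⟨R, hR1, hR2, hR3, fun b => ?_, fun b => ?_⟩
  · exact (eventuallyEq_of_eqOn k.isOpen_DeltaX hXne hrx.1 (meromorphic_congr hR1 hr1)
      (fun p hp => (hrx.2 p hp).trans (hr2 p hp).symm) b).trans (hr1 b)
  · exact (eventuallyEq_of_eqOn k.isOpen_DeltaY hYne hry.1 (meromorphic_congr hTm ht1)
      (fun p hp => (hry.2 p hp).trans (ht2 p hp).symm) b).trans (ht1 b)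

end Curve

/-! ### Translations by an incommensurable step -/

theorem mem_closure_translates {W B : ℝ} (hB : 0 < B) (hirr : Irrational (B / W)) (t : ℝ) (N : ℕ) :
    t ∈ closure {r : ℝ | ∃ n : ℕ, N ≤ n ∧ ∃ m : ℤ, r = n * W + m * B} := by
  have hpos : Fact (0 < B) := ⟨hB⟩
  have h2 := (AddCircle.denseRange_zsmul_coe_iff (p := B) (a := W)).mpr (by simpa using hirr.inv)
  have h3 : MapClusterPt (t : AddCircle B) atTop fun n : ℕ => n • (W : AddCircle B) :=
    ((mapClusterPt_atTop_nsmul_tfae _ _).out 3 0).mp (h2 _)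
  rw [mem_closure_iff]
  intro U hU ht
  have h4 : ((↑) : ℝ → AddCircle B) '' U ∈ 𝓝 (t : AddCircle B) :=
    (QuotientAddGroup.isOpenMap_coe _ hU).mem_nhds ⟨t, ht, rfl⟩
  obtain ⟨n, hn, r, hr, hrn⟩ := frequently_atTop.mp (mapClusterPt_iff_frequently.mp h3 _ h4) N
  refine ⟨r, hr, n, hn, ?_⟩
  rw [← AddCircle.coe_nsmul, ← sub_eq_zero, ← AddCircle.coe_sub, AddCircle.coe_eq_zero_iff] at hrn
  obtain ⟨m, hm⟩ := hrn
  refine ⟨m, ?_⟩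
  rw [zsmul_eq_mul, nsmul_eq_mul] at hm
  linarith

theorem int_eq_zero_of_irrational {W B : ℝ} (hirr : Irrational (B / W)) {m p : ℤ}
    (h : m * W = p * B) : m = 0 := by
  by_contra hm
  have hW : W ≠ 0 := by rintro rfl; simp at hirr
  have hmR : (m : ℝ) ≠ 0 := by exact_mod_cast hm
  have hp : (p : ℝ) ≠ 0 := by
    intro hp
    rw [hp, zero_mul] at h
    exact mul_ne_zero hmR hW h
  refine hirr ⟨(m : ℚ) / p, ?_⟩
  push_cast
  rw [div_eq_div_iff hp hW, h, mul_comm]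

/-- Only one of the translates `a + n W` can be a multiple of `B / 2`. -/
theorem eventually_ne_half_mul {W B : ℝ} (hirr : Irrational (B / W)) (a : ℝ) :
    ∀ᶠ n : ℕ in atTop, ∀ p : ℤ, a + n * W ≠ p * (B / 2) := by
  by_contra hc
  rw [not_eventually, frequently_atTop] at hc
  obtain ⟨n, -, hn⟩ := hc 0
  obtain ⟨m, hnm, hm⟩ := hc (n + 1)
  push Not at hn hm
  obtain ⟨p, hp⟩ := hn
  obtain ⟨q, hq⟩ := hm
  have := int_eq_zero_of_irrational hirr (m := 2 * ((m : ℤ) - n)) (p := q - p) (by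
    push_cast; linear_combination 2 * hq - 2 * hp)
  omega

namespace Unif

variable {S : Finset (ℤ × ℤ)} {z : ℝ} {L : PeriodPair} {A B g h ν s : ℝ}

/-- Each value of `x` is taken at most twice on a sequence `a + n W`. -/
theorem eventually_xCov_ne (u : Unif S z L A B g h ν s) {W : ℝ} (hirr : Irrational (B / W)) (a : ℂ)
    (p : OnePoint ℂ) : ∀ᶠ n : ℕ in atTop, xCov S z (a + n * W) ≠ p := by
  by_contra hc
  rw [not_eventually, frequently_atTop] at hc
  have key : ∀ {n m : ℕ}, n < m → xCov S z (a + n * W) = p → xCov S z (a + m * W) = p →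
      ∃ k : ℤ, 2 * a.re + (n + m) * W = k * B := by
    intro n m hnm h1 h2
    rcases (u.xCov_eq_iff _ _).mp (h1.trans h2.symm) with h | h
    · obtain ⟨⟨k, hk⟩, -⟩ := (u.rect.mem_iff _).mp h
      simp at hk
      have := int_eq_zero_of_irrational hirr (m := (n : ℤ) - m) (p := k)
        (by push_cast; linear_combination hk)
      omega
    · obtain ⟨⟨k, hk⟩, -⟩ := (u.rect.mem_iff _).mp h
      simp at hk
      exact ⟨k, by linear_combination hk⟩
  obtain ⟨n, -, hn⟩ := hc 0
  obtain ⟨m, hnm, hm⟩ := hc (n + 1)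
  obtain ⟨l, hml, hl⟩ := hc (m + 1)
  rw [not_not] at hn hm hl
  obtain ⟨k₁, h1⟩ := key (by omega) hn hm
  obtain ⟨k₂, h2⟩ := key (by omega) hn hl
  have := int_eq_zero_of_irrational hirr (m := (l : ℤ) - m) (p := k₂ - k₁)
    (by push_cast; linear_combination h2 - h1)
  omega

end Unif

/-! ### Poles of the branches -/

theorem tendsto_cobounded_add {l : Filter ℂ} {f g : ℂ → ℂ} {c : ℂ}
    (hf : Tendsto f l (Bornology.cobounded ℂ)) (hg : Tendsto g l (𝓝 c)) :
    Tendsto (fun v => f v + g v) l (Bornology.cobounded ℂ) := by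
  rw [← tendsto_norm_atTop_iff_cobounded] at hf ⊢
  refine tendsto_atTop_mono (fun v => ?_) (hf.atTop_add hg.norm.neg)
  have := norm_sub_norm_le (f v) (-g v)
  rwa [norm_neg, sub_neg_eq_add, sub_eq_add_neg] at this

namespace Unif

variable {S : Finset (ℤ × ℤ)} {z : ℝ} {L : PeriodPair} {A B g h ν s : ℝ}

/-- In a half-period strip a point is determined by the value of `x`, up to multiples of `ω₁`. -/
theorem eq_add_of_xCov_eq (u : Unif S z L A B g h ν s) {j : ℤ} {p q : ℂ}
    (hp : p.re ∈ Set.Icc (j * (B / 2)) ((j + 1) * (B / 2)))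
    (hq : q.re ∈ Set.Ioo (j * (B / 2)) ((j + 1) * (B / 2))) (h : xCov S z p = xCov S z q) :
    ∃ m : ℤ, p = q + m * L.ω₁ := by
  have hB := u.rect.posB
  obtain ⟨hp1, hp2⟩ := hp
  obtain ⟨hq1, hq2⟩ := hq
  rcases (u.xCov_eq_iff _ _).mp h with h | h
  · obtain ⟨⟨n, hn⟩, m, hm⟩ := (u.rect.mem_iff _).mp h
    rw [Complex.sub_re] at hn
    rw [Complex.sub_im] at hm
    have hn1 : (-1 : ℝ) < n := by nlinarith
    have hn2 : (n : ℝ) < 1 := by nlinarith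
    have hn0 : n = 0 := by
      have h5 : -1 < n := by exact_mod_cast hn1
      have h6 : n < 1 := by exact_mod_cast hn2
      omega
    rw [hn0, Int.cast_zero, zero_mul] at hn
    refine ⟨m, Complex.ext ?_ ?_⟩ <;> rw [u.rect.per₁] <;> simp <;> linarith
  · exfalso
    obtain ⟨⟨n, hn⟩, -⟩ := (u.rect.mem_iff _).mp h
    rw [Complex.add_re] at hn
    have hn1 : (j : ℝ) < n := by nlinarith
    have hn2 : (n : ℝ) < j + 1 := by nlinarith
    have h5 : j < n := by exact_mod_cast hn1
    have h6 : n < j + 1 := by exact_mod_cast hn2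
    omega

/-- A pole of `R` inside a cell `M` gives a pole of the branch that belongs to the cell. -/
theorem isPole_branch (u : Unif S z L A B g h ν s) {ξ : ℂ → OnePoint ℂ} {c : ℂ}
    (hξ : ∀ ω, ξ ω = xCov S z (ω - c)) {r R : ℂ → ℂ} (hr : ∀ b, r =ᶠ[𝓝[≠] b] R)
    (hper : Function.Periodic R L.ω₁) {P : ℂ[X]} (hP : P ≠ 0) {M : Set ℂ} {j : ℤ}
    (hM : ∀ ω ∈ M, (ω - c).re ∈ Set.Icc (j * (B / 2)) ((j + 1) * (B / 2)) ∧ ω.im ∈ Set.Ico 0 A)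
    (hM' : ∀ ω : ℂ, (ω - c).re ∈ Set.Ioo (j * (B / 2)) ((j + 1) * (B / 2)) →
      ω.im ∈ Set.Ico 0 A → ω ∈ M) {p x : ℂ} (hpx : ξ p = x)
    (hp : (p - c).re ∈ Set.Ioo (j * (B / 2)) ((j + 1) * (B / 2))) (hpole : IsPole R p) :
    IsPole (fun x : ℂ => r (Function.invFunOn ξ M (x : OnePoint ℂ)) / P.eval x) x := by
  have hA := u.rect.posA
  have hfin : xCov S z (p - c) ≠ OnePoint.infty := by
    rw [← hξ, hpx]; exact OnePoint.coe_ne_infty _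
  set f : ℂ → ℂ := fun ω => xVal S z (ω - c) with hf
  have hfp : f p = x := xVal_eq_of_coe (by rw [← hξ, hpx])
  have hsub : Tendsto (fun ω : ℂ => ω - c) (𝓝 p) (𝓝 (p - c)) :=
    (continuous_id.sub continuous_const).tendsto p
  have hsub' : Tendsto (fun ω : ℂ => ω - c) (𝓝[≠] p) (𝓝[≠] (p - c)) := by
    simpa only [sub_eq_add_neg] using tendsto_punctured_add p (-c)
  have hfcont : Tendsto f (𝓝 p) (𝓝 x) := by
    rw [← hfp]
    exact (u.xVal_analyticAt hfin).continuousAt.tendsto.comp hsub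
  -- by the open mapping theorem the images of punctured neighborhoods of `p` contain those of `x`
  have hopen : 𝓝[≠] x ≤ map f (𝓝[≠] p) := by
    have h1 : 𝓝 x ≤ map f (𝓝 p) := by
      have h2 := u.nhds_le_map hfin
      have h3 : map (fun ω : ℂ => ω - c) (𝓝 p) = 𝓝 (p - c) := (Homeomorph.subRight c).map_nhds_eq p
      rw [← h3, map_map] at h2
      rw [← hfp]
      exact h2
    intro V hV
    have h4 : ∀ᶠ q in 𝓝 p, q ≠ p → f q ∈ V := eventually_nhdsWithin_iff.mp hV
    have h5 : f '' {q | q ≠ p → f q ∈ V} ∈ 𝓝 x := h1 (image_mem_map h4)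
    filter_upwards [nhdsWithin_le_nhds h5, self_mem_nhdsWithin] with y hy hyx
    obtain ⟨q, hq, rfl⟩ := hy
    refine hq ?_
    rintro rfl
    exact hyx hfp
  refine Tendsto.mono_left ?_ hopen
  rw [tendsto_map'_iff]
  -- the point of the cell over `f q` is `q + m ω₁` with `m` in a finite range independent of `q`, so
  -- the discrete exceptional set of `r = R` can be avoided for all these `m` at once
  set N := ⌊-p.im / A⌋ with hN
  have hN1 : (N : ℝ) * A ≤ -p.im := (le_div_iff₀ hA).mp (Int.floor_le _)
  have hN2 : -p.im < (N + 1) * A := (div_lt_iff₀ hA).mp (Int.lt_floor_add_one _)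
  have hrR : ∀ᶠ q in 𝓝[≠] p, ∀ m ∈ Finset.Icc (N - 1) (N + 3), r (q + m * L.ω₁) = R q := by
    rw [Filter.eventually_all_finset]
    intro m _
    filter_upwards [(tendsto_punctured_add p (m * L.ω₁)).eventually (hr _)] with q hq
    rw [hq]
    exact hper.int_mul m q
  have him : ∀ᶠ q : ℂ in 𝓝 p, q.im ∈ Set.Ioo (p.im - A) (p.im + A) :=
    Complex.continuous_im.continuousAt.eventually
      (isOpen_Ioo.mem_nhds ⟨by linarith, by linarith⟩)
  have hre : ∀ᶠ q : ℂ in 𝓝 p, (q - c).re ∈ Set.Ioo (j * (B / 2)) ((j + 1) * (B / 2)) :=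
    (Complex.continuous_re.tendsto _ |>.comp hsub).eventually (isOpen_Ioo.mem_nhds hp)
  have hω₁ : ∀ (m : ℤ) (q : ℂ), (q + m * L.ω₁).im = q.im + m * A := by
    intro m q
    rw [u.rect.per₁]; simp
  have hω₁' : ∀ (m : ℤ) (q : ℂ), (q + m * L.ω₁ - c).re = (q - c).re := by
    intro m q
    rw [u.rect.per₁]; simp
  have hmL : ∀ m : ℤ, (m : ℂ) * L.ω₁ ∈ L.lattice := fun m => by
    have := L.lattice.smul_mem m L.ω₁_mem_lattice
    rwa [zsmul_eq_mul] at this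
  have hmain : ∀ᶠ q in 𝓝[≠] p, r (Function.invFunOn ξ M (f q : OnePoint ℂ)) = R q := by
    filter_upwards [hrR, nhdsWithin_le_nhds him, nhdsWithin_le_nhds hre,
      nhdsWithin_le_nhds (hsub.eventually (u.eventually_ne_infty_nhds hfin))] with q h1 h2 h3 h4
    have hfq : ξ q = f q := by rw [hξ, hf]; exact (xVal_coe S z h4).symm
    have hex : ∃ q' ∈ M, ξ q' = f q := by
      have hf1 : (⌊q.im / A⌋ : ℝ) * A ≤ q.im := (le_div_iff₀ hA).mp (Int.floor_le _)
      have hf2 : q.im < (⌊q.im / A⌋ + 1) * A := (div_lt_iff₀ hA).mp (Int.lt_floor_add_one _)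
      refine ⟨q + (-⌊q.im / A⌋ : ℤ) * L.ω₁, hM' _ (by rwa [hω₁']) ?_, ?_⟩
      · rw [hω₁]
        push_cast
        constructor <;> linarith
      · rw [← hfq, hξ, hξ, add_sub_right_comm, u.xCov_add (hmL _)]
    have h5 := Function.invFunOn_mem hex
    have h6 := Function.invFunOn_eq hex
    set q' := Function.invFunOn ξ M (f q : OnePoint ℂ)
    obtain ⟨h7, h8⟩ := hM q' h5
    rw [← hfq, hξ, hξ] at h6
    obtain ⟨m, hm⟩ := u.eq_add_of_xCov_eq h7 h3 h6
    have hm' : q' = q + m * L.ω₁ := by linear_combination hm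
    rw [hm', hω₁] at h8
    rw [hm']
    refine h1 m (Finset.mem_Icc.mpr ?_)
    have h9 : (N : ℝ) - 2 < m := by nlinarith [h8.1, h8.2, h2.1, h2.2]
    have h10 : (m : ℝ) < N + 3 := by nlinarith [h8.1, h8.2, h2.1, h2.2]
    have h11 : N - 2 < m := by exact_mod_cast h9
    have h12 : m < N + 3 := by exact_mod_cast h10
    omega
  have hP0 : ∀ᶠ q in 𝓝[≠] p, P.eval (f q) ≠ 0 :=
    hsub'.eventually (u.eventually_eval_ne_zero hP (p - c))
  have hPb : ∀ᶠ q in 𝓝 p, ‖P.eval (f q)‖ < ‖P.eval x‖ + 1 :=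
    ((P.continuous.tendsto x).comp hfcont).norm.eventually_lt_const (lt_add_one _)
  have hC : 0 < ‖P.eval x‖ + 1 := by positivity
  unfold IsPole at hpole
  rw [← tendsto_norm_atTop_iff_cobounded] at hpole ⊢
  refine tendsto_atTop_mono' _ ?_ (hpole.atTop_div_const hC)
  filter_upwards [hmain, hP0, nhdsWithin_le_nhds hPb] with q h1 h2 h3
  rw [Function.comp_apply, h1, norm_div]
  exact div_le_div_of_nonneg_left (norm_nonneg _) (norm_pos_iff.mpr h2) h3.le

end Unif

/-! ### Poles along the translates by `ω₃` -/

theorem PrecBy.trans {S : Finset (ℤ × ℤ)} {z : ℝ} {m n : ℕ} {a b c : ℂ} (h : PrecBy S z m a b)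
    (h' : PrecBy S z n b c) : PrecBy S z (m + n) a c := by
  obtain ⟨p, hp⟩ := h
  obtain ⟨q, hq⟩ := h'
  refine ⟨p + q, ?_⟩
  push_cast
  linear_combination hp + hq

/-- The shifts along a chain add up. -/
theorem precBy_of_chain {S : Finset (ℤ × ℤ)} {z : ℝ} {k : ℕ} {w : Fin (k + 1) → ℂ} {n : Fin k → ℕ}
    (hA : ∀ i : Fin k, PrecBy S z (n i) (w i.castSucc) (w i.succ)) (i : Fin (k + 1)) :
    PrecBy S z (∑ j : Fin k with j.castSucc < i, n j) (w 0) (w i) := by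
  induction i using Fin.induction with
  | zero => exact ⟨0, by simp⟩
  | succ i ih =>
    have : (∑ j : Fin k with j.castSucc < i.succ, n j) =
        (∑ j : Fin k with j.castSucc < i.castSucc, n j) + n i := by
      have h1 : ({j : Fin k | j.castSucc < i.succ} : Finset (Fin k)) =
          insert i ({j : Fin k | j.castSucc < i.castSucc} : Finset (Fin k)) := by
        ext j
        simp only [Finset.mem_filter_univ, Finset.mem_insert, Fin.castSucc_lt_succ_iff,
          Fin.castSucc_lt_castSucc_iff, le_iff_eq_or_lt]
      rw [h1, Finset.sum_insert (by simp), add_comm]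
    rw [this]
    exact ih.trans (hA i)

namespace Curve

variable {S : Finset (ℤ × ℤ)} {z : ℝ} {L : PeriodPair} {A B g h ν s g' h' ν' s' : ℝ}

theorem mem_cellM (k : Curve S z L A B (ω₃ S z) g h ν s g' h' ν' s') {j : ℤ} {ω : ℂ} :
    ω ∈ cellM S z j 0 ↔
      ω.re ∈ Set.Ico (j * (B / 2)) ((j + 1) * (B / 2)) ∧ ω.im ∈ Set.Ico 0 A := by
  have hA := k.u.rect.posA
  have hB := k.u.rect.posB
  have hre : ∀ s t : ℝ, ((s : ℂ) * ω₁ S z + (t : ℂ) * (ω₂ S z : ℂ)).re = t * B := by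
    intro s t; rw [k.u.per₁, k.u.per₂, k.u.rect.per₁]; simp
  have him : ∀ s t : ℝ, ((s : ℂ) * ω₁ S z + (t : ℂ) * (ω₂ S z : ℂ)).im = s * A := by
    intro s t; rw [k.u.per₁, k.u.per₂, k.u.rect.per₁]; simp
  simp only [cellM, Int.cast_zero, zero_add]
  constructor
  · rintro ⟨s, hs, t, ht, rfl⟩
    rw [hre, him]
    obtain ⟨ht1, ht2⟩ := ht
    refine ⟨⟨by nlinarith, by nlinarith⟩, ⟨mul_nonneg hs.1 hA.le, by nlinarith [hs.2]⟩⟩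
  · rintro ⟨⟨h1, h2⟩, ⟨h3, h4⟩⟩
    refine ⟨ω.im / A, ⟨div_nonneg h3 hA.le, (div_lt_one hA).mpr h4⟩, ω.re / B,
      ⟨(le_div_iff₀ hB).mpr (by linarith), (div_lt_iff₀ hB).mpr (by linarith)⟩, ?_⟩
    apply Complex.ext
    · rw [hre, div_mul_cancel₀ _ hB.ne']
    · rw [him, div_mul_cancel₀ _ hA.ne']

theorem mem_cellN (k : Curve S z L A B (ω₃ S z) g h ν s g' h' ν' s') {j : ℤ} {ω : ℂ} :
    ω ∈ cellN S z j 0 ↔ (ω - ω₃ S z / 2).re ∈ Set.Ioc (j * (B / 2)) ((j + 1) * (B / 2)) ∧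
      ω.im ∈ Set.Ico 0 A := by
  have hA := k.u.rect.posA
  have hB := k.u.rect.posB
  have hre : ∀ s t : ℝ, ((ω₃ S z : ℂ) / 2 + (s : ℂ) * ω₁ S z + (t : ℂ) * (ω₂ S z : ℂ)).re =
      ω₃ S z / 2 + t * B := by
    intro s t; rw [k.u.per₁, k.u.per₂, k.u.rect.per₁]; simp
  have him : ∀ s t : ℝ, ((ω₃ S z : ℂ) / 2 + (s : ℂ) * ω₁ S z + (t : ℂ) * (ω₂ S z : ℂ)).im =
      s * A := by
    intro s t; rw [k.u.per₁, k.u.per₂, k.u.rect.per₁]; simp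
  have hW : (ω - ω₃ S z / 2).re = ω.re - ω₃ S z / 2 := by simp
  rw [hW]
  simp only [cellN, Int.cast_zero, zero_add]
  constructor
  · rintro ⟨s, hs, t, ht, rfl⟩
    rw [hre, him]
    obtain ⟨ht1, ht2⟩ := ht
    refine ⟨⟨by nlinarith, by nlinarith⟩, ⟨mul_nonneg hs.1 hA.le, by nlinarith [hs.2]⟩⟩
  · rintro ⟨⟨h1, h2⟩, ⟨h3, h4⟩⟩
    refine ⟨ω.im / A, ⟨div_nonneg h3 hA.le, (div_lt_one hA).mpr h4⟩, (ω.re - ω₃ S z / 2) / B,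
      ⟨(lt_div_iff₀ hB).mpr (by linarith), (div_le_iff₀ hB).mpr (by linarith)⟩, ?_⟩
    apply Complex.ext
    · rw [hre, div_mul_cancel₀ _ hB.ne']; ring
    · rw [him, div_mul_cancel₀ _ hA.ne']

theorem mem_PiX (k : Curve S z L A B (ω₃ S z) g h ν s g' h' ν' s') {ω : ℂ} :
    ω ∈ PiX S z ↔ ω.re ∈ Set.Ico 0 B ∧ ω.im ∈ Set.Ico 0 A := by
  have hB := k.u.rect.posB
  rw [PiX, Set.mem_union, k.mem_cellM, k.mem_cellM, ← or_and_right]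
  refine and_congr_left fun _ => ?_
  simp only [Set.mem_Ico, Int.cast_zero, Int.cast_one]
  constructor
  · rintro (⟨h1, h2⟩ | ⟨h1, h2⟩) <;> constructor <;> linarith
  · rintro ⟨h1, h2⟩
    rcases lt_or_ge ω.re (B / 2) with h3 | h3
    · exact Or.inl ⟨by linarith, by linarith⟩
    · exact Or.inr ⟨by linarith, by linarith⟩

theorem mem_PiY (k : Curve S z L A B (ω₃ S z) g h ν s g' h' ν' s') {ω : ℂ} :
    ω ∈ PiY S z ↔ (ω - ω₃ S z / 2).re ∈ Set.Ioc 0 B ∧ ω.im ∈ Set.Ico 0 A := by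
  have hB := k.u.rect.posB
  rw [PiY, Set.mem_union, k.mem_cellN, k.mem_cellN, ← or_and_right]
  refine and_congr_left fun _ => ?_
  simp only [Set.mem_Ioc, Int.cast_zero, Int.cast_one]
  constructor
  · rintro (⟨h1, h2⟩ | ⟨h1, h2⟩) <;> constructor <;> linarith
  · rintro ⟨h1, h2⟩
    rcases le_or_gt (ω - ω₃ S z / 2).re (B / 2) with h3 | h3
    · exact Or.inl ⟨by linarith, by linarith⟩
    · exact Or.inr ⟨by linarith, by linarith⟩

theorem intCast_mul_mem (k : Curve S z L A B (ω₃ S z) g h ν s g' h' ν' s') (m : ℤ) :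
    (m : ℂ) * B ∈ L.lattice := by
  have := L.lattice.smul_mem m k.period₂_mem
  rwa [zsmul_eq_mul] at this

/-- Every point has a translate by a multiple of `ω₂` in `Π_x`. -/
theorem exists_mem_PiX (k : Curve S z L A B (ω₃ S z) g h ν s g' h' ν' s') {ω : ℂ}
    (hω : ω.im ∈ Set.Ico 0 A) : ∃ m : ℤ, ω + m * B ∈ PiX S z := by
  have hB := k.u.rect.posB
  obtain ⟨m, hm, -⟩ := existsUnique_add_zsmul_mem_Ico hB ω.re 0
  refine ⟨m, k.mem_PiX.mpr ⟨?_, by simpa using hω⟩⟩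
  simpa using hm

/-- Every point has a translate by a multiple of `ω₂` in `Π_y`. -/
theorem exists_mem_PiY (k : Curve S z L A B (ω₃ S z) g h ν s g' h' ν' s') {ω : ℂ}
    (hω : ω.im ∈ Set.Ico 0 A) : ∃ m : ℤ, ω + m * B ∈ PiY S z := by
  have hB := k.u.rect.posB
  obtain ⟨m, hm, -⟩ := existsUnique_add_zsmul_mem_Ioc hB (ω - ω₃ S z / 2).re 0
  refine ⟨m, k.mem_PiY.mpr ⟨?_, by simpa using hω⟩⟩
  rw [add_sub_right_comm, Complex.add_re]
  simpa using hm

/-- Points of `Π_y` that differ by a multiple of `ω₂` are equal. -/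
theorem eq_of_mem_PiY (k : Curve S z L A B (ω₃ S z) g h ν s g' h' ν' s') {a b : ℂ}
    (ha : a ∈ PiY S z) (hb : b ∈ PiY S z) {m : ℤ} (h : a = b + m * B) : a = b := by
  have hB := k.u.rect.posB
  obtain ⟨⟨ha1, ha2⟩, -⟩ := k.mem_PiY.mp ha
  obtain ⟨⟨hb1, hb2⟩, -⟩ := k.mem_PiY.mp hb
  have hre : (a - ω₃ S z / 2).re = (b - ω₃ S z / 2).re + m * B := by rw [h]; simp; ring
  have hn1 : (-1 : ℝ) < m := by nlinarith
  have hn2 : (m : ℝ) < 1 := by nlinarith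
  have : m = 0 := by
    have h5 : -1 < m := by exact_mod_cast hn1
    have h6 : m < 1 := by exact_mod_cast hn2
    omega
  rw [h, this]
  simp

theorem isPole_fy_add (k : Curve S z L A B (ω₃ S z) g h ν s g' h' ν' s') (a : ℂ) (m : ℤ) :
    IsPole (fy S z) (a + m * B) ↔ IsPole (fy S z) a := by
  rw [← isPole_comp_add]
  refine isPole_congr (.of_forall fun v => k.fy_add (k.intCast_mul_mem m) v)

/-- A solution `T` of `T(ω + ω₃) = T(ω) + f_y(ω)` without pole at `ω₀` has poles at all points
`ω₀ + n ω₃` for large `n`: the sum of the singular terms is infinite by assumption. -/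
theorem eventually_isPole (c : Curve S z L A B (ω₃ S z) g h ν s g' h' ν' s')
    (hirr : Irrational (B / ω₃ S z)) {T : ℂ → ℂ} (hT : Meromorphic T)
    (hTW : ∀ ω, T (ω + ω₃ S z) = T ω + fy S z ω) {ω₀ : ℂ} (hr : ¬ IsPole T ω₀)
    {k : ℕ} {w : Fin (k + 1) → ℂ} {n : Fin k → ℕ}
    (hw₀ : w 0 = ω₀) (hw : ∀ i, w i ∈ polesFy S z ω₀) (hinj : Function.Injective w)
    (hA : ∀ i : Fin k, PrecBy S z (n i) (w i.castSucc) (w i.succ))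
    (hB : Tendsto
      (fun ω : ℂ => ∑ i : Fin (k + 1),
        fy S z (ω + ((∑ j : Fin k with j.castSucc < i, n j : ℕ) : ℂ) * (ω₃ S z : ℂ)))
      (𝓝[≠] ω₀) (Bornology.cobounded ℂ))
    (hC : ∀ ω ∈ polesFy S z ω₀, Prec S z ω₀ ω → ∃ i, ω = w i) :
    ∀ᶠ N : ℕ in atTop, IsPole T (ω₀ + N * ω₃ S z) := by
  have hper : ω₂ S z = B := c.u.per₂
  set m : Fin (k + 1) → ℕ := fun i => ∑ j : Fin k with j.castSucc < i, n j with hm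
  have hmw : ∀ i, PrecBy S z (m i) ω₀ (w i) := fun i => hw₀ ▸ precBy_of_chain hA i
  have him : ω₀.im ∈ Set.Ico 0 A := by
    have := (c.mem_PiY.mp (hw 0).1).2
    rwa [hw₀] at this
  have hminj : Function.Injective m := by
    intro i i' hii
    obtain ⟨p, hp⟩ := hmw i
    obtain ⟨p', hp'⟩ := hmw i'
    rw [hii] at hp
    refine hinj (c.eq_of_mem_PiY (hw i).1 (hw i').1 (m := p' - p) ?_)
    rw [hper] at hp hp'
    push_cast
    linear_combination hp' - hp
  -- the other translates of `ω₀` are not poles of `f_y`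
  have hreg : ∀ j : ℕ, j ∉ Finset.univ.image m → ¬ IsPole (fy S z) (ω₀ + j * ω₃ S z) := by
    intro j hj hpole
    have him' : (ω₀ + j * ω₃ S z).im ∈ Set.Ico 0 A := by simpa using him
    obtain ⟨q, hq⟩ := c.exists_mem_PiY him'
    obtain ⟨i, hi⟩ := hC (ω₀ + j * ω₃ S z + q * B)
      ⟨hq, by simp, (c.isPole_fy_add _ q).mpr hpole⟩
      ⟨j, -q, by rw [hper]; push_cast; ring⟩
    obtain ⟨p, hp⟩ := hmw i
    rw [← hi, hper] at hp
    have hre := congrArg Complex.re hp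
    simp at hre
    have := int_eq_zero_of_irrational hirr (m := (m i : ℤ) - j) (p := q + p)
      (by push_cast; linarith)
    refine hj (Finset.mem_image.mpr ⟨i, Finset.mem_univ _, ?_⟩)
    omega
  have hsum : ∀ (N : ℕ) (ω : ℂ), T (ω + N * ω₃ S z) =
      T ω + ∑ j ∈ Finset.range N, fy S z (ω + j * ω₃ S z) := by
    intro N ω
    induction N with
    | zero => simp
    | succ N ih =>
      rw [Finset.sum_range_succ, ← add_assoc, ← ih, ← hTW]
      congr 1
      push_cast
      ring
  have hbound : ∀ᶠ N : ℕ in atTop, Finset.univ.image m ⊆ Finset.range N := by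
    filter_upwards [eventually_gt_atTop ((Finset.univ.image m).sup id)] with N hN j hj
    exact Finset.mem_range.mpr ((Finset.le_sup (f := id) hj).trans_lt hN)
  filter_upwards [hbound] with N hN
  rw [← isPole_comp_add]
  obtain ⟨t₀, ht₀⟩ := exists_tendsto_of_not_isPole (hT ω₀) hr
  have hlim : ∀ j ∈ Finset.range N \ Finset.univ.image m, ∃ t,
      Tendsto (fun ω => fy S z (ω + j * ω₃ S z)) (𝓝[≠] ω₀) (𝓝 t) := by
    intro j hj
    refine exists_tendsto_of_not_isPole (meromorphic_comp_add c.fy_meromorphic _ ω₀) ?_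
    rw [isPole_comp_add]
    exact hreg j (Finset.mem_sdiff.mp hj).2
  choose! t ht using hlim
  refine (tendsto_cobounded_add hB (ht₀.add (tendsto_finsetSum _ ht))).congr fun ω => ?_
  rw [hsum, ← Finset.sum_sdiff hN, Finset.sum_image fun i _ i' _ h => hminj h]
  ring

end Curve

/-! ### Density on the curves -/

theorem exists_mem_Ioo_half {B a : ℝ} (hB : 0 < B) (ha : ∀ p : ℤ, a ≠ p * (B / 2)) :
    ∃ j : ℤ, a ∈ Set.Ioo (j * (B / 2)) ((j + 1) * (B / 2)) := by
  have hB2 : 0 < B / 2 := by linarith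
  refine ⟨⌊a / (B / 2)⌋, ?_, (div_lt_iff₀ hB2).mp (Int.lt_floor_add_one _)⟩
  exact ((le_div_iff₀ hB2).mp (Int.floor_le _)).lt_of_ne (ha _).symm

/-- The points `ω₀ + n ω₃` are dense modulo `ω₂` on the line through `ω₀`. -/
theorem denseOnCurve_of_translates {W B : ℝ} (hB : 0 < B) (hirr : Irrational (B / W)) {ω₀ : ℂ}
    {ξ : ℂ → OnePoint ℂ} (hξ : Continuous ξ) (hper : ∀ (ω : ℂ) (m : ℤ), ξ (ω + m * B) = ξ ω)
    {D : Set ℂ} (hD : ∀ ω : ℂ, ω.im = ω₀.im → ∃ m : ℤ, ω + m * B ∈ D) {P : Set ℂ}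
    (hP : ∀ᶠ n : ℕ in atTop, ∃ x ∈ P, ξ (ω₀ + n * W) = x) :
    DenseOnCurve P (ξ '' {ω | ω ∈ D ∧ ω.im = ω₀.im}) := by
  obtain ⟨N, hN⟩ := eventually_atTop.mp hP
  rintro _ ⟨ω, ⟨-, him⟩, rfl⟩
  have hω : ω = ω₀ + ((ω.re - ω₀.re : ℝ) : ℂ) := by
    apply Complex.ext <;> simp [him]
  have hcont : Continuous fun r : ℝ => ξ (ω₀ + (r : ℂ)) := by fun_prop
  have h1 := map_mem_closure hcont (mem_closure_translates hB hirr (ω.re - ω₀.re) N)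
    (t := ((↑) : ℂ → OnePoint ℂ) '' P ∩ (ξ '' {ω | ω ∈ D ∧ ω.im = ω₀.im})) (by
      rintro _ ⟨n, hn, m, rfl⟩
      have h2 : ξ (ω₀ + ((n * W + m * B : ℝ) : ℂ)) = ξ (ω₀ + n * W) := by
        refine Eq.trans (congrArg ξ ?_) (hper (ω₀ + n * W) m)
        push_cast
        ring
      simp only [h2]
      obtain ⟨x, hx, hxe⟩ := hN n hn
      obtain ⟨m', hm'⟩ := hD (ω₀ + n * W) (by simp)
      exact ⟨⟨x, hx, hxe.symm⟩, _, ⟨hm', by simp⟩, hper _ _⟩)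
  simp only [← hω] at h1
  exact h1

namespace Curve

variable {S : Finset (ℤ × ℤ)} {z : ℝ} {L : PeriodPair} {A B g h ν s g' h' ν' s' : ℝ}

/-- Poles of the continuation off the lines `Re ω ∈ (ω₂ / 2) ℤ` give poles of branches. -/
theorem mem_polesX (k : Curve S z L A B (ω₃ S z) g h ν s g' h' ν' s') {R : ℂ → ℂ}
    (hper : Function.Periodic R L.ω₁) (hrx : ∀ b, rx S z =ᶠ[𝓝[≠] b] R) {p : ℂ}
    (hfin : xCov S z p ≠ OnePoint.infty) (hre : ∀ n : ℤ, p.re ≠ n * (B / 2)) (hpole : IsPole R p) :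
    xVal S z p ∈ polesX S z := by
  have hx := Unif.xVal_coe S z hfin
  obtain ⟨j, hj⟩ := exists_mem_Ioo_half k.u.rect.posB hre
  refine ⟨fun hc => ?_, j, 0, ?_⟩
  · obtain ⟨n, hn⟩ := k.u.re_of_mem_cutX hx.symm hc
    exact hre n hn
  · have := k.u.isPole_branch (ξ := xCov S z) (c := 0) (fun ω => by rw [sub_zero]) hrx hper
      (fiberPoly_ne_zero k.u.model 0) (M := cellM S z j 0) (j := j) (p := p) (x := xVal S z p)
      (fun ω hω => by
        rw [sub_zero]
        exact ⟨Set.Ico_subset_Icc_self (k.mem_cellM.mp hω).1, (k.mem_cellM.mp hω).2⟩)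
      (fun ω h1 h2 => by
        rw [sub_zero] at h1
        exact k.mem_cellM.mpr ⟨Set.Ioo_subset_Ico_self h1, h2⟩) hx.symm (by rwa [sub_zero]) hpole
    refine (isPole_congr (.of_forall fun x => ?_)).mpr this
    rw [branchX, fiberPoly_eval k.u.model.small.transpose, K_transpose z k.u.model.small]

theorem mem_polesY (k : Curve S z L A B (ω₃ S z) g h ν s g' h' ν' s') {T : ℂ → ℂ}
    (hper : Function.Periodic T L.ω₁) (hry : ∀ b, ry S z =ᶠ[𝓝[≠] b] T) {p : ℂ}
    (hfin : yCov S z p ≠ OnePoint.infty)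
    (hre : ∀ n : ℤ, (p - ω₃ S z / 2).re ≠ n * (B / 2)) (hpole : IsPole T p) :
    yVal S z p ∈ polesY S z := by
  have hy := yVal_coe hfin
  obtain ⟨j, hj⟩ := exists_mem_Ioo_half k.u.rect.posB hre
  refine ⟨fun hc => ?_, j, 0, ?_⟩
  · obtain ⟨n, hn⟩ := k.u'.re_of_mem_cutX ((k.yCov_eq p).symm.trans hy.symm) hc
    exact hre n hn
  · have := k.u'.isPole_branch (ξ := yCov S z) (c := ω₃ S z / 2) k.yCov_eq hry hper
      (fiberPoly_ne_zero k.u.model.transpose 0) (M := cellN S z j 0) (j := j) (p := p)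
      (x := yVal S z p)
      (fun ω hω => ⟨Set.Ioc_subset_Icc_self (k.mem_cellN.mp hω).1, (k.mem_cellN.mp hω).2⟩)
      (fun ω h1 h2 => k.mem_cellN.mpr ⟨Set.Ioo_subset_Ioc_self h1, h2⟩) hy.symm hj hpole
    refine (isPole_congr (.of_forall fun y => ?_)).mpr this
    rw [branchY, transpose_transpose, fiberPoly_eval k.u.model.small]

end Curve

end QuarterPlane

theorem lemma21 (S : Finset (ℤ × ℤ)) (hS : IsSmallStepSet S) (hns : NonSingular S)
    (z : ℝ) (hz₀ : 0 < z) (hz₁ : z < 1 / (S.card : ℝ))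
    (hirr : Irrational (ω₂ S z / ω₃ S z))
    (ω₀ : ℂ) (hω₀ : ω₀ ∈ polesFy S z ω₀) (hr : ¬ IsPole (ry S z) ω₀)
    -- the chain of distinct points `w 0 = ω₀, w 1, …, w k` and the shifts between neighbours
    (k : ℕ) (w : Fin (k + 1) → ℂ) (n : Fin k → ℕ)
    (hw₀ : w 0 = ω₀) (hw : ∀ i, w i ∈ polesFy S z ω₀) (hinj : Function.Injective w)
    (hA : ∀ i : Fin k, PrecBy S z (n i) (w i.castSucc) (w i.succ))
    (hB : Tendsto
      (fun ω : ℂ => ∑ i : Fin (k + 1),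
        fy S z (ω + ((∑ j : Fin k with j.castSucc < i, n j : ℕ) : ℂ) * (ω₃ S z : ℂ)))
      (𝓝[≠] ω₀) (Bornology.cobounded ℂ))
    (hC : ∀ ω ∈ polesFy S z ω₀, Prec S z ω₀ ω → ∃ i, ω = w i) :
    DenseOnCurve (polesX S z) (curveX S z ω₀) ∧ DenseOnCurve (polesY S z) (curveY S z ω₀) := by
  obtain ⟨L, A, B, g, h, ν, s, g', h', ν', s', u, u'⟩ := exists_unif ⟨hS, hns, hz₀, hz₁⟩
  have c := u.exists_curve u' hirr
  have hirr' : Irrational (B / ω₃ S z) := u.per₂ ▸ hirr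
  obtain ⟨R, hR, hRW, hRper, hrx, hry⟩ := c.exists_continuation
  -- off a discrete set `R` is `r_x` and `T` is `r_y`
  set T : ℂ → ℂ := fun v => K S z 0 0 * Q S z 0 0 + xVal S z v * yVal S z v - R v with hT
  have hTm : Meromorphic T := fun v => ((MeromorphicAt.const _ v).add
    ((u.xVal_meromorphic v).mul (c.yVal_meromorphic v))).sub (hR v)
  have hTW : ∀ ω, T (ω + ω₃ S z) = T ω + fy S z ω := fun ω => by
    simp only [hT, hRW, c.fy_eq]
    ring
  have hTper : Function.Periodic T L.ω₁ := fun ω => by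
    simp only [hT, hRper ω, u.xVal_add L.ω₁_mem_lattice, c.yVal_add L.ω₁_mem_lattice]
  rw [isPole_congr (hry ω₀)] at hr
  have hpole := c.eventually_isPole hirr' hTm hTW hr hw₀ hw hinj hA hB hC
  have hxfin := u.eventually_xCov_ne hirr' ω₀ OnePoint.infty
  have hyfin : ∀ᶠ n : ℕ in atTop, yCov S z (ω₀ + n * ω₃ S z) ≠ OnePoint.infty := by
    filter_upwards [u'.eventually_xCov_ne hirr' (ω₀ - ω₃ S z / 2) OnePoint.infty] with n hn
    rwa [c.yCov_eq, add_sub_right_comm]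
  have him : ω₀.im ∈ Set.Ico 0 A := (c.mem_PiY.mp hω₀.1).2
  constructor
  · refine denseOnCurve_of_translates u.rect.posB hirr' u.xCov_continuous
      (fun ω m => u.xCov_add (c.intCast_mul_mem m) ω)
      (fun ω hω => c.exists_mem_PiX (by rwa [hω])) ?_
    filter_upwards [hpole, hxfin, hyfin, eventually_ne_half_mul hirr' ω₀.re] with n h1 h2 h3 h4
    refine ⟨_, c.mem_polesX hRper hrx h2 (by simpa using h4) ?_, (Unif.xVal_coe S z h2).symm⟩
    -- `R = -T + (K(0,0) Q(0,0) + x y)`, and `x y` is finite at the point considered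
    have h5 : Tendsto (fun v => -T v) (𝓝[≠] (ω₀ + n * ω₃ S z)) (Bornology.cobounded ℂ) := by
      rw [IsPole, ← tendsto_norm_atTop_iff_cobounded] at h1
      simpa only [← tendsto_norm_atTop_iff_cobounded, norm_neg] using h1
    have h6 : ContinuousAt (fun v => K S z 0 0 * Q S z 0 0 + xVal S z v * yVal S z v)
        (ω₀ + n * ω₃ S z) := continuousAt_const.add
      ((u.xVal_analyticAt h2).continuousAt.mul (c.yVal_analyticAt h3).continuousAt)
    refine (tendsto_cobounded_add h5 (h6.tendsto.mono_left nhdsWithin_le_nhds)).congr fun v => ?_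
    simp only [hT]
    ring
  · refine denseOnCurve_of_translates u.rect.posB hirr' c.yCov_continuous
      (fun ω m => c.yCov_add (c.intCast_mul_mem m) ω)
      (fun ω hω => c.exists_mem_PiY (by rwa [hω])) ?_
    filter_upwards [hpole, hyfin, eventually_ne_half_mul hirr' (ω₀ - ω₃ S z / 2).re]
      with n h1 h2 h3
    refine ⟨_, c.mem_polesY hTper hry h2 ?_ h1, (Curve.yVal_coe h2).symm⟩
    rw [add_sub_right_comm, Complex.add_re]
    simpa using h3
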